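/- **Setting.** Let $d\ge 1$, let $(\mathcal M,\mathcal F_{\mathcal M},\mu_{\mathcal M})$ be a probability space (of marks), and for finite $\mathcal X\subset\mathbb R^d\times\mathcal M$ and $(x,t)\in\mathcal X$ let $\xi(x,t;\mathcal X,\cdot)$ be a finite Borel measure on $\mathbb R^d$, depending measurably on $(x,t,\mathcal X)$. If $(x,t)\notin\mathcal X$, write $\xi(x,t;\mathcal X)$ for $\xi(x,t;\mathcal X\cup\{(x,t)\})$; write $\mathcal X^{x,t}=\mathcal X\cup\{(x,t)\}$. Translations and dilations $y+a\mathcal X$ act on the $\mathbb R^d$-component only; $B_r(x)$ is the closed Euclidean ball and $B_r=B_r(0)$. For locally finite infinite $\mathcal X$ put $\xi(x,t;\mathcal X,A)=\limsup_{K\to\infty}\xi(x,t;\mathcal X\cap(B_K\times\mathcal M),A)$, and let $\xi_\infty^{x,t}(\mathcal X,A)=\xi(x,t;x+\mathcal X,x+A)$. Let $\kappa$ be a bounded, Lebesgue-a.e. continuous probability density on $\mathbb R^d$ (also denoting the corresponding measure). Let $\mathcal P_\lambda$ and $\mathcal H_a$ be Poisson processes on $\mathbb R^d\times\mathcal M$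 with intensity measures $\lambda\,\kappa\times\mu_{\mathcal M}$ and $a\,\mathrm{Leb}\times\mu_{\mathcal M}$ $(\lambda,a>0)$. Let $T,T'$ be independent marks with law $\mu_{\mathcal M}$, independent of these processes. Let $\Gamma_\lambda$ $(\lambda\ge1)$ be Borel sets, nondecreasing in $\lambda$, with union $\Gamma$, such that $\partial\Gamma$ is Lebesgue-null and $\operatorname{int}\Gamma=\bigcup_{\lambda\ge1}\operatorname{int}\Gamma_\lambda$. Put $$\xi_\lambda(x,t;\mathcal X,A)=\xi\big(x,t;\,x+\lambda^{1/d}(-x+\mathcal X),\,x+\lambda^{1/d}(-x+A)\big)\mathbf 1_{\Gamma_\lambda}(x),\qquad \mu_\lambda^\xi=\sum_{(x,t)\in\mathcal P_\lambda}\xi_\lambda(x,t;\mathcal P_\lambda,\cdot),$$ and $\langle f,\mu\rangle=\int f\,d\mu$. For locally finite $\mathcal X$ and Borel $A\subseteq\mathbb R^d$ let $R(x,t;\mathcal X,A)$ be the smallest integer $r\ge0$ such that $\xi(x,t;x+([\mathcal X\cap(B_r\times\mathcal M)]\cup\mathcal Y),B)=\xi(x,t;x+[\mathcal X\cap(B_r\times\mathcal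 M)],B)$ for all finite $\mathcal Y\subset(A\setminus B_r)\times\mathcal M$ and all Borel $B$ ($\infty$ if there is none), and $R(x,t;\mathcal X)=R(x,t;\mathcal X,\mathbb R^d)$. * $\xi$ is *$a$-homogeneously stabilizing at $x$* if for every $z\in\mathbb R^d$, almost surely $\lim_{\varepsilon\downarrow0}\sup_{y\in B_\varepsilon(x)}\max\big(R(y,T;\mathcal H_a),R(y,T;\mathcal H_a^{z,T'})\big)<\infty$. * $\xi$ is *power-law stabilizing of order $q$* if $\sup_{s\ge1}s^q\tau(s)<\infty$, where $\tau(s)=\sup_{\lambda\ge1,\,x\in\Gamma_\lambda}P\big[R(x,T;\lambda^{1/d}(-x+\mathcal P_\lambda),\lambda^{1/d}(-x+\operatorname{supp}\kappa))>s\big]$. * The *moments conditions* of order $p$ are $$\sup_{\lambda\ge1,\,x\in\operatorname{supp}\kappa}E[\xi_\lambda(x,T;\mathcal P_\lambda,\mathbb R^d)^p]<\infty,\qquad \sup_{\lambda\ge1,\,x,y\in\operatorname{supp}\kappa}E[\xi_\lambda(x,T;\mathcal P_\lambda\cup\{(y,T')\},\mathbb R^d)^p]<\infty .$$ Assumptions: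 **A1** $\xi(x,t;\mathcal X,\cdot)$ is always a point mass at $x$. **A3** $f$ is Lebesgue-a.e. continuous. **A4** $\xi$ is translation invariant: $\xi(x,t;\mathcal X,A)=\xi(y+x,t;y+\mathcal X,y+A)$. **A5** there is $K_1>0$ such that for all $m\ge1$, Lebesgue-almost all $(x,x_1,\dots,x_m)\in(\mathbb R^d)^{m+1}$ and $\mu_{\mathcal M}^{m+1}$-almost all $(t,t_1,\dots,t_m)$, for $A=\mathbb R^d$ and for every $A=B_K$ with $K>K_1$, the map $(y,y_1,\dots,y_m)\mapsto\xi(y,t;\{(y_1,t_1),\dots,(y_m,t_m)\},y+A)$ is continuous at $(x,x_1,\dots,x_m)$. **Theorem 2.2.** Suppose that $\xi$ is $\kappa(x)$-homogeneously stabilizing at $x$ for $\kappa$-almost all $x\in\mathbb R^d$, satisfies both moments conditions for some $p>2$, and is power-law stabilizing of some order $q>dp/(p-2)$. Let $f:\mathbb R^d\to\mathbb R$ be bounded and Borel measurable; assume A1 or A3, and A4 or A5. Then $\langle f,\mu_\lambda^\xi\rangle$ has finite variance for all $\lambda\ge1$, and $$\lim_{\lambda\to\infty}\lambda^{-1}\operatorname{Var}\langle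 f,\mu_\lambda^\xi\rangle=\int_\Gamma f(x)^2\,V^\xi(x,\kappa(x))\,\kappa(x)\,dx,$$ where $V^\xi(x,0)=0$ and, for $a>0$, $$V^\xi(x,a)=E[\xi_\infty^{x,T}(\mathcal H_a,\mathbb R^d)^2]+a\int_{\mathbb R^d}\Big(E\big[\xi_\infty^{x,T}(\mathcal H_a^{z,T'},\mathbb R^d)\,\xi_\infty^{x,T'}(-z+\mathcal H_a^{0,T},\mathbb R^d)\big]-\big(E[\xi_\infty^{x,T}(\mathcal H_a,\mathbb R^d)]\big)^2\Big)dz .$$ Moreover, for $\kappa$-almost all $x\in\Gamma$, with $a=\kappa(x)$, the expectations in this formula are finite (for the mixed one: for almost every $z$) and the integral over $z$ converges absolutely; and the right-hand side of the limit formula is finite (its integrand is integrable over $\Gamma$). -/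

import Mathlib

open MeasureTheory ProbabilityTheory Filter Topology
open scoped ENNReal NNReal

noncomputable section

namespace GeomMeas

/-- `ℝ^d` with the Euclidean norm and Lebesgue measure. -/
abbrev Rd (d : ℕ) : Type := EuclideanSpace ℝ (Fin d)

/-- `y + a X`: scalar multiplication and translation act on the spatial component only. -/
def act {d : ℕ} {M : Type*} (y : Rd d) (a : ℝ) (X : Set (Rd d × M)) : Set (Rd d × M) :=
  (fun p => (y + a • p.1, p.2)) '' X

/-- `X ∩ (B_r × M)`, with `B_r` the closed ball of radius `r` at the origin. -/
def inBall {d : ℕ} {M : Type*} (r : ℝ) (X : Set (Rd d × M)) : Set (Rd d × M) :=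
  X ∩ (Metric.closedBall 0 r ×ˢ Set.univ)

/-! ### Functionals -/

/-- The type of `ξ`: the measure `ξ(x, t; X, ·)`, of which only the values at finite `X`
with `(x, t) ∈ X` are ever used. -/
abbrev Functional (d : ℕ) (M : Type*) : Type _ :=
  Rd d → M → Set (Rd d × M) → Measure (Rd d)

/-- The standing assumptions on `ξ`: `ξ(x, t; X, ·)` is a finite measure, and `ξ(x, t; X, A)` is
measurable in `(x, t, X)` for each Borel set `A` (this is measurability into the space of measures).
A finite set `X` with the distinguished element `(x, t)` is listed as an injective tuple
starting with `(x, t)`. -/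
structure IsMeasureFunctional {d : ℕ} {M : Type*} [MeasurableSpace M] (ξ : Functional d M) :
    Prop where
  finite : ∀ (x : Rd d) (t : M) (X : Set (Rd d × M)), X.Finite → (x, t) ∈ X →
    IsFiniteMeasure (ξ x t X)
  measurable : ∀ n : ℕ, Measurable
    fun v : {v : Fin (n + 1) → Rd d × M // Function.Injective v} =>
      ξ (v.1 0).1 (v.1 0).2 (Set.range v.1)

/-- `ξ(x, t; X)` for finite `X`, with the convention that `(x, t)` is added to `X` if absent. -/
def ins {d : ℕ} {M : Type*} (ξ : Functional d M) (x : Rd d) (t : M) (X : Set (Rd d × M)) :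
    Measure (Rd d) :=
  ξ x t (insert (x, t) X)

/-- `ξ(x, t; X, A)` for locally finite `X`, as a limsup over the restrictions of `X` to balls
(for finite `X` this is `ξ(x, t; X, A)` itself). -/
def ext {d : ℕ} {M : Type*} (ξ : Functional d M) (x : Rd d) (t : M) (X : Set (Rd d × M))
    (A : Set (Rd d)) : ℝ≥0∞ :=
  limsup (fun K : ℝ => ins ξ x t (inBall K X) A) atTop

/-- The shifted version `ξ_∞^{x,t}(X, A) = ξ(x, t; x + X, x + A)`. -/
def xiInf {d : ℕ} {M : Type*} (ξ : Functional d M) (x : Rd d) (t : M) (X : Set (Rd d × M))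
    (A : Set (Rd d)) : ℝ≥0∞ :=
  ext ξ x t (act x 1 X) ((fun z => x + z) '' A)

/-- `x + l^{1/d} (-x + X)`. -/
def rescale {d : ℕ} {M : Type*} (l : ℝ) (x : Rd d) (X : Set (Rd d × M)) : Set (Rd d × M) :=
  act x (l ^ (1 / (d : ℝ))) (act (-x) 1 X)

open Classical in
/-- The rescaled measure
`ξ_l(x, t; X, A) = ξ(x, t; x + l^{1/d}(-x + X), x + l^{1/d}(-x + A)) 1_{Γ_l}(x)` for finite `X`,
written as a push-forward under `z ↦ x + l^{-1/d}(z - x)`, the inverse of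
`z ↦ x + l^{1/d}(-x + z)`. -/
def xiScaled {d : ℕ} {M : Type*} (ξ : Functional d M) (Γ : ℝ → Set (Rd d)) (l : ℝ)
    (x : Rd d) (t : M) (X : Set (Rd d × M)) : Measure (Rd d) :=
  if x ∈ Γ l then
    (ins ξ x t (rescale l x X)).map (fun z => x + (l ^ (1 / (d : ℝ)))⁻¹ • (z - x))
  else 0

/-- `⟨f, μ_l^ξ⟩` at the realization `X` of the Poisson process of intensity `l κ × μ_M`
(almost surely a finite set). -/
def pairing {d : ℕ} {M : Type*} (ξ : Functional d M) (Γ : ℝ → Set (Rd d)) (f : Rd d → ℝ) (l : ℝ)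
    (X : Set (Rd d × M)) : ℝ :=
  ∑ᶠ p ∈ X, ∫ z, f z ∂(xiScaled ξ Γ l p.1 p.2 X)

/-- `ξ = ξ^*`: `ξ(x, t; X, ·)` is a point mass at `x`. -/
def IsPointMass {d : ℕ} {M : Type*} (ξ : Functional d M) : Prop :=
  ∀ (x : Rd d) (t : M) (X : Set (Rd d × M)), X.Finite → (x, t) ∈ X →
    ξ x t X = ξ x t X Set.univ • Measure.dirac x

/-- Translation invariance. -/
def IsTranslationInvariant {d : ℕ} {M : Type*} (ξ : Functional d M) : Prop :=
  ∀ (y x : Rd d) (t : M) (X : Set (Rd d × M)), X.Finite → (x, t) ∈ X →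
    ∀ A : Set (Rd d), MeasurableSet A →
      ξ x t X A = ξ (y + x) t (act y 1 X) ((fun z => y + z) '' A)

/-- Almost everywhere continuous total measure. Index `0` of the tuples is the distinguished
point, indices `1, …, m` are the other points. -/
def HasAEContinuousTotalMeasure {d : ℕ} {M : Type*} [MeasurableSpace M] (ξ : Functional d M)
    (μM : Measure M) : Prop :=
  ∃ K₁ : ℝ, 0 < K₁ ∧ ∀ m : ℕ, 1 ≤ m →
    ∀ᵐ x : Fin (m + 1) → Rd d, ∀ᵐ t : Fin (m + 1) → M ∂(Measure.pi fun _ => μM),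
      ∀ A : Set (Rd d), (A = Set.univ ∨ ∃ K : ℝ, K₁ < K ∧ A = Metric.closedBall 0 K) →
        ContinuousAt
          (fun y : Fin (m + 1) → Rd d =>
            ins ξ (y 0) (t 0) (Set.range fun i : Fin m => (y i.succ, t i.succ))
              ((fun z => y 0 + z) '' A)) x

/-! ### Point processes -/

/-- Locally finite subsets of `ℝ^d × M`. -/
def Config (d : ℕ) (M : Type*) : Type _ :=
  {X : Set (Rd d × M) // ∀ B : Set (Rd d), Bornology.IsBounded B → (X ∩ B ×ˢ Set.univ).Finite}

/-- The number of points of `X` in `B`. -/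
def count {d : ℕ} {M : Type*} (B : Set (Rd d × M)) (X : Config d M) : ℕ∞ := (X.1 ∩ B).encard

/-- The usual σ-algebra on configurations, generated by the numbers of points in
measurable sets. -/
instance {d : ℕ} {M : Type*} [MeasurableSpace M] : MeasurableSpace (Config d M) :=
  ⨆ (B : Set (Rd d × M)) (_ : MeasurableSet B), MeasurableSpace.comap (count B) inferInstance

/-- `Q` is the law of a Poisson process with intensity measure `ν`: the number of points in a
measurable set of finite `ν`-measure is Poisson distributed, and the numbers of points in
finitely many disjoint measurable sets are independent. -/
structure IsPoissonLaw {d : ℕ} {M : Type*} [MeasurableSpace M] (Q : Measure (Config d M))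
    (ν : Measure (Rd d × M)) : Prop where
  prob : IsProbabilityMeasure Q
  poisson : ∀ B : Set (Rd d × M), MeasurableSet B → ν B < ∞ →
    Q.map (count B) = (poissonMeasure (ν B).toNNReal).map (fun n : ℕ => (n : ℕ∞))
  indep : ∀ (n : ℕ) (B : Fin n → Set (Rd d × M)), (∀ i, MeasurableSet (B i)) →
    Pairwise (fun i j => Disjoint (B i) (B j)) → iIndepFun (fun i => count (B i)) Q

/-- The probability measure on `ℝ^d` with density `κ`. -/
def densityMeasure {d : ℕ} (κ : Rd d → ℝ) : Measure (Rd d) :=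
  volume.withDensity fun x => ENNReal.ofReal (κ x)

/-! ### Stabilization and moments -/

/-- The radius of stabilization `R(x, t; X, A)`; the infimum of the empty set is `⊤`. -/
def radius {d : ℕ} {M : Type*} (ξ : Functional d M) (x : Rd d) (t : M) (X : Set (Rd d × M))
    (A : Set (Rd d)) : ℕ∞ :=
  ⨅ (r : ℕ) (_ : ∀ Y : Set (Rd d × M), Y.Finite →
      Y ⊆ (A \ Metric.closedBall 0 (r : ℝ)) ×ˢ Set.univ →
      ∀ B : Set (Rd d), MeasurableSet B →
        ins ξ x t (act x 1 (inBall r X ∪ Y)) B = ins ξ x t (act x 1 (inBall r X)) B), (r : ℕ∞)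

/-- Homogeneous stabilization at `x`, where `Q` is the law of the homogeneous Poisson process.
The points of the probability space are `(X, T, T')`. The supremum over `B_ε(x)` is monotone in
`ε`, so that its limit as `ε ↓ 0` is the infimum over `ε > 0`. -/
def IsHomStabilizing {d : ℕ} {M : Type*} [MeasurableSpace M] (ξ : Functional d M)
    (μM : Measure M) (Q : Measure (Config d M)) (x : Rd d) : Prop :=
  ∀ z : Rd d, ∀ᵐ ω ∂(Q.prod (μM.prod μM)),
    (⨅ (ε : ℝ) (_ : 0 < ε), ⨆ y ∈ Metric.closedBall x ε,
      max (radius ξ y ω.2.1 ω.1.1 Set.univ)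
        (radius ξ y ω.2.1 (insert (z, ω.2.2) ω.1.1) Set.univ)) < ⊤

/-- `R_l(x, t)` at the realization `X` of the Poisson process; `S` is the support of `κ`. -/
def radiusScaled {d : ℕ} {M : Type*} (ξ : Functional d M) (S : Set (Rd d)) (l : ℝ)
    (x : Rd d) (t : M) (X : Set (Rd d × M)) : ℕ∞ :=
  radius ξ x t (act 0 (l ^ (1 / (d : ℝ))) (act (-x) 1 X))
    ((fun y => l ^ (1 / (d : ℝ)) • (-x + y)) '' S)

/-- The tail probability `τ(s)`. -/
def tau {d : ℕ} {M : Type*} [MeasurableSpace M] (ξ : Functional d M) (μM : Measure M)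
    (Γ : ℝ → Set (Rd d)) (S : Set (Rd d)) (P : ℝ → Measure (Config d M)) (s : ℝ) : ℝ≥0∞ :=
  ⨆ (l : ℝ) (_ : 1 ≤ l) (x ∈ Γ l),
    ((P l).prod μM) {ω | ENNReal.ofReal s < (radiusScaled ξ S l x ω.2 ω.1.1 : ℝ≥0∞)}

/-- Power-law stabilization of order `q`. -/
def IsPowerLawStabilizing {d : ℕ} {M : Type*} [MeasurableSpace M] (ξ : Functional d M)
    (μM : Measure M) (Γ : ℝ → Set (Rd d)) (S : Set (Rd d)) (P : ℝ → Measure (Config d M))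
    (q : ℝ) : Prop :=
  (⨆ (s : ℝ) (_ : 1 ≤ s), ENNReal.ofReal (s ^ q) * tau ξ μM Γ S P s) < ∞

/-- The moments condition for `ξ_l(x, T; P_l, ℝ^d)`. -/
def MomentCond {d : ℕ} {M : Type*} [MeasurableSpace M] (ξ : Functional d M)
    (μM : Measure M) (Γ : ℝ → Set (Rd d)) (S : Set (Rd d)) (P : ℝ → Measure (Config d M))
    (p : ℝ) : Prop :=
  (⨆ (l : ℝ) (_ : 1 ≤ l) (x ∈ S),
    ∫⁻ ω, (xiScaled ξ Γ l x ω.2 ω.1.1 Set.univ) ^ p ∂((P l).prod μM)) < ∞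

/-- The moments condition for `ξ_l(x, T; P_l ∪ {(y, T')}, ℝ^d)`. -/
def MomentCondAdd {d : ℕ} {M : Type*} [MeasurableSpace M] (ξ : Functional d M)
    (μM : Measure M) (Γ : ℝ → Set (Rd d)) (S : Set (Rd d)) (P : ℝ → Measure (Config d M))
    (p : ℝ) : Prop :=
  (⨆ (l : ℝ) (_ : 1 ≤ l) (x ∈ S) (y ∈ S),
    ∫⁻ ω, (xiScaled ξ Γ l x ω.2.1 (insert (y, ω.2.2) ω.1.1) Set.univ) ^ p
      ∂((P l).prod (μM.prod μM))) < ∞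

/-! ### The limiting variance; `Q` is the law of the homogeneous Poisson process `H_a` -/

/-- `E[ξ_∞^{x,T}(H_a, ℝ^d)]`. -/
def mean {d : ℕ} {M : Type*} [MeasurableSpace M] (ξ : Functional d M) (μM : Measure M)
    (Q : Measure (Config d M)) (x : Rd d) : ℝ≥0∞ :=
  ∫⁻ ω, xiInf ξ x ω.2 ω.1.1 Set.univ ∂(Q.prod μM)

/-- `E[ξ_∞^{x,T}(H_a, ℝ^d)^2]`. -/
def secondMoment {d : ℕ} {M : Type*} [MeasurableSpace M] (ξ : Functional d M) (μM : Measure M)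
    (Q : Measure (Config d M)) (x : Rd d) : ℝ≥0∞ :=
  ∫⁻ ω, (xiInf ξ x ω.2 ω.1.1 Set.univ) ^ 2 ∂(Q.prod μM)

/-- `E[ξ_∞^{x,T}(H_a^{z,T'}, ℝ^d) ξ_∞^{x,T'}(-z + H_a^{0,T}, ℝ^d)]`. -/
def mixedMoment {d : ℕ} {M : Type*} [MeasurableSpace M] (ξ : Functional d M) (μM : Measure M)
    (Q : Measure (Config d M)) (x z : Rd d) : ℝ≥0∞ :=
  ∫⁻ ω, xiInf ξ x ω.2.1 (insert (z, ω.2.2) ω.1.1) Set.univ *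
      xiInf ξ x ω.2.2 (act (-z) 1 (insert (0, ω.2.1) ω.1.1)) Set.univ
    ∂(Q.prod (μM.prod μM))

/-- The integrand, as a function of `z`, in the definition of `V^ξ(x, a)`. -/
def covIntegrand {d : ℕ} {M : Type*} [MeasurableSpace M] (ξ : Functional d M) (μM : Measure M)
    (Q : Measure (Config d M)) (x z : Rd d) : ℝ :=
  (mixedMoment ξ μM Q x z).toReal - (mean ξ μM Q x).toReal ^ 2

open Classical in
/-- `V^ξ(x, a)`, where `H a` is the law of `H_a`. -/
def V {d : ℕ} {M : Type*} [MeasurableSpace M] (ξ : Functional d M) (μM : Measure M)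
    (H : ℝ → Measure (Config d M)) (x : Rd d) (a : ℝ) : ℝ :=
  if a = 0 then 0
  else (secondMoment ξ μM (H a) x).toReal + a * ∫ z, covIntegrand ξ μM (H a) x z

end GeomMeas

end

noncomputable section

open scoped Pointwise

namespace GeomMeas

section

/-! ### Measurability of integrals against measurable families of measures -/

section MeasurableFamilies

variable {α β : Type*} [MeasurableSpace α] [MeasurableSpace β]

/-! Magnified about a point x by the factor l^(1/d), the Poisson process looks like a homogeneous
process of intensity κ(x), and stabilization makes the contribution of x depend on finitely many
nearby points only. The variance is an integral of local covariances, which converge one by one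
under a common integrable bound.

Exact formula. Write the pairing as a sum of c(x) F((x,t), X) over the points of X, where F is the
integral of φ against the rescaled measure of the point and f = c φ. The Mecke formula, used twice,
gives the second moment (`IsSquareSummable.second_moment`). The substitution y = x + l^(-1/d) z then
turns l⁻¹ Var into the integral over κ(x)dx of c(x)² E F_x² plus the z-integral of κ(y) c(x) c(y)
Cov_l(x, y) (`VarData.integrable_varIntegrand`). Here Cov_l is the mixed moment with both points
present minus the product of the means; the Jacobian absorbs one factor l. The Mecke formula is
proved for an explicit law, `poissonLaw`, a mixture of images of product measures. An abstract
Poisson law is identified with it because the characteristic functional determines the law of a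
point process (`HasPoissonCF.unique`).

Pointwise limits. Where κ is continuous and positive, the law of the magnified process on a fixed
ball converges in total variation to that of the homogeneous process (`locallyTV_blow`). Homogeneous
stabilization, uniform near x, replaces the configuration by its restriction to one fixed ball. Then
only the location moves, and translation invariance or almost everywhere continuity takes care of
that (`ConvAt.tendsto_locF`). Since p > 2, the functional, its square and the products of two values
have bounded moments of some order greater than 1, hence are uniformly integrable, and expectations
converge (`LocLim.tendsto_integral`). For the contribution of y the same process is seen from z,
which is the shift by -z in the limit.

Domination. If neither radius of stabilization exceeds r and the balls of radius l^(-1/d) r about x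
and y are disjoint, the two contributions depend on independent parts of the process. A power-law
tail of order q and Hölder-type truncation with p moments give |Cov_l(x, y)| ≤ D (1 + ‖z‖)^(-s) with
s = q (p - 2)/p, and s > d is exactly the condition on q (`exists_cov_decay`). Dominated convergence
applies first in z and then in x; the same bound passes to the limit and makes the integral in V
absolutely convergent.

The two assumptions on f. If ξ is a point mass at x, take c = f and φ = 1: then no continuity of f
is needed, because x can be taken to be a Lebesgue point of f and the factor c(x + l^(-1/d) z) may
be replaced by c(x) under the integral over z. If f is almost everywhere continuous, take c = 1 and
φ = f: the mass of the rescaled measure concentrates at x and φ may be replaced by φ(x)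
(`tendsto_integral_rescaled`). -/

theorem measurable_lintegral_of_isFiniteMeasure {κ : α → Measure β} (hκ : Measurable κ)
    (hfin : ∀ a, IsFiniteMeasure (κ a)) {f : α → β → ℝ≥0∞} (hf : Measurable (Function.uncurry f)) :
    Measurable fun a => ∫⁻ b, f a b ∂(κ a) := by
  have hu : Measurable fun a => κ a Set.univ := Measure.measurable_coe MeasurableSet.univ |>.comp hκ
  -- The total masses need not be bounded in `a`, so `κ` may fail to be a finite kernel. Divided by
  -- one plus the mass it has mass at most 1, and the factor is put back at the end.
  let k : Kernel α β :=
    ⟨fun a => (1 + κ a Set.univ)⁻¹ • κ a, by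
      refine Measure.measurable_of_measurable_coe _ fun s hs => ?_
      simp only [Measure.smul_apply, smul_eq_mul]
      exact (measurable_const.add hu).inv.mul ((Measure.measurable_coe hs).comp hκ)⟩
  have hk : IsFiniteKernel k := by
    refine ⟨⟨1, by simp, fun a => ?_⟩⟩
    change ((1 + κ a Set.univ)⁻¹ • κ a) Set.univ ≤ 1
    rw [Measure.smul_apply, smul_eq_mul, mul_comm, ← div_eq_mul_inv]
    exact ENNReal.div_le_of_le_mul (by simp)
  have h1 : Measurable fun a => ∫⁻ b, f a b ∂(k a) := hf.lintegral_kernel_prod_right'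
  have h2 : (fun a => ∫⁻ b, f a b ∂(κ a)) =
      fun a => (1 + κ a Set.univ) * ∫⁻ b, f a b ∂(k a) := by
    funext a
    change _ = _ * ∫⁻ b, f a b ∂((1 + κ a Set.univ)⁻¹ • κ a)
    have := measure_ne_top (κ a) Set.univ
    rw [lintegral_smul_measure, smul_eq_mul, ← mul_assoc, ENNReal.mul_inv_cancel (by simp)
      (by simp [this]), one_mul]
  rw [h2]
  exact (measurable_const.add hu).mul h1

/-- Meant for counting measures of configurations, which are infinite in general but finite on
cylinders over balls: cut into disjoint pieces and sum. -/
theorem measurable_lintegral_of_spanning {κ : α → Measure β} (hκ : Measurable κ)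
    (S : ℕ → Set β) (hS : ∀ n, MeasurableSet (S n)) (hcov : ⋃ n, S n = Set.univ)
    (hfin : ∀ a n, κ a (S n) < ∞) {f : α → β → ℝ≥0∞} (hf : Measurable (Function.uncurry f)) :
    Measurable fun a => ∫⁻ b, f a b ∂(κ a) := by
  have hD : ∀ n, MeasurableSet (disjointed S n) := fun n => MeasurableSet.disjointed hS n
  have h : (fun a => ∫⁻ b, f a b ∂(κ a)) =
      fun a => ∑' n, ∫⁻ b, f a b ∂((κ a).restrict (disjointed S n)) := by
    funext a
    rw [← lintegral_iUnion hD (disjoint_disjointed S), iUnion_disjointed, hcov,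
      Measure.restrict_univ]
  rw [h]
  refine Measurable.tsum fun n => ?_
  refine measurable_lintegral_of_isFiniteMeasure ?_ (fun a => ⟨?_⟩) hf
  · refine Measure.measurable_of_measurable_coe _ fun s hs => ?_
    simp only [Measure.restrict_apply hs]
    exact (Measure.measurable_coe (hs.inter (hD n))).comp hκ
  · rw [Measure.restrict_apply_univ]
    exact (measure_mono (disjointed_le S n)).trans_lt (hfin a n)

theorem measurable_integral_of_isFiniteMeasure {κ : α → Measure β} (hκ : Measurable κ)
    (hfin : ∀ a, IsFiniteMeasure (κ a)) {f : α → β → ℝ} (hf : Measurable (Function.uncurry f))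
    {C : ℝ} (hC : ∀ a b, |f a b| ≤ C) :
    Measurable fun a => ∫ b, f a b ∂(κ a) := by
  have h : (fun a => ∫ b, f a b ∂(κ a)) = fun a =>
      (∫⁻ b, ENNReal.ofReal (f a b) ∂(κ a)).toReal -
        (∫⁻ b, ENNReal.ofReal (-f a b) ∂(κ a)).toReal := by
    funext a
    refine integral_eq_lintegral_pos_part_sub_lintegral_neg_part ?_
    exact Integrable.of_bound (hf.comp measurable_prodMk_left).aestronglyMeasurable C
      (Eventually.of_forall fun b => hC a b)
  rw [h]
  exact (measurable_lintegral_of_isFiniteMeasure hκ hfin (f := fun a b => ENNReal.ofReal (f a b))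
    hf.ennreal_ofReal).ennreal_toReal.sub
    (measurable_lintegral_of_isFiniteMeasure hκ hfin 
    (f := fun a b => ENNReal.ofReal (-f a b)) hf.neg.ennreal_ofReal).ennreal_toReal

end MeasurableFamilies

/-! ### Configurations -/

variable {d : ℕ} {M : Type*}

/-- The set of points of a configuration. -/
def Config.pts (X : Config d M) : Set (Rd d × M) := X.1

theorem Config.finite_inter (X : Config d M) {B : Set (Rd d)} (hB : Bornology.IsBounded B) :
    (X.pts ∩ B ×ˢ Set.univ).Finite := X.2 B hB

/-- A locally finite set of points as a configuration. -/
def Config.mk (X : Set (Rd d × M))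
    (h : ∀ B : Set (Rd d), Bornology.IsBounded B → (X ∩ B ×ˢ Set.univ).Finite) : Config d M :=
  ⟨X, h⟩

theorem Config.pts_mk (X : Set (Rd d × M))
    (h : ∀ B : Set (Rd d), Bornology.IsBounded B → (X ∩ B ×ˢ Set.univ).Finite) :
    (Config.mk X h).pts = X := rfl

theorem Config.ext {X Y : Config d M} (h : X.pts = Y.pts) : X = Y := Subtype.ext h

/-- A finite set of points as a configuration. -/
def Config.ofFinite (X : Set (Rd d × M)) (h : X.Finite) : Config d M :=
  Config.mk X fun _ _ => h.subset Set.inter_subset_left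

/-- The configuration that agrees with `U` on `B` and with `W` off `B`. -/
def Config.hyb (B : Set (Rd d)) (U W : Config d M) : Config d M :=
  Config.mk ((U.pts ∩ B ×ˢ Set.univ) ∪ (W.pts ∩ Bᶜ ×ˢ Set.univ)) fun C hC => by
    refine ((U.finite_inter hC).union (W.finite_inter hC)).subset ?_
    rintro p ⟨hp | hp, hpC⟩
    · exact Or.inl ⟨hp.1, hpC⟩
    · exact Or.inr ⟨hp.1, hpC⟩

theorem Config.pts_hyb (B : Set (Rd d)) (U W : Config d M) : (Config.hyb B U W).pts =
    (U.pts ∩ B ×ˢ Set.univ) ∪ (W.pts ∩ Bᶜ ×ˢ Set.univ) := rfl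

/-- The empty configuration. -/
def Config.empty : Config d M := Config.ofFinite ∅ Set.finite_empty

theorem Config.pts_empty : (Config.empty : Config d M).pts = ∅ := rfl

/-- The restriction of a configuration to `B`. -/
def Config.restr (B : Set (Rd d)) (U : Config d M) : Config d M := Config.hyb B U Config.empty

theorem Config.pts_restr (B : Set (Rd d)) (U : Config d M) :
    (Config.restr B U).pts = U.pts ∩ B ×ˢ Set.univ := by
  simp [Config.restr, Config.pts_hyb, Config.pts_empty]

open Classical in
/-- Adding a point to a configuration unless its location is already occupied. -/
def Config.add (p : Rd d × M) (X : Config d M) : Config d M :=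
  Config.mk (if p.1 ∈ Prod.fst '' X.pts then X.pts else insert p X.pts) fun C hC => by
    refine ((X.finite_inter hC).insert p).subset ?_
    split_ifs
    · exact Set.subset_insert _ _
    · rintro q ⟨hq | hq, hqC⟩
      · exact Or.inl hq
      · exact Or.inr ⟨hq, hqC⟩

theorem Config.pts_add {p : Rd d × M} {X : Config d M} (h : p.1 ∉ Prod.fst '' X.pts) :
    (Config.add p X).pts = insert p X.pts := by
  rw [Config.add, Config.pts_mk, if_neg h]

theorem Config.add_of_mem {p : Rd d × M} {X : Config d M} (h : p.1 ∈ Prod.fst '' X.pts) :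
    Config.add p X = X := by
  refine Config.ext ?_
  rw [Config.add, Config.pts_mk, if_pos h]

/-- The map `q ↦ (y + a q.1, q.2)`. -/
def affPt (y : Rd d) (a : ℝ) (q : Rd d × M) : Rd d × M := (y + a • q.1, q.2)

theorem affPt_injective (y : Rd d) {a : ℝ} (ha : a ≠ 0) :
    Function.Injective (affPt y a : Rd d × M → Rd d × M) := by
  rintro ⟨u, s⟩ ⟨v, t⟩ h
  simp only [affPt, Prod.mk.injEq, add_right_inj] at h
  exact Prod.ext (smul_right_injective _ ha h.1) h.2

theorem act_eq_image (y : Rd d) (a : ℝ) (X : Set (Rd d × M)) : act y a X = affPt y a '' X := rfl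

open Classical in
/-- `y + a X` as a configuration. -/
def Config.aff (y : Rd d) (a : ℝ) (X : Config d M) : Config d M :=
  -- For `a = 0` the image could have infinitely many points at one location with different marks,
  -- hence not be locally finite. The value there is a mere default.
  Config.mk (if a = 0 then X.pts else act y a X.pts) fun C hC => by
    split_ifs with ha
    · exact X.finite_inter hC
    have hb : Bornology.IsBounded ((fun u : Rd d => -(a⁻¹ • y) + a⁻¹ • u) '' C) := by
      have h1 : Bornology.IsBounded ((a⁻¹ • C : Set (Rd d))) := hC.smul₀ _
      have h2 := (Bornology.isBounded_singleton (x := -(a⁻¹ • y))).add h1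
      refine h2.subset ?_
      rintro _ ⟨u, hu, rfl⟩
      exact Set.add_mem_add rfl (Set.smul_mem_smul_set hu)
    refine ((X.finite_inter hb).image (affPt y a)).subset ?_
    rintro _ ⟨⟨q, hq, rfl⟩, hqC⟩
    refine ⟨q, ⟨hq, ⟨⟨y + a • q.1, hqC.1, ?_⟩, trivial⟩⟩, rfl⟩
    simp [smul_add, smul_smul, inv_mul_cancel₀ ha]

theorem Config.pts_aff (y : Rd d) {a : ℝ} (ha : a ≠ 0) (X : Config d M) :
    (Config.aff y a X).pts = act y a X.pts := by
  rw [Config.aff, Config.pts_mk, if_neg ha]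

theorem act_inter_prod (y : Rd d) (a : ℝ) (X : Set (Rd d × M)) (B : Set (Rd d)) :
    act y a (X ∩ ((fun u => y + a • u) ⁻¹' B) ×ˢ Set.univ) = act y a X ∩ B ×ˢ Set.univ := by
  rw [act_eq_image, act_eq_image, ← Set.image_inter_preimage]
  rfl

theorem act_act (y z : Rd d) (a b : ℝ) (X : Set (Rd d × M)) :
    act y a (act z b X) = act (y + a • z) (a * b) X := by
  simp only [act, Set.image_image, smul_add, smul_smul, add_assoc]

theorem act_zero_one (X : Set (Rd d × M)) : act 0 1 X = X := by simp [act]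

theorem act_insert (y : Rd d) (a : ℝ) (p : Rd d × M) (X : Set (Rd d × M)) :
    act y a (insert p X) = insert (affPt y a p) (act y a X) := by
  simp [act, Set.image_insert_eq, affPt]

theorem count_eq (B : Set (Rd d × M)) (X : Config d M) : count B X = (X.pts ∩ B).encard := rfl

theorem iUnion_ball_cyl : ⋃ n : ℕ, (Metric.closedBall (0 : Rd d) n ×ˢ (Set.univ : Set M)) =
    Set.univ := by
  rw [← Set.iUnion_prod_const, Metric.iUnion_closedBall_nat, Set.univ_prod_univ]

/-! ### Counting measures and measurability of operations on configurations. -/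

variable [MeasurableSpace M]

/-- The counting measure of a configuration. -/
def Config.cm (X : Config d M) : Measure (Rd d × M) :=
  Measure.sum fun p : X.pts => Measure.dirac p.1

theorem Config.lintegral_cm (X : Config d M) {g : Rd d × M → ℝ≥0∞} (hg : Measurable g) :
    ∫⁻ p, g p ∂X.cm = ∑' p : X.pts, g p := by
  simp [Config.cm, lintegral_sum_measure, lintegral_dirac' _ hg]

theorem Config.cm_apply (X : Config d M) {B : Set (Rd d × M)} (hB : MeasurableSet B) :
    X.cm B = (count B X : ℝ≥0∞) := by
  rw [← lintegral_indicator_one hB, Config.lintegral_cm _ (measurable_one.indicator hB), count_eq,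
    ← ENNReal.tsum_set_one, tsum_subtype X.pts (B.indicator 1),
    tsum_subtype (X.pts ∩ B) (fun _ => (1 : ℝ≥0∞)), ← Set.indicator_indicator]
  rfl

theorem measurable_count {B : Set (Rd d × M)} (hB : MeasurableSet B) :
    Measurable (count B : Config d M → ℕ∞) := by
  rw [measurable_iff_comap_le]
  exact le_iSup₂_of_le B hB le_rfl

theorem measurable_toENNReal' : Measurable (fun n : ℕ∞ => (n : ℝ≥0∞)) := measurable_of_countable _

theorem Config.measurable_cm : Measurable (Config.cm : Config d M → Measure (Rd d × M)) := by
  refine Measure.measurable_of_measurable_coe _ fun B hB => ?_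
  simp only [Config.cm_apply _ hB]
  exact measurable_toENNReal'.comp (measurable_count hB)

/-- The counts generate the σ-algebra and take countably many values, so their fibres suffice, and
these are fibres of `cm`. Measurability of an operation on configurations thus becomes a question
about integrals against counting measures. -/
theorem Config.measurable_of_cm {α : Type*} [MeasurableSpace α] {F : α → Config d M}
    (h : ∀ B, MeasurableSet B → Measurable fun a => (F a).cm B) : Measurable F := by
  refine measurable_iff_comap_le.2 ?_
  rw [instMeasurableSpaceConfig, MeasurableSpace.comap_iSup]
  refine iSup_le fun B => ?_
  rw [MeasurableSpace.comap_iSup]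
  refine iSup_le fun hB => ?_
  rw [MeasurableSpace.comap_comp]
  refine measurable_iff_comap_le.1 (measurable_to_countable' fun n => ?_)
  have h1 : (count B ∘ F) ⁻¹' {n} = (fun a => (F a).cm B) ⁻¹' {(n : ℝ≥0∞)} := by
    ext a
    simp [Config.cm_apply _ hB]
  rw [h1]
  exact h B hB (measurableSet_singleton _)

theorem measurableSet_cyl {B : Set (Rd d)} (hB : MeasurableSet B) :
    MeasurableSet (B ×ˢ (Set.univ : Set M)) := hB.prod MeasurableSet.univ

theorem Config.cm_ball_lt_top (X : Config d M) (n : ℕ) :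
    X.cm (Metric.closedBall 0 n ×ˢ Set.univ) < ∞ := by
  rw [Config.cm_apply _ (measurableSet_cyl measurableSet_closedBall), count_eq]
  have := X.finite_inter (Metric.isBounded_closedBall (x := (0 : Rd d)) (r := n))
  simpa using this

theorem Config.measurable_lintegral_cm {α : Type*} [MeasurableSpace α]
    {f : Config d M × α → Rd d × M → ℝ≥0∞} (hf : Measurable (Function.uncurry f)) :
    Measurable fun q : Config d M × α => ∫⁻ p, f q p ∂q.1.cm :=
  measurable_lintegral_of_spanning (Config.measurable_cm.comp measurable_fst) _
    (fun _ => measurableSet_cyl measurableSet_closedBall) iUnion_ball_cyl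
    (fun q n => q.1.cm_ball_lt_top n) hf

theorem Config.cm_hyb {B : Set (Rd d)} (hB : MeasurableSet B) (U W : Config d M) :
    (Config.hyb B U W).cm = U.cm.restrict (B ×ˢ Set.univ) + W.cm.restrict (Bᶜ ×ˢ Set.univ) := by
  refine Measure.ext fun C hC => ?_
  rw [Measure.add_apply, Measure.restrict_apply hC, Measure.restrict_apply hC,
    Config.cm_apply _ hC, Config.cm_apply _ (hC.inter (measurableSet_cyl hB)),
    Config.cm_apply _ (hC.inter (measurableSet_cyl hB.compl)), count_eq, count_eq, count_eq,
    ← ENat.toENNReal_add, ← Set.encard_union_eq]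
  · congr 2
    ext p
    simp only [Config.pts_hyb, Set.mem_inter_iff, Set.mem_union]
    tauto
  · rw [Set.disjoint_left]
    rintro p ⟨_, _, h1⟩ ⟨_, _, h2⟩
    exact h2.1 h1.1

theorem Config.measurable_hyb {B : Set (Rd d)} (hB : MeasurableSet B) :
    Measurable fun q : Config d M × Config d M => Config.hyb B q.1 q.2 := by
  refine Config.measurable_of_cm fun C hC => ?_
  simp only [Config.cm_hyb hB, Measure.add_apply, Measure.restrict_apply hC]
  exact ((Measure.measurable_coe (hC.inter (measurableSet_cyl hB))).comp
    (Config.measurable_cm.comp measurable_fst)).add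
    ((Measure.measurable_coe (hC.inter (measurableSet_cyl hB.compl))).comp
    (Config.measurable_cm.comp measurable_snd))

theorem Config.measurable_restr {B : Set (Rd d)} (hB : MeasurableSet B) :
    Measurable (Config.restr B : Config d M → Config d M) :=
  (Config.measurable_hyb hB).comp (measurable_id.prodMk measurable_const)

theorem measurable_affPt (a : ℝ) :
    Measurable fun q : Rd d × (Rd d × M) => affPt q.1 a q.2 := by
  unfold affPt
  fun_prop

theorem Config.cm_aff (y : Rd d) {a : ℝ} (ha : a ≠ 0) (X : Config d M) :
    (Config.aff y a X).cm = X.cm.map (affPt y a) := by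
  have hm : Measurable (affPt y a : Rd d × M → Rd d × M) :=
    (measurable_affPt a).comp measurable_prodMk_left
  refine Measure.ext fun C hC => ?_
  rw [Measure.map_apply hm hC, Config.cm_apply _ hC, Config.cm_apply _ (hm hC), count_eq, count_eq,
    Config.pts_aff y ha, act_eq_image, ← Set.image_inter_preimage,
    (affPt_injective y ha).encard_image]

theorem Config.measurable_aff {a : ℝ} (ha : a ≠ 0) :
    Measurable fun q : Rd d × Config d M => Config.aff q.1 a q.2 := by
  refine Config.measurable_of_cm fun C hC => ?_
  have hg : Measurable (C.indicator (1 : Rd d × M → ℝ≥0∞)) := measurable_one.indicator hC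
  have h0 : Measurable fun r : (Config d M × Rd d) × (Rd d × M) => affPt r.1.2 a r.2 := by
    unfold affPt; fun_prop
  have h3 : Measurable fun q : Config d M × Rd d => ∫⁻ p, C.indicator 1 (affPt q.2 a p) ∂q.1.cm :=
    Config.measurable_lintegral_cm (f := fun q p => C.indicator 1 (affPt q.2 a p)) (hg.comp h0)
  have h4 : Measurable fun q : Rd d × Config d M => (q.2, q.1) := by fun_prop
  have h5 := h3.comp h4
  convert h5 using 2 with q
  have hm : Measurable (affPt q.1 a : Rd d × M → Rd d × M) :=
    (measurable_affPt a).comp measurable_prodMk_left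
  rw [Config.cm_aff _ ha, ← lintegral_indicator_one hC, lintegral_map hg hm]
  rfl

theorem Config.cm_fiber_eq_zero (x : Rd d) (X : Config d M) :
    X.cm ({x} ×ˢ Set.univ) = 0 ↔ x ∉ Prod.fst '' X.pts := by
  rw [Config.cm_apply _ (measurableSet_cyl (measurableSet_singleton x)), count_eq]
  simp only [ENat.toENNReal_eq_zero, Set.encard_eq_zero, Set.eq_empty_iff_forall_notMem]
  constructor
  · rintro h ⟨p, hp, rfl⟩
    exact h p ⟨hp, rfl, trivial⟩
  · rintro h p ⟨hp, h1, -⟩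
    exact h ⟨p, hp, h1⟩

/-- The mass of the counting measure on a moving fibre is an integral of the indicator of the
measurable set of coinciding locations, hence depends measurably on all data. -/
theorem Config.measurable_fiber {α : Type*} [MeasurableSpace α] {F : α → Config d M}
    (hF : Measurable F) {x : α → Rd d} (hx : Measurable x) :
    MeasurableSet {a | x a ∉ Prod.fst '' (F a).pts} := by
  have h2 : Measurable fun q : Config d M × Rd d => q.1.cm ({q.2} ×ˢ Set.univ) := by
    have h3 : ∀ q : Config d M × Rd d, q.1.cm ({q.2} ×ˢ Set.univ) =
        ∫⁻ p, ({r : (Config d M × Rd d) × (Rd d × M) | r.2.1 = r.1.2}).indicator 1 (q, p)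
          ∂q.1.cm := by
      intro q
      rw [← lintegral_indicator_one (measurableSet_cyl (measurableSet_singleton _))]
      refine lintegral_congr fun p => ?_
      simp [Set.indicator]
    simp only [h3]
    refine Config.measurable_lintegral_cm ?_
    refine measurable_one.indicator (measurableSet_eq_fun ?_ ?_) <;> fun_prop
  have h4 := h2.comp (hF.prodMk hx) (measurableSet_singleton 0)
  convert h4 using 1
  ext a
  simp [Config.cm_fiber_eq_zero]

theorem Config.cm_add {p : Rd d × M} {X : Config d M} (h : p.1 ∉ Prod.fst '' X.pts) :
    (Config.add p X).cm = Measure.dirac p + X.cm := by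
  refine Measure.ext fun C hC => ?_
  have hp : p ∉ X.pts := fun hp => h ⟨p, hp, rfl⟩
  rw [Measure.add_apply, Config.cm_apply _ hC, Config.cm_apply _ hC, Measure.dirac_apply' _ hC,
    count_eq, count_eq, Config.pts_add h]
  by_cases hpC : p ∈ C
  · rw [Set.insert_inter_of_mem hpC, Set.encard_insert_of_notMem (fun h' => hp h'.1)]
    simp [hpC, add_comm]
  · rw [Set.insert_inter_of_notMem hpC]
    simp [hpC]

theorem Config.measurable_add :
    Measurable fun q : (Rd d × M) × Config d M => Config.add q.1 q.2 := by
  refine Config.measurable_of_cm fun C hC => ?_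
  have hs : MeasurableSet {q : (Rd d × M) × Config d M | q.1.1 ∉ Prod.fst '' q.2.pts} :=
    Config.measurable_fiber measurable_snd (measurable_fst.comp measurable_fst)
  have hX : Measurable fun q : (Rd d × M) × Config d M => q.2.cm C :=
    (Measure.measurable_coe hC).comp (Config.measurable_cm.comp measurable_snd)
  classical
  have h1 : (fun q : (Rd d × M) × Config d M => (Config.add q.1 q.2).cm C) = fun q =>
      if q.1.1 ∉ Prod.fst '' q.2.pts then
        C.indicator 1 q.1 + q.2.cm C else q.2.cm C := by
    funext q
    by_cases h : q.1.1 ∉ Prod.fst '' q.2.pts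
    · rw [if_pos h, Config.cm_add h, Measure.add_apply, Measure.dirac_apply' _ hC]
    · rw [if_neg h, Config.add_of_mem (not_not.1 h)]
  rw [h1]
  exact Measurable.ite hs (((measurable_one.indicator hC).comp measurable_fst).add hX) hX

end

section

variable {d : ℕ} {M : Type*}

/-! ### Enumerations of finite configurations -/

/-- Tuples of points with pairwise distinct locations. -/
def distinctTuples (d : ℕ) (M : Type*) (n : ℕ) : Set (Fin n → Rd d × M) :=
  {v | Function.Injective fun i => (v i).1}

open Classical in
/-- The configuration enumerated by a tuple with distinct locations. -/
def ofTuple {n : ℕ} (v : Fin n → Rd d × M) : Config d M :=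
  Config.ofFinite (if v ∈ distinctTuples d M n then Set.range v else ∅)
    (by split_ifs; exacts [Set.finite_range v, Set.finite_empty])

theorem pts_ofTuple {n : ℕ} {v : Fin n → Rd d × M} (hv : v ∈ distinctTuples d M n) :
    (ofTuple v).pts = Set.range v := by
  rw [ofTuple, Config.ofFinite, Config.pts_mk, if_pos hv]

theorem injective_of_mem_distinctTuples {n : ℕ} {v : Fin n → Rd d × M}
    (hv : v ∈ distinctTuples d M n) : Function.Injective v :=
  fun _ _ h => hv (congrArg Prod.fst h)

/-- Finite configurations whose points have distinct locations. -/
def simpleConfigs (d : ℕ) (M : Type*) : Set (Config d M) :=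
  {X | X.pts.Finite ∧ Set.InjOn Prod.fst X.pts}

theorem ofTuple_mem {n : ℕ} (v : Fin n → Rd d × M) : ofTuple v ∈ simpleConfigs d M := by
  by_cases hv : v ∈ distinctTuples d M n
  · rw [simpleConfigs, Set.mem_ofPred_eq, pts_ofTuple hv]
    refine ⟨Set.finite_range v, ?_⟩
    rintro _ ⟨i, rfl⟩ _ ⟨j, rfl⟩ h
    exact congrArg v (hv h)
  · have : (ofTuple v).pts = ∅ := by rw [ofTuple, Config.ofFinite, Config.pts_mk, if_neg hv]
    rw [simpleConfigs, Set.mem_ofPred_eq, this]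
    exact ⟨Set.finite_empty, Set.injOn_empty _⟩

theorem exists_ofTuple {X : Config d M} (hX : X ∈ simpleConfigs d M) :
    ∃ (v : Fin X.pts.ncard → Rd d × M), v ∈ distinctTuples d M _ ∧ X = ofTuple v ∧
      ∀ i, v i ∈ X.pts := by
  have := hX.1.fintype
  have e : Fin X.pts.ncard ≃ X.pts := (Finite.equivFinOfCardEq (Nat.card_coe_set_eq _)).symm
  have hv : (fun i => (e i : Rd d × M)) ∈ distinctTuples d M _ := fun i j h =>
    e.injective (Subtype.ext (hX.2 (e i).2 (e j).2 h))
  refine ⟨_, hv, Config.ext ?_, fun i => (e i).2⟩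
  rw [pts_ofTuple hv]
  ext p
  constructor
  · intro hp
    exact ⟨e.symm ⟨p, hp⟩, by simp⟩
  · rintro ⟨i, rfl⟩
    exact (e i).2

theorem eq_ofTuple {X : Config d M} {n : ℕ} (hfin : X.pts.Finite) (hn : X.pts.ncard = n)
    {v : Fin n → Rd d × M} (hv : v ∈ distinctTuples d M n) (hvX : ∀ i, v i ∈ X.pts) :
    X = ofTuple v := by
  refine Config.ext ?_
  rw [pts_ofTuple hv]
  refine (Set.eq_of_subset_of_ncard_le (Set.range_subset_iff.2 hvX) ?_ hfin).symm
  rw [hn, Set.ncard_range_of_injective (injective_of_mem_distinctTuples hv), Nat.card_fin]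

/-! ### Measurability on configurations tested on enumerating tuples. -/

variable [MeasurableSpace M]

theorem measurableSet_distinctTuples (n : ℕ) : MeasurableSet (distinctTuples d M n) := by
  have : distinctTuples d M n = ⋂ (i : Fin n) (j : Fin n) (_ : i ≠ j),
      {v : Fin n → Rd d × M | (v i).1 = (v j).1}ᶜ := by
    ext v
    simp only [distinctTuples, Set.mem_ofPred_eq, Set.mem_iInter, Set.mem_compl_iff]
    exact ⟨fun h i j hij he => hij (h he), fun h i j he => by_contra fun hij => h i j hij he⟩
  rw [this]
  refine MeasurableSet.iInter fun i => MeasurableSet.iInter fun j => MeasurableSet.iInter fun _ =>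
    (measurableSet_eq_fun ?_ ?_).compl <;> fun_prop

theorem measurable_ofTuple (n : ℕ) :
    Measurable (ofTuple : (Fin n → Rd d × M) → Config d M) := by
  refine Config.measurable_of_cm fun B hB => ?_
  classical
  have h : (fun v : Fin n → Rd d × M => (ofTuple v).cm B) =
      (distinctTuples d M n).indicator fun v => ∑ i, B.indicator (1 : Rd d × M → ℝ≥0∞) (v i) := by
    funext v
    by_cases hv : v ∈ distinctTuples d M n
    · rw [Set.indicator_of_mem hv, ← lintegral_indicator_one hB,
        Config.lintegral_cm _ (measurable_one.indicator hB), pts_ofTuple hv,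
        ← tsum_fintype (L := .unconditional _)]
      exact (Equiv.ofInjective v (injective_of_mem_distinctTuples hv)).tsum_eq
        (fun p => B.indicator (1 : Rd d × M → ℝ≥0∞) p) |>.symm
    · have : (ofTuple v).pts = ∅ := by rw [ofTuple, Config.ofFinite, Config.pts_mk, if_neg hv]
      rw [Set.indicator_of_notMem hv, Config.cm_apply _ hB, count_eq, this]
      simp
  rw [h]
  refine Measurable.indicator ?_ (measurableSet_distinctTuples n)
  exact Finset.measurable_sum _ fun i _ =>
    (measurable_one.indicator hB).comp (measurable_pi_apply i)

open Classical in
/-- The sum of the unit masses at all `n`-tuples of points of a configuration with `n` points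
(and zero at other configurations). -/
def tupleMeasure (n : ℕ) (X : Config d M) : Measure (Fin n → Rd d × M) :=
  if X.pts.encard = n then Measure.sum fun v : Fin n → X.pts => Measure.dirac fun i => (v i : _)
  else 0

theorem lintegral_tupleMeasure {n : ℕ} {X : Config d M} (hX : X.pts.encard = n)
    {g : (Fin n → Rd d × M) → ℝ≥0∞} (hg : Measurable g) :
    ∫⁻ v, g v ∂(tupleMeasure n X) = ∑' v : Fin n → X.pts, g fun i => (v i : _) := by
  simp [tupleMeasure, if_pos hX, lintegral_sum_measure, lintegral_dirac' _ hg]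

/-- The sum over all tuples of points, repetitions included, of a product of indicators is the
product of the sums. -/
theorem tupleMeasure_pi {n : ℕ} {X : Config d M} (hX : X.pts.encard = n)
    {B : Fin n → Set (Rd d × M)} (hB : ∀ i, MeasurableSet (B i)) :
    tupleMeasure n X (Set.univ.pi B) = ∏ i, X.cm (B i) := by
  have hf : X.pts.Finite := Set.finite_of_encard_eq_coe hX
  have := hf.fintype
  rw [← lintegral_indicator_one (MeasurableSet.univ_pi hB),
    lintegral_tupleMeasure hX (measurable_one.indicator (MeasurableSet.univ_pi hB))]
  have h1 : ∀ i, X.cm (B i) = ∑ p : X.pts, (B i).indicator (1 : Rd d × M → ℝ≥0∞) p := fun i => by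
    rw [← lintegral_indicator_one (hB i), Config.lintegral_cm _ (measurable_one.indicator (hB i)),
      tsum_fintype]
  simp only [h1]
  rw [Finset.prod_univ_sum, tsum_fintype, Fintype.piFinset_univ]
  refine Finset.sum_congr rfl fun v _ => ?_
  classical
  simp only [Set.indicator, Set.mem_univ_pi, Pi.one_apply, Finset.prod_ite_zero]
  simp

theorem isFiniteMeasure_tupleMeasure (n : ℕ) (X : Config d M) :
    IsFiniteMeasure (tupleMeasure n X) := by
  by_cases hX : X.pts.encard = n
  · refine ⟨?_⟩
    rw [← Set.pi_univ Set.univ, tupleMeasure_pi hX fun _ => MeasurableSet.univ]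
    refine ENNReal.prod_lt_top fun i _ => ?_
    rw [Config.cm_apply _ MeasurableSet.univ, count_eq, Set.inter_univ, hX]
    simp
  · rw [tupleMeasure, if_neg hX]
    infer_instance

theorem measurableSet_encard_eq (n : ℕ) :
    MeasurableSet {X : Config d M | X.pts.encard = n} := by
  have h := measurable_count (d := d) (MeasurableSet.univ (α := Rd d × M))
    (measurableSet_singleton (n : ℕ∞))
  convert h using 1
  ext X
  simp [count_eq]

theorem measurable_tupleMeasure (n : ℕ) :
    Measurable (tupleMeasure n : Config d M → Measure (Fin n → Rd d × M)) := by
  have := isFiniteMeasure_tupleMeasure (d := d) (M := M) n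
  have key : ∀ B : Fin n → Set (Rd d × M), (∀ i, MeasurableSet (B i)) →
      Measurable fun X : Config d M => tupleMeasure n X (Set.univ.pi B) := by
    intro B hB
    classical
    have h : (fun X : Config d M => tupleMeasure n X (Set.univ.pi B)) =
        ({X : Config d M | X.pts.encard = n}).indicator fun X => ∏ i, X.cm (B i) := by
      funext X
      by_cases hX : X.pts.encard = n
      · rw [Set.indicator_of_mem (by exact hX), tupleMeasure_pi hX hB]
      · rw [Set.indicator_of_notMem (by exact hX), tupleMeasure, if_neg hX]
        rfl
    rw [h]
    refine Measurable.indicator ?_ (measurableSet_encard_eq n)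
    exact Finset.measurable_prod _ fun i _ =>
      (Measure.measurable_coe (hB i)).comp Config.measurable_cm
  refine Measurable.measure_of_isPiSystem generateFrom_pi.symm isPiSystem_pi ?_ ?_
  · rintro _ ⟨B, hB, rfl⟩
    exact key B fun i => hB i trivial
  · have := key (fun _ => Set.univ) fun _ => MeasurableSet.univ
    simpa only [Set.pi_univ] using this

/-- A configuration with n points is simple exactly if some n-tuple of its points has distinct
locations: such a tuple must exhaust it. This makes simplicity a measurable condition. -/
theorem simpleConfigs_eq : simpleConfigs d M =
    ⋃ n : ℕ, {X | tupleMeasure n X (distinctTuples d M n) ≠ 0} := by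
  ext X
  simp only [Set.mem_iUnion, Set.mem_ofPred_eq]
  constructor
  · intro hX
    obtain ⟨v, hv, hXv, hvX⟩ := exists_ofTuple hX
    have hn : X.pts.encard = X.pts.ncard := by rw [hX.1.cast_ncard_eq]
    refine ⟨X.pts.ncard, fun h0 => ?_⟩
    rw [← lintegral_indicator_one (measurableSet_distinctTuples _), lintegral_tupleMeasure hn
      (measurable_one.indicator (measurableSet_distinctTuples _)), ENNReal.tsum_eq_zero] at h0
    have := h0 fun i => ⟨v i, hvX i⟩
    simp [hv] at this
  · rintro ⟨n, h0⟩
    have hn : X.pts.encard = n := by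
      by_contra hn
      rw [tupleMeasure, if_neg hn] at h0
      exact h0 rfl
    have hf : X.pts.Finite := Set.finite_of_encard_eq_coe hn
    rw [← lintegral_indicator_one (measurableSet_distinctTuples _), lintegral_tupleMeasure hn
      (measurable_one.indicator (measurableSet_distinctTuples _)), Ne, ENNReal.tsum_eq_zero] at h0
    push Not at h0
    obtain ⟨v, hv⟩ := h0
    have hv' := Set.mem_of_indicator_ne_zero hv
    rw [eq_ofTuple hf (by rw [Set.ncard, hn, ENat.toNat_natCast]) hv' fun i => (v i).2]
    exact ofTuple_mem _

theorem measurableSet_simpleConfigs : MeasurableSet (simpleConfigs d M) := by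
  rw [simpleConfigs_eq]
  refine MeasurableSet.iUnion fun n => ?_
  exact ((Measure.measurable_coe (measurableSet_distinctTuples n)).comp
    (measurable_tupleMeasure n)) (measurableSet_singleton 0).compl

/-- A function of a configuration and a parameter is measurable on the set of finite configurations
with distinct locations if it is measurable as a function of enumerating tuples. -/
theorem measurable_of_tuples {α : Type*} [MeasurableSpace α] {f : Config d M × α → ℝ≥0∞}
    (hf0 : ∀ q, q.1 ∉ simpleConfigs d M → f q = 0)
    (hf : ∀ n, Measurable ((distinctTuples d M n ×ˢ Set.univ).indicator
      fun r : (Fin n → Rd d × M) × α => f (ofTuple r.1, r.2))) : Measurable f := by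
  classical
  let g : ∀ n, (Fin n → Rd d × M) × α → ℝ≥0∞ := fun n =>
    (distinctTuples d M n ×ˢ Set.univ).indicator fun r => f (ofTuple r.1, r.2)
  let c : ℕ → Config d M → ℝ≥0∞ := fun n X => tupleMeasure n X (distinctTuples d M n)
  have hD : ∀ n, MeasurableSet (distinctTuples d M n) := measurableSet_distinctTuples
  have hc : ∀ n, Measurable (c n) := fun n =>
    (Measure.measurable_coe (hD n)).comp (measurable_tupleMeasure n)
  have hI : ∀ n, Measurable fun q : Config d M × α =>
      ∫⁻ v, g n (v, q.2) ∂(tupleMeasure n q.1) := fun n => by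
    refine measurable_lintegral_of_isFiniteMeasure (f := fun q v => g n (v, q.2))
      ((measurable_tupleMeasure n).comp measurable_fst)
      (fun q => isFiniteMeasure_tupleMeasure n q.1) ?_
    exact (hf n).comp (measurable_snd.prodMk (measurable_snd.comp measurable_fst))
  -- Every tuple charged by `tupleMeasure` with distinct locations enumerates the whole
  -- configuration, so each contributes the same value `f q`, and `c n` counts these tuples.
  have hval : ∀ n (q : Config d M × α),
      ∫⁻ v, g n (v, q.2) ∂(tupleMeasure n q.1) = f q * c n q.1 := by
    intro n q
    by_cases hn : q.1.pts.encard = n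
    · have hfin : q.1.pts.Finite := Set.finite_of_encard_eq_coe hn
      have hg : Measurable fun v => g n (v, q.2) := (hf n).comp measurable_prodMk_right
      change _ = f q * tupleMeasure n q.1 (distinctTuples d M n)
      rw [lintegral_tupleMeasure hn hg, ← lintegral_indicator_one (hD n),
        lintegral_tupleMeasure hn (measurable_one.indicator (hD n)), ← ENNReal.tsum_mul_left]
      refine tsum_congr fun v => ?_
      by_cases hv : (fun i => (v i : Rd d × M)) ∈ distinctTuples d M n
      · rw [Set.indicator_of_mem hv, Pi.one_apply, mul_one]
        change Set.indicator _ _ _ = _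
        rw [Set.indicator_of_mem (by exact ⟨hv, trivial⟩)]
        rw [← eq_ofTuple hfin (by rw [Set.ncard, hn, ENat.toNat_natCast]) hv fun i => (v i).2]
      · rw [Set.indicator_of_notMem hv, mul_zero]
        change Set.indicator _ _ _ = _
        rw [Set.indicator_of_notMem (fun h => hv h.1)]
    · change _ = f q * tupleMeasure n q.1 (distinctTuples d M n)
      rw [tupleMeasure, if_neg hn]
      simp
  have hcfin : ∀ n X, c n X ≠ ∞ := fun n X =>
    have := isFiniteMeasure_tupleMeasure n X
    measure_ne_top _ _
  have hF : ∀ n, Measurable fun q : Config d M × α =>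
      (∫⁻ v, g n (v, q.2) ∂(tupleMeasure n q.1)) / c n q.1 := fun n =>
    (hI n).div ((hc n).comp measurable_fst)
  -- Only the n that is the number of points of a simple configuration has `c n ≠ 0`. The other
  -- quotients are 0 / 0 = 0 and do not affect the supremum.
  have hsup : f = fun q => ⨆ n, (∫⁻ v, g n (v, q.2) ∂(tupleMeasure n q.1)) / c n q.1 := by
    funext q
    simp only [hval]
    have hle : ∀ n, f q * c n q.1 / c n q.1 ≤ f q := fun n =>
      ENNReal.div_le_of_le_mul le_rfl
    by_cases hq : q.1 ∈ simpleConfigs d M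
    · rw [simpleConfigs_eq, Set.mem_iUnion] at hq
      obtain ⟨n, hn⟩ := hq
      refine le_antisymm (le_iSup_of_le n ?_) (iSup_le hle)
      rw [ENNReal.mul_div_cancel_right hn (hcfin n q.1)]
    · rw [hf0 q hq]
      simp
  rw [hsup]
  exact Measurable.iSup hF

/-! ### Measurability of the functional -/

/-- Pairs `(p, X)` such that `X` is finite, the points of `X` have distinct locations, and the
location of `p` is not among them. -/
def regularPairs (d : ℕ) (M : Type*) : Set ((Rd d × M) × Config d M) :=
  {q | q.2 ∈ simpleConfigs d M ∧ q.1.1 ∉ Prod.fst '' q.2.pts}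

open Classical in
/-- `ξ(x, t; X, ·)` as a function of `((x, t), X)`, set to zero outside of the regular pairs. -/
def regXi (ξ : Functional d M) (q : (Rd d × M) × Config d M) : Measure (Rd d) :=
  if q ∈ regularPairs d M then ins ξ q.1.1 q.1.2 q.2.pts else 0

theorem regXi_of_mem (ξ : Functional d M) {q : (Rd d × M) × Config d M}
    (h : q ∈ regularPairs d M) : regXi ξ q = ins ξ q.1.1 q.1.2 q.2.pts := if_pos h

theorem isFiniteMeasure_regXi {ξ : Functional d M} (hξ : IsMeasureFunctional ξ)
    (q : (Rd d × M) × Config d M) : IsFiniteMeasure (regXi ξ q) := by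
  by_cases hq : q ∈ regularPairs d M
  · rw [regXi_of_mem ξ hq]
    exact hξ.finite _ _ _ (hq.1.1.insert _) (Set.mem_insert _ _)
  · rw [regXi, if_neg hq]
    infer_instance

theorem cons_mem_distinctTuples {n : ℕ} {p : Rd d × M} {v : Fin n → Rd d × M}
    (hv : v ∈ distinctTuples d M n) (hp : p.1 ∉ Prod.fst '' (ofTuple v).pts) :
    (Fin.cons p v : Fin (n + 1) → Rd d × M) ∈ distinctTuples d M (n + 1) := by
  rw [pts_ofTuple hv] at hp
  have : (fun i => ((Fin.cons p v : Fin (n + 1) → Rd d × M) i).1) =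
      Fin.cons p.1 fun i => (v i).1 := by
    funext i
    refine Fin.cases ?_ (fun j => ?_) i <;> simp
  rw [distinctTuples, Set.mem_ofPred_eq, this, Fin.cons_injective_iff]
  refine ⟨?_, hv⟩
  rintro ⟨i, hi⟩
  exact hp ⟨v i, ⟨i, rfl⟩, hi⟩

/-- The standing assumption gives measurability along injective tuples that start with the
distinguished point. Enumerating the configuration and putting the point in front turns it into
measurability on the space of configurations. -/
theorem measurable_regXi {ξ : Functional d M} (hξ : IsMeasureFunctional ξ) :
    Measurable (regXi ξ) := by
  classical
  refine Measure.measurable_of_measurable_coe _ fun A hA => ?_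
  have h : Measurable fun q : Config d M × (Rd d × M) => regXi ξ (q.2, q.1) A := by
    refine measurable_of_tuples (fun q hq => ?_) fun n => ?_
    · rw [regXi, if_neg fun h => hq h.1]
      rfl
    · let D : Set ((Fin n → Rd d × M) × (Rd d × M)) :=
        {r | r.1 ∈ distinctTuples d M n ∧ r.2.1 ∉ Prod.fst '' (ofTuple r.1).pts}
      have hD : MeasurableSet D :=
        (measurable_fst (measurableSet_distinctTuples n)).inter
          (Config.measurable_fiber ((measurable_ofTuple n).comp measurable_fst)
            (measurable_fst.comp measurable_snd))
      have hcons : Measurable fun r : (Fin n → Rd d × M) × (Rd d × M) =>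
          (Fin.cons r.2 r.1 : Fin (n + 1) → Rd d × M) := by
        refine measurable_pi_lambda _ fun i => ?_
        refine Fin.cases ?_ (fun j => ?_) i
        · simpa using measurable_snd
        · simp only [Fin.cons_succ]
          exact (measurable_pi_apply j).comp measurable_fst
      have hinj : ∀ r : D, Function.Injective (Fin.cons r.1.2 r.1.1 : Fin (n + 1) → Rd d × M) :=
        fun r => injective_of_mem_distinctTuples (cons_mem_distinctTuples r.2.1 r.2.2)
      have hmeas : Measurable fun r : D => (⟨Fin.cons r.1.2 r.1.1, hinj r⟩ :
          {v : Fin (n + 1) → Rd d × M // Function.Injective v}) :=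
        (hcons.comp measurable_subtype_coe).subtype_mk
      have h1 := (Measure.measurable_coe hA).comp ((hξ.measurable n).comp hmeas)
      have h2 : Measurable (D.indicator fun r : (Fin n → Rd d × M) × (Rd d × M) =>
          ins ξ r.2.1 r.2.2 (ofTuple r.1).pts A) := by
        refine measurable_of_restrict_of_restrict_compl hD ?_ ?_
        · convert h1 using 1
          funext r
          simp only [Set.domRestrict_apply, Set.indicator_of_mem r.2, Function.comp_apply,
            Fin.cons_zero, ins, Fin.range_cons, pts_ofTuple r.2.1]
        · convert (measurable_const : Measurable fun _ : (Dᶜ : Set _) => (0 : ℝ≥0∞)) using 1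
          funext r
          exact Set.indicator_of_notMem r.2 _
      convert h2 using 1
      funext r
      by_cases h1 : r.1 ∈ distinctTuples d M n
      · rw [Set.indicator_of_mem (show r ∈ _ ×ˢ Set.univ from ⟨h1, trivial⟩)]
        by_cases h2 : r.2.1 ∈ Prod.fst '' (ofTuple r.1).pts
        · rw [Set.indicator_of_notMem (show r ∉ D from fun h => h.2 h2), regXi,
            if_neg fun h => h.2 h2]
          rfl
        · rw [Set.indicator_of_mem (show r ∈ D from ⟨h1, h2⟩),
            regXi_of_mem ξ ⟨ofTuple_mem _, h2⟩]
      · rw [Set.indicator_of_notMem (show r ∉ D from fun h => h1 h.1),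
          Set.indicator_of_notMem (show r ∉ _ ×ˢ Set.univ from fun h => h1 h.1)]
  exact h.comp measurable_swap

end

section

variable {d : ℕ} {M : Type*} [MeasurableSpace M]

/-! ### Characteristic functionals of point processes -/

/-- Measures on `ℝ^d × M` that are finite on cylinders over balls. -/
def IsBallFinite (ν : Measure (Rd d × M)) : Prop :=
  ∀ n : ℕ, ν (Metric.closedBall 0 n ×ˢ Set.univ) < ∞

/-- Measurable functions with finitely many values that vanish off a cylinder over a ball. -/
structure IsTest (φ : Rd d × M → ℝ) : Prop where
  meas : Measurable φ
  fin : (Set.range φ).Finite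
  supp : ∃ n : ℕ, ∀ p : Rd d × M, p.1 ∉ Metric.closedBall 0 (n : ℝ) → φ p = 0

open Classical in
/-- The nonzero values of a test function. -/
def IsTest.vals {φ : Rd d × M → ℝ} (hφ : IsTest φ) : Finset ℝ := hφ.fin.toFinset.erase 0

theorem IsTest.measure_fiber {φ : Rd d × M → ℝ} (hφ : IsTest φ) {μ : Measure (Rd d × M)}
    (hμ : IsBallFinite μ) {y : ℝ} (hy : y ∈ hφ.vals) : μ (φ ⁻¹' {y}) < ∞ := by
  obtain ⟨n, hn⟩ := hφ.supp
  refine (measure_mono ?_).trans_lt (hμ n)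
  intro p hp
  refine ⟨by_contra fun h => ?_, trivial⟩
  have h1 := hn p h
  rw [hp] at h1
  exact Finset.ne_of_mem_erase hy h1

theorem IsTest.comp_eq {φ : Rd d × M → ℝ} (hφ : IsTest φ) {F : Type*} [AddCommMonoid F]
    {g : ℝ → F} (hg : g 0 = 0) (p : Rd d × M) :
    g (φ p) = ∑ y ∈ hφ.vals, (φ ⁻¹' {y}).indicator (fun _ => g y) p := by
  classical
  by_cases h0 : φ p = 0
  · rw [h0, hg, Finset.sum_eq_zero fun y hy => ?_]
    refine Set.indicator_of_notMem ?_ _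
    intro h
    have : φ p = y := h
    exact Finset.ne_of_mem_erase hy (this ▸ h0)
  · have hmem : φ p ∈ hφ.vals := Finset.mem_erase.2 ⟨h0, hφ.fin.mem_toFinset.2 ⟨p, rfl⟩⟩
    rw [Finset.sum_eq_single_of_mem (φ p) hmem]
    · rw [Set.indicator_of_mem]
      exact rfl
    · intro y _ hy
      refine Set.indicator_of_notMem ?_ _
      intro h
      exact hy h.symm

theorem IsTest.integrable {F : Type*} [NormedAddCommGroup F] {φ : Rd d × M → ℝ} (hφ : IsTest φ) {μ : Measure (Rd d × M)}
    (hμ : IsBallFinite μ) {g : ℝ → F} (hg : g 0 = 0) : Integrable (fun p => g (φ p)) μ := by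
  simp only [hφ.comp_eq hg]
  refine integrable_finsetSum _ fun y hy => ?_
  exact (integrable_indicator_iff (hφ.meas (measurableSet_singleton y))).2
    (integrableOn_const (hφ.measure_fiber hμ hy).ne)

theorem IsTest.integral_comp {F : Type*} [NormedAddCommGroup F] [NormedSpace ℝ F]
    [CompleteSpace F] {φ : Rd d × M → ℝ} (hφ : IsTest φ) {μ : Measure (Rd d × M)}
    (hμ : IsBallFinite μ) {g : ℝ → F} (hg : g 0 = 0) :
    ∫ p, g (φ p) ∂μ = ∑ y ∈ hφ.vals, μ.real (φ ⁻¹' {y}) • g y := by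
  simp only [hφ.comp_eq hg]
  rw [integral_finsetSum]
  · refine Finset.sum_congr rfl fun y _ => ?_
    rw [integral_indicator_const _ (hφ.meas (measurableSet_singleton y))]
  · intro y hy
    exact (integrable_indicator_iff (hφ.meas (measurableSet_singleton y))).2
      (integrableOn_const (hφ.measure_fiber hμ hy).ne)

theorem Config.isBallFinite_cm (X : Config d M) : IsBallFinite X.cm := X.cm_ball_lt_top

/-- The sum of `φ` over the points of a configuration. -/
def linStat (φ : Rd d × M → ℝ) (X : Config d M) : ℝ := ∫ p, φ p ∂X.cm

theorem IsTest.linStat_eq {φ : Rd d × M → ℝ} (hφ : IsTest φ) (X : Config d M) :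
    linStat φ X = ∑ y ∈ hφ.vals, X.cm.real (φ ⁻¹' {y}) * y := by
  exact hφ.integral_comp (g := id) X.isBallFinite_cm rfl

theorem IsTest.measurable_linStat {φ : Rd d × M → ℝ} (hφ : IsTest φ) :
    Measurable (linStat φ : Config d M → ℝ) := by
  simp only [funext hφ.linStat_eq]
  refine Finset.measurable_sum _ fun y _ => Measurable.mul_const ?_ _
  exact ((Measure.measurable_coe (hφ.meas (measurableSet_singleton y))).comp
    Config.measurable_cm).ennreal_toReal

/-- `Q` has the characteristic functional of a Poisson process with intensity measure `ν`. -/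
def HasPoissonCF (Q : Measure (Config d M)) (ν : Measure (Rd d × M)) : Prop :=
  ∀ φ : Rd d × M → ℝ, IsTest φ → ∫ X, Complex.exp (linStat φ X * Complex.I) ∂Q =
    Complex.exp (∫ p, (Complex.exp (φ p * Complex.I) - 1) ∂ν)

theorem integral_exp_count {Q : Measure (Config d M)} {B : Set (Rd d × M)} {r : ℝ≥0}
    (hB : MeasurableSet B)
    (h : Q.map (count B) = (poissonMeasure r).map (fun n : ℕ => (n : ℕ∞))) (y : ℝ) :
    ∫ X, Complex.exp ((X.cm.real B * y : ℝ) * Complex.I) ∂Q =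
      Complex.exp (r * (Complex.exp (y * Complex.I) - 1)) := by
  let g : ℕ∞ → ℂ := fun n => Complex.exp (((n : ℝ≥0∞).toReal * y : ℝ) * Complex.I)
  have h1 : ∀ X : Config d M, Complex.exp ((X.cm.real B * y : ℝ) * Complex.I) = g (count B X) :=
    fun X => by rw [Measure.real, Config.cm_apply _ hB]
  have h2 : ∫ X, g (count B X) ∂Q = ∫ n, g n ∂(Q.map (count B)) :=
    (integral_map (measurable_count hB).aemeasurable
      (measurable_of_countable g).aestronglyMeasurable).symm
  simp only [h1]
  rw [h2, h, integral_map (measurable_of_countable _).aemeasurable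
    (measurable_of_countable g).aestronglyMeasurable, ← charFun_map_cast_poissonMeasure,
    charFun_apply, integral_map (measurable_of_countable _).aemeasurable (by fun_prop)]
  simp only [g, Real.inner_apply]
  rfl

/-- The linear statistic of a test function is a finite linear combination of the counts on its
level sets, which are independent Poisson variables. The characteristic functional is therefore a
finite product of Poisson characteristic functions. -/
theorem IsPoissonLaw.hasPoissonCF {Q : Measure (Config d M)} {ν : Measure (Rd d × M)}
    (hQ : IsPoissonLaw Q ν) (hν : IsBallFinite ν) : HasPoissonCF Q ν := by
  intro φ hφ
  have := hQ.prob
  have hm : ∀ y, MeasurableSet (φ ⁻¹' {y}) := fun y => hφ.meas (measurableSet_singleton y)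
  have hind : iIndepFun (fun y : hφ.vals => count (φ ⁻¹' {y.1}) (M := M)) Q := by
    have e := hφ.vals.equivFin
    have h1 := hQ.indep _ (fun i => φ ⁻¹' {(e.symm i).1}) (fun i => hm _) ?_
    · have h2 := h1.precomp e.injective
      simpa [Function.comp_def] using h2
    · intro i j hij
      refine Disjoint.preimage _ ?_
      rw [Set.disjoint_singleton]
      exact fun h => hij (e.symm.injective (Subtype.ext h))
  have hind2 := hind.comp
    (fun y n => Complex.exp (((n : ℝ≥0∞).toReal * y.1 : ℝ) * Complex.I))
    fun y => measurable_of_countable _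
  have h3 := hind2.integral_fun_prod_eq_prod_integral fun y =>
    ((measurable_of_countable _).comp (measurable_count (hm y))).aestronglyMeasurable
  have h4 : ∀ X : Config d M, Complex.exp (linStat φ X * Complex.I) =
      ∏ y : hφ.vals, ((fun n : ℕ∞ => Complex.exp (((n : ℝ≥0∞).toReal * y.1 : ℝ) * Complex.I)) ∘
        count (φ ⁻¹' {y.1})) X := by
    intro X
    rw [hφ.linStat_eq, ← Finset.sum_coe_sort, Complex.ofReal_sum, Finset.sum_mul,
      Complex.exp_sum]
    simp only [Measure.real, Config.cm_apply _ (hm _)]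
    rfl
  simp only [h4]
  rw [h3, hφ.integral_comp (g := fun y => Complex.exp (y * Complex.I) - 1) hν (by simp),
    ← Finset.sum_coe_sort, Complex.exp_sum]
  refine Finset.prod_congr rfl fun y _ => ?_
  have h5 := integral_exp_count (hm y.1) (hQ.poisson _ (hm y.1) (hφ.measure_fiber hν y.2)) y.1
  simp only [Measure.real, Config.cm_apply _ (hm _)] at h5
  rw [Complex.real_smul]
  exact h5

theorem isTest_sum {ι : Type*} (I : Finset ι) (s : ι → ℝ) (B : ι → Set (Rd d × M))
    (hB : ∀ i, MeasurableSet (B i)) (n : ι → ℕ)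
    (hn : ∀ i, B i ⊆ Metric.closedBall 0 (n i) ×ˢ Set.univ) :
    IsTest fun p => ∑ i ∈ I, (B i).indicator (fun _ => s i) p := by
  classical
  induction I using Finset.induction_on with
  | empty =>
    refine ⟨measurable_const, ?_, 0, fun _ _ => by simp⟩
    refine (Set.finite_singleton (0 : ℝ)).subset ?_
    rintro _ ⟨p, rfl⟩
    simp
  | insert i I hi ih =>
    simp only [Finset.sum_insert hi]
    refine ⟨(measurable_const.indicator (hB i)).add ih.meas, ?_, ?_⟩
    · have h1 : (Set.range ((B i).indicator fun _ => s i)).Finite := by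
        refine (Set.toFinite {0, s i}).subset ?_
        rintro _ ⟨p, rfl⟩
        by_cases hp : p ∈ B i <;> simp [hp]
      refine (h1.add ih.fin).subset ?_
      rintro _ ⟨p, rfl⟩
      exact Set.add_mem_add ⟨p, rfl⟩ ⟨p, rfl⟩
    · obtain ⟨m, hm⟩ := ih.supp
      refine ⟨max m (n i), fun p hp => ?_⟩
      have h1 : p.1 ∉ Metric.closedBall 0 (m : ℝ) := fun h => hp
        (Metric.closedBall_subset_closedBall (by push_cast; exact le_max_left _ _) h)
      have h2 : p ∉ B i := fun h => hp
        (Metric.closedBall_subset_closedBall (by push_cast; exact le_max_right _ _) (hn i h).1)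
      simp [hm p h1, h2]

/-- The characteristic functional at step functions gives the joint characteristic functions of the
counts in finitely many bounded sets. These fix the finite-dimensional distributions, hence the law
of the whole family of counts, and the counts generate the σ-algebra. -/
theorem HasPoissonCF.unique {Q Q' : Measure (Config d M)} [IsProbabilityMeasure Q]
    [IsProbabilityMeasure Q'] {ν : Measure (Rd d × M)} (h : HasPoissonCF Q ν)
    (h' : HasPoissonCF Q' ν) : Q = Q' := by
  classical
  let ι := {B : Set (Rd d × M) // MeasurableSet B} × ℕ
  let B : ι → Set (Rd d × M) := fun i => i.1.1 ∩ Metric.closedBall 0 i.2 ×ˢ Set.univ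
  have hB : ∀ i, MeasurableSet (B i) := fun i =>
    i.1.2.inter (measurableSet_cyl measurableSet_closedBall)
  have hBfin : ∀ i (X : Config d M), X.cm (B i) < ∞ := fun i X =>
    (measure_mono Set.inter_subset_right).trans_lt (X.cm_ball_lt_top i.2)
  let J : Config d M → ι → ℝ := fun X i => X.cm.real (B i)
  have hJi : ∀ i, Measurable fun X : Config d M => X.cm.real (B i) := fun i =>
    ((Measure.measurable_coe (hB i)).comp Config.measurable_cm).ennreal_toReal
  have hJ : Measurable J := measurable_pi_lambda _ hJi
  have hQJ : Q.map J = Q'.map J := by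
    have hp : ∀ I : Finset ι, (Q'.map J).map I.restrict = (Q.map J).map I.restrict := by
      intro I
      have hI : Measurable (I.restrict : (ι → ℝ) → I → ℝ) := by fun_prop
      rw [Measure.map_map hI hJ, Measure.map_map hI hJ]
      have := Measure.isProbabilityMeasure_map (μ := Q) (hI.comp hJ).aemeasurable
      have := Measure.isProbabilityMeasure_map (μ := Q') (hI.comp hJ).aemeasurable
      refine Measure.ext_of_charFunDual ?_
      funext L
      rw [charFunDual_apply, charFunDual_apply,
        integral_map (hI.comp hJ).aemeasurable (by fun_prop),
        integral_map (hI.comp hJ).aemeasurable (by fun_prop)]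
      -- The coefficients of the functional `L`: its value at the vector of counts is the linear
      -- statistic of the step function with heights `s`.
      let s : I → ℝ := fun i => L (Pi.single i 1)
      have ht := isTest_sum (Finset.univ : Finset I) s (fun i => B i) (fun i => hB i)
        (fun i => i.1.2) (fun i => Set.inter_subset_right)
      have hlin : ∀ X : Config d M, linStat
          (fun p => ∑ i : I, (B i).indicator (fun _ => s i) p) X = L ((I.restrict ∘ J) X) := by
        intro X
        rw [linStat, integral_finsetSum]
        · have : (I.restrict ∘ J) X = ∑ i : I, X.cm.real (B i) • Pi.single i (1 : ℝ) := by
            funext j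
            rw [Finset.sum_apply, Finset.sum_eq_single j]
            · simp [J]
            · intro i _ hij
              simp [Pi.single_eq_of_ne hij.symm]
            · exact fun hj => (hj (Finset.mem_univ _)).elim
          rw [this, map_sum]
          refine Finset.sum_congr rfl fun i _ => ?_
          rw [integral_indicator_const _ (hB i), map_smul]
        · intro i _
          exact (integrable_indicator_iff (hB i)).2 (integrableOn_const (hBfin i X).ne)
      have e1 := h _ ht
      have e2 := h' _ ht
      simp only [hlin] at e1 e2
      rw [e1, e2]
    have : IsProbabilityMeasure (Q.map J) := Measure.isProbabilityMeasure_map hJ.aemeasurable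
    have : ∀ I : Finset ι, IsFiniteMeasure ((Q.map J).map I.restrict) := fun I => inferInstance
    exact IsProjectiveLimit.unique (P := fun I => (Q.map J).map I.restrict) (fun I => rfl) hp
  refine Measure.ext fun S hS => ?_
  -- The counts in bounded sets already generate the σ-algebra, since the count in `C` is the
  -- increasing limit of the counts in `C` intersected with balls.
  have hid : @Measurable _ _ (MeasurableSpace.comap J inferInstance) inferInstance
      (id : Config d M → Config d M) := by
    refine @Config.measurable_of_cm _ _ _ _ (MeasurableSpace.comap J inferInstance) _ fun C hC => ?_
    have h1 : (fun X : Config d M => X.cm C) =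
        fun X => ⨆ n : ℕ, ENNReal.ofReal (J X (⟨C, hC⟩, n)) := by
      funext X
      have h2 : C = ⋃ n : ℕ, B (⟨C, hC⟩, n) := by
        simp only [B]
        rw [← Set.inter_iUnion, iUnion_ball_cyl, Set.inter_univ]
      conv_lhs => rw [h2]
      rw [Monotone.measure_iUnion]
      · exact iSup_congr fun n => (ENNReal.ofReal_toReal (hBfin _ X).ne).symm
      · intro m n hmn
        refine Set.inter_subset_inter_right _ (Set.prod_mono ?_ subset_rfl)
        exact Metric.closedBall_subset_closedBall (by exact_mod_cast hmn)
    change @Measurable _ _ (MeasurableSpace.comap J inferInstance) _ fun X : Config d M => X.cm C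
    rw [h1]
    refine Measurable.iSup fun n => ENNReal.measurable_ofReal.comp ?_
    exact (measurable_pi_apply _).comp (comap_measurable J)
  obtain ⟨S', hS', hSS⟩ := hid hS
  rw [Set.preimage_id] at hSS
  rw [← hSS, ← Measure.map_apply hJ hS', ← Measure.map_apply hJ hS', hQJ]

end

section

variable {d : ℕ} {M : Type*}

theorem ofTuple_insertNth {n : ℕ} {i : Fin (n + 1)} {p : Rd d × M} {v : Fin n → Rd d × M}
    (h : (i.insertNth p v : Fin (n + 1) → Rd d × M) ∈ distinctTuples d M (n + 1))
    (hv : v ∈ distinctTuples d M n) :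
    p.1 ∉ Prod.fst '' (ofTuple v).pts ∧ ofTuple (i.insertNth p v) = Config.add p (ofTuple v) := by
  have hp : p.1 ∉ Prod.fst '' (ofTuple v).pts := by
    rw [pts_ofTuple hv]
    rintro ⟨_, ⟨j, rfl⟩, hj⟩
    have := @h (i.succAbove j) i (by simpa using hj)
    exact Fin.succAbove_ne i j this
  refine ⟨hp, Config.ext ?_⟩
  rw [pts_ofTuple h, Config.pts_add hp, pts_ofTuple hv, Fin.range_insertNth]
  rfl

variable [MeasurableSpace M]

/-! ### Operations on Poisson processes -/

theorem IsTest.indicator {φ : Rd d × M → ℝ} (hφ : IsTest φ) {B : Set (Rd d × M)}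
    (hB : MeasurableSet B) : IsTest (B.indicator φ) := by
  obtain ⟨n, hn⟩ := hφ.supp
  refine ⟨hφ.meas.indicator hB, (hφ.fin.insert 0).subset ?_, n, fun p hp => ?_⟩
  · rintro _ ⟨p, rfl⟩
    by_cases hp : p ∈ B
    · rw [Set.indicator_of_mem hp]
      exact Or.inr ⟨p, rfl⟩
    · rw [Set.indicator_of_notMem hp]
      exact Or.inl rfl
  · rw [Set.indicator_apply_eq_zero]
    exact fun _ => hn p hp

theorem IsTest.integrable_self {φ : Rd d × M → ℝ} (hφ : IsTest φ) {μ : Measure (Rd d × M)}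
    (hμ : IsBallFinite μ) : Integrable φ μ := hφ.integrable (g := id) hμ rfl

theorem IsBallFinite.restrict {ν : Measure (Rd d × M)} (hν : IsBallFinite ν)
    (B : Set (Rd d × M)) : IsBallFinite (ν.restrict B) := fun n =>
  (Measure.restrict_apply_le _ _).trans_lt (hν n)

theorem linStat_hyb {φ : Rd d × M → ℝ} (hφ : IsTest φ) {B : Set (Rd d)} (hB : MeasurableSet B)
    (U W : Config d M) : linStat φ (Config.hyb B U W) =
      linStat ((B ×ˢ Set.univ).indicator φ) U + linStat ((Bᶜ ×ˢ Set.univ).indicator φ) W := by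
  rw [linStat, Config.cm_hyb hB, integral_add_measure, linStat, linStat,
    integral_indicator (measurableSet_cyl hB), integral_indicator (measurableSet_cyl hB.compl)]
  · exact hφ.integrable_self (U.isBallFinite_cm.restrict _)
  · exact hφ.integrable_self (W.isBallFinite_cm.restrict _)

theorem integral_exp_restrict {φ : Rd d × M → ℝ} {ν : Measure (Rd d × M)} {B : Set (Rd d × M)}
    (hB : MeasurableSet B) :
    ∫ p, (Complex.exp (φ p * Complex.I) - 1) ∂(ν.restrict B) =
      ∫ p, (Complex.exp (B.indicator φ p * Complex.I) - 1) ∂ν := by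
  rw [← integral_indicator hB]
  refine integral_congr_ae (Eventually.of_forall fun p => ?_)
  by_cases hp : p ∈ B <;> simp [hp]

/-- The two parts come from independent configurations, so the characteristic functional factorizes
and the exponents add up. -/
theorem HasPoissonCF.map_hyb {Q Q' : Measure (Config d M)} [IsProbabilityMeasure Q]
    [IsProbabilityMeasure Q'] {ν ν' : Measure (Rd d × M)} (h : HasPoissonCF Q ν)
    (h' : HasPoissonCF Q' ν') (hν : IsBallFinite ν) (hν' : IsBallFinite ν')
    {B : Set (Rd d)} (hB : MeasurableSet B) :
    HasPoissonCF ((Q.prod Q').map fun q => Config.hyb B q.1 q.2)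
      (ν.restrict (B ×ˢ Set.univ) + ν'.restrict (Bᶜ ×ˢ Set.univ)) := by
  intro φ hφ
  have h1 := hφ.indicator (measurableSet_cyl (M := M) hB)
  have h2 := hφ.indicator (measurableSet_cyl (M := M) hB.compl)
  have hi : ∀ {μ : Measure (Rd d × M)}, IsBallFinite μ →
      Integrable (fun p => Complex.exp (φ p * Complex.I) - 1) μ := fun hμ =>
    hφ.integrable (g := fun y => Complex.exp (y * Complex.I) - 1) hμ (by simp)
  have hm : Measurable fun X : Config d M => Complex.exp (linStat φ X * Complex.I) := by
    have := hφ.measurable_linStat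
    fun_prop
  rw [integral_map (Config.measurable_hyb hB).aemeasurable hm.aestronglyMeasurable]
  simp only [linStat_hyb hφ hB, Complex.ofReal_add, add_mul, Complex.exp_add]
  rw [integral_prod_mul (fun U : Config d M => Complex.exp (linStat
    ((B ×ˢ Set.univ).indicator φ) U * Complex.I)) (fun W : Config d M => Complex.exp (linStat
    ((Bᶜ ×ˢ Set.univ).indicator φ) W * Complex.I)), h _ h1, h' _ h2, ← Complex.exp_add,
    integral_add_measure (hi (hν.restrict _)) (hi (hν'.restrict _)),
    integral_exp_restrict (measurableSet_cyl hB), integral_exp_restrict (measurableSet_cyl hB.compl)]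

theorem HasPoissonCF.map_restr {Q : Measure (Config d M)} {ν : Measure (Rd d × M)}
    (h : HasPoissonCF Q ν) {B : Set (Rd d)} (hB : MeasurableSet B) :
    HasPoissonCF (Q.map (Config.restr B)) (ν.restrict (B ×ˢ Set.univ)) := by
  intro φ hφ
  have hm : Measurable fun X : Config d M => Complex.exp (linStat φ X * Complex.I) := by
    have := hφ.measurable_linStat
    fun_prop
  have he : (Config.empty : Config d M).cm = 0 := by
    refine Measure.ext fun C hC => ?_
    simp [Config.cm_apply _ hC, count_eq, Config.pts_empty]
  rw [integral_map (Config.measurable_restr hB).aemeasurable hm.aestronglyMeasurable,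
    integral_exp_restrict (measurableSet_cyl hB), ← h _ (hφ.indicator (measurableSet_cyl hB))]
  have h0 : ∀ ψ : Rd d × M → ℝ, linStat ψ Config.empty = 0 := fun ψ => by simp [linStat, he]
  simp only [Config.restr, linStat_hyb hφ hB, h0, add_zero]

theorem IsTest.comp_affPt {φ : Rd d × M → ℝ} (hφ : IsTest φ) (y : Rd d) {a : ℝ} (ha : a ≠ 0) :
    IsTest (φ ∘ affPt y a) := by
  obtain ⟨n, hn⟩ := hφ.supp
  obtain ⟨m, hm⟩ := exists_nat_ge (|a|⁻¹ * (n + ‖y‖))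
  refine ⟨hφ.meas.comp ((measurable_affPt a).comp measurable_prodMk_left),
    hφ.fin.subset (Set.range_comp_subset_range _ _), m, fun p hp => hn _ fun h => hp ?_⟩
  simp only [affPt, mem_closedBall_zero_iff] at h ⊢
  refine le_trans ?_ hm
  have ha' : 0 < |a| := abs_pos.2 ha
  rw [inv_mul_eq_div, le_div_iff₀ ha', mul_comm, ← Real.norm_eq_abs, ← norm_smul]
  have := norm_sub_le (y + a • p.1) y
  rw [add_sub_cancel_left] at this
  linarith

theorem HasPoissonCF.map_aff {Q : Measure (Config d M)} {ν : Measure (Rd d × M)}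
    (h : HasPoissonCF Q ν) (y : Rd d) {a : ℝ} (ha : a ≠ 0) :
    HasPoissonCF (Q.map (Config.aff y a)) (ν.map (affPt y a)) := by
  intro φ hφ
  have hm : Measurable fun X : Config d M => Complex.exp (linStat φ X * Complex.I) := by
    have := hφ.measurable_linStat
    fun_prop
  have hφm := hφ.meas
  have hA : Measurable (affPt y a : Rd d × M → Rd d × M) :=
    (measurable_affPt a).comp measurable_prodMk_left
  have hA' : Measurable (Config.aff y a : Config d M → Config d M) :=
    (Config.measurable_aff ha).comp measurable_prodMk_left
  rw [integral_map hA'.aemeasurable hm.aestronglyMeasurable,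
    integral_map hA.aemeasurable (by fun_prop)]
  have h1 : ∀ X : Config d M, linStat φ (Config.aff y a X) = linStat (φ ∘ affPt y a) X := by
    intro X
    rw [linStat, Config.cm_aff y ha, integral_map hA.aemeasurable hφm.aestronglyMeasurable]
    rfl
  simp only [h1]
  exact h _ (hφ.comp_affPt y ha)

/-! ### The Poisson process with a finite intensity measure -/

/-- No location carries positive mass. -/
def IsDiffuse (ν : Measure (Rd d × M)) : Prop := ∀ x : Rd d, ν ({x} ×ˢ Set.univ) = 0

theorem IsDiffuse.restrict {ν : Measure (Rd d × M)} (hν : IsDiffuse ν)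
    (B : Set (Rd d × M)) : IsDiffuse (ν.restrict B) := fun x =>
  le_antisymm ((Measure.restrict_apply_le _ _).trans_eq (hν x)) bot_le

/-- The law of the Poisson process with finite intensity measure `ν`. -/
def poissonLaw (ν : Measure (Rd d × M)) : Measure (Config d M) :=
  ENNReal.ofReal (Real.exp (-ν.real Set.univ)) • Measure.sum fun n : ℕ =>
    ((n.factorial : ℝ≥0∞))⁻¹ • (Measure.pi fun _ : Fin n => ν).map ofTuple

theorem lintegral_poissonLaw (ν : Measure (Rd d × M)) {G : Config d M → ℝ≥0∞}
    (hG : Measurable G) : ∫⁻ X, G X ∂(poissonLaw ν) =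
      ENNReal.ofReal (Real.exp (-ν.real Set.univ)) *
        ∑' n : ℕ, (n.factorial : ℝ≥0∞)⁻¹ * ∫⁻ v, G (ofTuple v) ∂(Measure.pi fun _ : Fin n => ν) := by
  simp only [poissonLaw, lintegral_smul_measure, lintegral_sum_measure, smul_eq_mul,
    lintegral_map hG (measurable_ofTuple _)]

theorem measurable_insertNth {E : Type*} [MeasurableSpace E] {n : ℕ} (i : Fin (n + 1)) :
    Measurable fun r : E × (Fin n → E) => (i.insertNth r.1 r.2 : Fin (n + 1) → E) := by
  refine measurable_pi_lambda _ fun j => ?_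
  refine Fin.succAboveCases i ?_ (fun k => ?_) j
  · simp only [Fin.insertNth_apply_same]
    exact measurable_fst
  · simp only [Fin.insertNth_apply_succAbove]
    exact (measurable_pi_apply k).comp measurable_snd

theorem lintegral_pi_insertNth {E : Type*} [MeasurableSpace E] (ν : Measure E) [SigmaFinite ν]
    {n : ℕ} (i : Fin (n + 1)) {g : (Fin (n + 1) → E) → ℝ≥0∞} (hg : Measurable g) :
    ∫⁻ v, g v ∂(Measure.pi fun _ : Fin (n + 1) => ν) =
      ∫⁻ p, ∫⁻ v, g (i.insertNth p v) ∂(Measure.pi fun _ : Fin n => ν) ∂ν := by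
  have h := (measurePreserving_piFinSuccAbove (fun _ : Fin (n + 1) => ν) i).symm
  rw [← h.lintegral_comp hg, lintegral_prod]
  · rfl
  · exact (hg.comp (MeasurableEquiv.measurable _)).aemeasurable

theorem pi_mono {E : Type*} [MeasurableSpace E] {ν ν' : Measure E} [SigmaFinite ν] [SigmaFinite ν']
    (h : ν ≤ ν') (n : ℕ) {g : (Fin n → E) → ℝ≥0∞} (hg : Measurable g) :
    ∫⁻ v, g v ∂(Measure.pi fun _ : Fin n => ν) ≤ ∫⁻ v, g v ∂(Measure.pi fun _ : Fin n => ν') := by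
  induction n with
  | zero => rw [Measure.pi_of_empty, Measure.pi_of_empty]
  | succ n ih =>
    rw [lintegral_pi_insertNth ν 0 hg, lintegral_pi_insertNth ν' 0 hg]
    refine lintegral_mono' h fun p => ?_
    exact ih (hg.comp ((measurable_insertNth 0).comp measurable_prodMk_left))

theorem measure_fst_mem_finite {ν : Measure (Rd d × M)} (hν : IsDiffuse ν) {S : Set (Rd d)}
    (hS : S.Countable) : ν (S ×ˢ Set.univ) = 0 := by
  have h : S ×ˢ (Set.univ : Set M) = ⋃ x ∈ S, {x} ×ˢ Set.univ := by
    ext p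
    simp
  rw [h, measure_biUnion_null_iff hS]
  exact fun x _ => hν x

/-- By induction on n and Fubini: given the other points, a diffuse measure does not charge the
finitely many locations already taken. -/
theorem ae_distinctTuples {ν : Measure (Rd d × M)} [IsFiniteMeasure ν] (hν : IsDiffuse ν) (n : ℕ) :
    ∀ᵐ v ∂(Measure.pi fun _ : Fin n => ν), v ∈ distinctTuples d M n := by
  induction n with
  | zero => exact Eventually.of_forall fun v i => i.elim0
  | succ n ih =>
    have hm := (measurableSet_distinctTuples (d := d) (M := M) (n + 1)).compl
    rw [ae_iff]
    change (Measure.pi fun _ : Fin (n + 1) => ν) (distinctTuples d M (n + 1))ᶜ = 0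
    rw [← lintegral_indicator_one hm, lintegral_pi_insertNth ν 0 (measurable_one.indicator hm)]
    have hmm : Measurable fun r : (Rd d × M) × (Fin n → Rd d × M) =>
        (distinctTuples d M (n + 1))ᶜ.indicator (1 : (Fin (n + 1) → Rd d × M) → ℝ≥0∞)
          ((0 : Fin (n + 1)).insertNth r.1 r.2 : Fin (n + 1) → Rd d × M) :=
      (measurable_one.indicator hm).comp (measurable_insertNth 0)
    rw [lintegral_lintegral_swap hmm.aemeasurable,
      lintegral_eq_zero_iff' hmm.lintegral_prod_left'.aemeasurable]
    filter_upwards [ih] with v hv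
    have h0 := measure_fst_mem_finite hν (Set.countable_range fun i => (v i).1)
    have h1 : ∀ᵐ p ∂ν, p.1 ∉ Set.range fun i => (v i).1 := by
      rw [ae_iff]
      convert h0 using 2
      ext p
      simp
    refine (lintegral_eq_zero_iff' ?_).2 ?_
    · exact (hmm.comp measurable_prodMk_right).aemeasurable
    filter_upwards [h1] with p hp
    refine Set.indicator_of_notMem ?_ _
    have h2 : p.1 ∉ Prod.fst '' (ofTuple v).pts := by
      rw [pts_ofTuple hv, ← Set.range_comp]
      exact hp
    rw [Set.notMem_compl_iff, Fin.insertNth_zero]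
    exact cons_mem_distinctTuples hv h2

theorem integral_linStat_ofTuple {φ : Rd d × M → ℝ} (hφ : Measurable φ) {n : ℕ}
    {v : Fin n → Rd d × M} (hv : v ∈ distinctTuples d M n) :
    linStat φ (ofTuple v) = ∑ i, φ (v i) := by
  have h : (ofTuple v).cm = Measure.sum fun i => Measure.dirac (v i) := by
    refine Measure.ext fun B hB => ?_
    rw [Config.cm, Measure.sum_apply _ hB, Measure.sum_apply _ hB, pts_ofTuple hv]
    exact ((Equiv.ofInjective v (injective_of_mem_distinctTuples hv)).tsum_eq
        (fun p => Measure.dirac (p : Rd d × M) B)).symm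
  have : ∀ i, Integrable φ (Measure.dirac (v i)) := fun i =>
    integrable_dirac' hφ.stronglyMeasurable (by simp)
  rw [linStat, h, Measure.sum_fintype, integral_finsetSum_measure fun i _ => this i]
  exact Finset.sum_congr rfl fun i _ => integral_dirac' _ _ hφ.stronglyMeasurable

theorem tsum_pow_div_factorial (x : ℝ) (hx : 0 ≤ x) :
    ∑' n : ℕ, (n.factorial : ℝ≥0∞)⁻¹ * ENNReal.ofReal x ^ n = ENNReal.ofReal (Real.exp x) := by
  have h := NormedSpace.expSeries_div_hasSum_exp x
  rw [← Real.exp_eq_exp_ℝ] at h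
  rw [← h.tsum_eq, ENNReal.ofReal_tsum_of_nonneg (fun n => by positivity) h.summable]
  refine tsum_congr fun n => ?_
  rw [ENNReal.ofReal_div_of_pos (by positivity), ENNReal.ofReal_pow hx, ENNReal.ofReal_natCast,
    mul_comm, div_eq_mul_inv]

theorem isProbabilityMeasure_poissonLaw (ν : Measure (Rd d × M)) [IsFiniteMeasure ν] :
    IsProbabilityMeasure (poissonLaw ν) := by
  refine ⟨?_⟩
  have h := lintegral_poissonLaw ν (G := 1) measurable_one
  simp only [Pi.one_apply, lintegral_one, Measure.pi_univ, Finset.prod_const, Finset.card_univ,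
    Fintype.card_fin] at h
  rw [h, ← ENNReal.ofReal_toReal (measure_ne_top ν Set.univ)]
  change _ * ∑' n : ℕ, (n.factorial : ℝ≥0∞)⁻¹ * ENNReal.ofReal (ν.real Set.univ) ^ n = 1
  rw [tsum_pow_div_factorial _ measureReal_nonneg, ← ENNReal.ofReal_mul (Real.exp_pos _).le,
    ← Real.exp_add]
  simp

/-- On the n-th term the exponential of the linear statistic is a product over the points, so its
integral is the n-th power of ∫ exp(iφ) dν. The weights 1/n! sum these powers to an exponential. -/
theorem hasPoissonCF_poissonLaw {ν : Measure (Rd d × M)} [IsFiniteMeasure ν] (hν : IsDiffuse ν) :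
    HasPoissonCF (poissonLaw ν) ν := by
  intro φ hφ
  have hm : Measurable fun X : Config d M => Complex.exp (linStat φ X * Complex.I) := by
    have := hφ.measurable_linStat
    fun_prop
  have hφm := hφ.meas
  have := isProbabilityMeasure_poissonLaw ν
  have hint : Integrable (fun X : Config d M => Complex.exp (linStat φ X * Complex.I))
      (Measure.sum fun n : ℕ =>
        ((n.factorial : ℝ≥0∞))⁻¹ • (Measure.pi fun _ : Fin n => ν).map ofTuple) := by
    have h1 : Integrable (fun X : Config d M => Complex.exp (linStat φ X * Complex.I))
        (poissonLaw ν) :=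
      Integrable.of_bound hm.aestronglyMeasurable 1
        (Eventually.of_forall fun X => by rw [Complex.norm_exp_ofReal_mul_I])
    exact (integrable_smul_measure (by simpa using Real.exp_pos _) ENNReal.ofReal_ne_top).1 h1
  have hexp : Integrable (fun p => Complex.exp (φ p * Complex.I)) ν :=
    Integrable.of_bound (by fun_prop) 1
      (Eventually.of_forall fun X => by rw [Complex.norm_exp_ofReal_mul_I])
  have hn : ∀ n : ℕ, ∫ X, Complex.exp (linStat φ X * Complex.I)
      ∂(((n.factorial : ℝ≥0∞))⁻¹ • (Measure.pi fun _ : Fin n => ν).map ofTuple) =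
        (∫ p, Complex.exp (φ p * Complex.I) ∂ν) ^ n / n.factorial := by
    intro n
    rw [integral_smul_measure, integral_map (measurable_ofTuple n).aemeasurable
      hm.aestronglyMeasurable]
    have h2 : ∫ v, Complex.exp (linStat φ (ofTuple v) * Complex.I)
        ∂(Measure.pi fun _ : Fin n => ν) =
        ∫ v, ∏ i, Complex.exp (φ (v i) * Complex.I) ∂(Measure.pi fun _ : Fin n => ν) := by
      refine integral_congr_ae ?_
      filter_upwards [ae_distinctTuples hν n] with v hv
      rw [integral_linStat_ofTuple hφm hv, Complex.ofReal_sum, Finset.sum_mul, Complex.exp_sum]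
    rw [h2, integral_fintype_prod_eq_pow (ι := Fin n) fun p => Complex.exp (φ p * Complex.I),
      Fintype.card_fin, ENNReal.toReal_inv, ENNReal.toReal_natCast, Complex.real_smul]
    push_cast
    rw [inv_mul_eq_div]
  have hsum := hasSum_integral_measure hint
  simp only [hn] at hsum
  have h3 := hsum.unique (NormedSpace.expSeries_div_hasSum_exp
    (∫ p, Complex.exp (φ p * Complex.I) ∂ν))
  rw [poissonLaw, integral_smul_measure, h3, ← Complex.exp_eq_exp_ℂ,
    ENNReal.toReal_ofReal (Real.exp_pos _).le, integral_sub hexp (integrable_const _),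
    Complex.real_smul, Complex.ofReal_exp, ← Complex.exp_add]
  congr 1
  simp
  ring

theorem HasPoissonCF.eq_poissonLaw {Q : Measure (Config d M)} [IsProbabilityMeasure Q]
    {ν : Measure (Rd d × M)} [IsFiniteMeasure ν] (hν : IsDiffuse ν) (h : HasPoissonCF Q ν) :
    Q = poissonLaw ν :=
  have := isProbabilityMeasure_poissonLaw ν
  h.unique (hasPoissonCF_poissonLaw hν)

/-- Holds by construction, without diffuseness: `ofTuple` sends a tuple with a repeated location to
the empty configuration. -/
theorem ae_simpleConfigs_poissonLaw (ν : Measure (Rd d × M)) :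
    ∀ᵐ X ∂(poissonLaw ν), X ∈ simpleConfigs d M := by
  rw [ae_iff]
  change poissonLaw ν (simpleConfigs d M)ᶜ = 0
  rw [← lintegral_indicator_one measurableSet_simpleConfigs.compl,
    lintegral_poissonLaw _ (measurable_one.indicator measurableSet_simpleConfigs.compl)]
  simp [ofTuple_mem]

/-- Product measures increase with ν, so the unnormalized mixtures compare term by term, and only
the factors exp(-ν(univ)) differ. This is the source of all total variation estimates. -/
theorem poissonLaw_le {ν ν' : Measure (Rd d × M)} [IsFiniteMeasure ν] [IsFiniteMeasure ν']
    (h : ν ≤ ν') {G : Config d M → ℝ≥0∞} (hG : Measurable G) :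
    ∫⁻ X, G X ∂(poissonLaw ν) ≤ ENNReal.ofReal (Real.exp (ν'.real Set.univ - ν.real Set.univ)) *
      ∫⁻ X, G X ∂(poissonLaw ν') := by
  rw [lintegral_poissonLaw ν hG, lintegral_poissonLaw ν' hG, ← mul_assoc,
    ← ENNReal.ofReal_mul (Real.exp_pos _).le, ← Real.exp_add]
  rw [show ν'.real Set.univ - ν.real Set.univ + -ν'.real Set.univ = -ν.real Set.univ by ring]
  refine mul_le_mul_right (ENNReal.tsum_le_tsum fun n => mul_le_mul_right ?_ _) _
  exact pi_mono h n (hG.comp (measurable_ofTuple n))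

/-- The Mecke formula. -/
theorem mecke {ν : Measure (Rd d × M)} [IsFiniteMeasure ν] (hν : IsDiffuse ν)
    {G : (Rd d × M) × Config d M → ℝ≥0∞} (hG : Measurable G) :
    ∫⁻ X, ∫⁻ p, G (p, X) ∂X.cm ∂(poissonLaw ν) =
      ∫⁻ p, ∫⁻ X, G (p, Config.add p X) ∂(poissonLaw ν) ∂ν := by
  have hN : Measurable fun X : Config d M => ∫⁻ p, G (p, X) ∂X.cm :=
    measurable_lintegral_of_spanning (f := fun X p => G (p, X)) Config.measurable_cm _
      (fun _ => measurableSet_cyl measurableSet_closedBall) iUnion_ball_cyl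
      (fun X n => X.cm_ball_lt_top n) (hG.comp measurable_swap)
  have hcm : ∀ X : Config d M, ∫⁻ p, G (p, X) ∂X.cm = ∑' p : X.pts, G (p, X) := fun X =>
    X.lintegral_cm (g := fun p => G (p, X)) (hG.comp measurable_prodMk_right)
  have hGa : Measurable fun r : (Rd d × M) × Config d M => G (r.1, Config.add r.1 r.2) :=
    hG.comp (measurable_fst.prodMk Config.measurable_add)
  -- Each of the n + 1 coordinates can be the distinguished point, and integrating it out separately
  -- leaves a configuration of n points to which it is added.
  have hterm : ∀ n, ∫⁻ v, ∫⁻ p, G (p, ofTuple v) ∂(ofTuple v).cm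
      ∂(Measure.pi fun _ : Fin (n + 1) => ν) =
      (n + 1 : ℕ) * ∫⁻ p, ∫⁻ v, G (p, Config.add p (ofTuple v))
        ∂(Measure.pi fun _ : Fin n => ν) ∂ν := by
    intro n
    have h1 : ∫⁻ v, ∫⁻ p, G (p, ofTuple v) ∂(ofTuple v).cm ∂(Measure.pi fun _ : Fin (n + 1) => ν) =
        ∫⁻ v, ∑ i, G (v i, ofTuple v) ∂(Measure.pi fun _ : Fin (n + 1) => ν) := by
      refine lintegral_congr_ae ?_
      filter_upwards [ae_distinctTuples hν (n + 1)] with v hv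
      rw [hcm, ← tsum_fintype (L := .unconditional _)]
      have h2 := (Equiv.ofInjective v (injective_of_mem_distinctTuples hv)).tsum_eq
        (fun p => G (p, ofTuple v))
      rw [pts_ofTuple hv, ← h2]
      rfl
    have hGi : ∀ i : Fin (n + 1), Measurable fun v : Fin (n + 1) → Rd d × M =>
        G (v i, ofTuple v) := fun i =>
      hG.comp ((measurable_pi_apply i).prodMk (measurable_ofTuple _))
    rw [h1, lintegral_finsetSum _ fun i _ => hGi i]
    have h3 : ∀ i : Fin (n + 1), ∫⁻ v, G (v i, ofTuple v) ∂(Measure.pi fun _ : Fin (n + 1) => ν) =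
        ∫⁻ p, ∫⁻ v, G (p, Config.add p (ofTuple v)) ∂(Measure.pi fun _ : Fin n => ν) ∂ν := by
      intro i
      have hs := measurableSet_distinctTuples (d := d) (M := M) (n + 1)
      have h4 : ∀ᵐ p ∂ν, ∀ᵐ v ∂(Measure.pi fun _ : Fin n => ν),
          (i.insertNth p v : Fin (n + 1) → Rd d × M) ∈ distinctTuples d M (n + 1) := by
        have h5 := (measurePreserving_piFinSuccAbove (fun _ : Fin (n + 1) => ν)
          i).symm.quasiMeasurePreserving.ae (ae_distinctTuples hν (n + 1))
        exact Measure.ae_ae_of_ae_prod h5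
      rw [lintegral_pi_insertNth ν i (hGi i)]
      refine lintegral_congr_ae ?_
      filter_upwards [h4] with p hp
      refine lintegral_congr_ae ?_
      filter_upwards [hp, ae_distinctTuples hν n] with v hv hv'
      rw [(ofTuple_insertNth hv hv').2, Fin.insertNth_apply_same]
    simp only [h3]
    simp
  -- The term without points has nothing to sum over. Splitting it off shifts the index by one, so
  -- that n + 1 points on the left match n points on the right.
  rw [lintegral_poissonLaw ν hN, tsum_eq_zero_add' ENNReal.summable]
  have h0 : ∫⁻ v, ∫⁻ p, G (p, ofTuple v) ∂(ofTuple v).cm ∂(Measure.pi fun _ : Fin 0 => ν) = 0 := by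
    refine lintegral_eq_zero_of_ae_eq_zero (Eventually.of_forall fun v => ?_)
    have hv : v ∈ distinctTuples d M 0 := fun i => i.elim0
    change ∫⁻ p, G (p, ofTuple v) ∂(ofTuple v).cm = 0
    rw [hcm, ENNReal.tsum_eq_zero]
    rintro ⟨p, hp⟩
    rw [pts_ofTuple hv] at hp
    obtain ⟨i, _⟩ := hp
    exact i.elim0
  rw [h0, mul_zero, zero_add]
  have hR : ∀ p, ∫⁻ X, G (p, Config.add p X) ∂(poissonLaw ν) =
      ENNReal.ofReal (Real.exp (-ν.real Set.univ)) * ∑' n : ℕ, (n.factorial : ℝ≥0∞)⁻¹ *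
        ∫⁻ v, G (p, Config.add p (ofTuple v)) ∂(Measure.pi fun _ : Fin n => ν) := fun p =>
    lintegral_poissonLaw ν (G := fun X => G (p, Config.add p X)) (hGa.comp measurable_prodMk_left)
  have hmn : ∀ n : ℕ, Measurable fun p : Rd d × M =>
      ∫⁻ v, G (p, Config.add p (ofTuple v)) ∂(Measure.pi fun _ : Fin n => ν) := fun n =>
    Measurable.lintegral_prod_right' (f := fun r : (Rd d × M) × (Fin n → Rd d × M) =>
      G (r.1, Config.add r.1 (ofTuple r.2))) (hGa.comp
        (measurable_fst.prodMk ((measurable_ofTuple n).comp measurable_snd)))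
  simp only [hR]
  rw [lintegral_const_mul _ (Measurable.tsum fun n => (hmn n).const_mul _),
    lintegral_tsum fun n => ((hmn n).const_mul _).aemeasurable]
  congr 1
  refine tsum_congr fun n => ?_
  rw [hterm n, lintegral_const_mul _ (hmn n), ← mul_assoc]
  congr 1
  -- (n + 1)/(n + 1)! = 1/n!.
  rw [Nat.factorial_succ, Nat.cast_mul, ENNReal.mul_inv (by simp) (by simp), mul_comm,
    ← mul_assoc, ENNReal.mul_inv_cancel (by simp) (by simp), one_mul]

end

section

variable {d : ℕ} {M : Type*}

/-! ### Local convergence of functionals of point processes -/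

/-- Pairs of a large index and a finite configuration that agrees with `U` on a large ball. -/
def locNear (U : Config d M) : Filter (ℕ × Config d M) :=
  ⨅ K : ℕ, 𝓟 {q | K ≤ q.1 ∧ q.2 ∈ simpleConfigs d M ∧
    q.2.pts ∩ Metric.closedBall 0 (K : ℝ) ×ˢ Set.univ =
      U.pts ∩ Metric.closedBall 0 (K : ℝ) ×ˢ Set.univ}

theorem inter_ball_mono {X Y : Set (Rd d × M)} {r s : ℝ} (h : r ≤ s)
    (hXY : X ∩ Metric.closedBall 0 s ×ˢ Set.univ = Y ∩ Metric.closedBall 0 s ×ˢ Set.univ) :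
    X ∩ Metric.closedBall 0 r ×ˢ Set.univ = Y ∩ Metric.closedBall 0 r ×ˢ Set.univ := by
  have hsub : (Metric.closedBall (0 : Rd d) r ×ˢ (Set.univ : Set M)) ⊆
      Metric.closedBall 0 s ×ˢ Set.univ :=
    Set.prod_mono (Metric.closedBall_subset_closedBall h) subset_rfl
  rw [← Set.inter_eq_right.2 hsub, ← Set.inter_assoc, ← Set.inter_assoc, hXY]

theorem hasBasis_locNear (U : Config d M) : (locNear U).HasBasis (fun _ : ℕ => True)
    fun K => {q | K ≤ q.1 ∧ q.2 ∈ simpleConfigs d M ∧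
      q.2.pts ∩ Metric.closedBall 0 (K : ℝ) ×ˢ Set.univ =
        U.pts ∩ Metric.closedBall 0 (K : ℝ) ×ˢ Set.univ} := by
  refine hasBasis_iInf_principal (directed_of_isDirected_le ?_)
  intro K L hKL q hq
  exact ⟨hKL.trans hq.1, hq.2.1, inter_ball_mono (by exact_mod_cast hKL) hq.2.2⟩

theorem tendsto_fst_locNear (U : Config d M) : Tendsto Prod.fst (locNear U) atTop := by
  refine ((hasBasis_locNear U).tendsto_iff atTop_basis).2 fun K _ => ⟨K, trivial, ?_⟩
  exact fun q hq => hq.1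

theorem eventually_mem_locNear (U : Config d M) :
    ∀ᶠ q in locNear U, q.2 ∈ simpleConfigs d M :=
  (hasBasis_locNear U).eventually_iff.2 ⟨0, trivial, fun _ hq => hq.2.1⟩

theorem eventually_inter_locNear (U : Config d M) (r : ℝ) :
    ∀ᶠ q in locNear U, q.2.pts ∩ Metric.closedBall 0 r ×ˢ Set.univ =
      U.pts ∩ Metric.closedBall 0 r ×ˢ Set.univ := by
  obtain ⟨K, hK⟩ := exists_nat_ge r
  exact (hasBasis_locNear U).eventually_iff.2 ⟨K, trivial, fun _ hq => inter_ball_mono hK hq.2.2⟩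

theorem restr_agrees (K : ℕ) (U : Config d M) :
    (Config.restr (Metric.closedBall 0 (K : ℝ)) U).pts ∩ Metric.closedBall 0 (K : ℝ) ×ˢ Set.univ =
      U.pts ∩ Metric.closedBall 0 (K : ℝ) ×ˢ Set.univ := by
  rw [Config.pts_restr, Set.inter_assoc, Set.inter_self]

theorem hyb_agrees (B : Set (Rd d)) (U W : Config d M) :
    (Config.hyb B U W).pts ∩ B ×ˢ Set.univ = U.pts ∩ B ×ˢ Set.univ := by
  rw [Config.pts_hyb]
  ext p
  simp only [Set.mem_inter_iff, Set.mem_union, Set.mem_prod, Set.mem_univ, Set.mem_compl_iff]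
  tauto

theorem hyb_restr (B : Set (Rd d)) (U W : Config d M) :
    Config.hyb B (Config.restr B U) W = Config.hyb B U W := by
  refine Config.ext ?_
  rw [Config.pts_hyb, Config.pts_hyb, Config.pts_restr, Set.inter_assoc, Set.inter_self]

theorem hyb_mem_simpleConfigs {B : Set (Rd d)} {U W : Config d M}
    (hU : Config.restr B U ∈ simpleConfigs d M) (hW : W ∈ simpleConfigs d M) :
    Config.hyb B U W ∈ simpleConfigs d M := by
  have hU' : (U.pts ∩ B ×ˢ Set.univ).Finite ∧ Set.InjOn Prod.fst (U.pts ∩ B ×ˢ Set.univ) := by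
    rw [← Config.pts_restr]
    exact hU
  refine ⟨hU'.1.union (hW.1.subset Set.inter_subset_left), ?_⟩
  rintro p (hp | hp) q (hq | hq) h
  · exact hU'.2 hp hq h
  · exact (hq.2.1 (h ▸ hp.2.1)).elim
  · exact (hp.2.1 (h ▸ hq.2.1)).elim
  · exact hW.2 hp.1 hq.1 h

theorem tendsto_restr_locNear {U : Config d M}
    (hU : ∀ K : ℕ, Config.restr (Metric.closedBall 0 (K : ℝ)) U ∈ simpleConfigs d M) :
    Tendsto (fun k : ℕ => (k, Config.restr (Metric.closedBall 0 (k : ℝ)) U)) atTop (locNear U) := by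
  refine (atTop_basis.tendsto_iff (hasBasis_locNear U)).2 fun K _ => ⟨K, trivial, fun k hk => ?_⟩
  exact ⟨hk, hU k, inter_ball_mono (by exact_mod_cast hk) (restr_agrees k U)⟩

/-! ### Local convergence in total variation and convergence of expectations. -/

variable [MeasurableSpace M]

/-- The data of a sequence of point processes that converges locally in total variation. -/
structure LocallyTV (L : ℕ → Measure (Config d M)) (H : Measure (Config d M)) : Prop where
  prob : ∀ k, IsProbabilityMeasure (L k)
  probH : IsProbabilityMeasure H
  simple : ∀ k, ∀ᵐ V ∂(L k), V ∈ simpleConfigs d M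
  simpleH : ∀ᵐ U ∂H, ∀ K : ℕ, Config.restr (Metric.closedBall 0 (K : ℝ)) U ∈ simpleConfigs d M
  split : ∀ k (K : ℕ), ((L k).prod (L k)).map
    (fun q => Config.hyb (Metric.closedBall 0 (K : ℝ)) q.1 q.2) = L k
  tv : ∀ (K : ℕ) (ε : ℝ≥0∞), 0 < ε → ∀ᶠ k in atTop, ∀ G : Config d M → ℝ≥0∞, Measurable G →
    (∀ U, G U ≤ 1) → ∫⁻ U, G (Config.restr (Metric.closedBall 0 (K : ℝ)) U) ∂(L k) ≤
      ∫⁻ U, G (Config.restr (Metric.closedBall 0 (K : ℝ)) U) ∂H + ε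

section

variable {L : ℕ → Measure (Config d M)} {H : Measure (Config d M)} {Θ : Type*} [MeasurableSpace Θ]
  {μ : Measure Θ}

/-- By `split`, a sample of `L k` may be drawn independently inside and outside the ball. Only the
inside is replaced by the limit process, at the cost of its total variation distance; the outside
stays a fresh sample of `L k`, about which nothing needs to converge. -/
theorem LocallyTV.lintegral_le (h : LocallyTV L H) [IsProbabilityMeasure μ] (K : ℕ) {ε : ℝ≥0∞}
    (hε : 0 < ε) : ∀ᶠ k in atTop, ∀ G : Config d M × Θ → ℝ≥0∞, Measurable G → (∀ q, G q ≤ 1) →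
      ∫⁻ q, G q ∂((L k).prod μ) ≤ ∫⁻ q, ∫⁻ W, G (Config.hyb (Metric.closedBall 0 (K : ℝ)) q.1 W, q.2)
        ∂(L k) ∂(H.prod μ) + ε := by
  filter_upwards [h.tv K ε hε] with k hk G hG hG1
  have := h.prob k
  have := h.probH
  set B := Metric.closedBall (0 : Rd d) (K : ℝ)
  have hB : MeasurableSet B := measurableSet_closedBall
  have hhyb := Config.measurable_hyb (M := M) hB
  have hm3 : Measurable fun r : (Config d M × Θ) × Config d M => G (Config.hyb B r.1.1 r.2, r.1.2) :=
    hG.comp ((hhyb.comp ((measurable_fst.comp measurable_fst).prodMk measurable_snd)).prodMk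
      (measurable_snd.comp measurable_fst))
  have hm2 : Measurable fun q : Config d M × Θ => ∫⁻ W, G (Config.hyb B q.1 W, q.2) ∂(L k) :=
    hm3.lintegral_prod_right'
  rw [lintegral_prod_symm' _ hG, lintegral_prod_symm' _ hm2]
  have hθ : ∀ θ, ∫⁻ V, G (V, θ) ∂(L k) ≤
      ∫⁻ U, ∫⁻ W, G (Config.hyb B U W, θ) ∂(L k) ∂H + ε := by
    intro θ
    have hGθ : Measurable fun V => G (V, θ) := hG.comp measurable_prodMk_right
    have hmθ : Measurable fun U => ∫⁻ W, G (Config.hyb B U W, θ) ∂(L k) :=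
      hm2.comp measurable_prodMk_right
    have h1 := hk (fun U => ∫⁻ W, G (Config.hyb B U W, θ) ∂(L k)) hmθ fun U =>
      (lintegral_mono fun W => hG1 _).trans (by simp)
    simp only [hyb_restr] at h1
    refine le_trans (le_of_eq ?_) h1
    conv_lhs => rw [← h.split k K]
    rw [lintegral_map hGθ hhyb, lintegral_prod]
    exact (hGθ.comp hhyb).aemeasurable
  refine (lintegral_mono hθ).trans ?_
  rw [lintegral_add_right _ measurable_const]
  simp

variable (H μ) in
/-- `g k (V, θ)` converges to `g∞ (U, θ)` as `k` tends to infinity and `V` agrees with `U` on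
larger and larger balls. -/
def LocLim (g : ℕ → Config d M × Θ → ℝ) (g' : Config d M × Θ → ℝ) : Prop :=
  ∀ᵐ q ∂(H.prod μ), Tendsto (fun r : ℕ × Config d M => g r.1 (r.2, q.2)) (locNear q.1) (𝓝 (g' q))

theorem LocLim.comp {g : ℕ → Config d M × Θ → ℝ} {g' : Config d M × Θ → ℝ}
    (h : LocLim H μ g g') {c : ℝ → ℝ} (hc : Continuous c) :
    LocLim H μ (fun k q => c (g k q)) fun q => c (g' q) := by
  filter_upwards [h] with q hq
  exact (hc.tendsto _).comp hq

/-- Restrictions of `U` to growing balls are among the configurations along which the limit is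
taken, so `g'` is an almost everywhere limit of measurable functions. This is how the limit
functional, defined by a limsup over real radii, gets its measurability. -/
theorem LocLim.aemeasurable (h : LocallyTV L H) {g : ℕ → Config d M × Θ → ℝ}
    {g' : Config d M × Θ → ℝ} (hg : LocLim H μ g g') (hm : ∀ k, Measurable (g k)) [SFinite μ] :
    AEMeasurable g' (H.prod μ) := by
  have := h.probH
  refine aemeasurable_of_tendsto_metrizable_ae (u := atTop)
    (f := fun (k : ℕ) q => g k (Config.restr (Metric.closedBall 0 (k : ℝ)) q.1, q.2))
    (fun k => ?_) ?_
  · exact ((hm k).comp (((Config.measurable_restr measurableSet_closedBall).comp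
      measurable_fst).prodMk measurable_snd)).aemeasurable
  · filter_upwards [hg, Measure.quasiMeasurePreserving_fst.ae h.simpleH] with q hq hs
    exact hq.comp (tendsto_restr_locNear hs)

/-- The three errors are the total variation distance on a ball, the distance of `g k` from its
limit on a good event, and the probability of the bad event. -/
theorem LocLim.eventually_le (h : LocallyTV L H) [IsProbabilityMeasure μ]
    {g : ℕ → Config d M × Θ → ℝ} {g' : Config d M × Θ → ℝ} (hg : LocLim H μ g g')
    (hm : ∀ k, Measurable (g k)) (h1 : ∀ k q, g k q ≤ 1) {ε : ℝ} (hε : 0 < ε) :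
    ∀ᶠ k in atTop, ∫⁻ q, ENNReal.ofReal (g k q) ∂((L k).prod μ) ≤
      ∫⁻ q, ENNReal.ofReal (g' q) ∂(H.prod μ) + 3 * ENNReal.ofReal ε := by
  have := h.probH
  obtain ⟨g'', hm'', heq⟩ := hg.aemeasurable h hm
  have hε' : 0 < ENNReal.ofReal ε := by simpa using hε
  -- Egorov-like good sets: on `A K` the function is within ε of its limit for all indices from `K`
  -- on and all simple configurations that agree on the ball of radius `K`. They increase to a set
  -- of full measure.
  let A : ℕ → Set (Config d M × Θ) := fun K => {q | g' q = g'' q ∧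
    (∀ K : ℕ, Config.restr (Metric.closedBall 0 (K : ℝ)) q.1 ∈ simpleConfigs d M) ∧
    ∀ k V, K ≤ k → V ∈ simpleConfigs d M → V.pts ∩ Metric.closedBall 0 (K : ℝ) ×ˢ Set.univ =
      q.1.pts ∩ Metric.closedBall 0 (K : ℝ) ×ˢ Set.univ → |g k (V, q.2) - g' q| ≤ ε}
  have hAmono : Monotone A := fun K K' hKK q hq => ⟨hq.1, hq.2.1, fun k V hk hV hVq =>
    hq.2.2 k V (hKK.trans hk) hV (inter_ball_mono (by exact_mod_cast hKK) hVq)⟩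
  have hAall : ∀ᵐ q ∂(H.prod μ), q ∈ ⋃ K, A K := by
    filter_upwards [hg, heq, Measure.quasiMeasurePreserving_fst.ae h.simpleH] with q hq hq' hs
    have h2 := hq (Metric.closedBall_mem_nhds _ hε)
    obtain ⟨K, -, hK⟩ := (hasBasis_locNear q.1).mem_iff.1 h2
    refine Set.mem_iUnion.2 ⟨K, hq', hs, fun k V hk hV hVq => ?_⟩
    exact hK (show (k, V) ∈ _ from ⟨hk, hV, hVq⟩)
  have hA1 : Tendsto (fun K => (H.prod μ) (A K)) atTop (𝓝 1) := by
    have h3 := tendsto_measure_iUnion_atTop (μ := H.prod μ) hAmono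
    have h4 : (H.prod μ) (⋃ K, A K) = 1 := by
      have h4' : (⋃ K, A K) =ᵐ[H.prod μ] Set.univ := eventuallyEq_univ.2 hAall
      rw [measure_congr h4', measure_univ]
    rwa [h4] at h3
  have hlt : (1 : ℝ≥0∞) - ENNReal.ofReal ε < 1 :=
    ENNReal.sub_lt_self ENNReal.one_ne_top one_ne_zero hε'.ne'
  obtain ⟨K, hK⟩ := (hA1.eventually (lt_mem_nhds hlt)).exists
  filter_upwards [h.lintegral_le (μ := μ) K hε', eventually_ge_atTop K] with k hk hKk
  have := h.prob k
  have hGm : Measurable fun q => ENNReal.ofReal (g k q) := (hm k).ennreal_ofReal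
  have h5 := hk (fun q => ENNReal.ofReal (g k q)) hGm fun q => by
    rw [← ENNReal.ofReal_one]
    exact ENNReal.ofReal_le_ofReal (h1 k q)
  set B := Metric.closedBall (0 : Rd d) (K : ℝ)
  have hB : MeasurableSet B := measurableSet_closedBall
  have hm3 : Measurable fun r : (Config d M × Θ) × Config d M => g k (Config.hyb B r.1.1 r.2, r.1.2) :=
    (hm k).comp (((Config.measurable_hyb hB).comp
      ((measurable_fst.comp measurable_fst).prodMk measurable_snd)).prodMk
      (measurable_snd.comp measurable_fst))
  let S : Set ((Config d M × Θ) × Config d M) :=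
    {r | |g k (Config.hyb B r.1.1 r.2, r.1.2) - g'' r.1| ≤ ε}
  have hS : MeasurableSet S :=
    measurableSet_le (hm3.sub (hm''.comp measurable_fst)).abs measurable_const
  -- `A K` involves a quantifier over all configurations and need not be measurable. The probability
  -- `p q` that a fresh outside spoils the ε-closeness is measurable and vanishes on `A K`, so its
  -- integral can be bounded instead.
  let p : Config d M × Θ → ℝ≥0∞ := fun q => ∫⁻ W, Sᶜ.indicator 1 (q, W) ∂(L k)
  have hp : Measurable p := (measurable_one.indicator hS.compl).lintegral_prod_right'
  have hp1 : ∀ q, p q ≤ 1 := fun q => (lintegral_mono fun W =>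
    (Set.indicator_le_self' (fun _ _ => zero_le) _)).trans (by simp)
  have hpA : ∀ q ∈ A K, p q = 0 := by
    intro q hq
    refine lintegral_eq_zero_of_ae_eq_zero ?_
    filter_upwards [h.simple k] with W hW
    refine Set.indicator_of_notMem (Set.notMem_compl_iff.2 ?_) _
    change |_ - g'' q| ≤ ε
    rw [← hq.1]
    exact hq.2.2 k _ hKk (hyb_mem_simpleConfigs (hq.2.1 K) hW) (hyb_agrees _ _ _)
  have hpint : ∫⁻ q, p q ∂(H.prod μ) ≤ ENNReal.ofReal ε := by
    have h6 : MeasurableSet {q | p q = 0} := hp (measurableSet_singleton 0)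
    have h7 : ∫⁻ q, p q ∂(H.prod μ) ≤ (H.prod μ) {q | p q = 0}ᶜ := by
      rw [← lintegral_indicator_one h6.compl]
      refine lintegral_mono fun q => ?_
      by_cases hq : p q = 0
      · simp [hq]
      · rw [Set.indicator_of_mem (show q ∈ {q | p q = 0}ᶜ from hq)]
        exact hp1 q
    refine h7.trans ?_
    rw [prob_compl_eq_one_sub h6, tsub_le_iff_left, ← tsub_le_iff_right]
    exact hK.le.trans (measure_mono hpA)
  refine h5.trans ?_
  have h8 : ∀ q, ∫⁻ W, ENNReal.ofReal (g k (Config.hyb B q.1 W, q.2)) ∂(L k) ≤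
      ENNReal.ofReal (g'' q) + ENNReal.ofReal ε + p q := by
    intro q
    have h9 : ∀ W, ENNReal.ofReal (g k (Config.hyb B q.1 W, q.2)) ≤
        (ENNReal.ofReal (g'' q) + ENNReal.ofReal ε) + Sᶜ.indicator 1 (q, W) := by
      intro W
      by_cases hW : (q, W) ∈ S
      · refine le_trans ?_ le_self_add
        refine le_trans (ENNReal.ofReal_le_ofReal ?_) ENNReal.ofReal_add_le
        have : |g k (Config.hyb B q.1 W, q.2) - g'' q| ≤ ε := hW
        linarith [(abs_le.1 this).2]
      · rw [Set.indicator_of_mem (show (q, W) ∈ Sᶜ from hW)]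
        refine le_trans ?_ le_add_self
        rw [Pi.one_apply, ← ENNReal.ofReal_one]
        exact ENNReal.ofReal_le_ofReal (h1 k _)
    refine (lintegral_mono h9).trans ?_
    rw [lintegral_add_left measurable_const]
    simp [p]
  have h10 : ∫⁻ q, ENNReal.ofReal (g' q) ∂(H.prod μ) = ∫⁻ q, ENNReal.ofReal (g'' q) ∂(H.prod μ) :=
    lintegral_congr_ae (by filter_upwards [heq] with q hq; rw [hq])
  refine (add_le_add_left (lintegral_mono h8) _).trans ?_
  rw [lintegral_add_right _ hp, lintegral_add_right _ measurable_const, h10]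
  simp only [lintegral_const, measure_univ, mul_one]
  calc _ ≤ ∫⁻ q, ENNReal.ofReal (g'' q) ∂(H.prod μ) + ENNReal.ofReal ε + ENNReal.ofReal ε +
        ENNReal.ofReal ε := by gcongr
    _ = _ := by ring

/-- The one-sided bound is applied to `g` and to `1 - g`. -/
theorem LocLim.tendsto_integral_of_mem_Icc (h : LocallyTV L H) [IsProbabilityMeasure μ]
    {g : ℕ → Config d M × Θ → ℝ} {g' : Config d M × Θ → ℝ} (hg : LocLim H μ g g')
    (hm : ∀ k, Measurable (g k)) (h0 : ∀ k q, 0 ≤ g k q) (h1 : ∀ k q, g k q ≤ 1)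
    (h0' : ∀ q, 0 ≤ g' q) (h1' : ∀ q, g' q ≤ 1) :
    Tendsto (fun k => ∫ q, g k q ∂((L k).prod μ)) atTop (𝓝 (∫ q, g' q ∂(H.prod μ))) := by
  have := h.probH
  have := h.prob
  have hi : ∀ k, Integrable (g k) ((L k).prod μ) := fun k =>
    Integrable.of_bound (hm k).aestronglyMeasurable 1 (Eventually.of_forall fun q => by
      rw [Real.norm_eq_abs, abs_of_nonneg (h0 k q)]; exact h1 k q)
  have hi' : Integrable g' (H.prod μ) :=
    Integrable.of_bound (hg.aemeasurable h hm).aestronglyMeasurable 1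
      (Eventually.of_forall fun q => by
        rw [Real.norm_eq_abs, abs_of_nonneg (h0' q)]; exact h1' q)
  have key : ∀ {f : ℕ → Config d M × Θ → ℝ} {f' : Config d M × Θ → ℝ}, LocLim H μ f f' →
      (∀ k, Measurable (f k)) → (∀ k q, f k q ≤ 1) → (∀ k q, 0 ≤ f k q) → (∀ q, 0 ≤ f' q) →
      (∀ k, Integrable (f k) ((L k).prod μ)) → Integrable f' (H.prod μ) → ∀ ε > 0,
      ∀ᶠ k in atTop, ∫ q, f k q ∂((L k).prod μ) ≤ ∫ q, f' q ∂(H.prod μ) + 3 * ε := by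
    intro f f' hf hfm hf1 hf0 hf0' hfi hfi' ε hε
    filter_upwards [hf.eventually_le h hfm hf1 hε] with k hk
    rw [← ofReal_integral_eq_lintegral_ofReal (hfi k) (Eventually.of_forall (hf0 k)),
      ← ofReal_integral_eq_lintegral_ofReal hfi' (Eventually.of_forall hf0'),
      show (3 : ℝ≥0∞) = ENNReal.ofReal 3 by simp, ← ENNReal.ofReal_mul (by norm_num),
      ← ENNReal.ofReal_add (integral_nonneg hf0') (by positivity)] at hk
    have hnn : 0 ≤ ∫ q, f' q ∂(H.prod μ) := integral_nonneg hf0'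
    exact (ENNReal.ofReal_le_ofReal_iff (by positivity)).1 hk
  rw [Metric.tendsto_atTop']
  intro ε hε
  have e1 := key hg hm h1 h0 h0' hi hi' (ε / 6) (by positivity)
  have e2 := key (f := fun k q => 1 - g k q) (f' := fun q => 1 - g' q)
    (hg.comp (c := fun x => 1 - x) (by fun_prop))
    (fun k => measurable_const.sub (hm k)) (fun k q => by linarith [h0 k q])
    (fun k q => by linarith [h1 k q]) (fun q => by linarith [h1' q])
    (fun k => (integrable_const _).sub (hi k)) ((integrable_const _).sub hi') (ε / 6) (by positivity)
  obtain ⟨N, hN⟩ := eventually_atTop.1 (e1.and e2)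
  refine ⟨N, fun k hk => ?_⟩
  obtain ⟨a1, a2⟩ := hN k hk.le
  rw [integral_sub (integrable_const _) (hi k), integral_sub (integrable_const _) hi'] at a2
  simp only [integral_const, probReal_univ, smul_eq_mul, mul_one] at a2
  rw [Real.dist_eq, abs_lt]
  constructor <;> linarith

theorem LocLim.tendsto_integral_bounded (h : LocallyTV L H) [IsProbabilityMeasure μ]
    {g : ℕ → Config d M × Θ → ℝ} {g' : Config d M × Θ → ℝ} (hg : LocLim H μ g g')
    (hm : ∀ k, Measurable (g k)) {c : ℝ → ℝ} (hc : Continuous c) {N : ℝ} (hN : 0 < N)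
    (hcN : ∀ x, |c x| ≤ N) :
    Tendsto (fun k => ∫ q, c (g k q) ∂((L k).prod μ)) atTop (𝓝 (∫ q, c (g' q) ∂(H.prod μ))) := by
  have := h.probH
  have := h.prob
  have h1 : ∀ x, 0 ≤ (c x + N) / (2 * N) := fun x => by
    have := (abs_le.1 (hcN x)).1
    exact div_nonneg (by linarith) (by linarith)
  have h2 : ∀ x, (c x + N) / (2 * N) ≤ 1 := fun x => by
    have := (abs_le.1 (hcN x)).2
    rw [div_le_one (by linarith)]
    linarith
  have h3 := (hg.comp (c := fun x => (c x + N) / (2 * N)) (by fun_prop)).tendsto_integral_of_mem_Icc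
    h (fun k => ((hc.measurable.comp (hm k)).add_const N).div_const _) (fun k q => h1 _)
    (fun k q => h2 _) (fun q => h1 _) (fun q => h2 _)
  have hi : ∀ k, Integrable (fun q => c (g k q)) ((L k).prod μ) := fun k =>
    Integrable.of_bound (hc.measurable.comp (hm k)).aestronglyMeasurable N
      (Eventually.of_forall fun q => hcN _)
  have hi' : Integrable (fun q => c (g' q)) (H.prod μ) :=
    Integrable.of_bound (hc.measurable.comp_aemeasurable
      (hg.aemeasurable h hm)).aestronglyMeasurable N (Eventually.of_forall fun q => hcN _)
  simp only [integral_div, integral_add hi' (integrable_const N)] at h3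
  simp only [fun k => integral_add (hi k) (integrable_const N)] at h3
  simp only [integral_const, probReal_univ, smul_eq_mul, one_mul] at h3
  have h4 := (h3.mul_const (2 * N)).sub_const N
  have hN' : 2 * N ≠ 0 := by linarith
  simpa only [div_mul_cancel₀ _ hN', add_sub_cancel_right] using h4

/-- The difference is nonzero only where |x| > N, and there |x| = |x|^r |x|^(1-r) ≤ |x|^r N^(1-r).
-/
theorem abs_sub_clip_le {x N r : ℝ} (hN : 0 < N) (hr : 1 ≤ r) :
    |x - max (-N) (min x N)| ≤ |x| ^ r * N ^ (1 - r) := by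
  by_cases hx : |x| ≤ N
  · obtain ⟨a, b⟩ := abs_le.1 hx
    rw [min_eq_left b, max_eq_right a, sub_self, abs_zero]
    positivity
  · push Not at hx
    have h1 : |x - max (-N) (min x N)| ≤ |x| := by
      rcases le_total x N with h | h
      · rw [min_eq_left h]
        rcases le_total (-N) x with h' | h'
        · rw [max_eq_right h', sub_self, abs_zero]
          exact abs_nonneg x
        · rw [max_eq_left h', abs_of_nonpos (by linarith), abs_of_nonpos (by linarith)]
          linarith
      · rw [min_eq_right h, max_eq_right (by linarith), abs_of_nonneg (by linarith),
          abs_of_nonneg (by linarith)]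
        linarith
    refine h1.trans ?_
    have hx0 : 0 < |x| := hN.trans hx
    calc |x| = |x| ^ r * |x| ^ (1 - r) := by
          rw [← Real.rpow_add hx0, add_sub_cancel, Real.rpow_one]
      _ ≤ |x| ^ r * N ^ (1 - r) := by
          exact mul_le_mul_of_nonneg_left (Real.rpow_le_rpow_of_nonpos hN hx.le (by linarith))
            (by positivity)

theorem abs_le_one_add_rpow {x r : ℝ} (hr : 1 ≤ r) : |x| ≤ 1 + |x| ^ r := by
  rcases le_total |x| 1 with h | h
  · have : 0 ≤ |x| ^ r := by positivity
    linarith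
  · have := Real.rpow_le_rpow_of_exponent_le h hr
    rw [Real.rpow_one] at this
    linarith

theorem integrable_of_rpow {α : Type*} [MeasurableSpace α] {ν : Measure α} [IsFiniteMeasure ν]
    {f : α → ℝ} (hf : AEMeasurable f ν) {r : ℝ} (hr : 1 ≤ r)
    (h : Integrable (fun a => |f a| ^ r) ν) : Integrable f ν :=
  ((integrable_const (1 : ℝ)).add h).mono' hf.aestronglyMeasurable
    (Eventually.of_forall fun _ => abs_le_one_add_rpow hr)

/-- A Fatou lemma: the truncated moments converge by the bounded case, so their limits are at most
`C`; then let the truncation level grow by monotone convergence. -/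
theorem LocLim.moment (h : LocallyTV L H) [IsProbabilityMeasure μ]
    {g : ℕ → Config d M × Θ → ℝ} {g' : Config d M × Θ → ℝ} (hg : LocLim H μ g g')
    (hm : ∀ k, Measurable (g k)) {r C : ℝ} (hr : 0 ≤ r)
    (hi : ∀ᶠ k in atTop, Integrable (fun q => |g k q| ^ r) ((L k).prod μ))
    (hC : ∀ᶠ k in atTop, ∫ q, |g k q| ^ r ∂((L k).prod μ) ≤ C) :
    Integrable (fun q => |g' q| ^ r) (H.prod μ) ∧ ∫ q, |g' q| ^ r ∂(H.prod μ) ≤ C := by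
  have := h.probH
  have := h.prob
  have hC0 : 0 ≤ C := by
    obtain ⟨k, hk⟩ := hC.exists
    exact (integral_nonneg fun q => by positivity).trans hk
  have hgm := hg.aemeasurable h hm
  have hcont : ∀ N : ℝ, Continuous fun x : ℝ => min (|x| ^ r) N := fun N =>
    (continuous_abs.rpow_const fun _ => Or.inr hr).min continuous_const
  have hb : ∀ N : ℝ, 0 < N → ∀ x : ℝ, |min (|x| ^ r) N| ≤ N := fun N hN x => by
    rw [abs_of_nonneg (le_min (by positivity) hN.le)]
    exact min_le_right _ _
  have h1 : ∀ N : ℕ, ∫ q, min (|g' q| ^ r) ((N : ℝ) + 1) ∂(H.prod μ) ≤ C := by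
    intro N
    have hN : (0 : ℝ) < (N : ℝ) + 1 := by positivity
    refine le_of_tendsto (hg.tendsto_integral_bounded h hm (hcont _) hN (hb _ hN)) ?_
    filter_upwards [hi, hC] with k hik hCk
    refine (integral_mono_of_nonneg (Eventually.of_forall fun q => ?_) hik
      (Eventually.of_forall fun q => min_le_left _ _)).trans hCk
    exact le_min (by positivity) hN.le
  have h2 : ∫⁻ q, ENNReal.ofReal (|g' q| ^ r) ∂(H.prod μ) ≤ ENNReal.ofReal C := by
    have h3 : ∀ q, ENNReal.ofReal (|g' q| ^ r) =
        ⨆ N : ℕ, ENNReal.ofReal (min (|g' q| ^ r) ((N : ℝ) + 1)) := by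
      intro q
      refine le_antisymm ?_ (iSup_le fun N => ENNReal.ofReal_le_ofReal (min_le_left _ _))
      obtain ⟨N, hN⟩ := exists_nat_ge (|g' q| ^ r)
      refine le_iSup_of_le N ?_
      rw [min_eq_left (by linarith)]
    simp only [h3]
    rw [lintegral_iSup']
    · refine iSup_le fun N => ?_
      rw [← ofReal_integral_eq_lintegral_ofReal]
      · exact ENNReal.ofReal_le_ofReal (h1 N)
      · exact Integrable.of_bound ((hcont _).measurable.comp_aemeasurable hgm).aestronglyMeasurable
          ((N : ℝ) + 1) (Eventually.of_forall fun q => hb _ (by positivity) _)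
      · exact Eventually.of_forall fun q => le_min (by positivity) (by positivity)
    · exact fun N => ((hcont _).measurable.comp_aemeasurable hgm).ennreal_ofReal
    · refine Eventually.of_forall fun q N N' hN => ENNReal.ofReal_le_ofReal ?_
      refine min_le_min_left _ ?_
      have : (N : ℝ) ≤ N' := by exact_mod_cast hN
      linarith
  have hpow : AEMeasurable (fun q => |g' q| ^ r) (H.prod μ) :=
    (continuous_abs.rpow_const fun _ => Or.inr hr).measurable.comp_aemeasurable hgm
  have h4 : Integrable (fun q => |g' q| ^ r) (H.prod μ) := by
    refine ⟨hpow.aestronglyMeasurable, ?_⟩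
    rw [hasFiniteIntegral_iff_ofReal (Eventually.of_forall fun q => by positivity)]
    exact h2.trans_lt ENNReal.ofReal_lt_top
  refine ⟨h4, ?_⟩
  rw [← ofReal_integral_eq_lintegral_ofReal h4 (Eventually.of_forall fun q => by positivity)] at h2
  exact (ENNReal.ofReal_le_ofReal_iff hC0).1 h2

/-- A bounded moment of order r > 1 gives uniform integrability: clipping at ±N changes every
expectation, the limiting one included, by at most C N^(1-r). The clipped expectations converge by
the bounded case. -/
theorem LocLim.tendsto_integral (h : LocallyTV L H) [IsProbabilityMeasure μ]
    {g : ℕ → Config d M × Θ → ℝ} {g' : Config d M × Θ → ℝ} (hg : LocLim H μ g g')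
    (hm : ∀ k, Measurable (g k)) {r C : ℝ} (hr : 1 < r)
    (hi : ∀ᶠ k in atTop, Integrable (fun q => |g k q| ^ r) ((L k).prod μ))
    (hC : ∀ᶠ k in atTop, ∫ q, |g k q| ^ r ∂((L k).prod μ) ≤ C) :
    Tendsto (fun k => ∫ q, g k q ∂((L k).prod μ)) atTop (𝓝 (∫ q, g' q ∂(H.prod μ))) := by
  have := h.probH
  have := h.prob
  obtain ⟨hi', hC'⟩ := hg.moment h hm (by linarith) hi hC
  have hgm := hg.aemeasurable h hm
  have hC0 : 0 ≤ C := (integral_nonneg fun q => by positivity).trans hC'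
  have hcont : ∀ N : ℝ, Continuous fun x : ℝ => max (-N) (min x N) := fun N => by fun_prop
  have hb : ∀ N : ℝ, 0 < N → ∀ x : ℝ, |max (-N) (min x N)| ≤ N := fun N hN x =>
    abs_le.2 ⟨le_max_left _ _, max_le (by linarith) (min_le_right _ _)⟩
  have hdiff : ∀ {α : Type _} [MeasurableSpace α] {ν : Measure α} [IsProbabilityMeasure ν]
      {f : α → ℝ}, AEMeasurable f ν → Integrable (fun a => |f a| ^ r) ν →
      ∫ a, |f a| ^ r ∂ν ≤ C → ∀ N : ℝ, 0 < N →
      |∫ a, f a ∂ν - ∫ a, max (-N) (min (f a) N) ∂ν| ≤ C * N ^ (1 - r) := by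
    intro α _ ν _ f hf hfi hfC N hN
    have hint := integrable_of_rpow hf hr.le hfi
    have hcl : Integrable (fun a => max (-N) (min (f a) N)) ν :=
      Integrable.of_bound ((hcont N).measurable.comp_aemeasurable hf).aestronglyMeasurable N
        (Eventually.of_forall fun a => hb N hN _)
    rw [← integral_sub hint hcl]
    refine (abs_integral_le_integral_abs).trans ?_
    refine (integral_mono (hint.sub hcl).abs (hfi.mul_const (N ^ (1 - r)))
      fun a => abs_sub_clip_le hN hr.le).trans ?_
    rw [integral_mul_const]
    exact mul_le_mul_of_nonneg_right hfC (by positivity)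
  rw [Metric.tendsto_atTop']
  intro ε hε
  have hlim : Tendsto (fun N : ℝ => C * N ^ (1 - r)) atTop (𝓝 0) := by
    have := (tendsto_rpow_neg_atTop (y := r - 1) (by linarith)).const_mul C
    simpa only [mul_zero, neg_sub] using this
  obtain ⟨N, hNε, hN0⟩ := ((hlim.eventually (gt_mem_nhds (show (0 : ℝ) < ε / 3 by positivity))).and
    (eventually_gt_atTop 0)).exists
  have h5 := hg.tendsto_integral_bounded h hm (hcont N) hN0 (hb N hN0)
  rw [Metric.tendsto_atTop'] at h5
  obtain ⟨K, hK⟩ := h5 (ε / 3) (by positivity)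
  obtain ⟨K', hK'⟩ := eventually_atTop.1 (hi.and hC)
  refine ⟨max K K', fun k hk => ?_⟩
  obtain ⟨hik, hCk⟩ := hK' k ((le_max_right _ _).trans hk.le)
  have a1 := hdiff (hm k).aemeasurable hik hCk N hN0
  have a2 := hdiff hgm hi' hC' N hN0
  have a3 := hK k ((le_max_left _ _).trans_lt hk)
  rw [Real.dist_eq] at a3 ⊢
  rw [abs_le] at a1 a2
  rw [abs_lt] at a3 ⊢
  constructor <;> linarith [a1.1, a1.2, a2.1, a2.2, a3.1, a3.2]

end

end

section

variable {d : ℕ} {M : Type*}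

/-! ### Stabilization -/

/-- `r` is a radius of stabilization. -/
def StabAt (ξ : Functional d M) (x : Rd d) (t : M) (X : Set (Rd d × M)) (A : Set (Rd d))
    (r : ℕ) : Prop :=
  ∀ Y : Set (Rd d × M), Y.Finite → Y ⊆ (A \ Metric.closedBall 0 (r : ℝ)) ×ˢ Set.univ →
    ∀ B : Set (Rd d), MeasurableSet B →
      ins ξ x t (act x 1 (inBall r X ∪ Y)) B = ins ξ x t (act x 1 (inBall r X)) B

theorem exists_stabAt_of_radius_le {ξ : Functional d M} {x : Rd d} {t : M} {X : Set (Rd d × M)}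
    {A : Set (Rd d)} {s : ℝ} (hs : 0 ≤ s)
    (h : (radius ξ x t X A : ℝ≥0∞) ≤ ENNReal.ofReal s) :
    ∃ r : ℕ, (r : ℝ) ≤ s ∧ StabAt ξ x t X A r := by
  by_contra hcon
  push Not at hcon
  have h1 : ((⌊s⌋₊ + 1 : ℕ) : ℕ∞) ≤ radius ξ x t X A := by
    refine le_iInf₂ fun r hr => ?_
    have h2 : s < r := by
      by_contra h3
      exact hcon r (not_lt.1 h3) hr
    exact_mod_cast Nat.succ_le_of_lt ((Nat.floor_lt hs).2 h2)
  have h3 : (((⌊s⌋₊ + 1 : ℕ) : ℕ∞) : ℝ≥0∞) ≤ ENNReal.ofReal s :=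
    (ENat.toENNReal_mono h1).trans h
  rw [ENat.toENNReal_coe, ← ENNReal.ofReal_natCast, ENNReal.ofReal_le_ofReal_iff hs] at h3
  push_cast at h3
  linarith [Nat.lt_floor_add_one s]

/-- A finite set that agrees with `X` on a larger ball consists of the points of `X` within radius r
and of points beyond, and the latter are ignored by stabilization. -/
theorem StabAt.ins_eq {ξ : Functional d M} {x : Rd d} {t : M} {X : Set (Rd d × M)}
    {A : Set (Rd d)} {r : ℕ} (h : StabAt ξ x t X A r) {s : ℝ} (hrs : (r : ℝ) ≤ s)
    {V : Set (Rd d × M)} (hV : V.Finite) (hVA : V ⊆ A ×ˢ Set.univ)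
    (hVX : V ∩ Metric.closedBall 0 s ×ˢ Set.univ = X ∩ Metric.closedBall 0 s ×ˢ Set.univ) :
    ins ξ x t (act x 1 V) = ins ξ x t (act x 1 (inBall r X)) := by
  have h1 : V = inBall r X ∪ (V \ Metric.closedBall 0 (r : ℝ) ×ˢ Set.univ) := by
    rw [inBall, ← inter_ball_mono hrs hVX, Set.inter_union_sdiff]
  refine Measure.ext fun B hB => ?_
  have h2 := h (V \ Metric.closedBall 0 (r : ℝ) ×ˢ Set.univ) (hV.subset Set.sdiff_subset) ?_ B hB
  · rw [← h1] at h2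
    exact h2
  · rintro p ⟨hp, hpr⟩
    exact ⟨⟨(hVA hp).1, fun h => hpr ⟨h, trivial⟩⟩, trivial⟩

theorem StabAt.ins_eq_ins {ξ : Functional d M} {x : Rd d} {t : M} {X : Set (Rd d × M)}
    {A : Set (Rd d)} {r : ℕ} (h : StabAt ξ x t X A r) {s : ℝ} (hrs : (r : ℝ) ≤ s)
    {V W : Set (Rd d × M)} (hV : V.Finite) (hVA : V ⊆ A ×ˢ Set.univ)
    (hVX : V ∩ Metric.closedBall 0 s ×ˢ Set.univ = X ∩ Metric.closedBall 0 s ×ˢ Set.univ)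
    (hW : W.Finite) (hWA : W ⊆ A ×ˢ Set.univ)
    (hWX : W ∩ Metric.closedBall 0 s ×ˢ Set.univ = X ∩ Metric.closedBall 0 s ×ˢ Set.univ) :
    ins ξ x t (act x 1 V) = ins ξ x t (act x 1 W) := by
  rw [h.ins_eq hrs hV hVA hVX, h.ins_eq hrs hW hWA hWX]

/-- The sets in the limsup eventually differ only beyond the radius of stabilization, so the limsup
is over an eventually constant function. -/
theorem xiInf_eq {ξ : Functional d M} {x : Rd d} {t : M} {U : Config d M} {r : ℕ}
    (h : StabAt ξ x t U.pts Set.univ r) {s : ℝ} (hrs : (r : ℝ) ≤ s) :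
    xiInf ξ x t U.pts Set.univ =
      ins ξ x t (act x 1 (U.pts ∩ Metric.closedBall 0 s ×ˢ Set.univ)) Set.univ := by
  have h1 : ((fun z => x + z) '' (Set.univ : Set (Rd d))) = Set.univ := by
    rw [Set.image_univ, (add_left_surjective x).range_eq]
  have h2 : (fun K : ℝ => ins ξ x t (inBall K (act x 1 U.pts)) Set.univ) =ᶠ[atTop] fun _ =>
      ins ξ x t (act x 1 (U.pts ∩ Metric.closedBall 0 s ×ˢ Set.univ)) Set.univ := by
    -- The balls in `ext` are centred at the origin, whereas the radius of stabilization is measured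
    -- from `x`; this bound on `K` ensures that the former contains the translate by `x` of the ball
    -- of radius `s`.
    filter_upwards [eventually_ge_atTop (s + ‖x‖)] with K hK
    have h3 : inBall K (act x 1 U.pts) =
        act x 1 (U.pts ∩ ((fun u => x + (1 : ℝ) • u) ⁻¹' Metric.closedBall 0 K) ×ˢ Set.univ) := by
      rw [act_inter_prod, inBall]
    have hb : Bornology.IsBounded ((fun u : Rd d => x + (1 : ℝ) • u) ⁻¹' Metric.closedBall 0 K) := by
      refine (Metric.isBounded_closedBall (x := (0 : Rd d)) (r := K + ‖x‖)).subset ?_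
      intro u hu
      simp only [one_smul, Set.mem_preimage, mem_closedBall_zero_iff] at hu ⊢
      have := norm_sub_le (x + u) x
      rw [add_sub_cancel_left] at this
      linarith
    rw [h3]
    congr 1
    refine h.ins_eq_ins hrs (U.finite_inter hb) (fun p _ => ⟨trivial, trivial⟩) ?_
      (U.finite_inter Metric.isBounded_closedBall) (fun p _ => ⟨trivial, trivial⟩) ?_
    · rw [Set.inter_assoc]
      congr 1
      rw [Set.inter_eq_right]
      rintro p ⟨hp, -⟩
      refine ⟨?_, trivial⟩
      simp only [one_smul, Set.mem_preimage, mem_closedBall_zero_iff] at hp ⊢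
      linarith [norm_add_le x p.1]
    · rw [Set.inter_assoc, Set.inter_self]
  rw [xiInf, ext, h1, limsup_congr h2, limsup_const]

/-! ### Convergence of rescaled integrals -/

/-- The contraction towards `y k` brings every bounded ball close to x, where φ is near φ(x). The
mass outside a ball is under control because total mass and mass of the ball both converge. This is
why continuity of the functional is needed for balls and not only for the total mass. -/
theorem tendsto_integral_rescaled {m : ℕ → Measure (Rd d)} {m' : Measure (Rd d)}
    (hm : ∀ k, IsFiniteMeasure (m k)) (hm' : IsFiniteMeasure m') {φ : Rd d → ℝ}
    (hφ : Measurable φ) {C : ℝ} (hC : ∀ z, |φ z| ≤ C) {x : Rd d} (hφx : ContinuousAt φ x)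
    {y : ℕ → Rd d} (hy : Tendsto y atTop (𝓝 x)) {h : ℕ → ℝ} (hh : Tendsto h atTop (𝓝 0))
    (huniv : Tendsto (fun k => m k Set.univ) atTop (𝓝 (m' Set.univ))) {K₁ : ℝ}
    (hball : ∀ L : ℕ, K₁ < L → Tendsto (fun k => m k ((fun z => y k + z) '' Metric.closedBall 0 L))
      atTop (𝓝 (m' ((fun z => x + z) '' Metric.closedBall 0 L)))) :
    Tendsto (fun k => ∫ w, φ (y k + h k • (w - y k)) ∂(m k)) atTop
      (𝓝 (φ x * (m' Set.univ).toReal)) := by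
  have hC0 : 0 ≤ C := (abs_nonneg _).trans (hC 0)
  have him : ∀ (z : Rd d) (L : ℝ), (fun w => z + w) '' Metric.closedBall 0 L =
      Metric.closedBall z L := fun z L => by
    rw [Set.image_add_left]
    ext w
    rw [Set.mem_preimage, mem_closedBall_zero_iff, mem_closedBall_iff_norm, neg_add_eq_sub]
  simp only [him] at hball
  have hunivR : Tendsto (fun k => (m k).real Set.univ) atTop (𝓝 (m'.real Set.univ)) :=
    (ENNReal.tendsto_toReal (measure_ne_top _ _)).comp huniv
  have hballR : ∀ L : ℕ, K₁ < L → Tendsto (fun k => (m k).real (Metric.closedBall (y k) L))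
      atTop (𝓝 (m'.real (Metric.closedBall x L))) := fun L hL =>
    (ENNReal.tendsto_toReal (measure_ne_top _ _)).comp (hball L hL)
  have htail : Tendsto (fun L : ℕ => m'.real (Metric.closedBall x L)) atTop
      (𝓝 (m'.real Set.univ)) := by
    have h1 := tendsto_measure_iUnion_atTop (μ := m') (s := fun L : ℕ => Metric.closedBall x L)
      fun a b hab => Metric.closedBall_subset_closedBall (by exact_mod_cast hab)
    rw [Metric.iUnion_closedBall_nat] at h1
    exact (ENNReal.tendsto_toReal (measure_ne_top _ _)).comp h1
  have hmain : Tendsto (fun k => ∫ w, φ (y k + h k • (w - y k)) ∂(m k) -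
      φ x * (m k).real Set.univ) atTop (𝓝 0) := by
    rw [Metric.tendsto_atTop']
    intro ε hε
    set D := m'.real Set.univ with hD
    have hD0 : 0 ≤ D := measureReal_nonneg
    -- δ bounds the oscillation of φ on the contracted ball, whose mass is eventually at most D + 1;
    -- η below bounds the mass outside it, where φ may vary by 2C. Each contributes at most ε/4.
    set δ := ε / (4 * (D + 1)) with hδ
    have hδ0 : 0 < δ := by positivity
    set η := ε / (4 * (2 * C + 1)) with hη
    have hη0 : 0 < η := by positivity
    obtain ⟨L, hL1, hL2⟩ := ((htail.eventually (lt_mem_nhds (show D - η / 2 < D by linarith))).and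
      ((tendsto_natCast_atTop_atTop (R := ℝ)).eventually (eventually_gt_atTop K₁))).exists
    obtain ⟨ρ, hρ0, hρ⟩ := Metric.continuousAt_iff.1 hφx δ hδ0
    have e1 := hunivR.eventually (gt_mem_nhds (show D < D + min 1 (η / 4) by
      have : 0 < min 1 (η / 4) := by positivity
      linarith))
    have e2 := (hballR L hL2).eventually (lt_mem_nhds hL1)
    have e3 : ∀ᶠ k in atTop, dist (y k) x < ρ / 2 :=
      hy.eventually (Metric.ball_mem_nhds _ (by positivity))
    have e4 : ∀ᶠ k in atTop, |h k| * L < ρ / 2 := by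
      have h1 : Tendsto (fun k => |h k| * L) atTop (𝓝 0) := by
        simpa using (hh.abs).mul_const (L : ℝ)
      exact h1.eventually (gt_mem_nhds (by positivity))
    have e2' : ∀ᶠ k in atTop, D - η / 2 < (m k).real (Metric.closedBall (y k) L) := e2
    obtain ⟨N, hN⟩ := eventually_atTop.1 (e1.and (e2'.and (e3.and e4)))
    refine ⟨N, fun k hk => ?_⟩
    obtain ⟨b1, b2, b3, b4⟩ := hN k hk.le
    have := hm k
    have hmeas : Measurable fun w => φ (y k + h k • (w - y k)) := hφ.comp (by fun_prop)
    have hi : Integrable (fun w => φ (y k + h k • (w - y k))) (m k) :=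
      Integrable.of_bound hmeas.aestronglyMeasurable C (Eventually.of_forall fun w => hC _)
    have hrew : ∫ w, φ (y k + h k • (w - y k)) ∂(m k) - φ x * (m k).real Set.univ =
        ∫ w, (φ (y k + h k • (w - y k)) - φ x) ∂(m k) := by
      rw [integral_sub hi (integrable_const _)]
      simp [mul_comm]
    have hB : MeasurableSet (Metric.closedBall (y k) (L : ℝ)) := measurableSet_closedBall
    have hpt : ∀ w, |φ (y k + h k • (w - y k)) - φ x| ≤
        δ + (Metric.closedBall (y k) (L : ℝ))ᶜ.indicator (fun _ => 2 * C) w := by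
      intro w
      by_cases hw : w ∈ Metric.closedBall (y k) (L : ℝ)
      · rw [Set.indicator_of_notMem (Set.notMem_compl_iff.2 hw), add_zero, ← Real.dist_eq]
        refine (hρ ?_).le
        calc dist (y k + h k • (w - y k)) x ≤ dist (y k + h k • (w - y k)) (y k) + dist (y k) x :=
              dist_triangle _ _ _
          _ < ρ / 2 + ρ / 2 := by
              refine add_lt_add_of_le_of_lt ?_ b3
              rw [dist_self_add_left, norm_smul, Real.norm_eq_abs]
              refine le_trans ?_ b4.le
              rw [mem_closedBall_iff_norm] at hw
              exact mul_le_mul_of_nonneg_left hw (abs_nonneg _)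
          _ = ρ := by ring
      · rw [Set.indicator_of_mem (show w ∈ (Metric.closedBall (y k) (L : ℝ))ᶜ from hw)]
        have h1 := hC (y k + h k • (w - y k))
        have h2 := hC x
        have := abs_sub (φ (y k + h k • (w - y k))) (φ x)
        linarith
    rw [dist_zero_right, Real.norm_eq_abs, hrew]
    have hcompl : (m k).real (Metric.closedBall (y k) (L : ℝ))ᶜ =
        (m k).real Set.univ - (m k).real (Metric.closedBall (y k) L) :=
      measureReal_compl hB
    calc |∫ w, (φ (y k + h k • (w - y k)) - φ x) ∂(m k)|
        ≤ ∫ w, |φ (y k + h k • (w - y k)) - φ x| ∂(m k) := abs_integral_le_integral_abs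
      _ ≤ ∫ w, (δ + (Metric.closedBall (y k) (L : ℝ))ᶜ.indicator (fun _ => 2 * C) w) ∂(m k) :=
          integral_mono (hi.sub (integrable_const _)).abs
            ((integrable_const _).add ((integrable_const _).indicator hB.compl)) hpt
      _ = δ * (m k).real Set.univ + 2 * C * (m k).real (Metric.closedBall (y k) (L : ℝ))ᶜ := by
          rw [integral_add (integrable_const _) ((integrable_const _).indicator hB.compl),
            integral_indicator_const _ hB.compl]
          simp [mul_comm]
      _ ≤ δ * (D + 1) + 2 * C * η := by
          have c1 : (m k).real Set.univ ≤ D + 1 := b1.le.trans (by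
            have := min_le_left 1 (η / 4)
            linarith)
          have c2 : (m k).real (Metric.closedBall (y k) (L : ℝ))ᶜ ≤ η := by
            rw [hcompl]
            have := min_le_right 1 (η / 4)
            linarith
          gcongr
      _ < ε := by
          have c1 : δ * (D + 1) = ε / 4 := by
            rw [hδ]
            field_simp
          have c2 : η * (2 * C + 1) = ε / 4 := by
            rw [hη]
            field_simp
          nlinarith
  have h2 := hmain.add (hunivR.const_mul (φ x))
  simp only [sub_add_cancel, zero_add] at h2
  exact h2

theorem aff_mem_simpleConfigs {y : Rd d} {a : ℝ} (ha : a ≠ 0) {V : Config d M}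
    (hV : V ∈ simpleConfigs d M) : Config.aff y a V ∈ simpleConfigs d M := by
  rw [simpleConfigs, Set.mem_ofPred_eq, Config.pts_aff y ha, act_eq_image]
  refine ⟨hV.1.image _, ?_⟩
  rintro _ ⟨p, hp, rfl⟩ _ ⟨q, hq, rfl⟩ h
  simp only [affPt, add_right_inj] at h
  rw [hV.2 hp hq (smul_right_injective _ ha h)]

theorem mem_fst_aff {y : Rd d} {a : ℝ} (ha : a ≠ 0) {V : Config d M} {u : Rd d} :
    y + a • u ∈ Prod.fst '' (Config.aff y a V).pts ↔ u ∈ Prod.fst '' V.pts := by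
  rw [Config.pts_aff y ha, act_eq_image, Set.image_image]
  constructor
  · rintro ⟨p, hp, h⟩
    simp only [affPt, add_right_inj] at h
    exact ⟨p, hp, smul_right_injective _ ha h⟩
  · rintro ⟨p, hp, rfl⟩
    exact ⟨p, hp, rfl⟩

theorem notMem_fst_of_agrees {V U : Set (Rd d × M)} {K : ℝ} (hK : 0 ≤ K)
    (h : V ∩ Metric.closedBall 0 K ×ˢ Set.univ = U ∩ Metric.closedBall 0 K ×ˢ Set.univ)
    (h0 : (0 : Rd d) ∉ Prod.fst '' U) : (0 : Rd d) ∉ Prod.fst '' V := by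
  rintro ⟨p, hp, hp0⟩
  have : p ∈ V ∩ Metric.closedBall 0 K ×ˢ Set.univ := ⟨hp, by simpa [hp0] using hK, trivial⟩
  rw [h] at this
  exact h0 ⟨p, this.1, hp0⟩

/-! ### Convergence of functionals at moving locations. -/

variable [MeasurableSpace M]

/-- The integral of `z ↦ φ (y + h (z - y))` with respect to `ξ(y, t; y + V, ·)`. -/
def locF (ξ : Functional d M) (φ : Rd d → ℝ) (h : ℝ) (y : Rd d) (t : M) (V : Config d M) : ℝ :=
  ∫ w, φ (y + h • (w - y)) ∂(regXi ξ ((y, t), Config.aff y 1 V))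

theorem regXi_aff (ξ : Functional d M) {V : Config d M} (hV : V ∈ simpleConfigs d M)
    (h0 : (0 : Rd d) ∉ Prod.fst '' V.pts) (y : Rd d) (t : M) :
    regXi ξ ((y, t), Config.aff y 1 V) = ins ξ y t (act y 1 V.pts) := by
  rw [regXi_of_mem, Config.pts_aff y one_ne_zero]
  refine ⟨aff_mem_simpleConfigs one_ne_zero hV, ?_⟩
  have := mem_fst_aff (y := y) one_ne_zero (V := V) (u := 0)
  rw [smul_zero, add_zero] at this
  exact fun h => h0 (this.1 h)

/-- The conditions on a realization under which a rescaled functional converges. -/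
structure ConvAt (ξ : Functional d M) (x : Rd d) (y : ℕ → Rd d) (t : M) (U : Config d M) :
    Prop where
  stab : ∃ K : ℕ, ∃ ε : ℝ, 0 < ε ∧ ∀ z ∈ Metric.closedBall x ε, radius ξ z t U.pts Set.univ ≤ K
  cont : ∃ K₁ : ℝ, ∀ K : ℕ, (U.pts ∩ Metric.closedBall 0 (K : ℝ) ×ˢ Set.univ).Nonempty →
    ∀ A : Set (Rd d), (A = Set.univ ∨ ∃ L : ℕ, K₁ < L ∧ A = Metric.closedBall 0 (L : ℝ)) →
      Tendsto (fun k => regXi ξ ((y k, t), Config.aff (y k) 1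
        (Config.restr (Metric.closedBall 0 (K : ℝ)) U)) ((fun z => y k + z) '' A)) atTop
        (𝓝 (regXi ξ ((x, t), Config.aff x 1
          (Config.restr (Metric.closedBall 0 (K : ℝ)) U)) ((fun z => x + z) '' A)))
  nonempty : U.pts.Nonempty
  simple : ∀ K : ℕ, Config.restr (Metric.closedBall 0 (K : ℝ)) U ∈ simpleConfigs d M
  zero : (0 : Rd d) ∉ Prod.fst '' U.pts

theorem ConvAt.xiInf_eq {ξ : Functional d M} {x : Rd d} {y : ℕ → Rd d} {t : M} {U : Config d M}
    (h : ConvAt ξ x y t U) : ∃ K₀ : ℕ, ∀ K : ℕ, K₀ ≤ K → xiInf ξ x t U.pts Set.univ =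
      regXi ξ ((x, t), Config.aff x 1 (Config.restr (Metric.closedBall 0 (K : ℝ)) U)) Set.univ := by
  obtain ⟨K₀, ε, hε, hK₀⟩ := h.stab
  refine ⟨K₀, fun K hK => ?_⟩
  have h1 := hK₀ x (Metric.mem_closedBall_self hε.le)
  obtain ⟨r, hr, hstab⟩ := exists_stabAt_of_radius_le (s := K₀) (by positivity) (by
    rw [ENNReal.ofReal_natCast]
    exact_mod_cast ENat.toENNReal_mono h1)
  have hrK : (r : ℝ) ≤ K := hr.trans (by exact_mod_cast hK)
  rw [GeomMeas.xiInf_eq hstab hrK, regXi_aff ξ (h.simple K), Config.pts_restr]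
  rw [Config.pts_restr]
  exact fun h' => h.zero (Set.image_mono Set.inter_subset_left h')

/-- Stabilization with one radius for all locations near x lets the moving configuration be replaced
by a fixed finite part `W` of the limit. What remains is the dependence on the location, which is
the rescaling lemma for the measures of `W`. -/
theorem ConvAt.tendsto_locF {ξ : Functional d M} (hξ : IsMeasureFunctional ξ) {x : Rd d}
    {y : ℕ → Rd d} {t : M} {U : Config d M} (hc : ConvAt ξ x y t U) {φ : Rd d → ℝ}
    (hφ : Measurable φ) {C : ℝ} (hC : ∀ z, |φ z| ≤ C) (hφx : ContinuousAt φ x)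
    (hy : Tendsto y atTop (𝓝 x)) {h : ℕ → ℝ} (hh : Tendsto h atTop (𝓝 0)) :
    Tendsto (fun q : ℕ × Config d M => locF ξ φ (h q.1) (y q.1) t q.2) (locNear U)
      (𝓝 (φ x * (xiInf ξ x t U.pts Set.univ).toReal)) := by
  obtain ⟨K₀, ε, hε, hK₀⟩ := hc.stab
  obtain ⟨K₂, hK₂⟩ := hc.xiInf_eq
  obtain ⟨K₁, hK₁⟩ := hc.cont
  obtain ⟨p, hp⟩ := hc.nonempty
  obtain ⟨K₃, hK₃⟩ := exists_nat_ge ‖p.1‖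
  -- `K₀` exceeds the radii of stabilization near x, `K₂` makes the limit functional a function of
  -- the points in the ball, and `K₃` puts a point into the ball: the continuity condition says
  -- nothing about the empty configuration.
  set K := max K₀ (max K₂ K₃) with hK
  have hne : (U.pts ∩ Metric.closedBall 0 (K : ℝ) ×ˢ Set.univ).Nonempty := by
    refine ⟨p, hp, ?_, trivial⟩
    rw [mem_closedBall_zero_iff]
    refine hK₃.trans ?_
    exact_mod_cast (le_max_right _ _).trans (le_max_right _ _)
  set W := Config.restr (Metric.closedBall 0 (K : ℝ)) U with hW
  have hW0 : (0 : Rd d) ∉ Prod.fst '' W.pts := by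
    rw [hW, Config.pts_restr]
    exact fun h' => hc.zero (Set.image_mono Set.inter_subset_left h')
  have hlim : Tendsto (fun k => locF ξ φ (h k) (y k) t W) atTop
      (𝓝 (φ x * (xiInf ξ x t U.pts Set.univ).toReal)) := by
    rw [hK₂ K ((le_max_left _ _).trans (le_max_right _ _))]
    refine tendsto_integral_rescaled (fun k => isFiniteMeasure_regXi hξ _)
      (isFiniteMeasure_regXi hξ _) hφ hC hφx hy hh (K₁ := K₁) ?_ ?_
    · have := hK₁ K hne Set.univ (Or.inl rfl)
      simpa only [Set.image_univ, (add_left_surjective _).range_eq] using this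
    · exact fun L hL => hK₁ K hne _ (Or.inr ⟨L, hL, rfl⟩)
  refine (hlim.comp (tendsto_fst_locNear U)).congr' ?_
  have hyε : ∀ᶠ q in locNear U, y q.1 ∈ Metric.closedBall x ε :=
    (hy.comp (tendsto_fst_locNear U)).eventually (Metric.closedBall_mem_nhds _ hε)
  filter_upwards [hyε, eventually_mem_locNear U, eventually_inter_locNear U K] with q hq1 hq2 hq3
  have h1 := hK₀ _ hq1
  obtain ⟨r, hr, hstab⟩ := exists_stabAt_of_radius_le (s := K₀) (by positivity) (by
    rw [ENNReal.ofReal_natCast]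
    exact_mod_cast ENat.toENNReal_mono h1)
  have hrK : (r : ℝ) ≤ K := hr.trans (by exact_mod_cast le_max_left _ _)
  simp only [Function.comp_apply, locF]
  rw [regXi_aff ξ (hc.simple K) hW0,
    regXi_aff ξ hq2 (notMem_fst_of_agrees (by positivity) hq3 hc.zero)]
  congr 1
  exact (hstab.ins_eq_ins hrK (hc.simple K).1 (fun p _ => ⟨trivial, trivial⟩) (restr_agrees K U)
    hq2.1 (fun p _ => ⟨trivial, trivial⟩) hq3)

end

section

variable {d : ℕ} {M : Type*}

theorem add_comm_config {p p' : Rd d × M} {X : Config d M} (hp : p.1 ∉ Prod.fst '' X.pts)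
    (hp' : p'.1 ∉ Prod.fst '' X.pts) (h : p.1 ≠ p'.1) :
    Config.add p (Config.add p' X) = Config.add p' (Config.add p X) ∧
      p.1 ∉ Prod.fst '' (Config.add p' X).pts := by
  have h1 : p.1 ∉ Prod.fst '' (Config.add p' X).pts := by
    rw [Config.pts_add hp', Set.image_insert_eq]
    exact fun h' => h'.elim h hp
  have h2 : p'.1 ∉ Prod.fst '' (Config.add p X).pts := by
    rw [Config.pts_add hp, Set.image_insert_eq]
    exact fun h' => h'.elim h.symm hp'
  refine ⟨Config.ext ?_, h1⟩
  rw [Config.pts_add h1, Config.pts_add h2, Config.pts_add hp, Config.pts_add hp',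
    Set.insert_comm]

variable [MeasurableSpace M]

/-! ### Sums over the points of a configuration -/

/-- The sum of the values of `g` at the points of `X`. -/
def Config.sum (X : Config d M) (g : Rd d × M → ℝ) : ℝ :=
  (∫⁻ p, ENNReal.ofReal (g p) ∂X.cm).toReal - (∫⁻ p, ENNReal.ofReal (-g p) ∂X.cm).toReal

theorem Config.sum_eq_finsum {X : Config d M} (hX : X.pts.Finite) {g : Rd d × M → ℝ}
    (hg : Measurable g) : X.sum g = ∑ᶠ p ∈ X.pts, g p := by
  have := hX.fintype
  rw [finsum_mem_eq_finite_toFinset_sum _ hX, Config.sum, Config.lintegral_cm _ hg.ennreal_ofReal,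
    Config.lintegral_cm _ (g := fun p => ENNReal.ofReal (-g p)) hg.neg.ennreal_ofReal, tsum_fintype, tsum_fintype,
    ENNReal.toReal_sum (fun _ _ => ENNReal.ofReal_ne_top),
    ENNReal.toReal_sum (fun _ _ => ENNReal.ofReal_ne_top), ← Finset.sum_sub_distrib]
  have h1 : ∀ a : ℝ, (ENNReal.ofReal a).toReal - (ENNReal.ofReal (-a)).toReal = a := fun a => by
    rcases le_total 0 a with h | h
    · rw [ENNReal.toReal_ofReal h, ENNReal.ofReal_of_nonpos (by linarith)]
      simp
    · rw [ENNReal.toReal_ofReal (neg_nonneg.2 h), ENNReal.ofReal_of_nonpos h]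
      simp
  simp only [h1]
  rw [← Finset.sum_coe_sort hX.toFinset]
  refine Fintype.sum_equiv (Equiv.subtypeEquivRight fun p => by simp) _ _ fun p => rfl

theorem Config.measurable_lintegral {α : Type*} [MeasurableSpace α] {X : α → Config d M}
    (hX : Measurable X) {f : α → Rd d × M → ℝ≥0∞} (hf : Measurable (Function.uncurry f)) :
    Measurable fun a => ∫⁻ p, f a p ∂(X a).cm :=
  measurable_lintegral_of_spanning (Config.measurable_cm.comp hX) _
    (fun _ => measurableSet_cyl measurableSet_closedBall) iUnion_ball_cyl
    (fun a n => (X a).cm_ball_lt_top n) hf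

theorem Config.measurable_sum {α : Type*} [MeasurableSpace α] {X : α → Config d M}
    (hX : Measurable X) {f : α → Rd d × M → ℝ} (hf : Measurable (Function.uncurry f)) :
    Measurable fun a => (X a).sum (f a) :=
  (Config.measurable_lintegral hX (f := fun a p => ENNReal.ofReal (f a p))
    hf.ennreal_ofReal).ennreal_toReal.sub
  (Config.measurable_lintegral hX (f := fun a p => ENNReal.ofReal (-f a p))
    hf.neg.ennreal_ofReal).ennreal_toReal

theorem Config.measurable_lintegral_self {K : (Rd d × M) × Config d M → ℝ≥0∞}
    (hK : Measurable K) : Measurable fun X : Config d M => ∫⁻ p, K (p, X) ∂X.cm :=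
  Config.measurable_lintegral measurable_id (f := fun X p => K (p, X))
    (hK.comp (measurable_snd.prodMk measurable_fst))

theorem Config.measurable_sum_self {F : (Rd d × M) × Config d M → ℝ} (hF : Measurable F) :
    Measurable fun X : Config d M => X.sum fun p => F (p, X) :=
  Config.measurable_sum measurable_id (f := fun X p => F (p, X))
    (hF.comp (measurable_snd.prodMk measurable_fst))

theorem Config.sum_add {p : Rd d × M} {X : Config d M} (hX : X.pts.Finite)
    (hp : p.1 ∉ Prod.fst '' X.pts) {g : Rd d × M → ℝ} (hg : Measurable g) :
    (Config.add p X).sum g = g p + X.sum g := by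
  have h1 : (Config.add p X).pts.Finite := by
    rw [Config.pts_add hp]
    exact hX.insert p
  rw [Config.sum_eq_finsum h1 hg, Config.sum_eq_finsum hX hg, Config.pts_add hp,
    finsum_mem_insert _ (fun h => hp ⟨p, h, rfl⟩) hX]

theorem Config.sum_mul {X : Config d M} (hX : X.pts.Finite) {g : Rd d × M → ℝ}
    (hg : Measurable g) (c : ℝ) : X.sum (fun p => c * g p) = c * X.sum g := by
  rw [Config.sum_eq_finsum hX hg, Config.sum_eq_finsum hX (hg.const_mul c),
    finsum_mem_eq_finite_toFinset_sum _ hX, finsum_mem_eq_finite_toFinset_sum _ hX, Finset.mul_sum]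

theorem Config.ofReal_abs_sum_le (X : Config d M) (g : Rd d × M → ℝ) :
    ENNReal.ofReal |X.sum g| ≤ ∫⁻ p, ENNReal.ofReal |g p| ∂X.cm := by
  have h1 : ∫⁻ p, ENNReal.ofReal (g p) ∂X.cm ≤ ∫⁻ p, ENNReal.ofReal |g p| ∂X.cm :=
    lintegral_mono fun p => ENNReal.ofReal_le_ofReal (le_abs_self _)
  have h2 : ∫⁻ p, ENNReal.ofReal (-g p) ∂X.cm ≤ ∫⁻ p, ENNReal.ofReal |g p| ∂X.cm :=
    lintegral_mono fun p => ENNReal.ofReal_le_ofReal (neg_le_abs _)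
  have h3 : ∀ a b : ℝ≥0∞, ENNReal.ofReal |a.toReal - b.toReal| ≤ max a b := fun a b => by
    rcases abs_cases (a.toReal - b.toReal) with h | h
    · rw [h.1]
      refine (ENNReal.ofReal_le_ofReal (sub_le_self _ ENNReal.toReal_nonneg)).trans ?_
      exact ENNReal.ofReal_toReal_le.trans (le_max_left _ _)
    · rw [h.1, neg_sub]
      refine (ENNReal.ofReal_le_ofReal (sub_le_self _ ENNReal.toReal_nonneg)).trans ?_
      exact ENNReal.ofReal_toReal_le.trans (le_max_right _ _)
  exact (h3 _ _).trans (max_le h1 h2)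

/-! ### Moments of sums over a Poisson process -/

section

variable {ν : Measure (Rd d × M)} [IsFiniteMeasure ν]

/-- By the Mecke formula the expected number of points at `x` is the mass of ν there, which is zero.
-/
theorem ae_notMem_fst_poissonLaw (hν : IsDiffuse ν) (x : Rd d) :
    ∀ᵐ X ∂(poissonLaw ν), x ∉ Prod.fst '' X.pts := by
  have hm : MeasurableSet ({x} ×ˢ Set.univ : Set (Rd d × M)) :=
    measurableSet_cyl (measurableSet_singleton x)
  have h1 := mecke hν (G := fun q => ({x} ×ˢ Set.univ : Set (Rd d × M)).indicator 1 q.1)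
    ((measurable_one.indicator hm).comp measurable_fst)
  have := isProbabilityMeasure_poissonLaw ν
  simp only [lintegral_const, measure_univ, mul_one, lintegral_indicator_one hm] at h1
  have hcm : Measurable fun X : Config d M => X.cm ({x} ×ˢ Set.univ) :=
    (Measure.measurable_coe hm).comp Config.measurable_cm
  rw [hν x, lintegral_eq_zero_iff hcm] at h1
  filter_upwards [h1] with X hX
  exact (Config.cm_fiber_eq_zero x X).1 hX

theorem measurable_add_prod : Measurable fun q : (Rd d × M) × Config d M =>
    (q.1, Config.add q.1 q.2) := measurable_fst.prodMk Config.measurable_add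

/-- The Mecke formula is applied to the absolute value first, which gives integrability, and then to
positive and negative parts. -/
theorem mecke_integral (hν : IsDiffuse ν) {G : (Rd d × M) × Config d M → ℝ} (hG : Measurable G)
    (hi : Integrable (fun q : (Rd d × M) × Config d M => G (q.1, Config.add q.1 q.2))
      (ν.prod (poissonLaw ν))) :
    Integrable (fun X => X.sum fun p => G (p, X)) (poissonLaw ν) ∧
    ∫ X, X.sum (fun p => G (p, X)) ∂(poissonLaw ν) =
      ∫ q, G (q.1, Config.add q.1 q.2) ∂(ν.prod (poissonLaw ν)) := by
  have := isProbabilityMeasure_poissonLaw ν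
  have key : ∀ {K : (Rd d × M) × Config d M → ℝ≥0∞}, Measurable K →
      ∫⁻ X, ∫⁻ p, K (p, X) ∂X.cm ∂(poissonLaw ν) =
        ∫⁻ q, K (q.1, Config.add q.1 q.2) ∂(ν.prod (poissonLaw ν)) := fun {K} hK => by
    have hm : Measurable fun q : (Rd d × M) × Config d M => K (q.1, Config.add q.1 q.2) :=
      hK.comp measurable_add_prod
    rw [mecke hν hK, lintegral_prod _ hm.aemeasurable]
  have hsm : Measurable fun X : Config d M => X.sum fun p => G (p, X) :=
    Config.measurable_sum_self hG
  have habs : ∫⁻ X, ∫⁻ p, ENNReal.ofReal |G (p, X)| ∂X.cm ∂(poissonLaw ν) < ∞ := by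
    rw [key (K := fun q => ENNReal.ofReal |G q|) hG.abs.ennreal_ofReal]
    have := hi.abs.2
    rwa [hasFiniteIntegral_iff_ofReal (Eventually.of_forall fun _ => abs_nonneg _)] at this
  have hpos : ∫⁻ X, ∫⁻ p, ENNReal.ofReal (G (p, X)) ∂X.cm ∂(poissonLaw ν) ≠ ∞ :=
    ((lintegral_mono fun X => lintegral_mono fun p =>
      ENNReal.ofReal_le_ofReal (le_abs_self _)).trans_lt habs).ne
  have hneg : ∫⁻ X, ∫⁻ p, ENNReal.ofReal (-G (p, X)) ∂X.cm ∂(poissonLaw ν) ≠ ∞ :=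
    ((lintegral_mono fun X => lintegral_mono fun p =>
      ENNReal.ofReal_le_ofReal (neg_le_abs _)).trans_lt habs).ne
  have hposm := Config.measurable_lintegral_self (K := fun q => ENNReal.ofReal (G q))
    hG.ennreal_ofReal
  have hnegm := Config.measurable_lintegral_self (K := fun q => ENNReal.ofReal (-G q))
    hG.neg.ennreal_ofReal
  constructor
  · refine ⟨hsm.aestronglyMeasurable, ?_⟩
    refine lt_of_le_of_lt (lintegral_mono fun X => ?_) habs
    rw [Real.enorm_eq_ofReal_abs]
    exact Config.ofReal_abs_sum_le _ _
  · rw [integral_eq_lintegral_pos_part_sub_lintegral_neg_part hi,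
      ← key (K := fun q => ENNReal.ofReal (G q)) hG.ennreal_ofReal,
      ← key (K := fun q => ENNReal.ofReal (-G q)) hG.neg.ennreal_ofReal,
      ← integral_toReal hposm.aemeasurable (ae_lt_top hposm hpos),
      ← integral_toReal hnegm.aemeasurable (ae_lt_top hnegm hneg)]
    exact integral_sub (integrable_toReal_of_lintegral_ne_top hposm.aemeasurable hpos)
      (integrable_toReal_of_lintegral_ne_top hnegm.aemeasurable hneg)

/-- The conditions for the computation of the second moment of `∑_{p ∈ X} F (p, X)`. -/
structure IsSquareSummable (ν : Measure (Rd d × M)) (F : (Rd d × M) × Config d M → ℝ) : Prop where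
  meas : Measurable F
  idem : ∀ p X, p.1 ∉ Prod.fst '' X.pts → F (p, Config.add p X) = F (p, X)
  diag : Integrable (fun q => F q ^ 2) (ν.prod (poissonLaw ν))
  pair : Integrable (fun q : (Rd d × M) × (Rd d × M) × Config d M =>
    F (q.1, Config.add q.2.1 q.2.2) * F (q.2.1, Config.add q.1 q.2.2))
      (ν.prod (ν.prod (poissonLaw ν)))

theorem IsSquareSummable.integrable {F : (Rd d × M) × Config d M → ℝ}
    (h : IsSquareSummable ν F) : Integrable F (ν.prod (poissonLaw ν)) := by
  have := isProbabilityMeasure_poissonLaw ν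
  have h1 : MemLp F 2 (ν.prod (poissonLaw ν)) :=
    (memLp_two_iff_integrable_sq h.meas.aestronglyMeasurable).2 h.diag
  exact h1.integrable (by norm_num)

theorem IsSquareSummable.mean (hν : IsDiffuse ν) {F : (Rd d × M) × Config d M → ℝ}
    (h : IsSquareSummable ν F) : ∫ X, X.sum (fun p => F (p, X)) ∂(poissonLaw ν) =
      ∫ q, F q ∂(ν.prod (poissonLaw ν)) := by
  have := isProbabilityMeasure_poissonLaw ν
  have hae : ∀ᵐ q ∂(ν.prod (poissonLaw ν)), F (q.1, Config.add q.1 q.2) = F q := by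
    have hs : MeasurableSet {q : (Rd d × M) × Config d M | q.1.1 ∉ Prod.fst '' q.2.pts} :=
      Config.measurable_fiber measurable_snd (measurable_fst.comp measurable_fst)
    have : ∀ᵐ q ∂(ν.prod (poissonLaw ν)), q.1.1 ∉ Prod.fst '' q.2.pts :=
      (Measure.ae_prod_iff_ae_ae hs).2 (Eventually.of_forall fun p =>
        ae_notMem_fst_poissonLaw hν p.1)
    filter_upwards [this] with q hq
    exact h.idem _ _ hq
  rw [(mecke_integral hν h.meas (h.integrable.congr (hae.mono fun q hq => hq.symm))).2]
  exact integral_congr_ae hae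

/-- The square of the sum S(X) is the sum of F(p, X) S(X). After the Mecke formula the point p is
added, and S splits into the term of p itself and a sum T over the remaining points. The first gives
the diagonal; a second application of the formula, for fixed p, turns F T into the integral over
pairs. -/
theorem IsSquareSummable.second_moment (hν : IsDiffuse ν) {F : (Rd d × M) × Config d M → ℝ}
    (h : IsSquareSummable ν F) :
    Integrable (fun X => (X.sum fun p => F (p, X)) ^ 2) (poissonLaw ν) ∧
    ∫ X, (X.sum fun p => F (p, X)) ^ 2 ∂(poissonLaw ν) =
      ∫ q, F q ^ 2 ∂(ν.prod (poissonLaw ν)) +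
      ∫ q : (Rd d × M) × (Rd d × M) × Config d M,
        F (q.1, Config.add q.2.1 q.2.2) * F (q.2.1, Config.add q.1 q.2.2)
          ∂(ν.prod (ν.prod (poissonLaw ν))) := by
  have := isProbabilityMeasure_poissonLaw ν
  have hF := h.meas
  have hfin : ∀ᵐ X ∂(poissonLaw ν), X.pts.Finite :=
    (ae_simpleConfigs_poissonLaw ν).mono fun X hX => hX.1
  have hfib : MeasurableSet {q : (Rd d × M) × Config d M | q.1.1 ∉ Prod.fst '' q.2.pts} :=
    Config.measurable_fiber measurable_snd (measurable_fst.comp measurable_fst)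
  have hreg : ∀ᵐ q ∂(ν.prod (poissonLaw ν)), q.1.1 ∉ Prod.fst '' q.2.pts ∧ q.2.pts.Finite := by
    refine Eventually.and ((Measure.ae_prod_iff_ae_ae hfib).2 (Eventually.of_forall fun p =>
      ae_notMem_fst_poissonLaw hν p.1)) (Measure.quasiMeasurePreserving_snd.ae hfin)
  have hFs : ∀ X, Measurable fun p => F (p, X) := fun X =>
    hF.comp (measurable_id.prodMk measurable_const)
  let S : Config d M → ℝ := fun X => X.sum fun p => F (p, X)
  have hS : Measurable S := Config.measurable_sum_self hF
  -- The sum over the points other than the added one, evaluated in its presence.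
  let T : (Rd d × M) × Config d M → ℝ := fun q => q.2.sum fun p => F (p, Config.add q.1 q.2)
  have hT : Measurable T := by
    have h1 : Measurable fun r : ((Rd d × M) × Config d M) × (Rd d × M) =>
        F (r.2, Config.add r.1.1 r.1.2) :=
      hF.comp (measurable_snd.prodMk (Config.measurable_add.comp measurable_fst))
    exact Config.measurable_sum measurable_snd (f := fun q p => F (p, Config.add q.1 q.2)) h1
  let G' : (Rd d × M) → (Rd d × M) × Config d M → ℝ := fun p r =>
    F (p, r.2) * F (r.1, Config.add p r.2)
  have hG'j : Measurable fun q : (Rd d × M) × (Rd d × M) × Config d M => G' q.1 q.2 := by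
    refine (hF.comp (measurable_fst.prodMk (measurable_snd.comp measurable_snd))).mul
      (hF.comp ((measurable_fst.comp measurable_snd).prodMk (Config.measurable_add.comp
        (measurable_fst.prodMk (measurable_snd.comp measurable_snd)))))
  have hG' : ∀ p, Measurable (G' p) := fun p => hG'j.comp measurable_prodMk_left
  -- Almost surely the two points and the configuration occupy distinct locations, so the additions
  -- commute and adding a point to its own argument is immaterial.
  have hpairae : ∀ p, ∀ᵐ r ∂(ν.prod (poissonLaw ν)), G' p (r.1, Config.add r.1 r.2) =
      F (p, Config.add r.1 r.2) * F (r.1, Config.add p r.2) := by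
    intro p
    have h1 : ∀ᵐ r ∂(ν.prod (poissonLaw ν)), r.1.1 ≠ p.1 := by
      have : ∀ᵐ r ∂ν, r.1 ≠ p.1 := by
        rw [ae_iff]
        convert hν p.1 using 2
        ext r
        simp
      exact Measure.quasiMeasurePreserving_fst.ae this
    have h2 : ∀ᵐ r ∂(ν.prod (poissonLaw ν)), p.1 ∉ Prod.fst '' r.2.pts :=
      Measure.quasiMeasurePreserving_snd.ae (ae_notMem_fst_poissonLaw hν p.1)
    filter_upwards [h1, h2, hreg] with r hr1 hr2 hr3
    obtain ⟨e1, -⟩ := add_comm_config hr2 hr3.1 hr1.symm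
    obtain ⟨-, e2⟩ := add_comm_config hr3.1 hr2 hr1
    simp only [G', e1]
    rw [h.idem _ _ e2]
  have hTabs : Integrable (fun q => F q * T q) (ν.prod (poissonLaw ν)) := by
    refine ⟨(hF.mul hT).aestronglyMeasurable, ?_⟩
    have hle : ∀ q : (Rd d × M) × Config d M, ‖F q * T q‖ₑ ≤
        ∫⁻ p, ENNReal.ofReal |G' q.1 (p, q.2)| ∂q.2.cm := by
      intro q
      rw [Real.enorm_eq_ofReal_abs, abs_mul, ENNReal.ofReal_mul (abs_nonneg _)]
      simp only [G', abs_mul, ENNReal.ofReal_mul (abs_nonneg _)]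
      rw [lintegral_const_mul']
      · gcongr
        exact Config.ofReal_abs_sum_le _ _
      · exact ENNReal.ofReal_ne_top
    refine lt_of_le_of_lt (lintegral_mono hle) ?_
    have hGm : ∀ p, Measurable fun r : (Rd d × M) × Config d M => ENNReal.ofReal |G' p r| :=
      fun p => (hG' p).abs.ennreal_ofReal
    have hm0 : Measurable fun q : (Rd d × M) × Config d M =>
        ∫⁻ p, ENNReal.ofReal |G' q.1 (p, q.2)| ∂q.2.cm := by
      have h1 : Measurable fun r : ((Rd d × M) × Config d M) × (Rd d × M) =>
          G' r.1.1 (r.2, r.1.2) :=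
        hG'j.comp ((measurable_fst.comp measurable_fst).prodMk
          (measurable_snd.prodMk (measurable_snd.comp measurable_fst)))
      exact Config.measurable_lintegral measurable_snd
        (f := fun q p => ENNReal.ofReal |G' q.1 (p, q.2)|) h1.abs.ennreal_ofReal
    rw [lintegral_prod _ hm0.aemeasurable]
    have h3 := h.pair.abs.2
    rw [hasFiniteIntegral_iff_ofReal (Eventually.of_forall fun _ => abs_nonneg _),
      lintegral_prod] at h3
    · refine lt_of_le_of_lt (le_of_eq ?_) h3
      refine lintegral_congr fun p => ?_
      have h5 : Measurable fun r : (Rd d × M) × Config d M =>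
          ENNReal.ofReal |G' p (r.1, Config.add r.1 r.2)| := (hGm p).comp measurable_add_prod
      rw [mecke hν (hGm p), ← lintegral_prod _ h5.aemeasurable]
      refine lintegral_congr_ae ?_
      filter_upwards [hpairae p] with r hr
      rw [hr]
    · exact h.pair.1.aemeasurable.abs.ennreal_ofReal
  have hTval : ∫ q, F q * T q ∂(ν.prod (poissonLaw ν)) =
      ∫ q : (Rd d × M) × (Rd d × M) × Config d M,
        F (q.1, Config.add q.2.1 q.2.2) * F (q.2.1, Config.add q.1 q.2.2)
          ∂(ν.prod (ν.prod (poissonLaw ν))) := by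
    rw [integral_prod _ hTabs, integral_prod _ h.pair]
    refine integral_congr_ae ?_
    filter_upwards [h.pair.prod_right_ae] with p hp
    have h4 := mecke_integral hν (hG' p)
      (hp.congr ((hpairae p).mono fun r hr => hr.symm))
    rw [integral_congr_ae (hpairae p)] at h4
    refine Eq.trans ?_ h4.2
    refine integral_congr_ae ?_
    filter_upwards [hfin] with X hX
    simp only [G', T]
    exact (Config.sum_mul hX (g := fun p' => F (p', Config.add p X)) (hFs _) _).symm
  have hGae : ∀ᵐ q ∂(ν.prod (poissonLaw ν)),
      F (q.1, Config.add q.1 q.2) * S (Config.add q.1 q.2) = F q ^ 2 + F q * T q := by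
    filter_upwards [hreg] with q hq
    simp only [S, T]
    rw [Config.sum_add hq.2 hq.1 (hFs _),
      h.idem _ _ hq.1]
    ring
  have hmain := mecke_integral hν (G := fun q => F q * S q.2) (hF.mul (hS.comp measurable_snd))
    ((h.diag.add hTabs).congr (hGae.mono fun q hq => hq.symm))
  have hSsq : ∀ᵐ X ∂(poissonLaw ν), X.sum (fun p => F (p, X) * S X) = S X ^ 2 := by
    filter_upwards [hfin] with X hX
    simp only [mul_comm _ (S X)]
    rw [Config.sum_mul hX (hFs X), sq]
  refine ⟨hmain.1.congr hSsq, ?_⟩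
  change ∫ X, S X ^ 2 ∂(poissonLaw ν) = _
  rw [← integral_congr_ae hSsq, hmain.2, integral_congr_ae hGae, integral_add h.diag hTabs, hTval]

theorem IsSquareSummable.memLp (hν : IsDiffuse ν) {F : (Rd d × M) × Config d M → ℝ}
    (h : IsSquareSummable ν F) : MemLp (fun X => X.sum fun p => F (p, X)) 2 (poissonLaw ν) := by
  have hS : Measurable fun X : Config d M => X.sum fun p => F (p, X) :=
    Config.measurable_sum_self h.meas
  exact (memLp_two_iff_integrable_sq hS.aestronglyMeasurable).2 (h.second_moment hν).1

theorem IsSquareSummable.variance (hν : IsDiffuse ν) {F : (Rd d × M) × Config d M → ℝ}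
    (h : IsSquareSummable ν F) :
    variance (fun X => X.sum fun p => F (p, X)) (poissonLaw ν) =
      ∫ q, F q ^ 2 ∂(ν.prod (poissonLaw ν)) +
      ∫ q : (Rd d × M) × (Rd d × M) × Config d M,
        F (q.1, Config.add q.2.1 q.2.2) * F (q.2.1, Config.add q.1 q.2.2)
          ∂(ν.prod (ν.prod (poissonLaw ν))) - (∫ q, F q ∂(ν.prod (poissonLaw ν))) ^ 2 := by
  have := isProbabilityMeasure_poissonLaw ν
  rw [variance_eq_sub (h.memLp hν), h.mean hν, ← (h.second_moment hν).2]
  rfl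

end

end

section

variable {d : ℕ} {M : Type*}

/-! ### The rescaled functionals -/

/-- The dilation factor `l^{1/d}`. -/
def dil (d : ℕ) (l : ℝ) : ℝ := l ^ (1 / (d : ℝ))

theorem dil_pos {l : ℝ} (hl : 0 < l) : 0 < dil d l := Real.rpow_pos_of_pos hl _

/-- Removal of the points located at `x`. -/
def Config.del (x : Rd d) (X : Config d M) : Config d M := Config.restr {x}ᶜ X

theorem Config.pts_del (x : Rd d) (X : Config d M) :
    (Config.del x X).pts = X.pts ∩ {x}ᶜ ×ˢ Set.univ := Config.pts_restr _ _

theorem notMem_fst_del (x : Rd d) (X : Config d M) : x ∉ Prod.fst '' (Config.del x X).pts := by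
  rw [Config.pts_del]
  rintro ⟨p, ⟨-, hp, -⟩, rfl⟩
  exact hp rfl

theorem Config.del_of_notMem {x : Rd d} {X : Config d M} (h : x ∉ Prod.fst '' X.pts) :
    Config.del x X = X := by
  refine Config.ext ?_
  rw [Config.pts_del, Set.inter_eq_left]
  exact fun p hp => ⟨fun hpx => h ⟨p, hp, hpx⟩, trivial⟩

theorem Config.del_add {p : Rd d × M} {X : Config d M} (h : p.1 ∉ Prod.fst '' X.pts) :
    Config.del p.1 (Config.add p X) = X := by
  refine Config.ext ?_
  rw [Config.pts_del, Config.pts_add h]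
  ext r
  simp only [Set.mem_inter_iff, Set.mem_insert_iff, Set.mem_prod, Set.mem_compl_iff,
    Set.mem_singleton_iff, Set.mem_univ, and_true]
  constructor
  · rintro ⟨rfl | hr, hr'⟩
    · exact (hr' rfl).elim
    · exact hr
  · exact fun hr => ⟨Or.inr hr, fun h' => h ⟨r, hr, h'⟩⟩

theorem Config.del_mem_simpleConfigs {x : Rd d} {X : Config d M} (hX : X ∈ simpleConfigs d M) :
    Config.del x X ∈ simpleConfigs d M := by
  rw [simpleConfigs, Set.mem_ofPred_eq, Config.pts_del]
  exact ⟨hX.1.subset Set.inter_subset_left, hX.2.mono Set.inter_subset_left⟩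

theorem Config.insert_del {x : Rd d} {t : M} {X : Config d M} (hX : X ∈ simpleConfigs d M)
    (h : (x, t) ∈ X.pts ∨ x ∉ Prod.fst '' X.pts) :
    insert (x, t) (Config.del x X).pts = insert (x, t) X.pts := by
  rcases h with h | h
  · rw [Config.pts_del, Set.insert_eq_of_mem h]
    ext r
    simp only [Set.mem_inter_iff, Set.mem_insert_iff, Set.mem_prod, Set.mem_compl_iff,
      Set.mem_singleton_iff, Set.mem_univ, and_true]
    constructor
    · rintro (rfl | hr)
      exacts [h, hr.1]
    · intro hr
      by_cases hrx : r.1 = x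
      · exact Or.inl (hX.2 hr h hrx)
      · exact Or.inr ⟨hr, hrx⟩
  · rw [Config.del_of_notMem h]

/-- `l^{1/d} (-x + X)`. -/
def blow (l : ℝ) (x : Rd d) (X : Config d M) : Config d M :=
  Config.aff (-(dil d l • x)) (dil d l) X

theorem pts_blow {l : ℝ} (hl : 0 < l) (x : Rd d) (X : Config d M) :
    (blow l x X).pts = act (-(dil d l • x)) (dil d l) X.pts :=
  Config.pts_aff _ (dil_pos hl).ne' _

theorem act_blow {l : ℝ} (hl : 0 < l) (x : Rd d) (X : Config d M) :
    act x 1 (blow l x X).pts = rescale l x X.pts := by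
  rw [pts_blow hl, rescale, act_act, act_act]
  congr 1
  · simp [dil]
  · simp [dil]

theorem pts_blow_eq {l : ℝ} (hl : 0 < l) (x : Rd d) (X : Config d M) :
    (blow l x X).pts = act 0 (l ^ (1 / (d : ℝ))) (act (-x) 1 X.pts) := by
  rw [pts_blow hl, act_act]
  congr 1
  · simp [dil]
  · simp [dil]

theorem mem_fst_blow {l : ℝ} (hl : 0 < l) {x u : Rd d} {X : Config d M} :
    dil d l • (u - x) ∈ Prod.fst '' (blow l x X).pts ↔ u ∈ Prod.fst '' X.pts := by
  rw [smul_sub, sub_eq_neg_add]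
  exact mem_fst_aff (dil_pos hl).ne'

theorem zero_mem_fst_blow {l : ℝ} (hl : 0 < l) {x : Rd d} {X : Config d M} :
    (0 : Rd d) ∈ Prod.fst '' (blow l x X).pts ↔ x ∈ Prod.fst '' X.pts := by
  have h := mem_fst_blow hl (x := x) (u := x) (X := X)
  rwa [sub_self, smul_zero] at h

theorem blow_mem_simpleConfigs {l : ℝ} (hl : 0 < l) {x : Rd d} {X : Config d M}
    (hX : X ∈ simpleConfigs d M) : blow l x X ∈ simpleConfigs d M :=
  aff_mem_simpleConfigs (dil_pos hl).ne' hX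

theorem rescale_insert (l : ℝ) (x : Rd d) (t : M) (X : Set (Rd d × M)) :
    rescale l x (insert (x, t) X) = insert (x, t) (rescale l x X) := by
  rw [rescale, act_insert, act_insert, rescale]
  simp [affPt]

/-! ### Measurability and locality of the rescaled functionals. -/

variable [MeasurableSpace M]

theorem Config.measurable_del : Measurable fun q : Rd d × Config d M => Config.del q.1 q.2 := by
  refine Config.measurable_of_cm fun C hC => ?_
  have h1 : ∀ q : Rd d × Config d M, (Config.del q.1 q.2).cm C =
      ∫⁻ p, ({r : (Rd d × Config d M) × (Rd d × M) | r.2 ∈ C ∧ r.2.1 ≠ r.1.1}).indicator 1 (q, p)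
        ∂q.2.cm := by
    intro q
    have hD : MeasurableSet (C ∩ ({q.1}ᶜ : Set (Rd d)) ×ˢ (Set.univ : Set M)) :=
      hC.inter (measurableSet_cyl (measurableSet_singleton _).compl)
    rw [Config.cm_apply _ hC, count_eq, Config.pts_del, Set.inter_assoc,
      Set.inter_comm _ C, ← count_eq, ← Config.cm_apply _ hD, ← lintegral_indicator_one hD]
    refine lintegral_congr fun p => ?_
    have hiff : p ∈ C ∩ ({q.1}ᶜ : Set (Rd d)) ×ˢ (Set.univ : Set M) ↔ p ∈ C ∧ ¬p.1 = q.1 :=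
      ⟨fun h => ⟨h.1, h.2.1⟩, fun h => ⟨h.1, h.2, trivial⟩⟩
    by_cases hp : p ∈ C ∩ ({q.1}ᶜ : Set (Rd d)) ×ˢ (Set.univ : Set M)
    · rw [Set.indicator_of_mem hp, Set.indicator_of_mem]
      · rfl
      · exact hiff.1 hp
    · rw [Set.indicator_of_notMem hp, Set.indicator_of_notMem]
      exact fun h => hp (hiff.2 h)
  simp only [h1]
  refine Config.measurable_lintegral measurable_snd (f := fun q p =>
    ({r : (Rd d × Config d M) × (Rd d × M) | r.2 ∈ C ∧ r.2.1 ≠ r.1.1}).indicator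
      (1 : (Rd d × Config d M) × (Rd d × M) → ℝ≥0∞) (q, p)) ?_
  refine measurable_one.indicator ((measurable_snd hC).inter (measurableSet_eq_fun ?_ ?_).compl)
  · exact measurable_fst.comp measurable_snd
  · exact measurable_fst.comp measurable_fst

theorem measurable_blow {l : ℝ} (hl : 0 < l) :
    Measurable fun q : Rd d × Config d M => blow l q.1 q.2 := by
  have h1 : Measurable fun q : Rd d × Config d M => (-(dil d l • q.1), q.2) :=
    Measurable.prodMk (by fun_prop) measurable_snd
  exact (Config.measurable_aff (dil_pos hl).ne').comp h1

theorem measurable_locF {ξ : Functional d M} (hξ : IsMeasureFunctional ξ) {φ : Rd d → ℝ}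
    (hφ : Measurable φ) {C : ℝ} (hC : ∀ z, |φ z| ≤ C) (h : ℝ) :
    Measurable fun q : (Rd d × M) × Config d M => locF ξ φ h q.1.1 q.1.2 q.2 := by
  refine measurable_integral_of_isFiniteMeasure (κ := fun q : (Rd d × M) × Config d M =>
    regXi ξ ((q.1.1, q.1.2), Config.aff q.1.1 1 q.2)) ?_
    (fun q => isFiniteMeasure_regXi hξ _) (f := fun q w => φ (q.1.1 + h • (w - q.1.1))) ?_
    (fun q w => hC _)
  · have h1 : Measurable fun q : (Rd d × M) × Config d M => (q.1.1, q.2) :=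
      (measurable_fst.comp measurable_fst).prodMk measurable_snd
    have h2 := (Config.measurable_aff (M := M) (d := d) one_ne_zero).comp h1
    exact (measurable_regXi hξ).comp (measurable_fst.prodMk h2)
  · have h1 : Measurable fun r : ((Rd d × M) × Config d M) × Rd d =>
        r.1.1.1 + h • (r.2 - r.1.1.1) := by fun_prop
    exact hφ.comp h1

open Classical in
/-- The integral of `φ` with respect to `ξ_l(x, t; X, ·)`, as a function of `((x, t), X)`. -/
def scF (ξ : Functional d M) (Γ : ℝ → Set (Rd d)) (φ : Rd d → ℝ) (l : ℝ)
    (q : (Rd d × M) × Config d M) : ℝ :=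
  if q.1.1 ∈ Γ l then
    locF ξ φ (dil d l)⁻¹ q.1.1 q.1.2 (blow l q.1.1 (Config.del q.1.1 q.2)) else 0

theorem measurable_scF {ξ : Functional d M} (hξ : IsMeasureFunctional ξ) {Γ : ℝ → Set (Rd d)}
    {φ : Rd d → ℝ} (hφ : Measurable φ) {C : ℝ} (hC : ∀ z, |φ z| ≤ C) {l : ℝ} (hl : 0 < l)
    (hΓ : MeasurableSet (Γ l)) : Measurable (scF ξ Γ φ l) := by
  classical
  refine Measurable.ite (hΓ.preimage (measurable_fst.comp measurable_fst)) ?_ measurable_const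
  have h1 : Measurable fun q : (Rd d × M) × Config d M => (q.1.1, q.2) :=
    (measurable_fst.comp measurable_fst).prodMk measurable_snd
  have h2 : Measurable fun q : (Rd d × M) × Config d M => (q.1.1, Config.del q.1.1 q.2) :=
    (measurable_fst.comp measurable_fst).prodMk (Config.measurable_del.comp h1)
  exact (measurable_locF hξ hφ hC _).comp
    (measurable_fst.prodMk ((measurable_blow (M := M) (d := d) hl).comp h2))

/-- This is the purpose of deleting the points at the location first: the value is the same whether
the point belongs to the configuration, as in the sum, or has yet to be added, as in the Mecke
formula. -/
theorem scF_add (ξ : Functional d M) (Γ : ℝ → Set (Rd d)) (φ : Rd d → ℝ) (l : ℝ)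
    {p : Rd d × M} {X : Config d M} (h : p.1 ∉ Prod.fst '' X.pts) :
    scF ξ Γ φ l (p, Config.add p X) = scF ξ Γ φ l (p, X) := by
  rw [scF, scF, Config.del_add h, Config.del_of_notMem h]

/-- The measure `ξ_l` before the contraction, at a simple configuration. -/
theorem regXi_blow (ξ : Functional d M) {l : ℝ} (hl : 0 < l) {x : Rd d} {t : M}
    {X : Config d M} (hX : X ∈ simpleConfigs d M)
    (h : (x, t) ∈ X.pts ∨ x ∉ Prod.fst '' X.pts) :
    regXi ξ ((x, t), Config.aff x 1 (blow l x (Config.del x X))) =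
      ins ξ x t (rescale l x X.pts) := by
  have hX' := Config.del_mem_simpleConfigs (x := x) hX
  rw [regXi_aff ξ (blow_mem_simpleConfigs hl hX')
    (fun h' => notMem_fst_del x X ((zero_mem_fst_blow hl).1 h')), act_blow hl]
  rw [ins, ins, ← rescale_insert, ← rescale_insert, Config.insert_del hX h]

theorem integral_xiScaled (ξ : Functional d M) (Γ : ℝ → Set (Rd d)) {φ : Rd d → ℝ}
    (hφ : Measurable φ) {l : ℝ} (hl : 0 < l) {x : Rd d} {t : M}
    {X : Config d M} (hX : X ∈ simpleConfigs d M)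
    (h : (x, t) ∈ X.pts ∨ x ∉ Prod.fst '' X.pts) :
    ∫ z, φ z ∂(xiScaled ξ Γ l x t X.pts) = scF ξ Γ φ l ((x, t), X) := by
  rw [xiScaled, scF]
  split_ifs
  · rw [integral_map (by fun_prop) hφ.aestronglyMeasurable, locF, regXi_blow ξ hl hX h]
    rfl
  · simp

theorem xiScaled_univ {ξ : Functional d M} (hξ : IsMeasureFunctional ξ) (Γ : ℝ → Set (Rd d))
    {l : ℝ} (hl : 0 < l) {x : Rd d} {t : M} {X : Config d M} (hX : X ∈ simpleConfigs d M)
    (h : (x, t) ∈ X.pts ∨ x ∉ Prod.fst '' X.pts) :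
    xiScaled ξ Γ l x t X.pts Set.univ = ENNReal.ofReal (scF ξ Γ (fun _ => 1) l ((x, t), X)) := by
  rw [xiScaled, scF]
  split_ifs
  · have := isFiniteMeasure_regXi hξ ((x, t), Config.aff x 1 (blow l x (Config.del x X)))
    rw [Measure.map_apply (by fun_prop) MeasurableSet.univ, Set.preimage_univ, locF,
      integral_const, smul_eq_mul, mul_one, regXi_blow ξ hl hX h, Measure.real,
      ENNReal.ofReal_toReal]
    rw [← regXi_blow ξ hl hX h]
    exact measure_ne_top _ _
  · simp

theorem abs_scF_le {ξ : Functional d M} (hξ : IsMeasureFunctional ξ) (Γ : ℝ → Set (Rd d))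
    {φ : Rd d → ℝ} {C : ℝ} (hC : ∀ z, |φ z| ≤ C) (l : ℝ) (q : (Rd d × M) × Config d M) :
    |scF ξ Γ φ l q| ≤ C * scF ξ Γ (fun _ => 1) l q := by
  rw [scF, scF]
  split_ifs
  · have := isFiniteMeasure_regXi hξ
      ((q.1.1, q.1.2), Config.aff q.1.1 1 (blow l q.1.1 (Config.del q.1.1 q.2)))
    rw [locF, locF, ← Real.norm_eq_abs]
    refine (norm_integral_le_of_norm_le_const (C := C) (Eventually.of_forall fun w => hC _)).trans ?_
    simp
  · simp

theorem scF_one_nonneg (ξ : Functional d M) (Γ : ℝ → Set (Rd d)) (l : ℝ)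
    (q : (Rd d × M) × Config d M) : 0 ≤ scF ξ Γ (fun _ => 1) l q := by
  rw [scF]
  split_ifs
  · exact integral_nonneg fun _ => zero_le_one
  · exact le_rfl

/-- The value of the functional is determined by the points within the radius of stabilization. -/
theorem scF_eq_of_agree (ξ : Functional d M) (Γ : ℝ → Set (Rd d)) (φ : Rd d → ℝ) {l : ℝ}
    (hl : 0 < l) {S : Set (Rd d)} {x : Rd d} {t : M} {X Y : Config d M} {r : ℝ} (hr : 0 ≤ r)
    (hR : (radiusScaled ξ S l x t X.pts : ℝ≥0∞) ≤ ENNReal.ofReal r)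
    (hX : X ∈ simpleConfigs d M) (hY : Y ∈ simpleConfigs d M)
    (hxX : x ∉ Prod.fst '' X.pts) (hxY : x ∉ Prod.fst '' Y.pts)
    (hXS : X.pts ⊆ S ×ˢ Set.univ) (hYS : Y.pts ⊆ S ×ˢ Set.univ)
    (hXY : Y.pts ∩ Metric.closedBall x ((dil d l)⁻¹ * r) ×ˢ Set.univ =
      X.pts ∩ Metric.closedBall x ((dil d l)⁻¹ * r) ×ˢ Set.univ) :
    scF ξ Γ φ l ((x, t), X) = scF ξ Γ φ l ((x, t), Y) := by
  have ha := dil_pos (d := d) hl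
  rw [radiusScaled, ← pts_blow_eq hl] at hR
  obtain ⟨r', hr', hstab⟩ := exists_stabAt_of_radius_le hr hR
  -- A ball of radius r in magnified coordinates is a ball of radius l^(-1/d) r about x in the
  -- original ones.
  have hpre : ((fun u : Rd d => -(dil d l • x) + dil d l • u) ⁻¹' Metric.closedBall 0 r) =
      Metric.closedBall x ((dil d l)⁻¹ * r) := by
    ext u
    rw [Set.mem_preimage, mem_closedBall_zero_iff, mem_closedBall_iff_norm, neg_add_eq_sub,
      ← smul_sub, norm_smul, Real.norm_of_nonneg ha.le, inv_mul_eq_div, le_div_iff₀' ha]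
  have hsub : ∀ Z : Config d M, Z.pts ⊆ S ×ˢ Set.univ → (blow l x Z).pts ⊆
      ((fun y => l ^ (1 / (d : ℝ)) • (-x + y)) '' S) ×ˢ Set.univ := by
    intro Z hZ
    rw [pts_blow hl]
    rintro _ ⟨p, hp, rfl⟩
    refine ⟨⟨p.1, (hZ hp).1, ?_⟩, trivial⟩
    simp [dil]
  have hball : ∀ Z : Config d M, (blow l x Z).pts ∩ Metric.closedBall 0 r ×ˢ Set.univ =
      act (-(dil d l • x)) (dil d l)
        (Z.pts ∩ Metric.closedBall x ((dil d l)⁻¹ * r) ×ˢ Set.univ) := by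
    intro Z
    rw [pts_blow hl, ← hpre, act_inter_prod]
  have key := hstab.ins_eq_ins hr' (blow_mem_simpleConfigs hl hX).1 (hsub X hXS) rfl
    (blow_mem_simpleConfigs hl hY).1 (hsub Y hYS) (by rw [hball, hball, hXY])
  rw [scF, scF]
  split_ifs
  · simp only [locF]
    rw [regXi_blow ξ hl hX (Or.inr hxX), regXi_blow ξ hl hY (Or.inr hxY), ← act_blow hl,
      ← act_blow hl, key]
  · rfl

end

section

variable {d : ℕ} {M : Type*}

/-! ### Points and locations of modified configurations -/

theorem add_hyb_agrees {B : Set (Rd d)} {A C : Config d M} {p : Rd d × M} (hp : p.1 ∉ B)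
    (hpA : p.1 ∉ Prod.fst '' A.pts) (hpC : p.1 ∉ Prod.fst '' C.pts) {D : Set (Rd d)}
    (hD : D ⊆ B) : (Config.add p (Config.hyb B A C)).pts ∩ D ×ˢ Set.univ =
      A.pts ∩ D ×ˢ Set.univ := by
  have h1 : p.1 ∉ Prod.fst '' (Config.hyb B A C).pts := by
    rw [Config.pts_hyb]
    rintro ⟨r, hr | hr, h⟩
    exacts [hpA ⟨r, hr.1, h⟩, hpC ⟨r, hr.1, h⟩]
  rw [Config.pts_add h1, Config.pts_hyb]
  ext r
  simp only [Set.mem_inter_iff, Set.mem_insert_iff, Set.mem_union, Set.mem_prod, Set.mem_univ,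
    and_true, Set.mem_compl_iff]
  constructor
  · rintro ⟨rfl | hr | hr, hrD⟩
    · exact (hp (hD hrD)).elim
    · exact ⟨hr.1, hrD⟩
    · exact (hr.2 (hD hrD)).elim
  · exact fun hr => ⟨Or.inr (Or.inl ⟨hr.1, hD hr.2⟩), hr.2⟩

theorem hyb_compl (B : Set (Rd d)) (A C : Config d M) :
    Config.hyb Bᶜ C A = Config.hyb B A C := by
  refine Config.ext ?_
  rw [Config.pts_hyb, Config.pts_hyb, compl_compl, Set.union_comm]

theorem add_mem_simpleConfigs {p : Rd d × M} {X : Config d M} (hX : X ∈ simpleConfigs d M) :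
    Config.add p X ∈ simpleConfigs d M := by
  by_cases h : p.1 ∈ Prod.fst '' X.pts
  · rwa [Config.add_of_mem h]
  · rw [simpleConfigs, Set.mem_ofPred_eq, Config.pts_add h]
    refine ⟨hX.1.insert p, ?_⟩
    rw [Set.injOn_insert fun hp => h ⟨p, hp, rfl⟩]
    exact ⟨hX.2, h⟩

theorem restr_mem_simpleConfigs {X : Config d M} (hX : X ∈ simpleConfigs d M) {B : Set (Rd d)} :
    Config.restr B X ∈ simpleConfigs d M := by
  rw [simpleConfigs, Set.mem_ofPred_eq, Config.pts_restr]
  exact ⟨hX.1.subset Set.inter_subset_left, hX.2.mono Set.inter_subset_left⟩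

theorem add_pts_subset {p : Rd d × M} {X : Config d M} {S : Set (Rd d)} (hp : p.1 ∈ S)
    (hX : X.pts ⊆ S ×ˢ Set.univ) : (Config.add p X).pts ⊆ S ×ˢ Set.univ := by
  by_cases h : p.1 ∈ Prod.fst '' X.pts
  · rwa [Config.add_of_mem h]
  · rw [Config.pts_add h]
    exact Set.insert_subset ⟨hp, trivial⟩ hX

theorem hyb_pts_subset {B : Set (Rd d)} {A C : Config d M} {S : Set (Rd d × M)}
    (hA : A.pts ⊆ S) (hC : C.pts ⊆ S) : (Config.hyb B A C).pts ⊆ S := by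
  rw [Config.pts_hyb]
  exact Set.union_subset (Set.inter_subset_left.trans hA) (Set.inter_subset_left.trans hC)

theorem notMem_fst_add {x : Rd d} {p : Rd d × M} {X : Config d M} (hxp : x ≠ p.1)
    (hx : x ∉ Prod.fst '' X.pts) : x ∉ Prod.fst '' (Config.add p X).pts := by
  by_cases h : p.1 ∈ Prod.fst '' X.pts
  · rwa [Config.add_of_mem h]
  · rw [Config.pts_add h, Set.image_insert_eq]
    exact fun h' => h'.elim hxp hx

theorem notMem_fst_hyb {x : Rd d} {B : Set (Rd d)} {A C : Config d M}
    (hA : x ∉ Prod.fst '' A.pts) (hC : x ∉ Prod.fst '' C.pts) :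
    x ∉ Prod.fst '' (Config.hyb B A C).pts := by
  rw [Config.pts_hyb]
  rintro ⟨r, hr | hr, h⟩
  exacts [hA ⟨r, hr.1, h⟩, hC ⟨r, hr.1, h⟩]

variable [MeasurableSpace M]

/-! ### Decay of correlations -/

section

variable {Ω : Type*} [MeasurableSpace Ω]

theorem abs_le_of_truncation {w b r : ℝ} (hb : 0 < b) (hr : 1 ≤ r) :
    |w| ≤ b + |w| ^ r * b ^ (1 - r) := by
  rcases le_or_gt |w| b with h | h
  · have : 0 ≤ |w| ^ r * b ^ (1 - r) := by positivity
    linarith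
  · have hw : 0 < |w| := hb.trans h
    have h1 : |w| = |w| ^ r * |w| ^ (1 - r) := by
      rw [← Real.rpow_add hw, add_sub_cancel, Real.rpow_one]
    have h2 : |w| ^ r * |w| ^ (1 - r) ≤ |w| ^ r * b ^ (1 - r) :=
      mul_le_mul_of_nonneg_left (Real.rpow_le_rpow_of_nonpos hb h.le (by linarith)) (by positivity)
    linarith

/-- Two functions with bounded moments that agree outside of a small set have integrals close to
each other. -/
theorem abs_integral_sub_le {P : Measure Ω} [IsProbabilityMeasure P] {W W' : Ω → ℝ}
    (hW : Measurable W) (hW' : Measurable W') {r C n : ℝ} (hr : 1 ≤ r) (hn : 0 < n)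
    (hi : Integrable (fun ω => |W ω| ^ r) P) (hi' : Integrable (fun ω => |W' ω| ^ r) P)
    (hC : ∫ ω, |W ω| ^ r ∂P ≤ C) (hC' : ∫ ω, |W' ω| ^ r ∂P ≤ C) {N : Set Ω}
    (hN : MeasurableSet N) (hNn : P.real N ≤ n) (hWN : ∀ᵐ ω ∂P, ω ∉ N → W ω = W' ω) :
    |∫ ω, W ω ∂P - ∫ ω, W' ω ∂P| ≤ 2 * (1 + C) * n ^ (1 - r⁻¹) := by
  have hr0 : 0 < r := by linarith
  -- The truncation level that balances the two errors, b n on the exceptional set and b^(1-r) from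
  -- the tails: both become n^(1-1/r).
  set b : ℝ := n ^ (-r⁻¹) with hb
  have hb0 : 0 < b := Real.rpow_pos_of_pos hn _
  have h1 := integrable_of_rpow hW.aemeasurable hr hi
  have h1' := integrable_of_rpow hW'.aemeasurable hr hi'
  have hbn : b * n = n ^ (1 - r⁻¹) := by
    rw [hb, sub_eq_add_neg, Real.rpow_add hn, Real.rpow_one, mul_comm]
  have hbr : b ^ (1 - r) = n ^ (1 - r⁻¹) := by
    rw [hb, ← Real.rpow_mul hn.le]
    congr 1
    field_simp
    ring
  have hpt : ∀ᵐ ω ∂P, |W ω - W' ω| ≤ N.indicator (fun _ => 2 * b) ω +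
      (|W ω| ^ r + |W' ω| ^ r) * b ^ (1 - r) := by
    filter_upwards [hWN] with ω hω
    by_cases h : ω ∈ N
    · rw [Set.indicator_of_mem h]
      have a1 := abs_le_of_truncation (w := W ω) hb0 hr
      have a2 := abs_le_of_truncation (w := W' ω) hb0 hr
      have a3 := abs_sub (W ω) (W' ω)
      linarith
    · rw [hω h, sub_self, abs_zero, Set.indicator_of_notMem h, zero_add]
      positivity
  rw [← integral_sub h1 h1']
  have hind : Integrable (N.indicator fun _ => 2 * b) P := (integrable_const _).indicator hN
  calc |∫ ω, (W ω - W' ω) ∂P| ≤ ∫ ω, |W ω - W' ω| ∂P := abs_integral_le_integral_abs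
    _ ≤ ∫ ω, (N.indicator (fun _ => 2 * b) ω + (|W ω| ^ r + |W' ω| ^ r) * b ^ (1 - r)) ∂P :=
        integral_mono_ae (h1.sub h1').abs (hind.add ((hi.add hi').mul_const _)) hpt
    _ = P.real N * (2 * b) + (∫ ω, |W ω| ^ r ∂P + ∫ ω, |W' ω| ^ r ∂P) * b ^ (1 - r) := by
        have e1 := integral_add hind ((hi.add hi').mul_const (b ^ (1 - r)))
        rw [integral_indicator_const _ hN, integral_mul_const, integral_add' hi hi',
          smul_eq_mul] at e1
        exact e1
    _ ≤ n * (2 * b) + (C + C) * b ^ (1 - r) := by gcongr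
    _ = 2 * (1 + C) * n ^ (1 - r⁻¹) := by
        rw [hbr, ← hbn]
        ring

theorem abs_integral_le_of_rpow {P : Measure Ω} [IsProbabilityMeasure P] {W : Ω → ℝ}
    (hW : Measurable W) {r C : ℝ} (hr : 1 ≤ r) (hi : Integrable (fun ω => |W ω| ^ r) P)
    (hC : ∫ ω, |W ω| ^ r ∂P ≤ C) : |∫ ω, W ω ∂P| ≤ 1 + C := by
  have h1 := integrable_of_rpow hW.aemeasurable hr hi
  have h2 := integral_add (integrable_const (1 : ℝ)) hi
  rw [integral_const, probReal_univ, one_smul] at h2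
  calc |∫ ω, W ω ∂P| ≤ ∫ ω, |W ω| ∂P := abs_integral_le_integral_abs
    _ ≤ ∫ ω, (1 + |W ω| ^ r) ∂P :=
        integral_mono h1.abs ((integrable_const 1).add hi) fun ω => abs_le_one_add_rpow hr
    _ ≤ 1 + C := by rw [h2]; linarith

/-- From 2uv ≤ u² + v² with u = |a|^(p/2) and v = |b|^(p/2): products of two values have p/2
moments. With p > 2 this order exceeds 1. -/
theorem abs_mul_rpow_le (a b p : ℝ) :
    |a * b| ^ (p / 2) ≤ |a| ^ p + |b| ^ p := by
  have h1 : ∀ c : ℝ, |c| ^ p = (|c| ^ (p / 2)) ^ 2 := fun c => by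
    rw [← Real.rpow_natCast, ← Real.rpow_mul (abs_nonneg _)]
    congr 1
    push_cast
    ring
  rw [abs_mul, Real.mul_rpow (abs_nonneg _) (abs_nonneg _), h1, h1]
  nlinarith [sq_nonneg (|a| ^ (p / 2) - |b| ^ (p / 2)), sq_nonneg (|a| ^ (p / 2)),
    sq_nonneg (|b| ^ (p / 2))]

theorem integrable_mul_rpow {P : Measure Ω} {f g : Ω → ℝ} (hf : Measurable f) (hg : Measurable g)
    {p C : ℝ} (hfi : Integrable (fun ω => |f ω| ^ p) P)
    (hgi : Integrable (fun ω => |g ω| ^ p) P) (hfC : ∫ ω, |f ω| ^ p ∂P ≤ C)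
    (hgC : ∫ ω, |g ω| ^ p ∂P ≤ C) : Integrable (fun ω => |f ω * g ω| ^ (p / 2)) P ∧
      ∫ ω, |f ω * g ω| ^ (p / 2) ∂P ≤ 2 * C := by
  have h1 : Integrable (fun ω => |f ω * g ω| ^ (p / 2)) P := by
    refine (hfi.add hgi).mono' ((hf.mul hg).abs.pow_const _).aestronglyMeasurable
      (Eventually.of_forall fun ω => ?_)
    rw [Real.norm_of_nonneg (by positivity)]
    exact abs_mul_rpow_le _ _ _
  refine ⟨h1, (integral_mono h1 (hfi.add hgi) fun ω => abs_mul_rpow_le _ _ _).trans ?_⟩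
  change ∫ ω, (|f ω| ^ p + |g ω| ^ p) ∂P ≤ _
  rw [integral_add hfi hgi]
  linarith

variable {α β γ δ : Type*} [MeasurableSpace α] [MeasurableSpace β] [MeasurableSpace γ]
  [MeasurableSpace δ]

theorem measurePreserving_prod_comm (μa : Measure α) (μb : Measure β) (μc : Measure γ)
    (μd : Measure δ) [SFinite μa] [SFinite μb] [SFinite μc] [SFinite μd] :
    MeasurePreserving (fun ω : (α × β) × (γ × δ) => ((ω.1.1, ω.2.1), (ω.1.2, ω.2.2)))
      ((μa.prod μb).prod (μc.prod μd)) ((μa.prod μc).prod (μb.prod μd)) := by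
  have m1 := measurePreserving_prodAssoc μa μb (μc.prod μd)
  have m2 := (MeasurePreserving.id μa).prod ((measurePreserving_prodAssoc μb μc μd).symm)
  have m3 := (MeasurePreserving.id μa).prod
    ((Measure.measurePreserving_swap (μ := μb) (ν := μc)).prod (MeasurePreserving.id μd))
  have m4 := (MeasurePreserving.id μa).prod (measurePreserving_prodAssoc μc μb μd)
  have m5 := (measurePreserving_prodAssoc μa μc (μb.prod μd)).symm
  exact m5.comp (m4.comp (m3.comp (m2.comp m1)))

end

/-! ### Splitting a Poisson process -/

/-- Independence of a Poisson process on a set and on its complement, in the form used for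
couplings: gluing two independent copies along `B` reproduces the law. -/
theorem map_hyb_poissonLaw {ν : Measure (Rd d × M)} [IsFiniteMeasure ν] (hν : IsDiffuse ν)
    {B : Set (Rd d)} (hB : MeasurableSet B) :
    ((poissonLaw ν).prod (poissonLaw ν)).map (fun q => Config.hyb B q.1 q.2) = poissonLaw ν := by
  have := isProbabilityMeasure_poissonLaw ν
  have hbf : IsBallFinite ν := fun n => measure_lt_top _ _
  have h1 := hasPoissonCF_poissonLaw hν
  have h2 := h1.map_hyb h1 hbf hbf hB
  have h3 : ((Bᶜ : Set (Rd d)) ×ˢ (Set.univ : Set M)) = (B ×ˢ Set.univ)ᶜ := by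
    ext p
    simp
  rw [h3, Measure.restrict_add_restrict_compl (measurableSet_cyl hB)] at h2
  have := Measure.isProbabilityMeasure_map (μ := (poissonLaw ν).prod (poissonLaw ν))
    (Config.measurable_hyb hB).aemeasurable
  exact h2.eq_poissonLaw hν

theorem ae_subset_poissonLaw {ν : Measure (Rd d × M)} [IsFiniteMeasure ν] (hν : IsDiffuse ν)
    {S : Set (Rd d)} (hS : MeasurableSet S) (hνS : ν (Sᶜ ×ˢ Set.univ) = 0) :
    ∀ᵐ X ∂(poissonLaw ν), X.pts ⊆ S ×ˢ Set.univ := by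
  have hm : MeasurableSet (Sᶜ ×ˢ Set.univ : Set (Rd d × M)) := measurableSet_cyl hS.compl
  have h1 := mecke hν (G := fun q => (Sᶜ ×ˢ Set.univ : Set (Rd d × M)).indicator 1 q.1)
    ((measurable_one.indicator hm).comp measurable_fst)
  have := isProbabilityMeasure_poissonLaw ν
  simp only [lintegral_const, measure_univ, mul_one, lintegral_indicator_one hm] at h1
  have hcm : Measurable fun X : Config d M => X.cm (Sᶜ ×ˢ Set.univ) :=
    (Measure.measurable_coe hm).comp Config.measurable_cm
  rw [hνS, lintegral_eq_zero_iff hcm] at h1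
  filter_upwards [h1] with X hX p hp
  have hX' : X.cm (Sᶜ ×ˢ Set.univ) = 0 := hX
  rw [Config.cm_apply _ hm, count_eq, ENat.toENNReal_eq_zero, Set.encard_eq_zero] at hX'
  refine ⟨by_contra fun h => ?_, trivial⟩
  have : p ∈ X.pts ∩ Sᶜ ×ˢ Set.univ := ⟨hp, h, trivial⟩
  rw [hX'] at this
  exact this

/-! ### The covariance bound -/

/-- The moment bounds at the pair of locations `x`, `y`. -/
structure PairMoments (Q : Measure (Config d M)) (μM : Measure M)
    (F : (Rd d × M) × Config d M → ℝ) (p C : ℝ) (x y : Rd d) : Prop where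
  single : Integrable (fun ω : Config d M × M => |F ((x, ω.2), ω.1)| ^ p) (Q.prod μM)
  single_le : ∫ ω : Config d M × M, |F ((x, ω.2), ω.1)| ^ p ∂(Q.prod μM) ≤ C
  added : Integrable (fun ω : Config d M × (M × M) =>
    |F ((x, ω.2.1), Config.add (y, ω.2.2) ω.1)| ^ p) (Q.prod (μM.prod μM))
  added_le : ∫ ω : Config d M × (M × M),
    |F ((x, ω.2.1), Config.add (y, ω.2.2) ω.1)| ^ p ∂(Q.prod (μM.prod μM)) ≤ C

/-- The mixed moment at the pair of locations `x`, `y`. -/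
def mixF (Q : Measure (Config d M)) (μM : Measure M) (F : (Rd d × M) × Config d M → ℝ)
    (x y : Rd d) : ℝ :=
  ∫ ω : Config d M × (M × M), F ((x, ω.2.1), Config.add (y, ω.2.2) ω.1) *
    F ((y, ω.2.2), Config.add (x, ω.2.1) ω.1) ∂(Q.prod (μM.prod μM))

/-- The expectation at the location `x`. -/
def meanF (Q : Measure (Config d M)) (μM : Measure M) (F : (Rd d × M) × Config d M → ℝ)
    (x : Rd d) : ℝ := ∫ ω : Config d M × M, F ((x, ω.2), ω.1) ∂(Q.prod μM)

section

variable {Q : Measure (Config d M)} [IsProbabilityMeasure Q] {μM : Measure M}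
  [IsProbabilityMeasure μM] {F : (Rd d × M) × Config d M → ℝ} {p C : ℝ} {x y : Rd d}

theorem measurable_pair (hF : Measurable F) (x y : Rd d) :
    Measurable fun ω : Config d M × (M × M) => F ((x, ω.2.1), Config.add (y, ω.2.2) ω.1) := by
  have h1 : Measurable fun ω : Config d M × (M × M) => ((y, ω.2.2), ω.1) := by fun_prop
  have h2 : Measurable fun ω : Config d M × (M × M) => (x, ω.2.1) := by fun_prop
  exact hF.comp (h2.prodMk (Config.measurable_add.comp h1))

theorem measurable_pair' (hF : Measurable F) (x y : Rd d) :
    Measurable fun ω : Config d M × (M × M) => F ((y, ω.2.2), Config.add (x, ω.2.1) ω.1) := by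
  have h1 : Measurable fun ω : Config d M × (M × M) => ((x, ω.2.1), ω.1) := by fun_prop
  have h2 : Measurable fun ω : Config d M × (M × M) => (y, ω.2.2) := by fun_prop
  exact hF.comp (h2.prodMk (Config.measurable_add.comp h1))

theorem measurable_single (hF : Measurable F) (x : Rd d) :
    Measurable fun ω : Config d M × M => F ((x, ω.2), ω.1) := by
  have h1 : Measurable fun ω : Config d M × M => ((x, ω.2), ω.1) := by fun_prop
  exact hF.comp h1

theorem PairMoments.added' (h : PairMoments Q μM F p C y x) (hF : Measurable F) :
    Integrable (fun ω : Config d M × (M × M) =>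
      |F ((y, ω.2.2), Config.add (x, ω.2.1) ω.1)| ^ p) (Q.prod (μM.prod μM)) ∧
    ∫ ω : Config d M × (M × M),
      |F ((y, ω.2.2), Config.add (x, ω.2.1) ω.1)| ^ p ∂(Q.prod (μM.prod μM)) ≤ C := by
  have hmp := (MeasurePreserving.id Q).prod (Measure.measurePreserving_swap (μ := μM) (ν := μM))
  refine ⟨hmp.integrable_comp_of_integrable h.added, ?_⟩
  have h1 := integral_map (μ := Q.prod (μM.prod μM)) hmp.measurable.aemeasurable
    (f := fun ω : Config d M × (M × M) => |F ((y, ω.2.1), Config.add (x, ω.2.2) ω.1)| ^ p)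
    ((measurable_pair hF y x).abs.pow_const p).aestronglyMeasurable
  rw [hmp.map_eq] at h1
  exact h1.symm.le.trans h.added_le

theorem PairMoments.mix (h : PairMoments Q μM F p C x y)
    (h' : PairMoments Q μM F p C y x) (hF : Measurable F) :
    Integrable (fun ω : Config d M × (M × M) =>
      |F ((x, ω.2.1), Config.add (y, ω.2.2) ω.1) *
        F ((y, ω.2.2), Config.add (x, ω.2.1) ω.1)| ^ (p / 2)) (Q.prod (μM.prod μM)) ∧
    ∫ ω : Config d M × (M × M), |F ((x, ω.2.1), Config.add (y, ω.2.2) ω.1) *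
        F ((y, ω.2.2), Config.add (x, ω.2.1) ω.1)| ^ (p / 2) ∂(Q.prod (μM.prod μM)) ≤ 2 * C :=
  integrable_mul_rpow (measurable_pair hF x y) (measurable_pair' hF x y) h.added
    (h'.added' hF).1 h.added_le (h'.added' hF).2

theorem PairMoments.indep (h : PairMoments Q μM F p C x y)
    (h' : PairMoments Q μM F p C y x) (hF : Measurable F) :
    Integrable (fun ω : (Config d M × M) × (Config d M × M) =>
      |F ((x, ω.1.2), ω.1.1) * F ((y, ω.2.2), ω.2.1)| ^ (p / 2)) ((Q.prod μM).prod (Q.prod μM)) ∧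
    ∫ ω : (Config d M × M) × (Config d M × M),
      |F ((x, ω.1.2), ω.1.1) * F ((y, ω.2.2), ω.2.1)| ^ (p / 2)
        ∂((Q.prod μM).prod (Q.prod μM)) ≤ 2 * C := by
  have m1 := measurePreserving_fst (μ := Q.prod μM) (ν := Q.prod μM)
  have m2 := measurePreserving_snd (μ := Q.prod μM) (ν := Q.prod μM)
  refine integrable_mul_rpow ((measurable_single hF x).comp measurable_fst)
    ((measurable_single hF y).comp measurable_snd)
    (m1.integrable_comp_of_integrable h.single) (m2.integrable_comp_of_integrable h'.single) ?_ ?_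
  · have h1 := integral_map (μ := (Q.prod μM).prod (Q.prod μM)) m1.measurable.aemeasurable
      (f := fun ω : Config d M × M => |F ((x, ω.2), ω.1)| ^ p)
      ((measurable_single hF x).abs.pow_const p).aestronglyMeasurable
    rw [m1.map_eq] at h1
    exact h1.symm.le.trans h.single_le
  · have h1 := integral_map (μ := (Q.prod μM).prod (Q.prod μM)) m2.measurable.aemeasurable
      (f := fun ω : Config d M × M => |F ((y, ω.2), ω.1)| ^ p)
      ((measurable_single hF y).abs.pow_const p).aestronglyMeasurable
    rw [m2.map_eq] at h1
    exact h1.symm.le.trans h'.single_le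

/-- The crude bound, without any independence, which serves for nearby locations. -/
theorem PairMoments.abs_le (hp : 2 ≤ p) (h : PairMoments Q μM F p C x y)
    (h' : PairMoments Q μM F p C y x) (hF : Measurable F) :
    |mixF Q μM F x y - meanF Q μM F x * meanF Q μM F y| ≤ 2 * (1 + 2 * C) := by
  obtain ⟨a1, a2⟩ := h.mix h' hF
  obtain ⟨b1, b2⟩ := h.indep h' hF
  have hr : 1 ≤ p / 2 := by linarith
  have a4 : |mixF Q μM F x y| ≤ 1 + 2 * C :=
    abs_integral_le_of_rpow ((measurable_pair hF x y).mul (measurable_pair' hF x y)) hr a1 a2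
  have b4 : |meanF Q μM F x * meanF Q μM F y| ≤ 1 + 2 * C := by
    rw [meanF, meanF, ← integral_prod_mul]
    exact abs_integral_le_of_rpow (((measurable_single hF x).comp measurable_fst).mul
      ((measurable_single hF y).comp measurable_snd)) hr b1 b2
  have := abs_sub (mixF Q μM F x y) (meanF Q μM F x * meanF Q μM F y)
  linarith


/-- If a pair of values is determined, outside of a small set, by the points in two disjoint sets,
then the covariance is small. -/
theorem PairMoments.abs_le_of_split (hp : 2 ≤ p) (h : PairMoments Q μM F p C x y)
    (h' : PairMoments Q μM F p C y x) (hF : Measurable F) {B : Set (Rd d)} (hB : MeasurableSet B)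
    (hQ : (Q.prod Q).map (fun q => Config.hyb B q.1 q.2) = Q) {n : ℝ} (hn : 0 < n)
    {N₁ N₂ : Set (Config d M × M)} (hN₁ : MeasurableSet N₁) (hN₂ : MeasurableSet N₂)
    (hn₁ : (Q.prod μM).real N₁ ≤ n) (hn₂ : (Q.prod μM).real N₂ ≤ n)
    {G : Set (Config d M)} (hG : ∀ᵐ A ∂Q, A ∈ G)
    (hx : ∀ A ∈ G, ∀ D ∈ G, ∀ t t', (A, t) ∉ N₁ → F ((x, t), Config.add (y, t')
      (Config.hyb B A D)) = F ((x, t), A))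
    (hy : ∀ A ∈ G, ∀ D ∈ G, ∀ t t', (D, t') ∉ N₂ → F ((y, t'), Config.add (x, t)
      (Config.hyb B A D)) = F ((y, t'), D)) :
    |mixF Q μM F x y - meanF Q μM F x * meanF Q μM F y| ≤
      2 * (1 + 2 * C) * (2 * n) ^ (1 - (p / 2)⁻¹) := by
  obtain ⟨a1, a2⟩ := h.mix h' hF
  obtain ⟨b1, b2⟩ := h.indep h' hF
  have hhyb : MeasurePreserving (fun q : Config d M × Config d M => Config.hyb B q.1 q.2)
      (Q.prod Q) Q := ⟨Config.measurable_hyb hB, hQ⟩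
  have hcomm := measurePreserving_prod_comm Q μM Q μM
  -- The coupling: two independent samples with marks, glued along `B`. Under it the mixed moment
  -- and the product of the means are integrals over the same space, of functions that agree outside
  -- the exceptional sets.
  have hmp : MeasurePreserving (fun ω : (Config d M × M) × (Config d M × M) =>
      (Config.hyb B ω.1.1 ω.2.1, (ω.1.2, ω.2.2))) ((Q.prod μM).prod (Q.prod μM))
      (Q.prod (μM.prod μM)) := (hhyb.prod (MeasurePreserving.id (μM.prod μM))).comp hcomm
  let W : Config d M × (M × M) → ℝ := fun ω => F ((x, ω.2.1), Config.add (y, ω.2.2) ω.1) *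
    F ((y, ω.2.2), Config.add (x, ω.2.1) ω.1)
  have hW : Measurable W := (measurable_pair hF x y).mul (measurable_pair' hF x y)
  have hmix : mixF Q μM F x y = ∫ ω : (Config d M × M) × (Config d M × M),
      W (Config.hyb B ω.1.1 ω.2.1, (ω.1.2, ω.2.2)) ∂((Q.prod μM).prod (Q.prod μM)) := by
    have h1 := integral_map hmp.measurable.aemeasurable (f := W)
      (by rw [hmp.map_eq]; exact hW.aestronglyMeasurable)
    rw [hmp.map_eq] at h1
    exact h1
  have hWp : Measurable fun ω => |W ω| ^ (p / 2) := hW.abs.pow_const _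
  have hmix2 := integral_map hmp.measurable.aemeasurable (f := fun ω => |W ω| ^ (p / 2))
    (by rw [hmp.map_eq]; exact hWp.aestronglyMeasurable)
  rw [hmp.map_eq] at hmix2
  rw [hmix, meanF, meanF, ← integral_prod_mul, ← inv_inv (p / 2), inv_inv]
  have m1 := measurePreserving_fst (μ := Q.prod μM) (ν := Q.prod μM)
  have m2 := measurePreserving_snd (μ := Q.prod μM) (ν := Q.prod μM)
  refine abs_integral_sub_le (hW.comp hmp.measurable)
    (((measurable_single hF x).comp measurable_fst).mul
      ((measurable_single hF y).comp measurable_snd)) (by linarith) (by linarith)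
    (hmp.integrable_comp_of_integrable a1) b1 (hmix2.symm.le.trans a2) b2
    (N := Prod.fst ⁻¹' N₁ ∪ Prod.snd ⁻¹' N₂)
    ((measurable_fst hN₁).union (measurable_snd hN₂)) ?_ ?_
  · refine (measureReal_union_le _ _).trans ?_
    rw [m1.measureReal_preimage hN₁.nullMeasurableSet,
      m2.measureReal_preimage hN₂.nullMeasurableSet]
    linarith
  · have h3 := m1.quasiMeasurePreserving.ae
      ((measurePreserving_fst (μ := Q) (ν := μM)).quasiMeasurePreserving.ae hG)
    have h4 := m2.quasiMeasurePreserving.ae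
      ((measurePreserving_fst (μ := Q) (ν := μM)).quasiMeasurePreserving.ae hG)
    filter_upwards [h3, h4] with ω hω hω' hωN
    exact congrArg₂ (· * ·) (hx _ hω _ hω' _ _ fun h => hωN (Or.inl h))
      (hy _ hω _ hω' _ _ fun h => hωN (Or.inr h))

end

/-- The covariance bound for rescaled functionals of a Poisson process. -/
theorem abs_cov_scF_le {ξ : Functional d M} {Γ : ℝ → Set (Rd d)} {φ : Rd d → ℝ} {l : ℝ}
    (hl : 0 < l) (hF : Measurable (scF ξ Γ φ l)) {ν : Measure (Rd d × M)} [IsFiniteMeasure ν]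
    (hν : IsDiffuse ν) {μM : Measure M} [IsProbabilityMeasure μM] {S : Set (Rd d)}
    (hS : MeasurableSet S) (hνS : ν (Sᶜ ×ˢ Set.univ) = 0) {p C : ℝ} (hp : 2 ≤ p) (hC : 0 ≤ C)
    {x y : Rd d} (hxS : x ∈ S) (hyS : y ∈ S)
    (h : PairMoments (poissonLaw ν) μM (scF ξ Γ φ l) p C x y)
    (h' : PairMoments (poissonLaw ν) μM (scF ξ Γ φ l) p C y x) {r n : ℝ} (hr : 0 ≤ r)
    (hn : 0 < n) (hrxy : 2 * ((dil d l)⁻¹ * r) < ‖y - x‖)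
    (hτ : ∀ z ∈ Γ l, ((poissonLaw ν).prod μM) {ω | ENNReal.ofReal r <
      (radiusScaled ξ S l z ω.2 ω.1.1 : ℝ≥0∞)} ≤ ENNReal.ofReal n) :
    |mixF (poissonLaw ν) μM (scF ξ Γ φ l) x y -
      meanF (poissonLaw ν) μM (scF ξ Γ φ l) x * meanF (poissonLaw ν) μM (scF ξ Γ φ l) y| ≤
      2 * (1 + 2 * C) * (2 * n) ^ (1 - (p / 2)⁻¹) := by
  have := isProbabilityMeasure_poissonLaw ν
  -- The tail bound is available only at locations in `Γ l`; elsewhere the functional vanishes and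
  -- so does the covariance.
  have hzero : ∀ z ∉ Γ l, ∀ t X, scF ξ Γ φ l ((z, t), X) = 0 := fun z hz t X => if_neg hz
  by_cases hxΓ : x ∈ Γ l
  swap
  · simp only [mixF, meanF, hzero x hxΓ, zero_mul, integral_zero, sub_self, abs_zero]
    positivity
  by_cases hyΓ : y ∈ Γ l
  swap
  · simp only [mixF, meanF, hzero y hyΓ, mul_zero, integral_zero, sub_self, abs_zero]
    positivity
  set Q := (poissonLaw ν).prod μM with hQ
  let R : Rd d → Set (Config d M × M) := fun z =>
    {ω | ENNReal.ofReal r < (radiusScaled ξ S l z ω.2 ω.1.1 : ℝ≥0∞)}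
  -- The event that the radius of stabilization is large involves an infimum over conditions on all
  -- finite sets and is not known to be measurable, so it is enlarged to a measurable set of equal
  -- measure.
  have hRn : ∀ z ∈ Γ l, Q.real (toMeasurable Q (R z)) ≤ n := fun z hz => by
    rw [Measure.real, measure_toMeasurable]
    exact ENNReal.toReal_le_of_le_ofReal hn.le (hτ z hz)
  set ρ := (dil d l)⁻¹ * r with hρ
  have hρ0 : 0 ≤ ρ := mul_nonneg (inv_nonneg.2 (dil_pos hl).le) hr
  let B := Metric.closedBall x ρ
  have hxB : x ∈ B := Metric.mem_closedBall_self hρ0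
  have hyB : y ∉ B := by
    rw [mem_closedBall_iff_norm, not_le]
    linarith
  -- The distance exceeds 2ρ: the value at x reads the configuration in `B` and the value at y reads
  -- it outside, where the glued process comes from the other copy.
  have hdisj : Metric.closedBall y ρ ⊆ Bᶜ := by
    intro w hw hwB
    rw [mem_closedBall_iff_norm] at hw hwB
    have := norm_sub_le (w - x) (w - y)
    rw [sub_sub_sub_cancel_left] at this
    linarith
  have hB : MeasurableSet B := measurableSet_closedBall
  have hne : x ≠ y := fun h => hyB (h ▸ hxB)
  have hout : ∀ z A t, (A, t) ∉ toMeasurable Q (R z) →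
      (radiusScaled ξ S l z t (Config.pts A) : ℝ≥0∞) ≤ ENNReal.ofReal r := fun z A t hA =>
    not_lt.1 fun hlt => hA (subset_toMeasurable _ _ hlt)
  refine h.abs_le_of_split hp h' hF hB (map_hyb_poissonLaw hν hB) hn
    (measurableSet_toMeasurable Q (R x)) (measurableSet_toMeasurable Q (R y)) (hRn x hxΓ)
    (hRn y hyΓ) (G := {A | A ∈ simpleConfigs d M ∧ A.pts ⊆ S ×ˢ Set.univ ∧
      x ∉ Prod.fst '' A.pts ∧ y ∉ Prod.fst '' A.pts}) ?_ ?_ ?_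
  · filter_upwards [ae_simpleConfigs_poissonLaw ν, ae_subset_poissonLaw hν hS hνS,
      ae_notMem_fst_poissonLaw hν x, ae_notMem_fst_poissonLaw hν y] with A h1 h2 h3 h4
    exact ⟨h1, h2, h3, h4⟩
  · rintro A ⟨a1, a2, a3, a4⟩ D ⟨d1, d2, d3, d4⟩ t t' hA
    refine (scF_eq_of_agree ξ Γ φ hl hr (hout x A t hA) a1 (add_mem_simpleConfigs
      (hyb_mem_simpleConfigs (restr_mem_simpleConfigs a1) d1)) a3
      (notMem_fst_add hne (notMem_fst_hyb a3 d3)) a2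
      (add_pts_subset hyS (hyb_pts_subset a2 d2)) ?_).symm
    exact add_hyb_agrees hyB a4 d4 subset_rfl
  · rintro A ⟨a1, a2, a3, a4⟩ D ⟨d1, d2, d3, d4⟩ t t' hA
    refine (scF_eq_of_agree ξ Γ φ hl hr (hout y D t' hA) d1 (add_mem_simpleConfigs
      (hyb_mem_simpleConfigs (restr_mem_simpleConfigs a1) d1)) d4
      (notMem_fst_add hne.symm (notMem_fst_hyb a4 d4)) d2
      (add_pts_subset hxS (hyb_pts_subset a2 d2)) ?_).symm
    rw [← hyb_compl]
    exact add_hyb_agrees (Set.notMem_compl_iff.2 hxB) d3 a3 hdisj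

end

section

variable {d : ℕ} {M : Type*} [MeasurableSpace M]

/-! ### The Poisson processes of the model -/

/-- The intensity measure of `P_l`. -/
def modelIntensity (κ : Rd d → ℝ) (μM : Measure M) (l : ℝ) : Measure (Rd d × M) :=
  ENNReal.ofReal l • (densityMeasure κ).prod μM

section

variable {κ : Rd d → ℝ} {μM : Measure M} [IsProbabilityMeasure μM]

theorem densityMeasure_singleton (hd : 0 < d) (x : Rd d) : densityMeasure κ {x} = 0 := by
  have : Nonempty (Fin d) := ⟨⟨0, hd⟩⟩
  exact (withDensity_absolutelyContinuous _ _) (measure_singleton x)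

theorem isFiniteMeasure_modelIntensity [IsProbabilityMeasure (densityMeasure κ)] (l : ℝ) :
    IsFiniteMeasure (modelIntensity κ μM l) := by
  refine ⟨?_⟩
  rw [modelIntensity, Measure.smul_apply, smul_eq_mul]
  exact ENNReal.mul_lt_top ENNReal.ofReal_lt_top (measure_lt_top _ _)

theorem isDiffuse_modelIntensity (hd : 0 < d) (l : ℝ) : IsDiffuse (modelIntensity κ μM l) := by
  intro x
  rw [modelIntensity, Measure.smul_apply, Measure.prod_prod, densityMeasure_singleton hd]
  simp

theorem modelIntensity_compl_support (l : ℝ) :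
    modelIntensity κ μM l ((densityMeasure κ).supportᶜ ×ˢ Set.univ) = 0 := by
  rw [modelIntensity, Measure.smul_apply, Measure.prod_prod, Measure.measure_compl_support]
  simp

theorem IsPoissonLaw.eq_poissonLaw {Q : Measure (Config d M)} {ν : Measure (Rd d × M)}
    [IsFiniteMeasure ν] (hν : IsDiffuse ν) (h : IsPoissonLaw Q ν) : Q = poissonLaw ν := by
  have := h.prob
  exact (h.hasPoissonCF fun n => measure_lt_top _ _).eq_poissonLaw hν

/-! ### Consequences of the moments conditions -/

theorem integrable_rpow_of_lintegral {Ω : Type*} [MeasurableSpace Ω] {P : Measure Ω}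
    {g g₁ : Ω → ℝ} (hg : Measurable g) {m : Ω → ℝ≥0∞} {b p : ℝ} (hp : 0 ≤ p) (hb : 0 ≤ b)
    (h1 : ∀ ω, |g ω| ≤ b * g₁ ω) (hg₁ : ∀ ω, 0 ≤ g₁ ω)
    (hm : ∀ᵐ ω ∂P, m ω = ENNReal.ofReal (g₁ ω)) {D : ℝ}
    (hD : ∫⁻ ω, m ω ^ p ∂P ≤ ENNReal.ofReal D) (hD0 : 0 ≤ D) :
    Integrable (fun ω => |g ω| ^ p) P ∧ ∫ ω, |g ω| ^ p ∂P ≤ b ^ p * D := by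
  have h2 : ∫⁻ ω, ENNReal.ofReal (|g ω| ^ p) ∂P ≤ ENNReal.ofReal (b ^ p * D) := by
    rw [ENNReal.ofReal_mul (by positivity)]
    calc ∫⁻ ω, ENNReal.ofReal (|g ω| ^ p) ∂P ≤ ∫⁻ ω, ENNReal.ofReal (b ^ p) * m ω ^ p ∂P := by
          refine lintegral_mono_ae ?_
          filter_upwards [hm] with ω hω
          rw [hω, ENNReal.ofReal_rpow_of_nonneg (hg₁ ω) hp, ← ENNReal.ofReal_mul (by positivity),
            ← Real.mul_rpow hb (hg₁ ω)]
          exact ENNReal.ofReal_le_ofReal (Real.rpow_le_rpow (abs_nonneg _) (h1 ω) hp)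
      _ = ENNReal.ofReal (b ^ p) * ∫⁻ ω, m ω ^ p ∂P :=
          lintegral_const_mul' _ _ ENNReal.ofReal_ne_top
      _ ≤ _ := by gcongr
  have h3 : Integrable (fun ω => |g ω| ^ p) P := by
    refine ⟨(hg.abs.pow_const p).aestronglyMeasurable, ?_⟩
    rw [hasFiniteIntegral_iff_ofReal (Eventually.of_forall fun ω => by positivity)]
    exact h2.trans_lt ENNReal.ofReal_lt_top
  refine ⟨h3, ?_⟩
  rw [← ofReal_integral_eq_lintegral_ofReal h3 (Eventually.of_forall fun ω => by positivity)] at h2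
  exact (ENNReal.ofReal_le_ofReal_iff (by positivity)).1 h2

variable {ξ : Functional d M} {Γ : ℝ → Set (Rd d)} {P : ℝ → Measure (Config d M)} {p : ℝ}

/-- The two moments conditions in terms of the measurable versions of the functionals. -/
theorem exists_pairMoments (hd : 0 < d) [IsProbabilityMeasure (densityMeasure κ)]
    (hξ : IsMeasureFunctional ξ) (hP : ∀ l, 1 ≤ l → P l = poissonLaw (modelIntensity κ μM l))
    (hΓ : ∀ l : ℝ, 1 ≤ l → MeasurableSet (Γ l)) (hp : 0 ≤ p) {S : Set (Rd d)}
    (hmom : MomentCond ξ μM Γ S P p) (hmom2 : MomentCondAdd ξ μM Γ S P p)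
    {φ : Rd d → ℝ} (hφ : Measurable φ) {b : ℝ} (hb : ∀ z, |φ z| ≤ b) :
    ∃ C : ℝ, 0 ≤ C ∧ ∀ l, 1 ≤ l → ∀ x ∈ S, ∀ y ∈ S, x ≠ y →
      PairMoments (P l) μM (scF ξ Γ φ l) p C x y := by
  have hb0 : 0 ≤ b := (abs_nonneg _).trans (hb 0)
  obtain ⟨D, hD⟩ : ∃ D : ℝ≥0, (⨆ (l : ℝ) (_ : 1 ≤ l) (x ∈ S),
    ∫⁻ ω, (xiScaled ξ Γ l x ω.2 ω.1.1 Set.univ) ^ p ∂((P l).prod μM)) ≤ D :=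
    ⟨_, (ENNReal.coe_toNNReal hmom.ne).ge⟩
  obtain ⟨D', hD'⟩ : ∃ D : ℝ≥0, (⨆ (l : ℝ) (_ : 1 ≤ l) (x ∈ S) (y ∈ S),
    ∫⁻ ω, (xiScaled ξ Γ l x ω.2.1 (insert (y, ω.2.2) ω.1.1) Set.univ) ^ p
      ∂((P l).prod (μM.prod μM))) ≤ D := ⟨_, (ENNReal.coe_toNNReal hmom2.ne).ge⟩
  refine ⟨b ^ p * max D D', by positivity, fun l hl x hx y hy hxy => ?_⟩
  have hl0 : 0 < l := by linarith
  have h1 : ∫⁻ ω, (xiScaled ξ Γ l x ω.2 ω.1.1 Set.univ) ^ p ∂((P l).prod μM) ≤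
      ENNReal.ofReal (max (D : ℝ) D') := by
    refine le_trans (le_trans ?_ hD) ?_
    · exact le_iSup₂_of_le l hl (le_iSup₂_of_le x hx le_rfl)
    · rw [← ENNReal.ofReal_coe_nnreal]
      exact ENNReal.ofReal_le_ofReal (le_max_left _ _)
  have h2 : ∫⁻ ω, (xiScaled ξ Γ l x ω.2.1 (insert (y, ω.2.2) ω.1.1) Set.univ) ^ p
      ∂((P l).prod (μM.prod μM)) ≤ ENNReal.ofReal (max (D : ℝ) D') := by
    refine le_trans (le_trans ?_ hD') ?_
    · exact le_iSup₂_of_le l hl (le_iSup₂_of_le x hx (le_iSup₂_of_le y hy le_rfl))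
    · rw [← ENNReal.ofReal_coe_nnreal]
      exact ENNReal.ofReal_le_ofReal (le_max_right _ _)
  have := isFiniteMeasure_modelIntensity (κ := κ) (μM := μM) l
  have := isProbabilityMeasure_poissonLaw (modelIntensity κ μM l)
  rw [hP l hl] at h1 h2 ⊢
  have hF := measurable_scF hξ hφ hb hl0 (hΓ l hl)
  have hdiff := isDiffuse_modelIntensity (κ := κ) (μM := μM) hd l
  have hae : ∀ᵐ X ∂(poissonLaw (modelIntensity κ μM l)), X ∈ simpleConfigs d M ∧
      x ∉ Prod.fst '' X.pts ∧ y ∉ Prod.fst '' X.pts :=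
    (ae_simpleConfigs_poissonLaw _).and ((ae_notMem_fst_poissonLaw hdiff x).and
      (ae_notMem_fst_poissonLaw hdiff y))
  have k1 := integrable_rpow_of_lintegral (measurable_single hF x) hp hb0
    (fun ω => abs_scF_le hξ Γ hb l _) (fun ω => scF_one_nonneg ξ Γ l _)
    (P := (poissonLaw (modelIntensity κ μM l)).prod μM)
    (m := fun ω => xiScaled ξ Γ l x ω.2 ω.1.1 Set.univ) (by
      filter_upwards [Measure.quasiMeasurePreserving_fst.ae hae] with ω hω
      exact xiScaled_univ hξ Γ hl0 hω.1 (Or.inr hω.2.1)) h1 (by positivity)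
  have k2 := integrable_rpow_of_lintegral (measurable_pair hF x y) hp hb0
    (fun ω => abs_scF_le hξ Γ hb l _) (fun ω => scF_one_nonneg ξ Γ l _)
    (P := (poissonLaw (modelIntensity κ μM l)).prod (μM.prod μM))
    (m := fun ω => xiScaled ξ Γ l x ω.2.1 (insert (y, ω.2.2) ω.1.1) Set.univ) (by
      filter_upwards [Measure.quasiMeasurePreserving_fst.ae hae] with ω hω
      rw [← xiScaled_univ hξ Γ hl0 (add_mem_simpleConfigs hω.1)
        (Or.inr (notMem_fst_add hxy hω.2.1)), Config.pts_add hω.2.2]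
      rfl) h2 (by positivity)
  exact ⟨k1.1, k1.2, k2.1, k2.2⟩

/-- Power-law stabilization as an explicit tail bound. -/
theorem exists_tail_bound {S : Set (Rd d)} {q : ℝ}
    (hpow : IsPowerLawStabilizing ξ μM Γ S P q) :
    ∃ K : ℝ, 0 < K ∧ ∀ r : ℝ, 1 ≤ r → ∀ l, 1 ≤ l → ∀ x ∈ Γ l,
      ((P l).prod μM) {ω | ENNReal.ofReal r < (radiusScaled ξ S l x ω.2 ω.1.1 : ℝ≥0∞)} ≤
        ENNReal.ofReal (K * r ^ (-q)) := by
  obtain ⟨D, hD⟩ : ∃ D : ℝ≥0, (⨆ (s : ℝ) (_ : 1 ≤ s),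
    ENNReal.ofReal (s ^ q) * tau ξ μM Γ S P s) ≤ D := ⟨_, (ENNReal.coe_toNNReal hpow.ne).ge⟩
  refine ⟨D + 1, by positivity, fun r hr l hl x hx => ?_⟩
  have hr0 : 0 < r := by linarith
  have h1 : ENNReal.ofReal (r ^ q) * tau ξ μM Γ S P r ≤ D :=
    (le_iSup₂ (f := fun (s : ℝ) (_ : 1 ≤ s) => ENNReal.ofReal (s ^ q) * tau ξ μM Γ S P s)
      r hr).trans hD
  have h2 : ((P l).prod μM) {ω | ENNReal.ofReal r <
      (radiusScaled ξ S l x ω.2 ω.1.1 : ℝ≥0∞)} ≤ tau ξ μM Γ S P r :=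
    le_iSup₂_of_le l hl (le_iSup₂_of_le x hx le_rfl)
  refine h2.trans ?_
  have h3 : tau ξ μM Γ S P r = ENNReal.ofReal (r ^ (-q)) *
      (ENNReal.ofReal (r ^ q) * tau ξ μM Γ S P r) := by
    rw [← mul_assoc, ← ENNReal.ofReal_mul (by positivity), ← Real.rpow_add hr0]
    simp
  rw [h3, mul_comm _ (r ^ (-q)), ENNReal.ofReal_mul (by positivity)]
  gcongr
  refine h1.trans ?_
  rw [← ENNReal.ofReal_coe_nnreal]
  exact ENNReal.ofReal_le_ofReal (by linarith)

end

/-! ### The variance formula -/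

section

variable {α β γ δ ε : Type*} [MeasurableSpace α] [MeasurableSpace β] [MeasurableSpace γ]

/-- The Mecke formula groups location and mark together, whereas the moments at a fixed location
integrate over configuration and mark. -/
theorem measurePreserving_rotate (μa : Measure α) (μb : Measure β) (μc : Measure γ)
    [SFinite μa] [SFinite μb] [SFinite μc] :
    MeasurePreserving (fun r : α × (γ × β) => ((r.1, r.2.2), r.2.1))
      (μa.prod (μc.prod μb)) ((μa.prod μb).prod μc) :=
  ((measurePreserving_prodAssoc μa μb μc).symm).comp
    ((MeasurePreserving.id μa).prod Measure.measurePreserving_swap)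

theorem measurePreserving_rotate₂ (μa : Measure α) (μb : Measure β) (μc : Measure γ)
    [SFinite μa] [SFinite μb] [SFinite μc] :
    MeasurePreserving (fun r : (α × α) × (γ × (β × β)) =>
      ((r.1.1, r.2.2.1), ((r.1.2, r.2.2.2), r.2.1)))
      ((μa.prod μa).prod (μc.prod (μb.prod μb)))
      ((μa.prod μb).prod ((μa.prod μb).prod μc)) := by
  have m1 := measurePreserving_rotate (μa.prod μa) (μb.prod μb) μc
  have m2 := (measurePreserving_prod_comm μa μa μb μb).prod (MeasurePreserving.id μc)
  have m3 := measurePreserving_prodAssoc (μa.prod μb) (μa.prod μb) μc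
  exact m3.comp (m2.comp m1)

end

/-- The second moment at the location `x`. -/
def sqF (Q : Measure (Config d M)) (μM : Measure M) (F : (Rd d × M) × Config d M → ℝ)
    (x : Rd d) : ℝ := ∫ ω : Config d M × M, F ((x, ω.2), ω.1) ^ 2 ∂(Q.prod μM)

/-- The covariance at the locations `x` and `y`. -/
def covF (Q : Measure (Config d M)) (μM : Measure M) (F : (Rd d × M) × Config d M → ℝ)
    (x y : Rd d) : ℝ := mixF Q μM F x y - meanF Q μM F x * meanF Q μM F y

end

section

variable {d : ℕ} {M : Type*} [MeasurableSpace M]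

section

variable {α β : Type*} [MeasurableSpace α] [MeasurableSpace β] {μ : Measure α} {ν : Measure β}

theorem integral_comp_measurePreserving {f : α → β} (hf : MeasurePreserving f μ ν) {g : β → ℝ}
    (hg : AEStronglyMeasurable g ν) : ∫ a, g (f a) ∂μ = ∫ b, g b ∂ν := by
  have h := integral_map hf.measurable.aemeasurable (f := g) (by rwa [hf.map_eq])
  rw [hf.map_eq] at h
  exact h.symm

theorem integrable_prod_of_bound [IsFiniteMeasure μ] [SFinite ν] {f : α × β → ℝ}
    (hf : Measurable f) {b : ℝ} (h : ∀ᵐ a ∂μ, Integrable (fun y => f (a, y)) ν ∧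
      ∫ y, |f (a, y)| ∂ν ≤ b) : Integrable f (μ.prod ν) := by
  rw [integrable_prod_iff hf.aestronglyMeasurable]
  refine ⟨h.mono fun a ha => ha.1, ?_⟩
  refine Integrable.of_bound hf.norm.aestronglyMeasurable.integral_prod_right' b ?_
  filter_upwards [h] with a ha
  rw [Real.norm_of_nonneg (integral_nonneg fun y => norm_nonneg _)]
  exact ha.2

end

/-- The bounds for one location are packaged in `PairMoments` with a second location. A diffuse
probability measure is not supported at one point, so a partner always exists. -/
theorem exists_ne_mem_support {ρ : Measure (Rd d)} [IsProbabilityMeasure ρ]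
    (hρ : ∀ x, ρ {x} = 0) (x : Rd d) : ∃ y ∈ ρ.support, x ≠ y := by
  by_contra! hcon
  have h1 : ρ ρ.support ≤ ρ {x} := measure_mono fun y hy => (hcon y hy).symm
  have h2 : ρ ρ.supportᶜ = 0 := Measure.measure_compl_support
  have h3 := measure_add_measure_compl (μ := ρ) (Measure.isClosed_support (μ := ρ)).measurableSet
  rw [h2, add_zero, measure_univ] at h3
  rw [h3, hρ x] at h1
  simp at h1

section

variable {κ : Rd d → ℝ} {μM : Measure M} [IsProbabilityMeasure μM]
  [IsProbabilityMeasure (densityMeasure κ)] {l : ℝ} {F : (Rd d × M) × Config d M → ℝ}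
  {c : Rd d → ℝ} {b p C : ℝ}

/-- The hypotheses of the variance formula for `∑_{(x, t) ∈ X} c x F ((x, t), X)`. -/
structure VarData (κ : Rd d → ℝ) (μM : Measure M) (l : ℝ) (F : (Rd d × M) × Config d M → ℝ)
    (c : Rd d → ℝ) (b p C : ℝ) : Prop where
  dpos : 0 < d
  lpos : 0 < l
  measF : Measurable F
  idem : ∀ p X, p.1 ∉ Prod.fst '' X.pts → F (p, Config.add p X) = F (p, X)
  measc : Measurable c
  bound : ∀ x, |c x| ≤ b
  two_le : 2 ≤ p
  C_nonneg : 0 ≤ C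
  pm : ∀ x ∈ (densityMeasure κ).support, ∀ y ∈ (densityMeasure κ).support, x ≠ y →
    PairMoments (poissonLaw (modelIntensity κ μM l)) μM F p C x y

theorem VarData.b_nonneg (h : VarData κ μM l F c b p C) : 0 ≤ b :=
  (abs_nonneg _).trans (h.bound 0)

theorem VarData.ae_support (_h : VarData κ μM l F c b p C) :
    ∀ᵐ x ∂(densityMeasure κ), x ∈ (densityMeasure κ).support := by
  rw [ae_iff]
  exact Measure.measure_compl_support

theorem VarData.ae_pair (h : VarData κ μM l F c b p C) :
    ∀ᵐ q ∂((densityMeasure κ).prod (densityMeasure κ)), q.1 ∈ (densityMeasure κ).support ∧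
      q.2 ∈ (densityMeasure κ).support ∧ q.1 ≠ q.2 := by
  have h1 := h.ae_support
  have h2 : ∀ᵐ q ∂((densityMeasure κ).prod (densityMeasure κ)), q.1 ≠ q.2 := by
    have hm : MeasurableSet {q : Rd d × Rd d | q.1 ≠ q.2} :=
      (measurableSet_eq_fun measurable_fst measurable_snd).compl
    refine (Measure.ae_prod_iff_ae_ae hm).2 (Eventually.of_forall fun x => ?_)
    rw [ae_iff]
    convert densityMeasure_singleton (κ := κ) h.dpos x using 2
    ext y
    simp [eq_comm]
  filter_upwards [Measure.quasiMeasurePreserving_fst.ae h1,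
    Measure.quasiMeasurePreserving_snd.ae h1, h2] with q q1 q2 q3
  exact ⟨q1, q2, q3⟩

theorem sq_le_one_add_rpow (w : ℝ) (hp : 2 ≤ p) : w ^ 2 ≤ 1 + |w| ^ p := by
  have h1 := abs_le_one_add_rpow (x := w ^ 2) (r := p / 2) (by linarith)
  rw [abs_of_nonneg (sq_nonneg w)] at h1
  have h2 : (w ^ 2) ^ (p / 2) = |w| ^ p := by
    rw [← sq_abs, ← Real.rpow_natCast, ← Real.rpow_mul (abs_nonneg _)]
    congr 1
    push_cast
    ring
  rwa [h2] at h1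

theorem VarData.sq (h : VarData κ μM l F c b p C) {x : Rd d}
    (hx : x ∈ (densityMeasure κ).support) :
    Integrable (fun ω : Config d M × M => F ((x, ω.2), ω.1) ^ 2)
      ((poissonLaw (modelIntensity κ μM l)).prod μM) ∧
    sqF (poissonLaw (modelIntensity κ μM l)) μM F x ≤ 1 + C := by
  have := isFiniteMeasure_modelIntensity (κ := κ) (μM := μM) l
  have := isProbabilityMeasure_poissonLaw (modelIntensity κ μM l)
  obtain ⟨y, hy, hxy⟩ := exists_ne_mem_support
    (fun x => densityMeasure_singleton (κ := κ) h.dpos x) x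
  have h1 := h.pm x hx y hy hxy
  have h2 : Integrable (fun ω : Config d M × M => F ((x, ω.2), ω.1) ^ 2)
      ((poissonLaw (modelIntensity κ μM l)).prod μM) := by
    refine ((integrable_const (1 : ℝ)).add h1.single).mono'
      ((measurable_single h.measF x).pow_const 2).aestronglyMeasurable
      (Eventually.of_forall fun ω => ?_)
    rw [Real.norm_of_nonneg (sq_nonneg _)]
    exact sq_le_one_add_rpow _ h.two_le
  refine ⟨h2, ?_⟩
  have h3 := integral_add (integrable_const (1 : ℝ)) h1.single
  rw [integral_const, probReal_univ, one_smul] at h3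
  refine (integral_mono h2 ((integrable_const (1 : ℝ)).add h1.single)
    fun ω => sq_le_one_add_rpow _ h.two_le).trans ?_
  have h4 := h1.single_le
  refine (h3.le).trans ?_
  linarith

/-- The summand of the weighted sum. -/
def weighted (c : Rd d → ℝ) (F : (Rd d × M) × Config d M → ℝ) (q : (Rd d × M) × Config d M) : ℝ :=
  c q.1.1 * F q

theorem VarData.measurable_weighted (h : VarData κ μM l F c b p C) : Measurable (weighted c F) :=
  (h.measc.comp (measurable_fst.comp measurable_fst)).mul h.measF

theorem VarData.integrable_diag (h : VarData κ μM l F c b p C) :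
    Integrable (fun r : Rd d × (Config d M × M) => (c r.1 * F ((r.1, r.2.2), r.2.1)) ^ 2)
      ((densityMeasure κ).prod ((poissonLaw (modelIntensity κ μM l)).prod μM)) := by
  have := isFiniteMeasure_modelIntensity (κ := κ) (μM := μM) l
  have := isProbabilityMeasure_poissonLaw (modelIntensity κ μM l)
  have hm : Measurable fun r : Rd d × (Config d M × M) => F ((r.1, r.2.2), r.2.1) :=
    h.measF.comp (by fun_prop)
  refine integrable_prod_of_bound (((h.measc.comp measurable_fst).mul hm).pow_const 2)
    (b := b ^ 2 * (1 + C)) ?_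
  filter_upwards [h.ae_support] with x hx
  obtain ⟨h1, h2⟩ := h.sq hx
  simp only [mul_pow, abs_mul, abs_pow, sq_abs]
  refine ⟨h1.const_mul _, ?_⟩
  rw [integral_const_mul]
  have h3 : c x ^ 2 ≤ b ^ 2 := sq_le_sq' (abs_le.1 (h.bound x)).1 (abs_le.1 (h.bound x)).2
  exact mul_le_mul h3 h2 (integral_nonneg fun _ => sq_nonneg _) (sq_nonneg _)

theorem VarData.mix_bound (h : VarData κ μM l F c b p C) {x y : Rd d}
    (hx : x ∈ (densityMeasure κ).support) (hy : y ∈ (densityMeasure κ).support) (hxy : x ≠ y) :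
    Integrable (fun ω : Config d M × (M × M) => F ((x, ω.2.1), Config.add (y, ω.2.2) ω.1) *
      F ((y, ω.2.2), Config.add (x, ω.2.1) ω.1))
      ((poissonLaw (modelIntensity κ μM l)).prod (μM.prod μM)) ∧
    ∫ ω : Config d M × (M × M), |F ((x, ω.2.1), Config.add (y, ω.2.2) ω.1) *
      F ((y, ω.2.2), Config.add (x, ω.2.1) ω.1)|
      ∂((poissonLaw (modelIntensity κ μM l)).prod (μM.prod μM)) ≤ 1 + 2 * C := by
  have := isFiniteMeasure_modelIntensity (κ := κ) (μM := μM) l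
  have := isProbabilityMeasure_poissonLaw (modelIntensity κ μM l)
  have hr : 1 ≤ p / 2 := by linarith [h.two_le]
  obtain ⟨a1, a2⟩ := (h.pm x hx y hy hxy).mix (h.pm y hy x hx hxy.symm) h.measF
  have hm : Measurable fun ω : Config d M × (M × M) =>
      F ((x, ω.2.1), Config.add (y, ω.2.2) ω.1) * F ((y, ω.2.2), Config.add (x, ω.2.1) ω.1) :=
    (measurable_pair h.measF x y).mul (measurable_pair' h.measF x y)
  refine ⟨integrable_of_rpow hm.aemeasurable hr a1, ?_⟩
  have h3 := abs_integral_le_of_rpow hm.abs hr (by simpa only [abs_abs] using a1)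
    (by simpa only [abs_abs] using a2)
  exact (le_abs_self _).trans h3

theorem VarData.integrable_pair (h : VarData κ μM l F c b p C) :
    Integrable (fun r : (Rd d × Rd d) × (Config d M × (M × M)) => (c r.1.1 * c r.1.2) *
      (F ((r.1.1, r.2.2.1), Config.add (r.1.2, r.2.2.2) r.2.1) *
        F ((r.1.2, r.2.2.2), Config.add (r.1.1, r.2.2.1) r.2.1)))
      (((densityMeasure κ).prod (densityMeasure κ)).prod
        ((poissonLaw (modelIntensity κ μM l)).prod (μM.prod μM))) := by
  have := isFiniteMeasure_modelIntensity (κ := κ) (μM := μM) l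
  have := isProbabilityMeasure_poissonLaw (modelIntensity κ μM l)
  have hc := h.measc
  have e1 : Measurable fun r : (Rd d × Rd d) × (Config d M × (M × M)) =>
      F ((r.1.1, r.2.2.1), Config.add (r.1.2, r.2.2.2) r.2.1) := by
    have a1 : Measurable fun r : (Rd d × Rd d) × (Config d M × (M × M)) =>
        ((r.1.2, r.2.2.2), r.2.1) := by fun_prop
    have a2 : Measurable fun r : (Rd d × Rd d) × (Config d M × (M × M)) =>
        (r.1.1, r.2.2.1) := by fun_prop
    exact h.measF.comp (a2.prodMk (Config.measurable_add.comp a1))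
  have e2 : Measurable fun r : (Rd d × Rd d) × (Config d M × (M × M)) =>
      F ((r.1.2, r.2.2.2), Config.add (r.1.1, r.2.2.1) r.2.1) := by
    have a1 : Measurable fun r : (Rd d × Rd d) × (Config d M × (M × M)) =>
        ((r.1.1, r.2.2.1), r.2.1) := by fun_prop
    have a2 : Measurable fun r : (Rd d × Rd d) × (Config d M × (M × M)) =>
        (r.1.2, r.2.2.2) := by fun_prop
    exact h.measF.comp (a2.prodMk (Config.measurable_add.comp a1))
  have e3 : Measurable fun r : (Rd d × Rd d) × (Config d M × (M × M)) => c r.1.1 * c r.1.2 := by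
    fun_prop
  refine integrable_prod_of_bound (e3.mul (e1.mul e2)) (b := b * b * (1 + 2 * C)) ?_
  filter_upwards [h.ae_pair] with q hq
  obtain ⟨h1, h2⟩ := h.mix_bound hq.1 hq.2.1 hq.2.2
  refine ⟨h1.const_mul _, ?_⟩
  simp only [abs_mul (c q.1 * c q.2)]
  rw [integral_const_mul]
  have h3 : |c q.1 * c q.2| ≤ b * b := by
    rw [abs_mul]
    exact mul_le_mul (h.bound _) (h.bound _) (abs_nonneg _) h.b_nonneg
  exact mul_le_mul h3 h2 (integral_nonneg fun _ => abs_nonneg _)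
    (mul_nonneg h.b_nonneg h.b_nonneg)

theorem VarData.measurable_weighted_pair (h : VarData κ μM l F c b p C) :
    Measurable fun q : (Rd d × M) × (Rd d × M) × Config d M =>
      weighted c F (q.1, Config.add q.2.1 q.2.2) * weighted c F (q.2.1, Config.add q.1 q.2.2) := by
  have a1 : Measurable fun q : (Rd d × M) × (Rd d × M) × Config d M => (q.1, q.2.2) := by fun_prop
  have a2 : Measurable fun q : (Rd d × M) × (Rd d × M) × Config d M => q.2 := by fun_prop
  refine (h.measurable_weighted.comp (measurable_fst.prodMk
    (Config.measurable_add.comp a2))).mul (h.measurable_weighted.comp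
      (Measurable.prodMk (by fun_prop) (Config.measurable_add.comp a1)))

theorem VarData.integrable_pair' (h : VarData κ μM l F c b p C) :
    Integrable (fun r : (Rd d × Rd d) × (Config d M × (M × M)) =>
      weighted c F ((r.1.1, r.2.2.1), Config.add (r.1.2, r.2.2.2) r.2.1) *
        weighted c F ((r.1.2, r.2.2.2), Config.add (r.1.1, r.2.2.1) r.2.1))
      (((densityMeasure κ).prod (densityMeasure κ)).prod
        ((poissonLaw (modelIntensity κ μM l)).prod (μM.prod μM))) := by
  refine h.integrable_pair.congr (Eventually.of_forall fun r => ?_)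
  simp only [weighted]
  ring

theorem smul_prod_eq {β : Type*} [MeasurableSpace β] (Q : Measure β) [SFinite Q] :
    (modelIntensity κ μM l).prod Q = ENNReal.ofReal l • ((densityMeasure κ).prod μM).prod Q := by
  rw [modelIntensity, Measure.prod_smul_left]

theorem smul_prod_prod_eq {β : Type*} [MeasurableSpace β] (Q : Measure β) [SFinite Q] :
    (modelIntensity κ μM l).prod ((modelIntensity κ μM l).prod Q) =
      ENNReal.ofReal l • ENNReal.ofReal l •
        ((densityMeasure κ).prod μM).prod (((densityMeasure κ).prod μM).prod Q) := by
  rw [smul_prod_eq Q, smul_prod_eq, Measure.prod_smul_right]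

theorem VarData.isSquareSummable (h : VarData κ μM l F c b p C) :
    IsSquareSummable (modelIntensity κ μM l) (weighted c F) := by
  have := isFiniteMeasure_modelIntensity (κ := κ) (μM := μM) l
  have := isProbabilityMeasure_poissonLaw (modelIntensity κ μM l)
  have hm := h.measurable_weighted
  refine ⟨hm, fun p X hp => ?_, ?_, ?_⟩
  · rw [weighted, weighted, h.idem p X hp]
  · rw [smul_prod_eq]
    refine Integrable.smul_measure ?_ ENNReal.ofReal_ne_top
    exact ((measurePreserving_rotate _ _ _).integrable_comp
      (hm.pow_const 2).aestronglyMeasurable).1 h.integrable_diag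
  · rw [smul_prod_prod_eq]
    refine (Integrable.smul_measure ?_ ENNReal.ofReal_ne_top).smul_measure ENNReal.ofReal_ne_top
    exact ((measurePreserving_rotate₂ _ _ _).integrable_comp
      h.measurable_weighted_pair.aestronglyMeasurable).1 h.integrable_pair'

theorem VarData.integrable_sqF (h : VarData κ μM l F c b p C) :
    Integrable (fun x => c x ^ 2 * sqF (poissonLaw (modelIntensity κ μM l)) μM F x)
      (densityMeasure κ) := by
  have := isFiniteMeasure_modelIntensity (κ := κ) (μM := μM) l
  have := isProbabilityMeasure_poissonLaw (modelIntensity κ μM l)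
  have h1 := h.integrable_diag.integral_prod_left
  simp only [mul_pow, integral_const_mul] at h1
  exact h1

theorem VarData.integrable_mixF (h : VarData κ μM l F c b p C) :
    Integrable (fun q : Rd d × Rd d => c q.1 * c q.2 *
      mixF (poissonLaw (modelIntensity κ μM l)) μM F q.1 q.2)
      ((densityMeasure κ).prod (densityMeasure κ)) := by
  have := isFiniteMeasure_modelIntensity (κ := κ) (μM := μM) l
  have := isProbabilityMeasure_poissonLaw (modelIntensity κ μM l)
  have h1 := h.integrable_pair.integral_prod_left
  simp only [integral_const_mul] at h1
  exact h1

theorem VarData.integrable_meanF (h : VarData κ μM l F c b p C) :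
    Integrable (fun x => c x * meanF (poissonLaw (modelIntensity κ μM l)) μM F x)
      (densityMeasure κ) := by
  have := isFiniteMeasure_modelIntensity (κ := κ) (μM := μM) l
  have := isProbabilityMeasure_poissonLaw (modelIntensity κ μM l)
  have hm : Measurable fun r : Rd d × (Config d M × M) => c r.1 * F ((r.1, r.2.2), r.2.1) :=
    (h.measc.comp measurable_fst).mul (h.measF.comp (by fun_prop))
  have h0 := ((memLp_two_iff_integrable_sq hm.aestronglyMeasurable).2
    h.integrable_diag).integrable (by norm_num)
  have h1 := h0.integral_prod_left
  simp only [integral_const_mul] at h1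
  exact h1

theorem VarData.integrable_covF (h : VarData κ μM l F c b p C) :
    Integrable (fun q : Rd d × Rd d => c q.1 * c q.2 *
      covF (poissonLaw (modelIntensity κ μM l)) μM F q.1 q.2)
      ((densityMeasure κ).prod (densityMeasure κ)) := by
  refine (h.integrable_mixF.sub (h.integrable_meanF.mul_prod h.integrable_meanF)).congr
    (Eventually.of_forall fun q => ?_)
  simp only [covF, Pi.sub_apply]
  ring

/-- The second moment gives one factor l for the diagonal and l² for pairs; the squared mean is l²
times a double integral of products of means, and subtracting it under the double integral turns
mixed moments into covariances. -/
theorem VarData.variance_eq (h : VarData κ μM l F c b p C) :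
    ProbabilityTheory.variance (fun X => X.sum fun p => weighted c F (p, X)) (poissonLaw (modelIntensity κ μM l)) =
      l * ∫ x, c x ^ 2 * sqF (poissonLaw (modelIntensity κ μM l)) μM F x ∂(densityMeasure κ) +
      l * (l * ∫ x, ∫ y, c x * c y * covF (poissonLaw (modelIntensity κ μM l)) μM F x y
        ∂(densityMeasure κ) ∂(densityMeasure κ)) := by
  have := isFiniteMeasure_modelIntensity (κ := κ) (μM := μM) l
  have := isProbabilityMeasure_poissonLaw (modelIntensity κ μM l)
  have hm := h.measurable_weighted
  rw [h.isSquareSummable.variance (isDiffuse_modelIntensity h.dpos l), smul_prod_prod_eq,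
    smul_prod_eq, integral_smul_measure, integral_smul_measure, integral_smul_measure,
    integral_smul_measure, ENNReal.toReal_ofReal h.lpos.le,
    ← integral_comp_measurePreserving (measurePreserving_rotate _ _ _)
      (hm.pow_const 2).aestronglyMeasurable,
    ← integral_comp_measurePreserving (measurePreserving_rotate _ _ _) hm.aestronglyMeasurable,
    ← integral_comp_measurePreserving (measurePreserving_rotate₂ _ _ _)
      h.measurable_weighted_pair.aestronglyMeasurable]
  have hmm : Measurable fun r : Rd d × (Config d M × M) => c r.1 * F ((r.1, r.2.2), r.2.1) :=
    (h.measc.comp measurable_fst).mul (h.measF.comp (by fun_prop))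
  have h0 := ((memLp_two_iff_integrable_sq hmm.aestronglyMeasurable).2
    h.integrable_diag).integrable (by norm_num)
  have e1 := integral_prod _ h.integrable_diag
  have e2 := integral_prod _ h.integrable_pair
  have e3 := integral_prod _ h0
  simp only [mul_pow, integral_const_mul] at e1 e2 e3
  have e4 : ∀ r : (Rd d × Rd d) × (Config d M × (M × M)),
      weighted c F ((r.1.1, r.2.2.1), Config.add (r.1.2, r.2.2.2) r.2.1) *
        weighted c F ((r.1.2, r.2.2.2), Config.add (r.1.1, r.2.2.1) r.2.1) =
      (c r.1.1 * c r.1.2) * (F ((r.1.1, r.2.2.1), Config.add (r.1.2, r.2.2.2) r.2.1) *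
        F ((r.1.2, r.2.2.2), Config.add (r.1.1, r.2.2.1) r.2.1)) := fun r => by
    simp only [weighted]
    ring
  simp only [e4, e2]
  simp only [weighted, mul_pow, e1, e3, smul_eq_mul]
  have e5 := integral_prod _ h.integrable_covF
  have e6 := integral_sub h.integrable_mixF (h.integrable_meanF.mul_prod h.integrable_meanF)
  rw [integral_prod_mul (μ := densityMeasure κ) (ν := densityMeasure κ)
    (fun x => c x * meanF (poissonLaw (modelIntensity κ μM l)) μM F x)
    (fun x => c x * meanF (poissonLaw (modelIntensity κ μM l)) μM F x)] at e6
  have e7 : ∫ q, c q.1 * c q.2 * covF (poissonLaw (modelIntensity κ μM l)) μM F q.1 q.2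
      ∂((densityMeasure κ).prod (densityMeasure κ)) =
      ∫ q, c q.1 * c q.2 * mixF (poissonLaw (modelIntensity κ μM l)) μM F q.1 q.2
        ∂((densityMeasure κ).prod (densityMeasure κ)) -
      (∫ x, c x * meanF (poissonLaw (modelIntensity κ μM l)) μM F x ∂(densityMeasure κ)) *
      ∫ x, c x * meanF (poissonLaw (modelIntensity κ μM l)) μM F x ∂(densityMeasure κ) := by
    rw [← e6]
    refine integral_congr_ae (Eventually.of_forall fun q => ?_)
    simp only [covF]
    ring
  rw [← e5, e7]
  simp only [sqF, mixF, meanF]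
  ring

/-! ### Change of variables -/

theorem integral_densityMeasure (hκ : Measurable κ) (hκ0 : ∀ x, 0 ≤ κ x) (g : Rd d → ℝ) :
    ∫ x, g x ∂(densityMeasure κ) = ∫ x, κ x * g x := by
  rw [densityMeasure, integral_withDensity_eq_integral_toReal_smul hκ.ennreal_ofReal
    (Eventually.of_forall fun x => ENNReal.ofReal_lt_top)]
  simp only [ENNReal.toReal_ofReal (hκ0 _), smul_eq_mul]

theorem integrable_densityMeasure (hκ : Measurable κ) (hκ0 : ∀ x, 0 ≤ κ x) (g : Rd d → ℝ) :
    Integrable g (densityMeasure κ) ↔ Integrable fun x => κ x * g x := by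
  rw [densityMeasure, integrable_withDensity_iff_integrable_smul' hκ.ennreal_ofReal
    (Eventually.of_forall fun x => ENNReal.ofReal_lt_top)]
  simp only [ENNReal.toReal_ofReal (hκ0 _), smul_eq_mul]

theorem dil_pow (hd : 0 < d) (hl : 0 ≤ l) : dil d l ^ d = l := by
  rw [dil, ← Real.rpow_natCast, ← Real.rpow_mul hl]
  have : (d : ℝ) ≠ 0 := by positivity
  rw [one_div, inv_mul_cancel₀ this, Real.rpow_one]

theorem integral_comp_dil (hd : 0 < d) (hl : 0 < l) (x : Rd d) (u : Rd d → ℝ) :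
    ∫ z, u (x + (dil d l)⁻¹ • z) = l * ∫ y, u y := by
  have h1 := Measure.integral_comp_smul (volume : Measure (Rd d)) (fun w => u (x + w)) (dil d l)⁻¹
  rw [h1, integral_add_left_eq_self, finrank_euclideanSpace_fin, inv_pow, inv_inv,
    dil_pow hd hl.le, abs_of_pos hl, smul_eq_mul]

/-- The integrand of the rescaled variance. -/
def varIntegrand (κ : Rd d → ℝ) (μM : Measure M) (l : ℝ) (F : (Rd d × M) × Config d M → ℝ)
    (c : Rd d → ℝ) (x : Rd d) : ℝ :=
  c x ^ 2 * sqF (poissonLaw (modelIntensity κ μM l)) μM F x +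
    ∫ z, κ (x + (dil d l)⁻¹ • z) * (c x * c (x + (dil d l)⁻¹ • z) *
      covF (poissonLaw (modelIntensity κ μM l)) μM F x (x + (dil d l)⁻¹ • z))

/-- The second factor l in front of the double integral is the Jacobian of y = x + l^(-1/d) z. -/
theorem VarData.integrable_varIntegrand (h : VarData κ μM l F c b p C) (hκ : Measurable κ)
    (hκ0 : ∀ x, 0 ≤ κ x) : Integrable (varIntegrand κ μM l F c) (densityMeasure κ) ∧
      l⁻¹ * ProbabilityTheory.variance (fun X => X.sum fun p => weighted c F (p, X))
        (poissonLaw (modelIntensity κ μM l)) = ∫ x, varIntegrand κ μM l F c x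
          ∂(densityMeasure κ) := by
  have h1 : ∀ x, ∫ z, κ (x + (dil d l)⁻¹ • z) * (c x * c (x + (dil d l)⁻¹ • z) *
      covF (poissonLaw (modelIntensity κ μM l)) μM F x (x + (dil d l)⁻¹ • z)) =
      l * ∫ y, c x * c y * covF (poissonLaw (modelIntensity κ μM l)) μM F x y
        ∂(densityMeasure κ) := by
    intro x
    rw [integral_densityMeasure hκ hκ0]
    exact integral_comp_dil h.dpos h.lpos x (fun y => κ y * (c x * c y *
      covF (poissonLaw (modelIntensity κ μM l)) μM F x y))
  have h2 := h.integrable_covF.integral_prod_left.const_mul l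
  unfold varIntegrand
  simp only [h1]
  refine ⟨h.integrable_sqF.add h2, ?_⟩
  rw [integral_add h.integrable_sqF h2, h.variance_eq, integral_const_mul]
  have := h.lpos.ne'
  field_simp

end

end

section

variable {d : ℕ} {M : Type*} [MeasurableSpace M]

/-! ### Decay of the covariances -/

section

variable {κ : Rd d → ℝ} {μM : Measure M} [IsProbabilityMeasure μM]
  [IsProbabilityMeasure (densityMeasure κ)] {ξ : Functional d M} {Γ : ℝ → Set (Rd d)} {p q C : ℝ}

/-- Take the radius r proportional to 1 + ‖z‖ and small enough that the two balls are disjoint. Then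
both radii of stabilization are at most r except with probability of order r^(-q), and the moments
of order p/2 of the product turn this into a covariance of order r^(-q(1 - 2/p)). -/
theorem exists_cov_decay (hd : 0 < d) (hξ : IsMeasureFunctional ξ)
    (hΓ : ∀ l : ℝ, 1 ≤ l → MeasurableSet (Γ l)) {φ : Rd d → ℝ} (hφ : Measurable φ) {b : ℝ}
    (hb : ∀ z, |φ z| ≤ b) (hp : 2 < p) (hC : 0 ≤ C)
    (hpm : ∀ l, 1 ≤ l → ∀ x ∈ (densityMeasure κ).support, ∀ y ∈ (densityMeasure κ).support,
      x ≠ y → PairMoments (poissonLaw (modelIntensity κ μM l)) μM (scF ξ Γ φ l) p C x y)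
    (hq : d * p / (p - 2) < q)
    (hpow : IsPowerLawStabilizing ξ μM Γ (densityMeasure κ).support
      (fun l => poissonLaw (modelIntensity κ μM l)) q) :
    ∃ D s : ℝ, 0 ≤ D ∧ (d : ℝ) < s ∧ ∀ l, 1 ≤ l → ∀ x ∈ (densityMeasure κ).support,
      ∀ z : Rd d, z ≠ 0 → x + (dil d l)⁻¹ • z ∈ (densityMeasure κ).support →
      |covF (poissonLaw (modelIntensity κ μM l)) μM (scF ξ Γ φ l) x (x + (dil d l)⁻¹ • z)| ≤
        D * (1 + ‖z‖) ^ (-s) := by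
  obtain ⟨K, hK, htail⟩ := exists_tail_bound hpow
  set e := 1 - (p / 2)⁻¹ with he
  have he' : e = (p - 2) / p := by
    rw [he]
    field_simp
  have he0 : 0 < e := by
    rw [he']
    exact div_pos (by linarith) (by linarith)
  -- This is the condition on q: the decay rate s = q (p - 2)/p exceeds the dimension, so the bound
  -- is integrable in z.
  have hs : (d : ℝ) < q * e := by
    rw [he', ← div_lt_iff₀ (div_pos (by linarith) (by linarith)), div_div_eq_mul_div]
    exact hq
  have hs0 : 0 < q * e := lt_of_le_of_lt (Nat.cast_nonneg d) hs
  -- The factor 6^s comes from the radius (1 + ‖z‖)/6, the term (2K)^e from the tail bound at that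
  -- radius, and the summand 1 covers small z with the crude bound.
  refine ⟨2 * (1 + 2 * C) * ((2 * K) ^ e + 1) * 6 ^ (q * e), q * e, by positivity, hs,
    fun l hl x hx z hz hy => ?_⟩
  have hl0 : 0 < l := by linarith
  have := isFiniteMeasure_modelIntensity (κ := κ) (μM := μM) l
  have := isProbabilityMeasure_poissonLaw (modelIntensity κ μM l)
  have hF := measurable_scF hξ hφ hb hl0 (hΓ l hl)
  have hdil := dil_pos (d := d) hl0
  have hxy : x ≠ x + (dil d l)⁻¹ • z := by
    rw [ne_eq, left_eq_add, smul_eq_zero]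
    push Not
    exact ⟨(inv_pos.2 hdil).ne', hz⟩
  have h1 := hpm l hl x hx _ hy hxy
  have h2 := hpm l hl _ hy x hx hxy.symm
  have hz0 : 0 < 1 + ‖z‖ := by positivity
  have h6 : ((6 : ℝ) ^ (q * e)) * (1 + ‖z‖) ^ (-(q * e)) = ((1 + ‖z‖) / 6) ^ (-(q * e)) := by
    rw [Real.div_rpow hz0.le (by norm_num), Real.rpow_neg (by norm_num : (0 : ℝ) ≤ 6), div_inv_eq_mul,
      mul_comm]
  rw [mul_assoc, h6]
  -- For ‖z‖ ≥ 5 the radius (1 + ‖z‖)/6 is at least 1, as the tail bound requires, and twice the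
  -- radius is less than ‖z‖. For smaller z it is below 1, so its power of exponent -s is at least 1
  -- and the crude bound suffices.
  by_cases hzz : 5 ≤ ‖z‖
  · have hr1 : 1 ≤ (1 + ‖z‖) / 6 := by linarith
    have hr0 : 0 < (1 + ‖z‖) / 6 := by linarith
    have h3 := abs_cov_scF_le hl0 hF (isDiffuse_modelIntensity (κ := κ) (μM := μM) hd l)
      Measure.isClosed_support.measurableSet (modelIntensity_compl_support l) hp.le hC hx hy h1 h2
      (r := (1 + ‖z‖) / 6) (n := K * ((1 + ‖z‖) / 6) ^ (-q)) hr0.le (by positivity) (by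
        rw [add_sub_cancel_left, norm_smul, Real.norm_of_nonneg (inv_pos.2 hdil).le,
          mul_left_comm]
        exact mul_lt_mul_of_pos_left (by linarith) (inv_pos.2 hdil))
      (fun w hw => htail _ hr1 l hl w hw)
    refine h3.trans ?_
    rw [← he, ← mul_assoc 2 K, Real.mul_rpow (by positivity) (by positivity), ← Real.rpow_mul hr0.le,
      neg_mul, ← mul_assoc]
    refine mul_le_mul_of_nonneg_right (mul_le_mul_of_nonneg_left (by linarith) (by positivity))
      (by positivity)
  · have h3 := h1.abs_le hp.le h2 hF
    refine h3.trans ?_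
    have h4 : 1 ≤ ((1 + ‖z‖) / 6) ^ (-(q * e)) := by
      refine Real.one_le_rpow_of_pos_of_le_one_of_nonpos (by positivity) ?_ (by linarith)
      linarith
    have h5 : 0 ≤ (2 * K) ^ e := by positivity
    have h7 : 1 ≤ (2 * K) ^ e + 1 := by linarith
    have h8 : 0 ≤ 2 * (1 + 2 * C) := by positivity
    calc 2 * (1 + 2 * C) = 2 * (1 + 2 * C) * 1 * 1 := by ring
      _ ≤ _ := by gcongr

theorem integrable_one_add_norm_rpow {s : ℝ} (hs : (d : ℝ) < s) :
    Integrable fun z : Rd d => (1 + ‖z‖) ^ (-s) :=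
  integrable_one_add_norm (by rwa [finrank_euclideanSpace_fin])

end

end

section

variable {d : ℕ} {M : Type*} [MeasurableSpace M]

/-! ### Local convergence of the rescaled Poisson processes -/

/-- Both intensities lie below ν' and miss at most η of its mass. The comparison for ν₁ is applied
to G and the one for ν₂ to 1 - G; the integral against ν' is eliminated between them, leaving the
error exp(η) - 1. -/
theorem lintegral_poissonLaw_le_add {ν₁ ν₂ ν' : Measure (Rd d × M)} [IsFiniteMeasure ν₁]
    [IsFiniteMeasure ν₂] [IsFiniteMeasure ν'] (h₁ : ν₁ ≤ ν') (h₂ : ν₂ ≤ ν') {η : ℝ}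
    (hη₁ : ν'.real Set.univ - ν₁.real Set.univ ≤ η)
    (hη₂ : ν'.real Set.univ - ν₂.real Set.univ ≤ η) {G : Config d M → ℝ≥0∞} (hG : Measurable G)
    (hG1 : ∀ X, G X ≤ 1) : ∫⁻ X, G X ∂(poissonLaw ν₁) ≤ ∫⁻ X, G X ∂(poissonLaw ν₂) +
      ENNReal.ofReal (Real.exp η - 1) := by
  have := isProbabilityMeasure_poissonLaw ν₁
  have := isProbabilityMeasure_poissonLaw ν₂
  have := isProbabilityMeasure_poissonLaw ν'
  have hle : ∀ (Q : Measure (Config d M)) [IsProbabilityMeasure Q], ∫⁻ X, G X ∂Q ≤ 1 :=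
    fun Q _ => (lintegral_mono hG1).trans (by simp)
  have hfin : ∀ (Q : Measure (Config d M)) [IsProbabilityMeasure Q], ∫⁻ X, G X ∂Q ≠ ∞ :=
    fun Q _ => ((hle Q).trans_lt ENNReal.one_lt_top).ne
  have hsub : ∀ (Q : Measure (Config d M)) [IsProbabilityMeasure Q],
      ∫⁻ X, (1 - G X) ∂Q = ENNReal.ofReal (1 - (∫⁻ X, G X ∂Q).toReal) := fun Q _ => by
    rw [lintegral_sub hG (hfin Q) (Eventually.of_forall hG1), lintegral_one, measure_univ,
      ENNReal.ofReal_sub _ ENNReal.toReal_nonneg, ENNReal.ofReal_toReal (hfin Q),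
      ENNReal.ofReal_one]
  have hR1 : ∀ (Q : Measure (Config d M)) [IsProbabilityMeasure Q],
      (∫⁻ X, G X ∂Q).toReal ≤ 1 := fun Q _ => by
    simpa using ENNReal.toReal_mono ENNReal.one_ne_top (hle Q)
  have a1 := poissonLaw_le h₁ hG
  have a2 := poissonLaw_le h₂ (G := fun X => 1 - G X) (measurable_const.sub hG)
  rw [hsub, hsub, ← ENNReal.ofReal_mul (Real.exp_pos _).le, ENNReal.ofReal_le_ofReal_iff
    (mul_nonneg (Real.exp_pos _).le (by linarith [hR1 (poissonLaw ν')]))] at a2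
  rw [← ENNReal.ofReal_toReal (hfin (poissonLaw ν₁)), ← ENNReal.ofReal_toReal
    (hfin (poissonLaw ν')), ← ENNReal.ofReal_mul (Real.exp_pos _).le,
    ENNReal.ofReal_le_ofReal_iff (by positivity)] at a1
  have e1 := Real.exp_le_exp.2 hη₁
  have e2 := Real.exp_le_exp.2 hη₂
  have b1 := mul_le_mul_of_nonneg_right e1
    (ENNReal.toReal_nonneg (a := ∫⁻ X, G X ∂(poissonLaw ν')))
  have b2 := mul_le_mul_of_nonneg_right e2
    (show 0 ≤ 1 - (∫⁻ X, G X ∂(poissonLaw ν')).toReal by linarith [hR1 (poissonLaw ν')])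
  have hη0 : 0 ≤ η := by
    refine le_trans ?_ hη₁
    rw [sub_nonneg]
    exact ENNReal.toReal_mono (measure_ne_top _ _) (h₁ _)
  have hexp : 0 ≤ Real.exp η - 1 := by linarith [Real.one_le_exp hη0]
  rw [← ENNReal.ofReal_toReal (hfin (poissonLaw ν₁)), ← ENNReal.ofReal_toReal
    (hfin (poissonLaw ν₂)), ← ENNReal.ofReal_add ENNReal.toReal_nonneg hexp]
  exact ENNReal.ofReal_le_ofReal (by linarith)

theorem lintegral_comp_dil (hd : 0 < d) {l : ℝ} (hl : 0 < l) (x : Rd d) {u : Rd d → ℝ≥0∞}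
    (hu : Measurable u) : ∫⁻ z, u (x + (dil d l)⁻¹ • z) = ENNReal.ofReal l * ∫⁻ y, u y := by
  have hD := dil_pos (d := d) hl
  have h1 := Measure.map_addHaar_smul (volume : Measure (Rd d)) (inv_pos.2 hD).ne'
  rw [← lintegral_map (f := fun w => u (x + w)) (hu.comp (measurable_const_add x))
    (measurable_const_smul _), h1, lintegral_smul_measure, lintegral_add_left_eq_self u,
    finrank_euclideanSpace_fin, inv_pow, inv_inv, dil_pow hd hl.le, abs_of_pos hl, smul_eq_mul]

/-- The intensity measure of the rescaled process. -/
def localIntensity (κ : Rd d → ℝ) (μM : Measure M) (l : ℝ) (x : Rd d) : Measure (Rd d × M) :=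
  (volume.withDensity fun z => ENNReal.ofReal (κ (x + (dil d l)⁻¹ • z))).prod μM

/-- The intensity measure of a homogeneous process in a set `B`. -/
def homIntensity (μM : Measure M) (a : ℝ) (B : Set (Rd d)) : Measure (Rd d × M) :=
  (ENNReal.ofReal a • (volume.restrict B)).prod μM

/-! ### Intensities near a point. -/

section

variable {κ : Rd d → ℝ} {μM : Measure M} [IsProbabilityMeasure μM]

/-- The factor l is cancelled by the Jacobian of the magnification, which leaves the density κ(x +
l^(-1/d) z). -/
theorem modelIntensity_map [IsProbabilityMeasure (densityMeasure κ)] (hd : 0 < d)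
    (hκ : Measurable κ) {l : ℝ} (hl : 0 < l) (x : Rd d) :
    (modelIntensity κ μM l).map (affPt (-(dil d l • x)) (dil d l)) = localIntensity κ μM l x := by
  have hD := dil_pos (d := d) hl
  set f : Rd d → Rd d := fun u => -(dil d l • x) + dil d l • u with hf
  have hfm : Measurable f := by fun_prop
  have h1 : (affPt (-(dil d l • x)) (dil d l) : Rd d × M → Rd d × M) = Prod.map f id := rfl
  have h2 : (ENNReal.ofReal l • densityMeasure κ).map f =
      volume.withDensity fun z => ENNReal.ofReal (κ (x + (dil d l)⁻¹ • z)) := by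
    refine Measure.ext fun A hA => ?_
    have hκ' : Measurable fun u => ENNReal.ofReal (κ u) := hκ.ennreal_ofReal
    have h3 := lintegral_comp_dil hd hl x
      (u := fun u => (f ⁻¹' A).indicator (fun u => ENNReal.ofReal (κ u)) u)
      (hκ'.indicator (hfm hA))
    rw [lintegral_indicator (hfm hA)] at h3
    rw [Measure.map_apply hfm hA, Measure.smul_apply, densityMeasure, withDensity_apply _ (hfm hA),
      smul_eq_mul, ← h3, withDensity_apply _ hA, ← lintegral_indicator hA]
    refine lintegral_congr fun z => ?_
    have h4 : f (x + (dil d l)⁻¹ • z) = z := by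
      simp only [hf, smul_add, smul_inv_smul₀ hD.ne', neg_add_cancel_left]
    by_cases hz : z ∈ A
    · rw [Set.indicator_of_mem (show _ ∈ f ⁻¹' A by rwa [Set.mem_preimage, h4]),
        Set.indicator_of_mem hz]
    · rw [Set.indicator_of_notMem (show _ ∉ f ⁻¹' A by rwa [Set.mem_preimage, h4]),
        Set.indicator_of_notMem hz]
  have : IsFiniteMeasure (ENNReal.ofReal l • densityMeasure κ) :=
    Measure.smul_finite _ ENNReal.ofReal_ne_top
  rw [modelIntensity, ← Measure.prod_smul_left, h1, localIntensity, ← h2]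
  conv_rhs => rw [← Measure.map_id (μ := μM)]
  exact (Measure.map_prod_map _ _ hfm measurable_id).symm

theorem isDiffuse_prod (hd : 0 < d) {ρ : Measure (Rd d)} (hρ : ρ ≪ volume) :
    IsDiffuse (ρ.prod μM) := by
  intro x
  have : Nonempty (Fin d) := ⟨⟨0, hd⟩⟩
  rw [Measure.prod_prod, hρ (measure_singleton x), zero_mul]

theorem isFiniteMeasure_homIntensity (a : ℝ) {B : Set (Rd d)} (hB : volume B < ∞) :
    IsFiniteMeasure (homIntensity μM a B) := by
  refine ⟨?_⟩
  rw [homIntensity, ← Set.univ_prod_univ, Measure.prod_prod, Measure.smul_apply,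
    Measure.restrict_apply_univ, measure_univ, mul_one]
  exact ENNReal.mul_lt_top ENNReal.ofReal_lt_top hB

theorem homIntensity_real {a : ℝ} (ha : 0 ≤ a) (B : Set (Rd d)) :
    (homIntensity μM a B).real Set.univ = a * volume.real B := by
  rw [measureReal_def, homIntensity, ← Set.univ_prod_univ, Measure.prod_prod, Measure.smul_apply,
    Measure.restrict_apply_univ, measure_univ, mul_one, smul_eq_mul, ENNReal.toReal_mul,
    ENNReal.toReal_ofReal ha, measureReal_def]

theorem isDiffuse_homIntensity (hd : 0 < d) (a : ℝ) (B : Set (Rd d)) :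
    IsDiffuse (homIntensity μM a B) :=
  isDiffuse_prod hd (Measure.smul_absolutelyContinuous.trans Measure.restrict_le_self.absolutelyContinuous)

theorem homIntensity_eq (a : ℝ) (B : Set (Rd d)) :
    (ENNReal.ofReal a • (volume : Measure (Rd d)).prod μM).restrict (B ×ˢ Set.univ) =
      homIntensity μM a B := by
  rw [homIntensity, Measure.prod_smul_left, Measure.restrict_smul, ← Measure.prod_restrict,
    Measure.restrict_univ]

theorem localIntensity_restrict {l : ℝ} (x : Rd d) {B : Set (Rd d)} (hB : MeasurableSet B) :
    (localIntensity κ μM l x).restrict (B ×ˢ Set.univ) = ((volume.restrict B).withDensity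
      fun z => ENNReal.ofReal (κ (x + (dil d l)⁻¹ • z))).prod μM := by
  rw [localIntensity, ← Measure.prod_restrict, Measure.restrict_univ, restrict_withDensity hB]

theorem localIntensity_restrict_le {l : ℝ} {x : Rd d} {B : Set (Rd d)} (hB : MeasurableSet B)
    {a : ℝ} (h : ∀ z ∈ B, κ (x + (dil d l)⁻¹ • z) ≤ a) :
    (localIntensity κ μM l x).restrict (B ×ˢ Set.univ) ≤ homIntensity μM a B := by
  rw [localIntensity_restrict x hB, homIntensity]
  refine Measure.prod_mono ?_ le_rfl
  rw [← withDensity_const]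
  refine withDensity_mono ?_
  filter_upwards [ae_restrict_mem hB] with z hz using ENNReal.ofReal_le_ofReal (h z hz)

theorem homIntensity_le_localIntensity {l : ℝ} {x : Rd d} {B : Set (Rd d)} (hB : MeasurableSet B)
    {a : ℝ} (h : ∀ z ∈ B, a ≤ κ (x + (dil d l)⁻¹ • z)) :
    homIntensity μM a B ≤ (localIntensity κ μM l x).restrict (B ×ˢ Set.univ) := by
  rw [localIntensity_restrict x hB, homIntensity]
  refine Measure.prod_mono ?_ le_rfl
  rw [← withDensity_const]
  refine withDensity_mono ?_
  filter_upwards [ae_restrict_mem hB] with z hz using ENNReal.ofReal_le_ofReal (h z hz)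

/-- The homogeneous process has infinite intensity and no law of the form `poissonLaw`, but its
restriction to a bounded set has; almost sure statements about it are reduced to such restrictions.
-/
theorem IsPoissonLaw.map_restr_homogeneous (hd : 0 < d) {Q : Measure (Config d M)} {a : ℝ}
    (hQ : IsPoissonLaw Q (ENNReal.ofReal a • (volume : Measure (Rd d)).prod μM)) {B : Set (Rd d)}
    (hB : MeasurableSet B) (hBv : volume B < ∞) :
    Q.map (Config.restr B) = poissonLaw (homIntensity μM a B) := by
  have := hQ.prob
  have hfin : IsBallFinite (ENNReal.ofReal a • (volume : Measure (Rd d)).prod μM) := fun n => by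
    rw [Measure.smul_apply, Measure.prod_prod, measure_univ, mul_one]
    exact ENNReal.mul_lt_top ENNReal.ofReal_lt_top measure_closedBall_lt_top
  have := isFiniteMeasure_homIntensity (μM := μM) a hBv
  have : IsProbabilityMeasure (Q.map (Config.restr B)) :=
    Measure.isProbabilityMeasure_map (Config.measurable_restr hB).aemeasurable
  have h1 := (hQ.hasPoissonCF hfin).map_restr hB
  rw [homIntensity_eq] at h1
  exact h1.eq_poissonLaw (isDiffuse_homIntensity hd _ _)

variable [IsProbabilityMeasure (densityMeasure κ)]

theorem isFiniteMeasure_localIntensity (hd : 0 < d) (hκ : Measurable κ) {l : ℝ} (hl : 0 < l)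
    (x : Rd d) : IsFiniteMeasure (localIntensity κ μM l x) := by
  have := isFiniteMeasure_modelIntensity (κ := κ) (μM := μM) l
  rw [← modelIntensity_map hd hκ hl]
  infer_instance

theorem map_blow_poissonLaw (hd : 0 < d) (hκ : Measurable κ) {l : ℝ} (hl : 0 < l) (x : Rd d) :
    (poissonLaw (modelIntensity κ μM l)).map (blow l x) = poissonLaw (localIntensity κ μM l x) := by
  have := isFiniteMeasure_modelIntensity (κ := κ) (μM := μM) l
  have := isProbabilityMeasure_poissonLaw (modelIntensity κ μM l)
  have := isFiniteMeasure_localIntensity (μM := μM) hd hκ hl x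
  have h1 := (hasPoissonCF_poissonLaw (isDiffuse_modelIntensity (κ := κ) (μM := μM) hd l)).map_aff
    (-(dil d l • x)) (dil_pos (d := d) hl).ne'
  rw [modelIntensity_map hd hκ hl] at h1
  have : IsProbabilityMeasure ((poissonLaw (modelIntensity κ μM l)).map (blow l x)) :=
    Measure.isProbabilityMeasure_map ((measurable_blow hl).comp measurable_prodMk_left).aemeasurable
  exact HasPoissonCF.eq_poissonLaw (isDiffuse_prod hd (withDensity_absolutelyContinuous _ _)) h1

/-- On a fixed ball of magnified coordinates the density is within δ of κ(x), by continuity. The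
rescaled and the homogeneous intensity thus both lie below the constant κ(x) + δ, with a small
defect of mass. -/
theorem locallyTV_blow (hd : 0 < d) (hκ : Measurable κ) {x : Rd d} (hx : 0 < κ x)
    (hcont : ContinuousAt κ x) {Q : Measure (Config d M)}
    (hQ : IsPoissonLaw Q (ENNReal.ofReal (κ x) • (volume : Measure (Rd d)).prod μM))
    {l : ℕ → ℝ} (hl : ∀ k, 0 < l k) (hlim : Tendsto (fun k => (dil d (l k))⁻¹) atTop (𝓝 0))
    {y : ℕ → Rd d} (hy : Tendsto y atTop (𝓝 x)) :
    LocallyTV (fun k => (poissonLaw (modelIntensity κ μM (l k))).map (blow (l k) (y k))) Q := by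
  have hfin := fun k => isFiniteMeasure_localIntensity (μM := μM) hd hκ (hl k) (y k)
  have hdiff : ∀ k, IsDiffuse (localIntensity κ μM (l k) (y k)) := fun k =>
    isDiffuse_prod hd (withDensity_absolutelyContinuous _ _)
  have hvol : ∀ K : ℕ, volume (Metric.closedBall (0 : Rd d) K) < ∞ := fun K =>
    measure_closedBall_lt_top
  have hmeas : ∀ K : ℕ, MeasurableSet (Metric.closedBall (0 : Rd d) K) := fun K =>
    measurableSet_closedBall
  simp only [fun k => map_blow_poissonLaw (μM := μM) hd hκ (hl k) (y k)]
  refine ⟨fun k => isProbabilityMeasure_poissonLaw _, hQ.prob, fun k =>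
    ae_simpleConfigs_poissonLaw _, ?_, fun k K => map_hyb_poissonLaw (hdiff k) (hmeas K), ?_⟩
  · rw [ae_all_iff]
    intro K
    have h1 := ae_simpleConfigs_poissonLaw (homIntensity μM (κ x)
      (Metric.closedBall (0 : Rd d) (K : ℝ)))
    rw [← hQ.map_restr_homogeneous hd (hmeas K) (hvol K)] at h1
    exact ae_of_ae_map (Config.measurable_restr (hmeas K)).aemeasurable h1
  · intro K ε hε
    set B := Metric.closedBall (0 : Rd d) (K : ℝ) with hB
    obtain ⟨η, hη0, hη⟩ : ∃ η : ℝ, 0 < η ∧ ENNReal.ofReal (Real.exp η - 1) ≤ ε := by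
      have h1 : Tendsto (fun η : ℝ => ENNReal.ofReal (Real.exp η - 1)) (𝓝[>] 0) (𝓝 0) := by
        have h2 : ContinuousAt (fun η : ℝ => ENNReal.ofReal (Real.exp η - 1)) 0 :=
          (ENNReal.continuous_ofReal.comp (Real.continuous_exp.sub continuous_const)).continuousAt
        have h3 := h2.tendsto
        simp only [Real.exp_zero, sub_self, ENNReal.ofReal_zero] at h3
        exact h3.mono_left nhdsWithin_le_nhds
      obtain ⟨η, h2, h3⟩ := ((h1.eventually (gt_mem_nhds hε)).and self_mem_nhdsWithin).exists
      exact ⟨η, h3, h2.le⟩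
    set v := volume.real B with hv
    have hv0 : 0 ≤ v := measureReal_nonneg
    -- δ ≤ κ(x) keeps the lower density κ(x) - δ nonnegative, and 2δv ≤ η bounds the defect of mass
    -- of either intensity below κ(x) + δ.
    set δ := min (κ x) (η / (2 * (v + 1))) with hδ
    have hδ0 : 0 < δ := lt_min hx (by positivity)
    have hδκ : δ ≤ κ x := min_le_left _ _
    have hδv : 2 * δ * v ≤ η := by
      have h1 : δ ≤ η / (2 * (v + 1)) := min_le_right _ _
      rw [le_div_iff₀ (by positivity)] at h1
      nlinarith
    obtain ⟨ρ, hρ0, hρ⟩ := Metric.continuousAt_iff.1 hcont δ hδ0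
    have h2 : Tendsto (fun k => (dil d (l k))⁻¹ * K + dist (y k) x) atTop (𝓝 0) := by
      simpa using (hlim.mul_const (K : ℝ)).add (tendsto_iff_dist_tendsto_zero.1 hy)
    filter_upwards [h2.eventually (gt_mem_nhds hρ0)] with k hk G hG hG1
    have hz : ∀ z ∈ B, |κ (y k + (dil d (l k))⁻¹ • z) - κ x| < δ := fun z hz => by
      rw [← Real.dist_eq]
      refine hρ ?_
      refine lt_of_le_of_lt (dist_triangle _ (y k) _) (lt_of_le_of_lt ?_ hk)
      rw [dist_self_add_left, norm_smul, Real.norm_of_nonneg (inv_pos.2 (dil_pos (hl k))).le]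
      refine add_le_add_left ?_ _
      rw [hB, mem_closedBall_zero_iff] at hz
      exact mul_le_mul_of_nonneg_left hz (inv_pos.2 (dil_pos (hl k))).le
    have hfk := hfin k
    have hBm : MeasurableSet B := hmeas K
    have i1 := isFiniteMeasure_homIntensity (μM := μM) (κ x) (hvol K)
    have i2 := isFiniteMeasure_homIntensity (μM := μM) (κ x + δ) (hvol K)
    have i3 := isFiniteMeasure_homIntensity (μM := μM) (κ x - δ) (hvol K)
    have i4 : IsFiniteMeasure ((localIntensity κ μM (l k) (y k)).restrict (B ×ˢ Set.univ)) :=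
      inferInstance
    have hle₁ : (localIntensity κ μM (l k) (y k)).restrict (B ×ˢ Set.univ) ≤
        homIntensity μM (κ x + δ) B :=
      localIntensity_restrict_le hBm fun z hzB => by linarith [(abs_lt.1 (hz z hzB)).2]
    have hle₃ : homIntensity μM (κ x - δ) B ≤
        (localIntensity κ μM (l k) (y k)).restrict (B ×ˢ Set.univ) :=
      homIntensity_le_localIntensity hBm fun z hzB => by linarith [(abs_lt.1 (hz z hzB)).1]
    have hle₂ : homIntensity μM (κ x) B ≤ homIntensity μM (κ x + δ) B := by
      rw [homIntensity, homIntensity]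
      refine Measure.prod_mono ?_ le_rfl
      gcongr
      linarith
    have hm3 : (homIntensity μM (κ x - δ) B).real Set.univ ≤
        ((localIntensity κ μM (l k) (y k)).restrict (B ×ˢ Set.univ)).real Set.univ :=
      ENNReal.toReal_mono (measure_ne_top _ _) (hle₃ _)
    rw [homIntensity_real (by linarith)] at hm3
    have h5 := lintegral_poissonLaw_le_add hle₁ hle₂ (η := η)
      (by rw [homIntensity_real (by linarith)]; nlinarith)
      (by rw [homIntensity_real (by linarith), homIntensity_real hx.le]; nlinarith) hG hG1
    have hr := Config.measurable_restr (M := M) hBm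
    have e1 : (poissonLaw (localIntensity κ μM (l k) (y k))).map (Config.restr B) =
        poissonLaw ((localIntensity κ μM (l k) (y k)).restrict (B ×ˢ Set.univ)) := by
      have := isProbabilityMeasure_poissonLaw (localIntensity κ μM (l k) (y k))
      have : IsProbabilityMeasure
          ((poissonLaw (localIntensity κ μM (l k) (y k))).map (Config.restr B)) :=
        Measure.isProbabilityMeasure_map hr.aemeasurable
      exact ((hasPoissonCF_poissonLaw (hdiff k)).map_restr hBm).eq_poissonLaw
        ((hdiff k).restrict _)
    rw [← lintegral_map hG hr, ← lintegral_map hG hr, e1,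
      hQ.map_restr_homogeneous hd hBm (hvol K)]
    exact h5.trans (by gcongr)

end

end

section

variable {d : ℕ} {M : Type*}

/-! ### Continuity of the functional along sequences -/

theorem Config.aff_neg_aff (y : Rd d) (V : Config d M) :
    Config.aff (-y) 1 (Config.aff y 1 V) = V := by
  refine Config.ext ?_
  rw [Config.pts_aff _ one_ne_zero, Config.pts_aff _ one_ne_zero, act_act, one_smul, one_mul,
    neg_add_cancel, act_zero_one]

variable [MeasurableSpace M]

theorem Config.add_ofTuple {n : ℕ} {p : Rd d × M} {v : Fin n → Rd d × M}
    (hv : v ∈ distinctTuples d M n) (hp : p.1 ∉ Prod.fst '' (ofTuple v).pts) :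
    Config.add p (ofTuple v) = ofTuple (Fin.cons p v : Fin (n + 1) → Rd d × M) := by
  have h1 := cons_mem_distinctTuples hv hp
  rw [← Fin.insertNth_zero'] at h1 ⊢
  exact (ofTuple_insertNth h1 hv).2.symm

theorem regXi_aff_of_not (ξ : Functional d M) {V : Config d M}
    (h : ¬(V ∈ simpleConfigs d M ∧ (0 : Rd d) ∉ Prod.fst '' V.pts)) (y : Rd d) (t : M) :
    regXi ξ ((y, t), Config.aff y 1 V) = 0 := by
  rw [regXi, if_neg]
  rintro ⟨h1, h2⟩
  refine h ⟨?_, fun h0 => h2 ?_⟩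
  · have := aff_mem_simpleConfigs (y := -y) one_ne_zero h1
    rwa [Config.aff_neg_aff] at this
  · have := (mem_fst_aff (y := y) one_ne_zero (V := V) (u := 0)).2 h0
    rwa [smul_zero, add_zero] at this

/-- Convergence of `ξ(y k, t; y k + V, y k + A)` for `A = ℝ^d` and for large balls `A`. -/
def ContAt (ξ : Functional d M) (K₁ : ℝ) (x : Rd d) (y : ℕ → Rd d) (t : M) (V : Config d M) :
    Prop :=
  ∀ A : Set (Rd d), (A = Set.univ ∨ ∃ L : ℕ, K₁ < L ∧ A = Metric.closedBall 0 (L : ℝ)) →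
    Tendsto (fun k => regXi ξ ((y k, t), Config.aff (y k) 1 V) ((fun z => y k + z) '' A)) atTop
      (𝓝 (regXi ξ ((x, t), Config.aff x 1 V) ((fun z => x + z) '' A)))

theorem contAt_of_not {ξ : Functional d M} {V : Config d M}
    (h : ¬(V ∈ simpleConfigs d M ∧ (0 : Rd d) ∉ Prod.fst '' V.pts)) (K₁ : ℝ) (x : Rd d)
    (y : ℕ → Rd d) (t : M) : ContAt ξ K₁ x y t V := by
  intro A _
  simp only [regXi_aff_of_not ξ h]
  exact tendsto_const_nhds

/-- The sequence is constant, equal to the value at the origin. -/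
theorem IsTranslationInvariant.contAt {ξ : Functional d M} (h : IsTranslationInvariant ξ) (K₁ : ℝ)
    (x : Rd d) (y : ℕ → Rd d) (t : M) (V : Config d M) : ContAt ξ K₁ x y t V := by
  by_cases hV : V ∈ simpleConfigs d M ∧ (0 : Rd d) ∉ Prod.fst '' V.pts
  · intro A hA
    have hAm : MeasurableSet A := by
      rcases hA with rfl | ⟨L, -, rfl⟩
      · exact MeasurableSet.univ
      · exact measurableSet_closedBall
    have h1 : ∀ z : Rd d, regXi ξ ((z, t), Config.aff z 1 V) ((fun w => z + w) '' A) =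
        ins ξ 0 t V.pts A := fun z => by
      rw [regXi_aff ξ hV.1 hV.2, ins, ins, h z 0 t _ (hV.1.1.insert _) (Set.mem_insert _ _) A hAm,
        act_insert, add_zero]
      simp [affPt]
    simp only [h1]
    exact tendsto_const_nhds
  · exact contAt_of_not hV K₁ x y t

/-- `ContAt` involves balls of integer radius only, which makes this a countable intersection of
convergence events. -/
theorem measurableSet_contAt {ξ : Functional d M} (hξ : IsMeasureFunctional ξ) (K₁ : ℝ)
    (x : Rd d) (y : ℕ → Rd d) {Θ : Type*} [MeasurableSpace Θ] {V : Θ → Config d M}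
    (hV : Measurable V) {t : Θ → M} (ht : Measurable t) :
    MeasurableSet {θ | ContAt ξ K₁ x y (t θ) (V θ)} := by
  have h1 : ∀ (w : Rd d) (A : Set (Rd d)), MeasurableSet A → Measurable fun θ =>
      regXi ξ ((w, t θ), Config.aff w 1 (V θ)) ((fun z => w + z) '' A) := fun w A hA => by
    have hA' : MeasurableSet ((fun z => w + z) '' A) :=
      (MeasurableEquiv.addLeft w).measurableSet_image.2 hA
    refine (Measure.measurable_coe hA').comp ((measurable_regXi hξ).comp ?_)
    exact (measurable_const.prodMk ht).prodMk ((Config.measurable_aff one_ne_zero).comp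
      (measurable_const.prodMk hV))
  have h2 : ∀ A : Set (Rd d), MeasurableSet A → MeasurableSet {θ | Tendsto (fun k =>
      regXi ξ ((y k, t θ), Config.aff (y k) 1 (V θ)) ((fun z => y k + z) '' A)) atTop
      (𝓝 (regXi ξ ((x, t θ), Config.aff x 1 (V θ)) ((fun z => x + z) '' A)))} := fun A hA =>
    measurableSet_tendsto_fun (fun k => h1 (y k) A hA) (h1 x A hA)
  have h3 : {θ | ContAt ξ K₁ x y (t θ) (V θ)} = {θ | Tendsto (fun k =>
      regXi ξ ((y k, t θ), Config.aff (y k) 1 (V θ)) ((fun z => y k + z) '' Set.univ)) atTop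
      (𝓝 (regXi ξ ((x, t θ), Config.aff x 1 (V θ)) ((fun z => x + z) '' Set.univ)))} ∩
      ⋂ (L : ℕ) (_ : K₁ < L), {θ | Tendsto (fun k =>
      regXi ξ ((y k, t θ), Config.aff (y k) 1 (V θ)) ((fun z => y k + z) ''
        Metric.closedBall 0 (L : ℝ))) atTop
      (𝓝 (regXi ξ ((x, t θ), Config.aff x 1 (V θ)) ((fun z => x + z) ''
        Metric.closedBall 0 (L : ℝ))))} := by
    ext θ
    simp only [Set.mem_inter_iff, Set.mem_iInter]
    constructor
    · exact fun h => ⟨h _ (Or.inl rfl), fun L hL => h _ (Or.inr ⟨L, hL, rfl⟩)⟩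
    · rintro ⟨h, h'⟩ A (rfl | ⟨L, hL, rfl⟩)
      · exact h
      · exact h' L hL
  rw [h3]
  exact (h2 _ MeasurableSet.univ).inter (MeasurableSet.iInter fun L => MeasurableSet.iInter
    fun _ => h2 _ measurableSet_closedBall)

/-- The configuration is translated along with its centre: the tuple (y k, y k + u) converges to (x,
x + u), where continuity is assumed. -/
theorem contAt_of_continuousAt {ξ : Functional d M} {K₁ : ℝ} {x : Rd d} {y : ℕ → Rd d}
    (hy : Tendsto y atTop (𝓝 x)) {m : ℕ} {u : Fin m → Rd d} {t₀ : M} {t : Fin m → M}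
    (hu : (fun i => (u i, t i)) ∈ distinctTuples d M m)
    (h : ∀ A : Set (Rd d), (A = Set.univ ∨ ∃ K : ℝ, K₁ < K ∧ A = Metric.closedBall 0 K) →
      ContinuousAt (fun y : Fin (m + 1) → Rd d =>
        ins ξ (y 0) ((Fin.cons t₀ t : Fin (m + 1) → M) 0) (Set.range fun i : Fin m =>
          (y i.succ, (Fin.cons t₀ t : Fin (m + 1) → M) i.succ)) ((fun z => y 0 + z) '' A))
        (Fin.cons x fun i => x + u i)) :
    ContAt ξ K₁ x y t₀ (ofTuple fun i => (u i, t i)) := by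
  by_cases hV : (ofTuple fun i => (u i, t i)) ∈ simpleConfigs d M ∧
      (0 : Rd d) ∉ Prod.fst '' (ofTuple fun i => (u i, t i)).pts
  swap
  · exact contAt_of_not hV K₁ x y t₀
  intro A hA
  have h1 := h A (by
    rcases hA with rfl | ⟨L, hL, rfl⟩
    exacts [Or.inl rfl, Or.inr ⟨L, hL, rfl⟩])
  have h2 : Tendsto (fun k => (Fin.cons (y k) fun i => y k + u i : Fin (m + 1) → Rd d)) atTop
      (𝓝 (Fin.cons x fun i => x + u i)) := by
    rw [tendsto_pi_nhds]
    intro i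
    refine Fin.cases ?_ (fun i => ?_) i
    · simpa using hy
    · simpa using hy.add_const (u i)
  have h3 := h1.tendsto.comp h2
  have h4 : ∀ z : Rd d, regXi ξ ((z, t₀), Config.aff z 1 (ofTuple fun i => (u i, t i))) =
      ins ξ z t₀ (Set.range fun i => (z + u i, t i)) := fun z => by
    rw [regXi_aff ξ hV.1 hV.2, pts_ofTuple hu, act, ← Set.range_comp]
    simp [Function.comp_def]
  simp only [h4]
  simpa [Function.comp_def] using h3

/-! ### From tuples to Poisson processes -/

section

variable {E : Type*} [MeasurableSpace E]

theorem measurePreserving_cons (ν : Measure E) [SigmaFinite ν] (n : ℕ) :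
    MeasurePreserving (fun r : E × (Fin n → E) => (Fin.cons r.1 r.2 : Fin (n + 1) → E))
      (ν.prod (Measure.pi fun _ => ν)) (Measure.pi fun _ => ν) := by
  have h := (measurePreserving_piFinSuccAbove (fun _ : Fin (n + 1) => ν) 0).symm
  convert h using 1
  funext r
  exact (Fin.insertNth_zero' r.1 r.2).symm

theorem measurePreserving_cons_cons (ν : Measure E) [SigmaFinite ν] (n : ℕ) :
    MeasurePreserving (fun r : (Fin n → E) × (E × E) =>
      (Fin.cons r.2.1 (Fin.cons r.2.2 r.1 : Fin (n + 1) → E) : Fin (n + 2) → E))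
      ((Measure.pi fun _ => ν).prod (ν.prod ν)) (Measure.pi fun _ => ν) :=
  (measurePreserving_cons ν (n + 1)).comp (((MeasurePreserving.id ν).prod
    (measurePreserving_cons ν n)).comp ((measurePreserving_prodAssoc ν ν _).comp
      Measure.measurePreserving_swap))

theorem pi_absolutelyContinuous {ν ν' : Measure E} [SigmaFinite ν] [SigmaFinite ν'] (h : ν ≪ ν')
    (n : ℕ) : (Measure.pi fun _ : Fin n => ν) ≪ Measure.pi fun _ : Fin n => ν' := by
  induction n with
  | zero => rw [Measure.pi_of_empty, Measure.pi_of_empty]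
  | succ n ih =>
    rw [← (measurePreserving_cons ν n).map_eq, ← (measurePreserving_cons ν' n).map_eq]
    exact (h.prod ih).map (measurePreserving_cons ν n).measurable

end

section

variable {μM : Measure M} [IsProbabilityMeasure μM] {Θ : Type*} [MeasurableSpace Θ] {μ : Measure Θ}
  [SFinite μ]

/-- Given the number of points, the process is an enumerated tuple with a law absolutely continuous
with respect to Lebesgue measure times marks, so a property of almost every tuple is almost sure. -/
theorem ae_poissonLaw_of_tuples {ν : Measure (Rd d × M)} [IsFiniteMeasure ν] (hν : IsDiffuse ν)
    (hac : ν ≪ (volume : Measure (Rd d)).prod μM) {S : Set (Config d M × Θ)} (hS : MeasurableSet S)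
    (h : ∀ n, ∀ᵐ v : Fin n → Rd d, ∀ᵐ τ ∂(Measure.pi fun _ : Fin n => μM), ∀ᵐ θ ∂μ,
      (fun i => (v i, τ i)) ∈ distinctTuples d M n → (ofTuple (fun i => (v i, τ i)), θ) ∈ S) :
    ∀ᵐ q ∂((poissonLaw ν).prod μ), q ∈ S := by
  refine (Measure.ae_prod_iff_ae_ae hS).2 ?_
  set S' : Set (Config d M) := {W | μ (Prod.mk W ⁻¹' Sᶜ) = 0} with hS'
  have hS'm : MeasurableSet S' := measurable_measure_prodMk_left hS.compl (measurableSet_singleton 0)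
  have key : ∀ n, ∀ᵐ v ∂(Measure.pi fun _ : Fin n => ν), ofTuple v ∈ S' := by
    intro n
    have h1 : ∀ᵐ v ∂(Measure.pi fun _ : Fin n => (volume : Measure (Rd d)).prod μM),
        v ∈ {v | v ∈ distinctTuples d M n → ofTuple v ∈ S'} := by
      have hT : MeasurableSet {v : Fin n → Rd d × M | v ∈ distinctTuples d M n → ofTuple v ∈ S'} :=
        (measurableSet_distinctTuples n).imp (measurable_ofTuple n hS'm)
      have e := measurePreserving_arrowProdEquivProdArrow (Rd d) M (Fin n)
        (fun _ => (volume : Measure (Rd d))) (fun _ => μM)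
      have h2 : ∀ᵐ r ∂((Measure.pi fun _ : Fin n => (volume : Measure (Rd d))).prod
          (Measure.pi fun _ : Fin n => μM)), (fun i => (r.1 i, r.2 i)) ∈
            {v : Fin n → Rd d × M | v ∈ distinctTuples d M n → ofTuple v ∈ S'} := by
        refine (Measure.ae_prod_iff_ae_ae (hT.preimage (by fun_prop))).2 ?_
        filter_upwards [h n] with v hv
        filter_upwards [hv] with τ hτ
        intro hd
        change μ _ = 0
        refine ae_iff.1 (hτ.mono fun θ hθ => ?_)
        exact hθ hd
      exact e.quasiMeasurePreserving.ae h2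
    filter_upwards [(pi_absolutelyContinuous hac n).ae_le h1, ae_distinctTuples hν n] with v h1 h2
    exact h1 h2
  have h3 : poissonLaw ν S'ᶜ = 0 := by
    rw [← lintegral_indicator_one hS'm.compl,
      lintegral_poissonLaw _ (measurable_one.indicator hS'm.compl)]
    have h4 : ∀ n, ∫⁻ v, S'ᶜ.indicator (1 : Config d M → ℝ≥0∞) (ofTuple v)
        ∂(Measure.pi fun _ : Fin n => ν) = 0 := fun n => by
      refine lintegral_eq_zero_of_ae_eq_zero ?_
      filter_upwards [key n] with v hv
      exact Set.indicator_of_notMem (Set.notMem_compl_iff.2 hv) _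
    simp [h4]
  have h5 : ∀ᵐ W ∂(poissonLaw ν), W ∈ S' := ae_iff.2 h3
  filter_upwards [h5] with W hW
  exact ae_iff.2 hW

end

section

variable {μM : Measure M} [IsProbabilityMeasure μM] {ξ : Functional d M}

/-- Fubini separates the centre x, and for the process with an added point also the location z, from
the remaining points. The exceptional null sets of x and z come from the continuity condition alone
and do not depend on the sequence y or the intensity ν. -/
theorem exists_ae_contAt (hξ : IsMeasureFunctional ξ)
    (hA : IsTranslationInvariant ξ ∨ HasAEContinuousTotalMeasure ξ μM) :
    ∃ K₁ : ℝ, ∀ᵐ x : Rd d,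
      (∀ y : ℕ → Rd d, Tendsto y atTop (𝓝 x) → ∀ ν : Measure (Rd d × M), IsFiniteMeasure ν →
        IsDiffuse ν → ν ≪ (volume : Measure (Rd d)).prod μM →
        ∀ᵐ q ∂((poissonLaw ν).prod μM), q.1.pts.Nonempty → ContAt ξ K₁ x y q.2 q.1) ∧
      ∀ᵐ z : Rd d, ∀ y : ℕ → Rd d, Tendsto y atTop (𝓝 x) → ∀ ν : Measure (Rd d × M),
        IsFiniteMeasure ν → IsDiffuse ν → ν ≪ (volume : Measure (Rd d)).prod μM →
        ∀ᵐ q ∂((poissonLaw ν).prod (μM.prod μM)), z ∉ Prod.fst '' q.1.pts →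
          ContAt ξ K₁ x y q.2.1 (Config.add (z, q.2.2) q.1) := by
  rcases hA with hA | ⟨K₁, -, hA⟩
  -- Under translation invariance there is no restriction on the radii of the balls, and the
  -- threshold 0 is arbitrary.
  · refine ⟨0, Eventually.of_forall fun x => ⟨fun y _ ν _ _ _ => Eventually.of_forall fun q _ =>
      hA.contAt _ _ _ _ _, Eventually.of_forall fun z y _ ν _ _ _ => Eventually.of_forall fun q _ =>
      hA.contAt _ _ _ _ _⟩⟩
  refine ⟨K₁, ?_⟩
  have h1 : ∀ᵐ x : Rd d, ∀ m : ℕ, ∀ᵐ v : Fin (m + 1) → Rd d,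
      ∀ᵐ t ∂(Measure.pi fun _ : Fin (m + 2) => μM),
      ∀ A : Set (Rd d), (A = Set.univ ∨ ∃ K : ℝ, K₁ < K ∧ A = Metric.closedBall 0 K) →
        ContinuousAt (fun y : Fin (m + 2) → Rd d =>
          ins ξ (y 0) (t 0) (Set.range fun i : Fin (m + 1) => (y i.succ, t i.succ))
            ((fun z => y 0 + z) '' A)) (Fin.cons x fun i => x + v i) := by
    rw [ae_all_iff]
    intro m
    have h2 := Measure.ae_ae_of_ae_prod ((measurePreserving_cons (volume : Measure (Rd d))
      (m + 1)).quasiMeasurePreserving.ae (hA (m + 1) (by omega)))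
    filter_upwards [h2] with x hx
    -- Tuples are listed relative to the centre, and Lebesgue measure is invariant under the shift
    -- by x.
    exact (measurePreserving_add_left (volume : Measure (Fin (m + 1) → Rd d))
      fun _ => x).quasiMeasurePreserving.ae hx
  filter_upwards [h1] with x hx
  constructor
  · intro y hy ν hνf hν hac
    have hS : MeasurableSet {q : Config d M × M | q.1.pts.Nonempty → ContAt ξ K₁ x y q.2 q.1} := by
      refine MeasurableSet.imp ?_ (measurableSet_contAt hξ K₁ x y measurable_fst measurable_snd)
      have : MeasurableSet {X : Config d M | X.pts.Nonempty} := by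
        convert (measurableSet_encard_eq (d := d) (M := M) 0).compl using 1
        ext X
        simp [Set.nonempty_iff_ne_empty]
      exact measurable_fst this
    refine ae_poissonLaw_of_tuples hν hac hS fun n => ?_
    -- The continuity condition starts with one other point; the empty tuple is excluded by the
    -- nonemptiness in the claim.
    rcases n with _ | n
    · refine Eventually.of_forall fun v => Eventually.of_forall fun τ => Eventually.of_forall
        fun θ hd hne => ?_
      rw [pts_ofTuple hd] at hne
      obtain ⟨_, i, _⟩ := hne
      exact i.elim0
    · filter_upwards [hx n] with v hv
      have h3 := Measure.ae_ae_of_ae_prod (((measurePreserving_cons μM (n + 1)).comp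
        Measure.measurePreserving_swap).quasiMeasurePreserving.ae hv)
      filter_upwards [h3] with τ hτ
      filter_upwards [hτ] with θ hθ
      exact fun hd _ => contAt_of_continuousAt hy hd hθ
  · have h2 : ∀ᵐ z : Rd d, ∀ n : ℕ, ∀ᵐ v : Fin n → Rd d,
        ∀ᵐ t ∂(Measure.pi fun _ : Fin (n + 2) => μM),
        ∀ A : Set (Rd d), (A = Set.univ ∨ ∃ K : ℝ, K₁ < K ∧ A = Metric.closedBall 0 K) →
        ContinuousAt (fun y : Fin (n + 2) → Rd d =>
          ins ξ (y 0) (t 0) (Set.range fun i : Fin (n + 1) => (y i.succ, t i.succ))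
            ((fun z => y 0 + z) '' A))
            (Fin.cons x fun i => x + (Fin.cons z v : Fin (n + 1) → Rd d) i) := by
      rw [ae_all_iff]
      intro n
      exact Measure.ae_ae_of_ae_prod ((measurePreserving_cons (volume : Measure (Rd d))
        n).quasiMeasurePreserving.ae (hx n))
    filter_upwards [h2] with z hz
    intro y hy ν hνf hν hac
    have hS : MeasurableSet {q : Config d M × (M × M) | z ∉ Prod.fst '' q.1.pts →
        ContAt ξ K₁ x y q.2.1 (Config.add (z, q.2.2) q.1)} := by
      refine MeasurableSet.imp ?_ (measurableSet_contAt hξ K₁ x y ?_ (by fun_prop))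
      · exact Config.measurable_fiber measurable_fst measurable_const
      · have a1 : Measurable fun q : Config d M × (M × M) => ((z, q.2.2), q.1) := by fun_prop
        exact Config.measurable_add.comp a1
    refine ae_poissonLaw_of_tuples hν hac hS fun n => ?_
    filter_upwards [hz n] with v hv
    have h3 := Measure.ae_ae_of_ae_prod
      ((measurePreserving_cons_cons μM n).quasiMeasurePreserving.ae hv)
    filter_upwards [h3] with τ hτ
    filter_upwards [hτ] with θ hθ
    intro hd hzn
    have h4 := cons_mem_distinctTuples (p := (z, θ.2)) hd hzn
    have h5 : (Fin.cons (z, θ.2) (fun i => (v i, τ i)) : Fin (n + 1) → Rd d × M) =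
        fun i => ((Fin.cons z v : Fin (n + 1) → Rd d) i, (Fin.cons θ.2 τ : Fin (n + 1) → M) i) := by
      funext i
      refine Fin.cases ?_ (fun i => ?_) i <;> simp
    change ContAt ξ K₁ x y θ.1 (Config.add (z, θ.2) (ofTuple fun i => (v i, τ i)))
    rw [Config.add_ofTuple hd hzn, h5]
    rw [h5] at h4
    exact contAt_of_continuousAt hy h4 hθ

end

end

section

variable {d : ℕ} {M : Type*}

/-! ### Operations on configurations and local convergence -/

theorem Config.aff_add (y : Rd d) {a : ℝ} (ha : a ≠ 0) (p : Rd d × M) (X : Config d M) :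
    Config.aff y a (Config.add p X) = Config.add (affPt y a p) (Config.aff y a X) := by
  have h := mem_fst_aff (y := y) ha (V := X) (u := p.1)
  by_cases hp : p.1 ∈ Prod.fst '' X.pts
  · rw [Config.add_of_mem hp, Config.add_of_mem (h.2 hp)]
  · refine Config.ext ?_
    rw [Config.pts_add (p := affPt y a p) fun h' => hp (h.1 h'), Config.pts_aff y ha,
      Config.pts_aff y ha, Config.pts_add hp, act_insert]

theorem Config.restr_add_of_mem {B : Set (Rd d)} {p : Rd d × M} {X : Config d M} (hB : p.1 ∈ B)
    (hp : p.1 ∉ Prod.fst '' X.pts) :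
    Config.restr B (Config.add p X) = Config.add p (Config.restr B X) := by
  have hp' : p.1 ∉ Prod.fst '' (Config.restr B X).pts := fun h => hp (by
    rw [Config.pts_restr] at h
    exact Set.image_mono Set.inter_subset_left h)
  refine Config.ext ?_
  rw [Config.pts_restr, Config.pts_add hp, Config.pts_add hp', Config.pts_restr,
    Set.insert_inter_of_mem (show p ∈ B ×ˢ Set.univ from ⟨hB, trivial⟩)]

theorem Config.restr_add_of_notMem {B : Set (Rd d)} {p : Rd d × M} {X : Config d M}
    (hB : p.1 ∉ B) (hp : p.1 ∉ Prod.fst '' X.pts) :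
    Config.restr B (Config.add p X) = Config.restr B X := by
  refine Config.ext ?_
  rw [Config.pts_restr, Config.pts_add hp, Config.pts_restr,
    Set.insert_inter_of_notMem fun h : p ∈ B ×ˢ Set.univ => hB h.1]

theorem blow_add {l : ℝ} (hl : 0 < l) (x : Rd d) (p : Rd d × M) (X : Config d M) :
    blow l x (Config.add p X) = Config.add (dil d l • (p.1 - x), p.2) (blow l x X) := by
  rw [blow, Config.aff_add _ (dil_pos hl).ne', affPt, smul_sub, neg_add_eq_sub]
  rfl

/-- Magnifying about the point with magnified coordinate z is magnifying about x and then shifting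
by -z; hence the shift in the mixed moment of V. -/
theorem blow_add_smul {l : ℝ} (hl : 0 < l) (x z : Rd d) (X : Config d M) :
    blow l (x + (dil d l)⁻¹ • z) X = Config.aff (-z) 1 (blow l x X) := by
  refine Config.ext ?_
  rw [pts_blow hl, Config.pts_aff _ one_ne_zero, pts_blow hl, act_act, smul_add,
    smul_inv_smul₀ (dil_pos hl).ne', one_smul, one_mul, neg_add_rev]

variable [MeasurableSpace M]

theorem tendsto_add_locNear {p : Rd d × M} {U : Config d M} (hp : p.1 ∉ Prod.fst '' U.pts) :
    Tendsto (fun q : ℕ × Config d M => (q.1, Config.add p q.2)) (locNear U)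
      (locNear (Config.add p U)) := by
  refine ((hasBasis_locNear U).tendsto_iff (hasBasis_locNear _)).2 fun K _ => ?_
  obtain ⟨N, hN⟩ := exists_nat_ge ‖p.1‖
  refine ⟨max K N, trivial, ?_⟩
  rintro ⟨k, V⟩ ⟨hk, hV, hVU⟩
  have h1 := inter_ball_mono (show (K : ℝ) ≤ (max K N : ℕ) by exact_mod_cast le_max_left _ _) hVU
  have hpV : p.1 ∉ Prod.fst '' V.pts := by
    rintro ⟨p', hp', hpp⟩
    have h2 : p' ∈ V.pts ∩ Metric.closedBall 0 ((max K N : ℕ) : ℝ) ×ˢ Set.univ := by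
      refine ⟨hp', ?_, trivial⟩
      rw [hpp, mem_closedBall_zero_iff]
      exact hN.trans (by exact_mod_cast le_max_right _ _)
    simp only at hVU
    rw [hVU] at h2
    exact hp ⟨p', h2.1, hpp⟩
  refine ⟨(le_max_left _ _).trans hk, add_mem_simpleConfigs hV, ?_⟩
  simp only at h1 ⊢
  rw [Config.pts_add hp, Config.pts_add hpV]
  by_cases hB : p ∈ Metric.closedBall (0 : Rd d) (K : ℝ) ×ˢ (Set.univ : Set M)
  · rw [Set.insert_inter_of_mem hB, Set.insert_inter_of_mem hB, h1]
  · rw [Set.insert_inter_of_notMem hB, Set.insert_inter_of_notMem hB, h1]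

theorem tendsto_aff_locNear (y : Rd d) (U : Config d M) :
    Tendsto (fun q : ℕ × Config d M => (q.1, Config.aff y 1 q.2)) (locNear U)
      (locNear (Config.aff y 1 U)) := by
  refine ((hasBasis_locNear U).tendsto_iff (hasBasis_locNear _)).2 fun K _ => ?_
  obtain ⟨N, hN⟩ := exists_nat_ge ‖y‖
  refine ⟨K + N, trivial, ?_⟩
  rintro ⟨k, V⟩ ⟨hk, hV, hVU⟩
  refine ⟨(Nat.le_add_right _ _).trans hk, aff_mem_simpleConfigs one_ne_zero hV, ?_⟩
  have hsub : ((fun u : Rd d => y + (1 : ℝ) • u) ⁻¹' Metric.closedBall 0 (K : ℝ)) ⊆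
      Metric.closedBall 0 ((K + N : ℕ) : ℝ) := by
    intro u hu
    simp only [one_smul, Set.mem_preimage, mem_closedBall_zero_iff] at hu ⊢
    have := norm_sub_le (y + u) y
    rw [add_sub_cancel_left] at this
    push_cast
    linarith
  have hsub' : ((fun u : Rd d => y + (1 : ℝ) • u) ⁻¹' Metric.closedBall 0 (K : ℝ)) ×ˢ
      (Set.univ : Set M) = Metric.closedBall 0 ((K + N : ℕ) : ℝ) ×ˢ Set.univ ∩
        ((fun u : Rd d => y + (1 : ℝ) • u) ⁻¹' Metric.closedBall 0 (K : ℝ)) ×ˢ Set.univ :=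
    (Set.inter_eq_right.2 (Set.prod_mono hsub subset_rfl)).symm
  simp only at hVU ⊢
  rw [Config.pts_aff _ one_ne_zero, Config.pts_aff _ one_ne_zero, ← act_inter_prod,
    ← act_inter_prod, hsub', ← Set.inter_assoc, ← Set.inter_assoc, hVU]

/-! ### Typical realizations of a homogeneous Poisson process -/

section

variable {μM : Measure M} [IsProbabilityMeasure μM] {Q : Measure (Config d M)} {a : ℝ}
  {Θ : Type*} [MeasurableSpace Θ] {μ : Measure Θ} [SFinite μ]

theorem isBallFinite_homogeneous : IsBallFinite
    (ENNReal.ofReal a • (volume : Measure (Rd d)).prod μM) := fun n => by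
  rw [Measure.smul_apply, Measure.prod_prod, measure_univ, mul_one]
  exact ENNReal.mul_lt_top ENNReal.ofReal_lt_top measure_closedBall_lt_top

theorem IsPoissonLaw.ae_restr (hd : 0 < d)
    (hQ : IsPoissonLaw Q (ENNReal.ofReal a • (volume : Measure (Rd d)).prod μM)) (K : ℕ)
    {S : Config d M × Θ → Prop} (h : ∀ᵐ q ∂((poissonLaw (homIntensity μM a
      (Metric.closedBall (0 : Rd d) (K : ℝ)))).prod μ), S q) :
    ∀ᵐ q ∂(Q.prod μ), S (Config.restr (Metric.closedBall 0 (K : ℝ)) q.1, q.2) := by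
  have := hQ.prob
  have h1 : MeasurePreserving (Config.restr (Metric.closedBall (0 : Rd d) (K : ℝ))) Q
      (poissonLaw (homIntensity μM a (Metric.closedBall (0 : Rd d) (K : ℝ)))) :=
    ⟨Config.measurable_restr measurableSet_closedBall,
      hQ.map_restr_homogeneous hd measurableSet_closedBall measure_closedBall_lt_top⟩
  exact (h1.prod (MeasurePreserving.id μ)).quasiMeasurePreserving.ae h

theorem IsPoissonLaw.ae_simple (hd : 0 < d)
    (hQ : IsPoissonLaw Q (ENNReal.ofReal a • (volume : Measure (Rd d)).prod μM)) :
    ∀ᵐ U ∂Q, ∀ K : ℕ, Config.restr (Metric.closedBall 0 (K : ℝ)) U ∈ simpleConfigs d M := by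
  rw [ae_all_iff]
  intro K
  have h1 := ae_simpleConfigs_poissonLaw (homIntensity μM a (Metric.closedBall (0 : Rd d) (K : ℝ)))
  rw [← hQ.map_restr_homogeneous hd measurableSet_closedBall measure_closedBall_lt_top] at h1
  exact ae_of_ae_map (Config.measurable_restr measurableSet_closedBall).aemeasurable h1

theorem IsPoissonLaw.ae_notMem_fst (hd : 0 < d)
    (hQ : IsPoissonLaw Q (ENNReal.ofReal a • (volume : Measure (Rd d)).prod μM)) (x : Rd d) :
    ∀ᵐ U ∂Q, x ∉ Prod.fst '' U.pts := by
  obtain ⟨K, hK⟩ := exists_nat_ge ‖x‖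
  have := isFiniteMeasure_homIntensity (μM := μM) a
    (measure_closedBall_lt_top (μ := (volume : Measure (Rd d))) (x := 0) (r := K))
  have h1 := ae_notMem_fst_poissonLaw
    (isDiffuse_homIntensity (μM := μM) hd a (Metric.closedBall (0 : Rd d) (K : ℝ))) x
  rw [← hQ.map_restr_homogeneous hd measurableSet_closedBall measure_closedBall_lt_top] at h1
  filter_upwards [ae_of_ae_map (Config.measurable_restr measurableSet_closedBall).aemeasurable h1]
    with U hU
  rintro ⟨p, hp, rfl⟩
  rw [Config.pts_restr] at hU
  exact hU ⟨p, ⟨hp, mem_closedBall_zero_iff.2 hK, trivial⟩, rfl⟩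

/-- The probability of an empty ball is the exponential of minus its intensity, which tends to 0 as
the ball grows. -/
theorem IsPoissonLaw.ae_nonempty (hd : 0 < d) (ha : 0 < a)
    (hQ : IsPoissonLaw Q (ENNReal.ofReal a • (volume : Measure (Rd d)).prod μM)) :
    ∀ᵐ U ∂Q, U.pts.Nonempty := by
  set ν := ENNReal.ofReal a • (volume : Measure (Rd d)).prod μM with hν
  have hB : ∀ K : ℕ, MeasurableSet (Metric.closedBall (0 : Rd d) (K : ℝ) ×ˢ (Set.univ : Set M)) :=
    fun K => measurableSet_cyl measurableSet_closedBall
  have h1 : ∀ K : ℕ, Q {U | ¬U.pts.Nonempty} ≤ ENNReal.ofReal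
      (Real.exp (-(ν (Metric.closedBall (0 : Rd d) (K : ℝ) ×ˢ Set.univ)).toReal)) := by
    intro K
    have h2 := hQ.poisson _ (hB K) (isBallFinite_homogeneous K)
    have h3 : Q.map (count (Metric.closedBall (0 : Rd d) (K : ℝ) ×ˢ (Set.univ : Set M))) {0} =
        ENNReal.ofReal
          (Real.exp (-(ν (Metric.closedBall (0 : Rd d) (K : ℝ) ×ˢ Set.univ)).toReal)) := by
      rw [h2, Measure.map_apply (measurable_of_countable _) (measurableSet_singleton 0)]
      have : (fun n : ℕ => (n : ℕ∞)) ⁻¹' {0} = {0} := by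
        ext n
        simp
      rw [this, poissonMeasure_singleton, pow_zero, mul_one, Nat.factorial_zero, Nat.cast_one,
        div_one]
      rfl
    rw [← h3, Measure.map_apply (measurable_count (hB K)) (measurableSet_singleton 0)]
    refine measure_mono fun U hU => ?_
    rw [Set.mem_ofPred_eq, Set.not_nonempty_iff_eq_empty] at hU
    rw [Set.mem_preimage, count_eq, hU]
    simp
  have hlim : Tendsto (fun K : ℕ => ν (Metric.closedBall (0 : Rd d) (K : ℝ) ×ˢ
      (Set.univ : Set M))) atTop (𝓝 ∞) := by
    have h2 := tendsto_measure_iUnion_atTop (μ := ν)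
      (s := fun K : ℕ => Metric.closedBall (0 : Rd d) (K : ℝ) ×ˢ (Set.univ : Set M))
      fun a b hab => Set.prod_mono
        (Metric.closedBall_subset_closedBall (by exact_mod_cast hab)) subset_rfl
    rw [iUnion_ball_cyl] at h2
    have : Nonempty (Fin d) := ⟨⟨0, hd⟩⟩
    have h3 : ν Set.univ = ∞ := by
      rw [hν, Measure.smul_apply, ← Set.univ_prod_univ, Measure.prod_prod, measure_univ (μ := μM),
        mul_one, measure_univ_of_isAddLeftInvariant, smul_eq_mul]
      exact ENNReal.mul_top (by simpa using ha)
    rwa [h3] at h2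
  have hlim' : Tendsto (fun K : ℕ => ENNReal.ofReal
      (Real.exp (-(ν (Metric.closedBall (0 : Rd d) (K : ℝ) ×ˢ Set.univ)).toReal))) atTop (𝓝 0) := by
    have h2 : Tendsto (fun K : ℕ => (ν (Metric.closedBall (0 : Rd d) (K : ℝ) ×ˢ
        (Set.univ : Set M))).toReal) atTop atTop := by
      rw [← ENNReal.tendsto_ofReal_nhds_top]
      refine hlim.congr fun K => ?_
      rw [ENNReal.ofReal_toReal (isBallFinite_homogeneous K).ne]
    rw [← ENNReal.ofReal_zero]
    exact (ENNReal.continuous_ofReal.tendsto 0).comp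
      (Real.tendsto_exp_neg_atTop_nhds_zero.comp h2)
  rw [ae_iff]
  exact le_antisymm (ge_of_tendsto' hlim' h1) bot_le

theorem IsPoissonLaw.map_aff_homogeneous
    (hQ : IsPoissonLaw Q (ENNReal.ofReal a • (volume : Measure (Rd d)).prod μM)) (z : Rd d) :
    Q.map (Config.aff z 1) = Q := by
  have := hQ.prob
  have h1 := (hQ.hasPoissonCF isBallFinite_homogeneous).map_aff z one_ne_zero
  have h2 : (ENNReal.ofReal a • (volume : Measure (Rd d)).prod μM).map (affPt z 1) =
      ENNReal.ofReal a • (volume : Measure (Rd d)).prod μM := by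
    have h3 : (affPt z 1 : Rd d × M → Rd d × M) = Prod.map (fun u => z + u) id := by
      funext q
      simp only [affPt, one_smul]
      rfl
    rw [Measure.map_smul, h3, ((measurePreserving_add_left (volume : Measure (Rd d)) z).prod
      (MeasurePreserving.id μM)).map_eq]
  rw [h2] at h1
  have : IsProbabilityMeasure (Q.map (Config.aff z 1)) := Measure.isProbabilityMeasure_map
    ((Config.measurable_aff one_ne_zero).comp measurable_prodMk_left).aemeasurable
  exact h1.unique (hQ.hasPoissonCF isBallFinite_homogeneous)

end

/-! ### Almost sure convergence conditions for the homogeneous process, with and without an added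
point. -/

section

variable {μM : Measure M} [IsProbabilityMeasure μM] {Q : Measure (Config d M)} {a : ℝ}
  {ξ : Functional d M} {K₁ : ℝ} {x : Rd d} {y : ℕ → Rd d}

theorem exists_radius_le {X : Set (Rd d × M)} {t : M} {X' : Set (Rd d × M)}
    (h : (⨅ (ε : ℝ) (_ : 0 < ε), ⨆ y ∈ Metric.closedBall x ε,
      max (radius ξ y t X Set.univ) (radius ξ y t X' Set.univ)) < ⊤) :
    ∃ K : ℕ, ∃ ε : ℝ, 0 < ε ∧ ∀ z ∈ Metric.closedBall x ε,
      radius ξ z t X Set.univ ≤ K ∧ radius ξ z t X' Set.univ ≤ K := by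
  simp only [iInf_lt_iff] at h
  obtain ⟨ε, hε, h⟩ := h
  obtain ⟨K, hK⟩ := ENat.ne_top_iff_exists.1 h.ne
  refine ⟨K, ε, hε, fun z hz => ?_⟩
  rw [hK, ← max_le_iff]
  exact le_iSup₂ (f := fun y (_ : y ∈ Metric.closedBall x ε) =>
    max (radius ξ y t X Set.univ) (radius ξ y t X' Set.univ)) z hz

theorem homIntensity_absolutelyContinuous (B : Set (Rd d)) :
    homIntensity μM a B ≪ (volume : Measure (Rd d)).prod μM :=
  (Measure.smul_absolutelyContinuous.trans
    Measure.restrict_le_self.absolutelyContinuous).prod Measure.AbsolutelyContinuous.rfl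

theorem ae_convAt (hd : 0 < d) (ha : 0 < a)
    (hQ : IsPoissonLaw Q (ENNReal.ofReal a • (volume : Measure (Rd d)).prod μM))
    (hs : IsHomStabilizing ξ μM Q x)
    (hc : ∀ ν : Measure (Rd d × M), IsFiniteMeasure ν → IsDiffuse ν →
      ν ≪ (volume : Measure (Rd d)).prod μM →
      ∀ᵐ q ∂((poissonLaw ν).prod μM), q.1.pts.Nonempty → ContAt ξ K₁ x y q.2 q.1) :
    ∀ᵐ q ∂(Q.prod μM), ConvAt ξ x y q.2 q.1 := by
  have := hQ.prob
  have h1 : ∀ᵐ q ∂(Q.prod μM), ∃ K : ℕ, ∃ ε : ℝ, 0 < ε ∧ ∀ z ∈ Metric.closedBall x ε,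
      radius ξ z q.2 q.1.pts Set.univ ≤ K := by
    -- The stabilization condition bounds two radii, and the first involves neither the added
    -- location nor the second mark; any z and almost any value of that mark will do.
    have h2 := ((measurePreserving_prodAssoc Q μM μM).quasiMeasurePreserving).ae (hs 0)
    filter_upwards [Measure.ae_ae_of_ae_prod h2] with q hq
    obtain ⟨t', ht'⟩ := hq.exists
    obtain ⟨K, ε, hε, h⟩ := exists_radius_le ht'
    exact ⟨K, ε, hε, fun z hz => (h z hz).1⟩
  have h2 : ∀ᵐ q ∂(Q.prod μM), ∀ K : ℕ,
      (Config.restr (Metric.closedBall 0 (K : ℝ)) q.1).pts.Nonempty →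
      ContAt ξ K₁ x y q.2 (Config.restr (Metric.closedBall 0 (K : ℝ)) q.1) := by
    rw [ae_all_iff]
    intro K
    exact hQ.ae_restr hd K (hc _ (isFiniteMeasure_homIntensity a measure_closedBall_lt_top)
      (isDiffuse_homIntensity hd _ _) (homIntensity_absolutelyContinuous _))
  have q1 := Measure.quasiMeasurePreserving_fst (μ := Q) (ν := μM)
  filter_upwards [h1, h2, q1.ae (hQ.ae_nonempty hd ha), q1.ae (hQ.ae_simple hd),
    q1.ae (hQ.ae_notMem_fst hd 0)] with q a1 a2 a3 a4 a5
  exact ⟨a1, ⟨K₁, fun K hK => a2 K (by rwa [Config.pts_restr])⟩, a3, a4, a5⟩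

/-- Restrictions to balls that contain z are handled by continuity with the added point, and
restrictions to smaller balls by continuity without it. Nonemptiness comes from the added point. -/
theorem ae_convAt_add (hd : 0 < d)
    (hQ : IsPoissonLaw Q (ENNReal.ofReal a • (volume : Measure (Rd d)).prod μM))
    (hs : IsHomStabilizing ξ μM Q x)
    (hc : ∀ ν : Measure (Rd d × M), IsFiniteMeasure ν → IsDiffuse ν →
      ν ≪ (volume : Measure (Rd d)).prod μM →
      ∀ᵐ q ∂((poissonLaw ν).prod μM), q.1.pts.Nonempty → ContAt ξ K₁ x y q.2 q.1)
    {z : Rd d} (hz : z ≠ 0)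
    (hc' : ∀ ν : Measure (Rd d × M), IsFiniteMeasure ν → IsDiffuse ν →
      ν ≪ (volume : Measure (Rd d)).prod μM →
      ∀ᵐ q ∂((poissonLaw ν).prod (μM.prod μM)), z ∉ Prod.fst '' q.1.pts →
        ContAt ξ K₁ x y q.2.1 (Config.add (z, q.2.2) q.1)) :
    ∀ᵐ q ∂(Q.prod (μM.prod μM)), ConvAt ξ x y q.2.1 (Config.add (z, q.2.2) q.1) := by
  have := hQ.prob
  have h2 : ∀ᵐ q ∂(Q.prod (μM.prod μM)), ∀ K : ℕ,
      (Config.restr (Metric.closedBall 0 (K : ℝ)) q.1).pts.Nonempty →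
      ContAt ξ K₁ x y q.2.1 (Config.restr (Metric.closedBall 0 (K : ℝ)) q.1) := by
    rw [ae_all_iff]
    intro K
    have h3 := hc _ (isFiniteMeasure_homIntensity a measure_closedBall_lt_top)
      (isDiffuse_homIntensity hd a (Metric.closedBall 0 (K : ℝ)))
      (homIntensity_absolutelyContinuous _)
    exact ((MeasurePreserving.id Q).prod
      (measurePreserving_fst (μ := μM) (ν := μM))).quasiMeasurePreserving.ae (hQ.ae_restr hd K h3)
  have h3 : ∀ᵐ q ∂(Q.prod (μM.prod μM)), ∀ K : ℕ,
      z ∉ Prod.fst '' (Config.restr (Metric.closedBall 0 (K : ℝ)) q.1).pts →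
      ContAt ξ K₁ x y q.2.1 (Config.add (z, q.2.2)
        (Config.restr (Metric.closedBall 0 (K : ℝ)) q.1)) := by
    rw [ae_all_iff]
    intro K
    exact hQ.ae_restr hd K (hc' _ (isFiniteMeasure_homIntensity a measure_closedBall_lt_top)
      (isDiffuse_homIntensity hd _ _) (homIntensity_absolutelyContinuous _))
  have q1 := Measure.quasiMeasurePreserving_fst (μ := Q) (ν := μM.prod μM)
  filter_upwards [hs z, h2, h3, q1.ae (hQ.ae_simple hd),
    q1.ae (hQ.ae_notMem_fst hd 0), q1.ae (hQ.ae_notMem_fst hd z)] with q a1 a2 a3 a4 a5 a6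
  have e1 : (Config.add (z, q.2.2) q.1).pts = insert (z, q.2.2) q.1.pts := Config.pts_add a6
  refine ⟨?_, ⟨K₁, fun K hK => ?_⟩, ?_, fun K => ?_, ?_⟩
  · obtain ⟨K, ε, hε, h⟩ := exists_radius_le a1
    refine ⟨K, ε, hε, fun w hw => ?_⟩
    rw [e1]
    exact (h w hw).2
  · rw [← Config.pts_restr] at hK
    by_cases hB : z ∈ Metric.closedBall (0 : Rd d) (K : ℝ)
    · rw [Config.restr_add_of_mem (p := (z, q.2.2)) hB a6]
      refine a3 K fun h => a6 ?_
      rw [Config.pts_restr] at h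
      exact Set.image_mono Set.inter_subset_left h
    · rw [Config.restr_add_of_notMem (p := (z, q.2.2)) hB a6] at hK ⊢
      exact a2 K hK
  · rw [e1]
    exact Set.insert_nonempty _ _
  · by_cases hB : z ∈ Metric.closedBall (0 : Rd d) (K : ℝ)
    · rw [Config.restr_add_of_mem (p := (z, q.2.2)) hB a6]
      exact add_mem_simpleConfigs (a4 K)
    · rw [Config.restr_add_of_notMem (p := (z, q.2.2)) hB a6]
      exact a4 K
  · exact notMem_fst_add hz.symm a5

end

end

section

variable {d : ℕ} {M : Type*} [MeasurableSpace M]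

/-! ### Limits at a point -/

section

variable {κ : Rd d → ℝ} {μM : Measure M} {ξ : Functional d M} {Γ : ℝ → Set (Rd d)}
  {φ : Rd d → ℝ} {b p C K₁ : ℝ} {l : ℕ → ℝ} {Q : Measure (Config d M)} {x : Rd d}

/-- Moment bounds are assumed only at locations in the support, so points converging to x must
eventually lie there. -/
theorem eventually_mem_support (hκ : Measurable κ) (hx : 0 < κ x) (hcont : ContinuousAt κ x) :
    ∀ᶠ y in 𝓝 x, y ∈ (densityMeasure κ).support := by
  obtain ⟨U, hU, hUo, hxU⟩ := eventually_nhds_iff.1 (hcont.eventually (lt_mem_nhds hx))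
  filter_upwards [hUo.mem_nhds hxU] with y hy
  rw [Measure.mem_support_iff_forall]
  intro W hW
  rw [pos_iff_ne_zero]
  intro h0
  rw [densityMeasure, withDensity_apply_eq_zero hκ.ennreal_ofReal] at h0
  refine (Measure.measure_pos_of_mem_nhds volume (inter_mem hW (hUo.mem_nhds hy))).ne' ?_
  refine measure_mono_null ?_ h0
  rintro w ⟨hwW, hwU⟩
  exact ⟨by simpa using hU w hwU, hwW⟩

/-- Almost sure convergence at `x`, for the processes with an additional point at `z`. -/
def PairCont (ξ : Functional d M) (μM : Measure M) (K₁ : ℝ) (x z : Rd d) : Prop :=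
  ∀ y : ℕ → Rd d, Tendsto y atTop (𝓝 x) → ∀ ν : Measure (Rd d × M), IsFiniteMeasure ν →
    IsDiffuse ν → ν ≪ (volume : Measure (Rd d)).prod μM →
    ∀ᵐ q ∂((poissonLaw ν).prod (μM.prod μM)), z ∉ Prod.fst '' q.1.pts →
      ContAt ξ K₁ x y q.2.1 (Config.add (z, q.2.2) q.1)

/-- The hypotheses under which the moments at `x` converge. -/
structure LimitPoint (κ : Rd d → ℝ) (μM : Measure M) (ξ : Functional d M) (Γ : ℝ → Set (Rd d))
    (φ : Rd d → ℝ) (b p C K₁ : ℝ) (l : ℕ → ℝ) (Q : Measure (Config d M)) (x : Rd d) : Prop where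
  dpos : 0 < d
  measκ : Measurable κ
  functional : IsMeasureFunctional ξ
  measφ : Measurable φ
  bound : ∀ z, |φ z| ≤ b
  contφ : ContinuousAt φ x
  pos : 0 < κ x
  contκ : ContinuousAt κ x
  law : IsPoissonLaw Q (ENNReal.ofReal (κ x) • (volume : Measure (Rd d)).prod μM)
  stab : IsHomStabilizing ξ μM Q x
  lpos : ∀ k, 0 < l k
  lim : Tendsto (fun k => (dil d (l k))⁻¹) atTop (𝓝 0)
  measΓ : ∀ k, MeasurableSet (Γ (l k))
  mem : ∃ U ∈ 𝓝 x, ∀ᶠ k in atTop, U ⊆ Γ (l k)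
  pm : ∀ k, ∀ x ∈ (densityMeasure κ).support, ∀ y ∈ (densityMeasure κ).support, x ≠ y →
    PairMoments (poissonLaw (modelIntensity κ μM (l k))) μM (scF ξ Γ φ (l k)) p C x y
  two_lt : 2 < p
  cont : ∀ y : ℕ → Rd d, Tendsto y atTop (𝓝 x) → ∀ ν : Measure (Rd d × M), IsFiniteMeasure ν →
    IsDiffuse ν → ν ≪ (volume : Measure (Rd d)).prod μM →
    ∀ᵐ q ∂((poissonLaw ν).prod μM), q.1.pts.Nonempty → ContAt ξ K₁ x y q.2 q.1

variable [IsProbabilityMeasure μM] [IsProbabilityMeasure (densityMeasure κ)]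

/-- A fixed location is almost surely unoccupied, so the deletion has no effect. -/
theorem scF_ae_eq (hd : 0 < d) {lam : ℝ} {y : Rd d} (hy : y ∈ Γ lam) :
    (fun ω : Config d M × M => scF ξ Γ φ lam ((y, ω.2), ω.1))
      =ᵐ[(poissonLaw (modelIntensity κ μM lam)).prod μM]
    fun ω => locF ξ φ (dil d lam)⁻¹ y ω.2 (blow lam y ω.1) := by
  have := isFiniteMeasure_modelIntensity (κ := κ) (μM := μM) lam
  filter_upwards [Measure.quasiMeasurePreserving_fst.ae (ae_notMem_fst_poissonLaw
    (isDiffuse_modelIntensity (κ := κ) (μM := μM) hd lam) y)] with ω hω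
  rw [scF, if_pos hy, Config.del_of_notMem hω]

theorem measurePreserving_blow {lam : ℝ} (hl : 0 < lam) (y : Rd d) :
    MeasurePreserving (blow lam y) (poissonLaw (modelIntensity κ μM lam))
      ((poissonLaw (modelIntensity κ μM lam)).map (blow lam y)) :=
  have hm : Measurable (blow lam y : Config d M → Config d M) :=
    (Config.measurable_aff (dil_pos hl).ne').comp (measurable_const.prodMk measurable_id)
  hm.measurePreserving _

theorem LimitPoint.measurable_locF_single (h : LimitPoint κ μM ξ Γ φ b p C K₁ l Q x) (k : ℕ)
    (y : Rd d) : Measurable fun q : Config d M × M => locF ξ φ (dil d (l k))⁻¹ y q.2 q.1 := by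
  have h1 : Measurable fun q : Config d M × M => ((y, q.2), q.1) := by fun_prop
  exact (measurable_locF h.functional h.measφ h.bound _).comp h1

theorem LimitPoint.locLim (h : LimitPoint κ μM ξ Γ φ b p C K₁ l Q x) {y : ℕ → Rd d}
    (hy : Tendsto y atTop (𝓝 x)) : LocLim Q μM
      (fun k q => locF ξ φ (dil d (l k))⁻¹ (y k) q.2 q.1)
      fun q => φ x * (xiInf ξ x q.2 q.1.pts Set.univ).toReal := by
  filter_upwards [ae_convAt h.dpos h.pos h.law h.stab (h.cont y hy)] with q hq
  exact hq.tendsto_locF h.functional h.measφ h.bound h.contφ hy h.lim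

theorem LimitPoint.eventually_mem (h : LimitPoint κ μM ξ Γ φ b p C K₁ l Q x) {y : ℕ → Rd d}
    (hy : Tendsto y atTop (𝓝 x)) : ∀ᶠ k in atTop, y k ∈ Γ (l k) := by
  obtain ⟨U, hU, hUΓ⟩ := h.mem
  filter_upwards [hUΓ, hy.eventually hU] with k h1 h2 using h1 h2

theorem LimitPoint.eventually_support (h : LimitPoint κ μM ξ Γ φ b p C K₁ l Q x) {y : ℕ → Rd d}
    (hy : Tendsto y atTop (𝓝 x)) : ∀ᶠ k in atTop, y k ∈ (densityMeasure κ).support :=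
  hy.eventually (eventually_mem_support h.measκ h.pos h.contκ)

theorem LimitPoint.locallyTV (h : LimitPoint κ μM ξ Γ φ b p C K₁ l Q x) {y : ℕ → Rd d}
    (hy : Tendsto y atTop (𝓝 x)) :
    LocallyTV (fun k => (poissonLaw (modelIntensity κ μM (l k))).map (blow (l k) (y k))) Q :=
  locallyTV_blow h.dpos h.measκ h.pos h.contκ h.law h.lpos h.lim hy

theorem LimitPoint.eventually_moment (h : LimitPoint κ μM ξ Γ φ b p C K₁ l Q x) {y : ℕ → Rd d}
    (hy : Tendsto y atTop (𝓝 x)) : ∀ᶠ k in atTop,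
      Integrable (fun q : Config d M × M => |locF ξ φ (dil d (l k))⁻¹ (y k) q.2 q.1| ^ p)
        (((poissonLaw (modelIntensity κ μM (l k))).map (blow (l k) (y k))).prod μM) ∧
      ∫ q : Config d M × M, |locF ξ φ (dil d (l k))⁻¹ (y k) q.2 q.1| ^ p
        ∂(((poissonLaw (modelIntensity κ μM (l k))).map (blow (l k) (y k))).prod μM) ≤ C := by
  filter_upwards [h.eventually_mem hy, h.eventually_support hy] with k hk hkS
  have := isFiniteMeasure_modelIntensity (κ := κ) (μM := μM) (l k)
  have := isProbabilityMeasure_poissonLaw (modelIntensity κ μM (l k))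
  obtain ⟨w, hw, hyw⟩ := exists_ne_mem_support
    (fun x => densityMeasure_singleton (κ := κ) h.dpos x) (y k)
  have h1 := h.pm k _ hkS w hw hyw
  have mp := (measurePreserving_blow (κ := κ) (μM := μM) (h.lpos k) (y k)).prod
    (MeasurePreserving.id μM)
  have hm := ((h.measurable_locF_single k (y k)).abs.pow_const p).aestronglyMeasurable
    (μ := ((poissonLaw (modelIntensity κ μM (l k))).map (blow (l k) (y k))).prod μM)
  have hae := scF_ae_eq (κ := κ) (μM := μM) (ξ := ξ) (φ := φ) h.dpos hk
  have hae' : (fun ω : Config d M × M => |scF ξ Γ φ (l k) ((y k, ω.2), ω.1)| ^ p)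
      =ᵐ[(poissonLaw (modelIntensity κ μM (l k))).prod μM]
      fun ω => |locF ξ φ (dil d (l k))⁻¹ (y k) ω.2 (blow (l k) (y k) ω.1)| ^ p :=
    hae.fun_comp fun w => |w| ^ p
  refine ⟨(mp.integrable_comp hm).1 (h1.single.congr hae'), ?_⟩
  rw [← integral_comp_measurePreserving mp hm]
  exact (integral_congr_ae hae').symm.le.trans h1.single_le

/-- Stated along an arbitrary sequence converging to x, because the covariance also needs the mean
at the moving location x + l^(-1/d) z. -/
theorem LimitPoint.tendsto_meanF (h : LimitPoint κ μM ξ Γ φ b p C K₁ l Q x) {y : ℕ → Rd d}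
    (hy : Tendsto y atTop (𝓝 x)) :
    Tendsto (fun k => meanF (poissonLaw (modelIntensity κ μM (l k))) μM (scF ξ Γ φ (l k)) (y k))
      atTop (𝓝 (φ x * ∫ q, (xiInf ξ x q.2 q.1.pts Set.univ).toReal ∂(Q.prod μM))) := by
  have h1 := (h.locLim hy).tendsto_integral (h.locallyTV hy)
    (fun k => h.measurable_locF_single k (y k)) (r := p) (by linarith [h.two_lt])
    ((h.eventually_moment hy).mono fun k hk => hk.1)
    ((h.eventually_moment hy).mono fun k hk => hk.2)
  rw [integral_const_mul] at h1
  refine h1.congr' ?_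
  filter_upwards [h.eventually_mem hy] with k hk
  have := isFiniteMeasure_modelIntensity (κ := κ) (μM := μM) (l k)
  have := isProbabilityMeasure_poissonLaw (modelIntensity κ μM (l k))
  rw [meanF, integral_congr_ae (scF_ae_eq (κ := κ) (μM := μM) (ξ := ξ) (φ := φ) h.dpos hk)]
  exact (integral_comp_measurePreserving ((measurePreserving_blow (κ := κ) (μM := μM) (h.lpos k)
    (y k)).prod (MeasurePreserving.id μM))
    (h.measurable_locF_single k (y k)).aestronglyMeasurable).symm

theorem abs_sq_rpow (w p : ℝ) : |w ^ 2| ^ (p / 2) = |w| ^ p := by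
  rw [abs_of_nonneg (sq_nonneg w), ← sq_abs, ← Real.rpow_natCast, ← Real.rpow_mul (abs_nonneg _)]
  congr 1
  push_cast
  ring

/-- The square has bounded moments of order p/2 > 1, hence is uniformly integrable. -/
theorem LimitPoint.tendsto_sqF (h : LimitPoint κ μM ξ Γ φ b p C K₁ l Q x) :
    Tendsto (fun k => sqF (poissonLaw (modelIntensity κ μM (l k))) μM (scF ξ Γ φ (l k)) x)
      atTop (𝓝 (φ x ^ 2 * ∫ q, (xiInf ξ x q.2 q.1.pts Set.univ).toReal ^ 2 ∂(Q.prod μM))) := by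
  have hy : Tendsto (fun _ : ℕ => x) atTop (𝓝 x) := tendsto_const_nhds
  have h1 := ((h.locLim hy).comp (c := fun w => w ^ 2) (by fun_prop)).tendsto_integral
    (h.locallyTV hy) (fun k => (h.measurable_locF_single k x).pow_const 2) (r := p / 2) (C := C)
    (by linarith [h.two_lt])
    ((h.eventually_moment hy).mono fun k hk => by simpa only [abs_sq_rpow] using hk.1)
    ((h.eventually_moment hy).mono fun k hk => by simpa only [abs_sq_rpow] using hk.2)
  simp only [mul_pow] at h1
  rw [integral_const_mul] at h1
  refine h1.congr' ?_
  filter_upwards [h.eventually_mem hy] with k hk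
  have := isFiniteMeasure_modelIntensity (κ := κ) (μM := μM) (l k)
  have := isProbabilityMeasure_poissonLaw (modelIntensity κ μM (l k))
  refine Eq.trans ?_ (integral_congr_ae ((scF_ae_eq (κ := κ) (μM := μM) (ξ := ξ) (φ := φ) h.dpos hk).fun_comp fun w => w ^ 2)).symm
  exact (integral_comp_measurePreserving ((measurePreserving_blow (κ := κ) (μM := μM) (h.lpos k)
    x).prod (MeasurePreserving.id μM))
    ((h.measurable_locF_single k x).pow_const 2).aestronglyMeasurable).symm

/-- The product of the contributions of the points `0` and `z` of a configuration. -/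
def pairLoc (ξ : Functional d M) (φ : Rd d → ℝ) (s : ℝ) (x z : Rd d)
    (q : Config d M × (M × M)) : ℝ :=
  locF ξ φ s x q.2.1 (Config.add (z, q.2.2) q.1) *
    locF ξ φ s (x + s • z) q.2.2 (Config.aff (-z) 1 (Config.add (0, q.2.1) q.1))

/-- The limit of `pairLoc`. -/
def pairInf (ξ : Functional d M) (x z : Rd d) (q : Config d M × (M × M)) : ℝ :=
  (xiInf ξ x q.2.1 (insert (z, q.2.2) q.1.1) Set.univ).toReal *
    (xiInf ξ x q.2.2 (act (-z) 1 (insert (0, q.2.1) q.1.1)) Set.univ).toReal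

theorem LimitPoint.measurable_pairLoc (h : LimitPoint κ μM ξ Γ φ b p C K₁ l Q x) (s : ℝ)
    (z : Rd d) : Measurable (pairLoc ξ φ s x z) := by
  have h0 := measurable_locF h.functional h.measφ h.bound s
  have h1 : Measurable fun q : Config d M × (M × M) => ((z, q.2.2), q.1) := by fun_prop
  have h2 : Measurable fun q : Config d M × (M × M) => (((0 : Rd d), q.2.1), q.1) := by fun_prop
  have h3 : Measurable fun q : Config d M × (M × M) => (x, q.2.1) := by fun_prop
  have h4 : Measurable fun q : Config d M × (M × M) => (x + s • z, q.2.2) := by fun_prop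
  have h5 : Measurable fun q : Config d M × (M × M) => Config.add (z, q.2.2) q.1 :=
    Config.measurable_add.comp h1
  have h6 : Measurable fun q : Config d M × (M × M) => Config.add ((0 : Rd d), q.2.1) q.1 :=
    Config.measurable_add.comp h2
  have h7 : Measurable fun q : Config d M × (M × M) =>
      Config.aff (-z) 1 (Config.add ((0 : Rd d), q.2.1) q.1) :=
    (Config.measurable_aff one_ne_zero).comp (measurable_const.prodMk h6)
  have h8 := h0.comp (h3.prodMk h5)
  have h9 := h0.comp (h4.prodMk h7)
  exact h8.mul h9

theorem LimitPoint.tendsto_line (h : LimitPoint κ μM ξ Γ φ b p C K₁ l Q x) (z : Rd d) :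
    Tendsto (fun k => x + (dil d (l k))⁻¹ • z) atTop (𝓝 x) := by
  simpa using (h.lim.smul_const z).const_add x

/-- Seen from z, the point 0 lies at -z and the marks exchange roles. The law of the homogeneous
process is invariant under the shift, so the second condition is the first one with -z in place of
z. -/
theorem LimitPoint.ae_convAt_pair (h : LimitPoint κ μM ξ Γ φ b p C K₁ l Q x) {z : Rd d}
    (hz : z ≠ 0) (hc : PairCont ξ μM K₁ x z) (hc' : PairCont ξ μM K₁ x (-z)) :
    ∀ᵐ q ∂(Q.prod (μM.prod μM)), ConvAt ξ x (fun _ => x) q.2.1 (Config.add (z, q.2.2) q.1) ∧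
      ConvAt ξ x (fun k => x + (dil d (l k))⁻¹ • z) q.2.2
        (Config.aff (-z) 1 (Config.add (0, q.2.1) q.1)) ∧
      z ∉ Prod.fst '' q.1.pts ∧ (0 : Rd d) ∉ Prod.fst '' q.1.pts := by
  have hQ := h.law.prob
  have h1 := ae_convAt_add h.dpos h.law h.stab (h.cont _ tendsto_const_nhds) hz
    (hc _ tendsto_const_nhds)
  have h2 := ae_convAt_add h.dpos h.law h.stab (h.cont _ (h.tendsto_line z)) (neg_ne_zero.2 hz)
    (hc' _ (h.tendsto_line z))
  have mp : MeasurePreserving (Config.aff (-z) 1 : Config d M → Config d M) Q Q :=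
    ⟨(Config.measurable_aff one_ne_zero).comp measurable_prodMk_left,
      h.law.map_aff_homogeneous (-z)⟩
  have h3 := (mp.prod (Measure.measurePreserving_swap (μ := μM) (ν := μM))).quasiMeasurePreserving.ae
    h2
  have q1 := Measure.quasiMeasurePreserving_fst (μ := Q) (ν := μM.prod μM)
  filter_upwards [h1, h3, q1.ae (h.law.ae_notMem_fst h.dpos z),
    q1.ae (h.law.ae_notMem_fst h.dpos 0)] with q a1 a2 a3 a4
  refine ⟨a1, ?_, a3, a4⟩
  rw [Config.aff_add _ one_ne_zero]
  have e : affPt (-z) 1 ((0 : Rd d), q.2.1) = (-z, q.2.1) := by simp [affPt]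
  rw [e]
  exact a2

theorem LimitPoint.locLim_pair (h : LimitPoint κ μM ξ Γ φ b p C K₁ l Q x) {z : Rd d}
    (hz : z ≠ 0) (hc : PairCont ξ μM K₁ x z) (hc' : PairCont ξ μM K₁ x (-z)) :
    LocLim Q (μM.prod μM) (fun k => pairLoc ξ φ (dil d (l k))⁻¹ x z)
      fun q => φ x ^ 2 * pairInf ξ x z q := by
  filter_upwards [h.ae_convAt_pair hz hc hc'] with q hq
  obtain ⟨a1, a2, a3, a4⟩ := hq
  have b1 := (a1.tendsto_locF h.functional h.measφ h.bound h.contφ tendsto_const_nhds h.lim).comp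
    (tendsto_add_locNear (p := (z, q.2.2)) a3)
  have b2 := (a2.tendsto_locF h.functional h.measφ h.bound h.contφ (h.tendsto_line z) h.lim).comp
    ((tendsto_aff_locNear (-z) _).comp (tendsto_add_locNear (p := ((0 : Rd d), q.2.1)) a4))
  have b3 := b1.mul b2
  rw [Config.pts_add (p := (z, q.2.2)) a3, Config.pts_aff _ one_ne_zero,
    Config.pts_add (p := ((0 : Rd d), q.2.1)) a4] at b3
  have e : φ x ^ 2 * pairInf ξ x z q =
      φ x * (xiInf ξ x q.2.1 (insert (z, q.2.2) q.1.pts) Set.univ).toReal *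
      (φ x * (xiInf ξ x q.2.2 (act (-z) 1 (insert (0, q.2.1) q.1.pts)) Set.univ).toReal) := by
    rw [pairInf]
    simp only [Config.pts]
    ring
  rw [e]
  exact b3

/-- Almost surely both locations are unoccupied, so nothing is deleted, and magnification about x
sends x to 0 and the other location to z. -/
theorem scF_pair_ae_eq (hd : 0 < d) {lam : ℝ} (hl : 0 < lam) {z : Rd d} (hz : z ≠ 0)
    (hx : x ∈ Γ lam) (hy : x + (dil d lam)⁻¹ • z ∈ Γ lam) :
    (fun ω : Config d M × (M × M) =>
      scF ξ Γ φ lam ((x, ω.2.1), Config.add (x + (dil d lam)⁻¹ • z, ω.2.2) ω.1) *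
      scF ξ Γ φ lam ((x + (dil d lam)⁻¹ • z, ω.2.2), Config.add (x, ω.2.1) ω.1))
      =ᵐ[(poissonLaw (modelIntensity κ μM lam)).prod (μM.prod μM)]
    fun ω => pairLoc ξ φ (dil d lam)⁻¹ x z (blow lam x ω.1, ω.2) := by
  have := isFiniteMeasure_modelIntensity (κ := κ) (μM := μM) lam
  have hdiff := isDiffuse_modelIntensity (κ := κ) (μM := μM) hd lam
  have hD := dil_pos (d := d) hl
  have hxy : x ≠ x + (dil d lam)⁻¹ • z := by
    rw [ne_eq, left_eq_add, smul_eq_zero]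
    push Not
    exact ⟨(inv_pos.2 hD).ne', hz⟩
  have q1 := Measure.quasiMeasurePreserving_fst (μ := poissonLaw (modelIntensity κ μM lam))
    (ν := μM.prod μM)
  filter_upwards [q1.ae (ae_notMem_fst_poissonLaw hdiff x),
    q1.ae (ae_notMem_fst_poissonLaw hdiff (x + (dil d lam)⁻¹ • z))] with ω h1 h2
  rw [scF, scF, if_pos hx, if_pos hy, pairLoc]
  simp only
  rw [Config.del_of_notMem (notMem_fst_add hxy h1),
    Config.del_of_notMem (notMem_fst_add hxy.symm h2), blow_add hl, blow_add_smul hl, blow_add hl]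
  simp only [add_sub_cancel_left, smul_inv_smul₀ hD.ne', sub_self, smul_zero]

theorem LimitPoint.eventually_moment_pair (h : LimitPoint κ μM ξ Γ φ b p C K₁ l Q x) {z : Rd d}
    (hz : z ≠ 0) : ∀ᶠ k in atTop,
      Integrable (fun q => |pairLoc ξ φ (dil d (l k))⁻¹ x z q| ^ (p / 2))
        (((poissonLaw (modelIntensity κ μM (l k))).map (blow (l k) x)).prod (μM.prod μM)) ∧
      ∫ q, |pairLoc ξ φ (dil d (l k))⁻¹ x z q| ^ (p / 2)
        ∂(((poissonLaw (modelIntensity κ μM (l k))).map (blow (l k) x)).prod (μM.prod μM)) ≤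
          2 * C := by
  filter_upwards [h.eventually_mem (tendsto_const_nhds (x := x)),
    h.eventually_mem (h.tendsto_line z), h.eventually_support (h.tendsto_line z)] with k hx hy hyS
  have hxS : x ∈ (densityMeasure κ).support :=
    (eventually_mem_support h.measκ h.pos h.contκ).self_of_nhds
  have := isFiniteMeasure_modelIntensity (κ := κ) (μM := μM) (l k)
  have := isProbabilityMeasure_poissonLaw (modelIntensity κ μM (l k))
  have hxy : x ≠ x + (dil d (l k))⁻¹ • z := by
    rw [ne_eq, left_eq_add, smul_eq_zero]
    push Not
    exact ⟨(inv_pos.2 (dil_pos (h.lpos k))).ne', hz⟩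
  have h1 := (h.pm k _ hxS _ hyS hxy).mix (h.pm k _ hyS _ hxS hxy.symm)
    (measurable_scF h.functional h.measφ h.bound (h.lpos k) (h.measΓ k))
  have mp := (measurePreserving_blow (κ := κ) (μM := μM) (h.lpos k) x).prod
    (MeasurePreserving.id (μM.prod μM))
  have hm := ((h.measurable_pairLoc (dil d (l k))⁻¹ z).abs.pow_const (p / 2)).aestronglyMeasurable
    (μ := ((poissonLaw (modelIntensity κ μM (l k))).map (blow (l k) x)).prod (μM.prod μM))
  have hae := (scF_pair_ae_eq (κ := κ) (μM := μM) (ξ := ξ) (φ := φ) h.dpos (h.lpos k) hz hx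
    hy).fun_comp fun w => |w| ^ (p / 2)
  refine ⟨(mp.integrable_comp hm).1 (h1.1.congr hae), ?_⟩
  rw [← integral_comp_measurePreserving mp hm]
  exact (integral_congr_ae hae).symm.le.trans h1.2

theorem LimitPoint.tendsto_mixF (h : LimitPoint κ μM ξ Γ φ b p C K₁ l Q x) {z : Rd d}
    (hz : z ≠ 0) (hc : PairCont ξ μM K₁ x z) (hc' : PairCont ξ μM K₁ x (-z)) :
    Tendsto (fun k => mixF (poissonLaw (modelIntensity κ μM (l k))) μM (scF ξ Γ φ (l k)) x
      (x + (dil d (l k))⁻¹ • z)) atTop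
      (𝓝 (φ x ^ 2 * ∫ q, pairInf ξ x z q ∂(Q.prod (μM.prod μM)))) := by
  have hy : Tendsto (fun _ : ℕ => x) atTop (𝓝 x) := tendsto_const_nhds
  have h1 := (h.locLim_pair hz hc hc').tendsto_integral (h.locallyTV hy)
    (fun k => h.measurable_pairLoc _ z) (r := p / 2) (by linarith [h.two_lt])
    ((h.eventually_moment_pair hz).mono fun k hk => hk.1)
    ((h.eventually_moment_pair hz).mono fun k hk => hk.2)
  rw [integral_const_mul] at h1
  refine h1.congr' ?_
  filter_upwards [h.eventually_mem hy, h.eventually_mem (h.tendsto_line z)] with k hx hy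
  have := isFiniteMeasure_modelIntensity (κ := κ) (μM := μM) (l k)
  have := isProbabilityMeasure_poissonLaw (modelIntensity κ μM (l k))
  rw [mixF, integral_congr_ae (scF_pair_ae_eq (κ := κ) (μM := μM) (ξ := ξ) (φ := φ) h.dpos
    (h.lpos k) hz hx hy)]
  exact (integral_comp_measurePreserving ((measurePreserving_blow (κ := κ) (μM := μM) (h.lpos k)
    x).prod (MeasurePreserving.id (μM.prod μM)))
    (h.measurable_pairLoc _ z).aestronglyMeasurable).symm

/-! ### Finiteness of the limiting moments -/

theorem ConvAt.xiInf_ne_top (hξ : IsMeasureFunctional ξ) {y : ℕ → Rd d} {t : M} {U : Config d M}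
    (h : ConvAt ξ x y t U) : xiInf ξ x t U.pts Set.univ ≠ ∞ := by
  obtain ⟨K, hK⟩ := h.xiInf_eq
  have := isFiniteMeasure_regXi hξ ((x, t), Config.aff x 1
    (Config.restr (Metric.closedBall 0 (K : ℝ)) U))
  rw [hK K le_rfl]
  exact measure_ne_top _ _

/-- The limits found above are integrals of `toReal`, whereas V is written with lower integrals of
extended values. The two agree because the limit functional is almost surely finite, and the p-th
moment bound makes the second moment finite. -/
theorem LimitPoint.finite_moments (h : LimitPoint κ μM ξ Γ (fun _ => 1) b p C K₁ l Q x) :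
    secondMoment ξ μM Q x < ∞ ∧
    ∫ q, (xiInf ξ x q.2 q.1.pts Set.univ).toReal ^ 2 ∂(Q.prod μM) =
      (secondMoment ξ μM Q x).toReal ∧
    ∫ q, (xiInf ξ x q.2 q.1.pts Set.univ).toReal ∂(Q.prod μM) = (mean ξ μM Q x).toReal := by
  have hQ := h.law.prob
  have hy : Tendsto (fun _ : ℕ => x) atTop (𝓝 x) := tendsto_const_nhds
  have h1 := h.locLim hy
  simp only [one_mul] at h1
  have hfin : ∀ᵐ q ∂(Q.prod μM), xiInf ξ x q.2 q.1.pts Set.univ < ∞ := by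
    filter_upwards [ae_convAt h.dpos h.pos h.law h.stab (h.cont _ hy)] with q hq
    exact (hq.xiInf_ne_top h.functional).lt_top
  have hm : AEMeasurable (fun q : Config d M × M => (xiInf ξ x q.2 q.1.pts Set.univ).toReal)
      (Q.prod μM) := h1.aemeasurable (h.locallyTV hy) fun k => h.measurable_locF_single k x
  have hm' : AEMeasurable (fun q : Config d M × M => xiInf ξ x q.2 q.1.pts Set.univ)
      (Q.prod μM) := hm.ennreal_ofReal.congr (by
    filter_upwards [hfin] with q hq
    rw [ENNReal.ofReal_toReal hq.ne])
  have h2 := (h1.moment (h.locallyTV hy) (fun k => h.measurable_locF_single k x) (r := p)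
    (by linarith [h.two_lt]) ((h.eventually_moment hy).mono fun k hk => hk.1)
    ((h.eventually_moment hy).mono fun k hk => hk.2)).1
  have h3 : Integrable (fun q : Config d M × M =>
      (xiInf ξ x q.2 q.1.pts Set.univ).toReal ^ 2) (Q.prod μM) := by
    refine ((integrable_const (1 : ℝ)).add h2).mono' (hm.pow_const 2).aestronglyMeasurable
      (Eventually.of_forall fun q => ?_)
    rw [Real.norm_of_nonneg (sq_nonneg _)]
    exact sq_le_one_add_rpow _ h.two_lt.le
  refine ⟨?_, ?_, ?_⟩
  · have h4 := h3.lintegral_lt_top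
    refine lt_of_eq_of_lt (lintegral_congr_ae ?_) h4
    filter_upwards [hfin] with q hq
    rw [ENNReal.ofReal_pow ENNReal.toReal_nonneg]
    exact congrArg (· ^ 2) (ENNReal.ofReal_toReal hq.ne).symm
  · rw [secondMoment]
    simp only [← ENNReal.toReal_pow]
    exact integral_toReal (hm'.pow_const 2)
      (hfin.mono fun q hq => ENNReal.pow_lt_top hq)
  · exact integral_toReal hm' hfin

theorem LimitPoint.finite_mixedMoment (h : LimitPoint κ μM ξ Γ (fun _ => 1) b p C K₁ l Q x)
    {z : Rd d} (hz : z ≠ 0) (hc : PairCont ξ μM K₁ x z) (hc' : PairCont ξ μM K₁ x (-z)) :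
    mixedMoment ξ μM Q x z < ∞ ∧ ∫ q, pairInf ξ x z q ∂(Q.prod (μM.prod μM)) =
      (mixedMoment ξ μM Q x z).toReal := by
  have hQ := h.law.prob
  have hy : Tendsto (fun _ : ℕ => x) atTop (𝓝 x) := tendsto_const_nhds
  have h1 := h.locLim_pair hz hc hc'
  simp only [one_pow, one_mul] at h1
  set g : Config d M × (M × M) → ℝ≥0∞ := fun q =>
    xiInf ξ x q.2.1 (insert (z, q.2.2) q.1.1) Set.univ *
      xiInf ξ x q.2.2 (act (-z) 1 (insert (0, q.2.1) q.1.1)) Set.univ with hg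
  have hgp : ∀ q, pairInf ξ x z q = (g q).toReal := fun q => (ENNReal.toReal_mul).symm
  have hfin : ∀ᵐ q ∂(Q.prod (μM.prod μM)), g q < ∞ := by
    filter_upwards [h.ae_convAt_pair hz hc hc'] with q hq
    obtain ⟨a1, a2, a3, a4⟩ := hq
    have b1 := a1.xiInf_ne_top h.functional
    have b2 := a2.xiInf_ne_top h.functional
    rw [Config.pts_add (p := (z, q.2.2)) a3] at b1
    rw [Config.pts_aff _ one_ne_zero, Config.pts_add (p := ((0 : Rd d), q.2.1)) a4] at b2
    exact ENNReal.mul_lt_top b1.lt_top b2.lt_top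
  have hm := h1.aemeasurable (h.locallyTV hy) fun k => h.measurable_pairLoc _ z
  have h2 := (h1.moment (h.locallyTV hy) (fun k => h.measurable_pairLoc _ z) (r := p / 2)
    (by linarith [h.two_lt]) ((h.eventually_moment_pair hz).mono fun k hk => hk.1)
    ((h.eventually_moment_pair hz).mono fun k hk => hk.2)).1
  have h3 := integrable_of_rpow hm (by linarith [h.two_lt]) h2
  have hm' : AEMeasurable g (Q.prod (μM.prod μM)) := hm.ennreal_ofReal.congr (by
    filter_upwards [hfin] with q hq
    rw [hgp, ENNReal.ofReal_toReal hq.ne])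
  constructor
  · have h4 := h3.lintegral_lt_top
    refine lt_of_eq_of_lt (lintegral_congr_ae ?_) h4
    filter_upwards [hfin] with q hq
    rw [hgp, ENNReal.ofReal_toReal hq.ne]
  · simp only [hgp]
    exact integral_toReal hm' hfin

end

end

section

variable {d : ℕ} {M : Type*} [MeasurableSpace M]

/-! ### Dilations at a Lebesgue point -/

section

variable {c : Rd d → ℝ} {b : ℝ}

theorem ae_comp_dil (hd : 0 < d) {l : ℝ} (hl : 0 < l) (x : Rd d) {s : Set (Rd d)}
    (hs : MeasurableSet s) (h0 : volume sᶜ = 0) : ∀ᵐ z, x + (dil d l)⁻¹ • z ∈ s := by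
  have h1 := lintegral_comp_dil hd hl x (u := sᶜ.indicator 1) (measurable_one.indicator hs.compl)
  rw [lintegral_indicator_one hs.compl, h0, mul_zero] at h1
  have h2 : Measurable fun z => sᶜ.indicator (1 : Rd d → ℝ≥0∞) (x + (dil d l)⁻¹ • z) :=
    (measurable_one.indicator hs.compl).comp (by fun_prop)
  rw [lintegral_eq_zero_iff h2] at h1
  filter_upwards [h1] with z hz
  by_contra hcon
  have : x + (dil d l)⁻¹ • z ∈ sᶜ := hcon
  simp [this] at hz

/-- Convergence in mean, on bounded sets, of the dilations of a function at a point. -/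
def IsDilationPoint (c : Rd d → ℝ) (x : Rd d) : Prop :=
  ∀ l : ℕ → ℝ, (∀ k, 0 < l k) → Tendsto (fun k => (dil d (l k))⁻¹) atTop (𝓝 0) → ∀ R : ℕ,
    Tendsto (fun k => ∫ z, (Metric.closedBall (0 : Rd d) R).indicator
      (fun z => |c (x + (dil d (l k))⁻¹ • z) - c x|) z) atTop (𝓝 0)

/-- This is Lebesgue's differentiation theorem on balls of radius l^(-1/d) (R + 1) about x, in
magnified coordinates. -/
theorem ae_isDilationPoint (hd : 0 < d) (hc : Measurable c) (hb : ∀ x, |c x| ≤ b) :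
    ∀ᵐ x, IsDilationPoint c x := by
  have hloc : LocallyIntegrable c := by
    refine (locallyIntegrable_const b).mono hc.aestronglyMeasurable (Eventually.of_forall fun x => ?_)
    exact (hb x).trans (le_abs_self b)
  filter_upwards [IsUnifLocDoublingMeasure.ae_tendsto_average_norm_sub volume hloc 1] with x hx
  intro l hl hlim R
  have hpos : ∀ k, 0 < (dil d (l k))⁻¹ := fun k => inv_pos.2 (dil_pos (hl k))
  -- The radius is R + 1 instead of R so that the balls have positive volume also for R = 0; the
  -- average over them must make sense.
  have hball : ∀ k (z : Rd d), x + (dil d (l k))⁻¹ • z ∈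
      Metric.closedBall x ((dil d (l k))⁻¹ * (R + 1)) ↔ z ∈ Metric.closedBall (0 : Rd d) (R + 1) := by
    intro k z
    rw [mem_closedBall_iff_norm, mem_closedBall_iff_norm, add_sub_cancel_left, sub_zero, norm_smul,
      Real.norm_of_nonneg (hpos k).le, mul_le_mul_iff_right₀ (hpos k)]
  have h1 := hx (l := atTop) (fun _ : ℕ => x) (fun k => (dil d (l k))⁻¹ * (R + 1))
    (tendsto_nhdsWithin_iff.2 ⟨by simpa using hlim.mul_const ((R : ℝ) + 1),
      Eventually.of_forall fun k => mul_pos (hpos k) (by positivity)⟩)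
    (Eventually.of_forall fun k => Metric.mem_closedBall_self
      (by have := hpos k; positivity))
  set v := volume.real (Metric.closedBall (0 : Rd d) (R + 1)) with hv
  have h2 : ∀ k, v = l k * volume.real (Metric.closedBall x ((dil d (l k))⁻¹ * (R + 1))) := by
    intro k
    have e := integral_comp_dil hd (hl k) x
      ((Metric.closedBall x ((dil d (l k))⁻¹ * (R + 1))).indicator (1 : Rd d → ℝ))
    rw [integral_indicator_one Metric.isClosed_closedBall.measurableSet] at e
    rw [← e, hv, ← integral_indicator_one Metric.isClosed_closedBall.measurableSet]
    congr 1
    funext z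
    by_cases hz : z ∈ Metric.closedBall (0 : Rd d) (R + 1)
    · rw [Set.indicator_of_mem hz, Set.indicator_of_mem ((hball k z).2 hz)]
      rfl
    · rw [Set.indicator_of_notMem hz, Set.indicator_of_notMem (fun h => hz ((hball k z).1 h))]
  have h3 : ∀ k, ∫ z, (Metric.closedBall (0 : Rd d) (R + 1)).indicator
      (fun z => |c (x + (dil d (l k))⁻¹ • z) - c x|) z =
      v * ⨍ y in Metric.closedBall x ((dil d (l k))⁻¹ * (R + 1)), ‖c y - c x‖ := by
    intro k
    have e := integral_comp_dil hd (hl k) x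
      ((Metric.closedBall x ((dil d (l k))⁻¹ * (R + 1))).indicator fun y => |c y - c x|)
    rw [integral_indicator Metric.isClosed_closedBall.measurableSet] at e
    have hv0 : volume.real (Metric.closedBall x ((dil d (l k))⁻¹ * (R + 1))) ≠ 0 := by
      have := hpos k
      refine (ENNReal.toReal_pos (Metric.measure_closedBall_pos volume x (by positivity)).ne'
        measure_closedBall_lt_top.ne).ne'
    rw [setAverage_eq, h2 k, smul_eq_mul, mul_assoc, mul_inv_cancel_left₀ hv0]
    simp only [Real.norm_eq_abs]
    rw [← e]
    congr 1
    funext z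
    by_cases hz : z ∈ Metric.closedBall (0 : Rd d) (R + 1)
    · rw [Set.indicator_of_mem hz, Set.indicator_of_mem ((hball k z).2 hz)]
    · rw [Set.indicator_of_notMem hz, Set.indicator_of_notMem (fun h => hz ((hball k z).1 h))]
  have h4 : Tendsto (fun k => ∫ z, (Metric.closedBall (0 : Rd d) (R + 1)).indicator
      (fun z => |c (x + (dil d (l k))⁻¹ • z) - c x|) z) atTop (𝓝 0) := by
    simp only [h3]
    simpa using h1.const_mul v
  refine squeeze_zero (fun k => integral_nonneg fun z => Set.indicator_nonneg
    (fun _ _ => abs_nonneg _) z) (fun k => ?_) h4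
  refine integral_mono_of_nonneg (Eventually.of_forall fun z => Set.indicator_nonneg
    (fun _ _ => abs_nonneg _) z) ?_ (Eventually.of_forall fun z =>
      Set.indicator_le_indicator_of_subset (Metric.closedBall_subset_closedBall (by linarith))
        (fun _ => abs_nonneg _) z)
  refine (integrable_indicator_iff Metric.isClosed_closedBall.measurableSet).2 ?_
  have hb0 : 0 ≤ b := (abs_nonneg _).trans (hb 0)
  refine Measure.integrableOn_of_bounded (M := 2 * b) measure_closedBall_lt_top.ne
    (Measurable.aestronglyMeasurable (by fun_prop)) (Eventually.of_forall fun z => ?_)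
  rw [Real.norm_of_nonneg (abs_nonneg _)]
  have := abs_sub (c (x + (dil d (l k))⁻¹ • z)) (c x)
  have := hb (x + (dil d (l k))⁻¹ • z)
  have := hb x
  linarith

/-- On a large ball g is at most 1 and the definition applies; beyond it the difference is at most
2b and the tail of the integral of g is small. -/
theorem IsDilationPoint.tendsto {x : Rd d} (hx : IsDilationPoint c x) (hc : Measurable c)
    (hb : ∀ x, |c x| ≤ b) {l : ℕ → ℝ} (hl : ∀ k, 0 < l k)
    (hlim : Tendsto (fun k => (dil d (l k))⁻¹) atTop (𝓝 0)) {g : Rd d → ℝ} (hg : Integrable g)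
    (hg0 : ∀ z, 0 ≤ g z) (hg1 : ∀ z, g z ≤ 1) :
    Tendsto (fun k => ∫ z, |c (x + (dil d (l k))⁻¹ • z) - c x| * g z) atTop (𝓝 0) := by
  have hb0 : 0 ≤ b := (abs_nonneg _).trans (hb 0)
  have hdiff : ∀ k z, |c (x + (dil d (l k))⁻¹ • z) - c x| ≤ 2 * b := fun k z => by
    have := abs_sub (c (x + (dil d (l k))⁻¹ • z)) (c x)
    have := hb (x + (dil d (l k))⁻¹ • z)
    have := hb x
    linarith
  have htail : Tendsto (fun R : ℕ => ∫ z, (Metric.closedBall (0 : Rd d) R)ᶜ.indicator g z) atTop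
      (𝓝 0) := by
    have := tendsto_integral_of_dominated_convergence (F := fun (R : ℕ) z =>
      (Metric.closedBall (0 : Rd d) R)ᶜ.indicator g z) (f := fun _ => 0) (μ := volume) g
      (fun R => (hg.indicator Metric.isClosed_closedBall.measurableSet.compl).aestronglyMeasurable)
      hg (fun R => Eventually.of_forall fun z => by
        rw [Real.norm_of_nonneg (Set.indicator_nonneg (fun _ _ => hg0 _) z)]
        exact Set.indicator_le_self' (fun _ _ => hg0 _) z) (Eventually.of_forall fun z => by
        obtain ⟨N, hN⟩ := exists_nat_ge ‖z‖
        refine tendsto_const_nhds.congr' ?_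
        filter_upwards [eventually_ge_atTop N] with R hR
        rw [Set.indicator_of_notMem]
        simp only [Set.mem_compl_iff, not_not, mem_closedBall_zero_iff]
        exact hN.trans (by exact_mod_cast hR))
    simpa using this
  rw [Metric.tendsto_atTop]
  intro ε hε
  have h1 := htail.const_mul (2 * b)
  rw [mul_zero] at h1
  obtain ⟨R, hR⟩ := (h1.eventually (gt_mem_nhds (half_pos hε))).exists
  obtain ⟨N, hN⟩ := eventually_atTop.1 ((hx l hl hlim R).eventually (gt_mem_nhds (half_pos hε)))
  refine ⟨N, fun k hk => ?_⟩
  rw [Real.dist_eq, sub_zero, abs_of_nonneg (integral_nonneg fun z =>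
    mul_nonneg (abs_nonneg _) (hg0 z))]
  have hi : Integrable ((Metric.closedBall (0 : Rd d) R).indicator
      (fun z => |c (x + (dil d (l k))⁻¹ • z) - c x|)) := by
    refine (integrable_indicator_iff Metric.isClosed_closedBall.measurableSet).2 ?_
    refine Measure.integrableOn_of_bounded (M := 2 * b) measure_closedBall_lt_top.ne
      (Measurable.aestronglyMeasurable (by fun_prop)) (Eventually.of_forall fun z => ?_)
    rw [Real.norm_of_nonneg (abs_nonneg _)]
    exact hdiff k z
  have hi' := (hg.indicator (Metric.isClosed_closedBall (x := (0 : Rd d))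
    (ε := (R : ℝ))).measurableSet.compl).const_mul (2 * b)
  have h2 : ∫ z, |c (x + (dil d (l k))⁻¹ • z) - c x| * g z ≤
      ∫ z, ((Metric.closedBall (0 : Rd d) R).indicator
        (fun z => |c (x + (dil d (l k))⁻¹ • z) - c x|) z +
        2 * b * (Metric.closedBall (0 : Rd d) R)ᶜ.indicator g z) := by
    refine integral_mono_of_nonneg (Eventually.of_forall fun z => mul_nonneg (abs_nonneg _) (hg0 z))
      (hi.add hi') (Eventually.of_forall fun z => ?_)
    by_cases hz : z ∈ Metric.closedBall (0 : Rd d) R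
    · simp only [Set.indicator_of_mem hz, Set.indicator_of_notMem (Set.notMem_compl_iff.2 hz),
        mul_zero, add_zero]
      exact mul_le_of_le_one_right (abs_nonneg _) (hg1 z)
    · simp only [Set.indicator_of_notMem hz, Set.indicator_of_mem (Set.mem_compl hz), zero_add]
      exact mul_le_mul_of_nonneg_right (hdiff k z) (hg0 z)
  rw [integral_add hi hi', integral_const_mul] at h2
  have := hN k hk
  linarith

end

/-! ### Measurability of the covariances -/

section

variable {Q : Measure (Config d M)} [SFinite Q] {μM : Measure M} [SFinite μM]
  {F : (Rd d × M) × Config d M → ℝ}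

theorem measurable_covF (hF : Measurable F) (x : Rd d) : Measurable (covF Q μM F x) := by
  have h1 : Measurable fun q : Rd d × (Config d M × M) => F ((q.1, q.2.2), q.2.1) :=
    hF.comp (by fun_prop)
  have h2 : Measurable fun q : Rd d × (Config d M × (M × M)) => ((q.1, q.2.2.2), q.2.1) := by
    fun_prop
  have h3 : Measurable fun q : Rd d × (Config d M × (M × M)) => ((x, q.2.2.1), q.2.1) := by
    fun_prop
  have h4 : Measurable fun q : Rd d × (Config d M × (M × M)) => (x, q.2.2.1) := by fun_prop
  have h5 : Measurable fun q : Rd d × (Config d M × (M × M)) => (q.1, q.2.2.2) := by fun_prop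
  have h6 := (hF.comp (h4.prodMk (Config.measurable_add.comp h2))).mul
    (hF.comp (h5.prodMk (Config.measurable_add.comp h3)))
  have h7 := (h1.stronglyMeasurable.integral_prod_right' (ν := Q.prod μM)).measurable
  have h8 := (h6.stronglyMeasurable.integral_prod_right' (ν := Q.prod (μM.prod μM))).measurable
  exact h8.sub (h7.const_mul _)

end

end

section

variable {d : ℕ} {M : Type*} [MeasurableSpace M]

/-! ### The limit of the integrand of the variance -/

section

variable {κ : Rd d → ℝ} {μM : Measure M} {ξ : Functional d M} {Γ : ℝ → Set (Rd d)}
  {φ c : Rd d → ℝ} {b b' p C C' K₁ K D s : ℝ} {l : ℕ → ℝ} {Q : Measure (Config d M)} {x : Rd d}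

/-- The covariances at scale `l` decay at rate `s`. -/
def CovDecay (κ : Rd d → ℝ) (μM : Measure M) (l : ℝ) (F : (Rd d × M) × Config d M → ℝ)
    (D s : ℝ) : Prop :=
  ∀ x ∈ (densityMeasure κ).support, ∀ z : Rd d, z ≠ 0 →
    x + (dil d l)⁻¹ • z ∈ (densityMeasure κ).support →
    |covF (poissonLaw (modelIntensity κ μM l)) μM F x (x + (dil d l)⁻¹ • z)| ≤
      D * (1 + ‖z‖) ^ (-s)

theorem ae_ne_zero (hd : 0 < d) : ∀ᵐ z : Rd d, z ≠ 0 := by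
  have : Nonempty (Fin d) := ⟨⟨0, hd⟩⟩
  rw [ae_iff]
  simp

/-- Off the support κ vanishes almost everywhere, and the affine map z ↦ x + l^(-1/d) z respects
null sets. The covariance bound on the support is therefore sufficient under the z-integral. -/
theorem ae_support_of_ne_zero (hκ : Measurable κ) (hκ0 : ∀ x, 0 ≤ κ x) (hd : 0 < d) {lam : ℝ}
    (hl : 0 < lam) (x : Rd d) : ∀ᵐ z, κ (x + (dil d lam)⁻¹ • z) = 0 ∨
      x + (dil d lam)⁻¹ • z ∈ (densityMeasure κ).support := by
  refine ae_comp_dil hd hl x (s := {y | κ y = 0 ∨ y ∈ (densityMeasure κ).support}) ?_ ?_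
  · exact (hκ (measurableSet_singleton 0)).union Measure.isClosed_support.measurableSet
  · have h1 : ∀ᵐ y ∂(densityMeasure κ), y ∈ (densityMeasure κ).support := by
      rw [ae_iff]
      exact Measure.measure_compl_support
    rw [densityMeasure, ae_withDensity_iff hκ.ennreal_ofReal] at h1
    have h2 : ∀ᵐ y, κ y = 0 ∨ y ∈ (densityMeasure κ).support := by
      filter_upwards [h1] with y hy
      by_cases h : κ y = 0
      · exact Or.inl h
      · refine Or.inr (hy ?_)
        rw [ne_eq, ENNReal.ofReal_eq_zero, not_le]
        exact lt_of_le_of_ne (hκ0 y) (Ne.symm h)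
    exact h2

theorem CovDecay.ae_bound {F : (Rd d × M) × Config d M → ℝ} {lam : ℝ}
    (h : CovDecay κ μM lam F D s) (hD : 0 ≤ D) (hκ : Measurable κ) (hκ0 : ∀ x, 0 ≤ κ x)
    (hK : ∀ x, κ x ≤ K) (hd : 0 < d) (hl : 0 < lam) (hx : x ∈ (densityMeasure κ).support) :
    ∀ᵐ z, |κ (x + (dil d lam)⁻¹ • z) * covF (poissonLaw (modelIntensity κ μM lam)) μM F x
      (x + (dil d lam)⁻¹ • z)| ≤ K * D * (1 + ‖z‖) ^ (-s) := by
  have hK0 : 0 ≤ K := (hκ0 0).trans (hK 0)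
  filter_upwards [ae_support_of_ne_zero hκ hκ0 hd hl x, ae_ne_zero hd] with z h1 hz
  rcases h1 with h1 | h1
  · rw [h1, zero_mul, abs_zero]
    positivity
  · rw [abs_mul, abs_of_nonneg (hκ0 _), mul_assoc]
    exact mul_le_mul (hK _) (h x hx z hz h1) (abs_nonneg _) hK0

variable [IsProbabilityMeasure μM] [IsProbabilityMeasure (densityMeasure κ)]

/-- The bound involves neither x nor the scale, so for constants C, D and s common to all scales it
dominates the outer integral against a probability measure. -/
theorem VarData.abs_varIntegrand_le {F : (Rd d × M) × Config d M → ℝ} {lam : ℝ}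
    (h : VarData κ μM lam F c b p C) (hdec : CovDecay κ μM lam F D s) (hD : 0 ≤ D)
    (hs : (d : ℝ) < s) (hκ : Measurable κ) (hκ0 : ∀ x, 0 ≤ κ x)
    (hK : ∀ x, κ x ≤ K) (hx : x ∈ (densityMeasure κ).support) :
    |varIntegrand κ μM lam F c x| ≤
      b ^ 2 * (1 + C) + b ^ 2 * (K * D * ∫ z : Rd d, (1 + ‖z‖) ^ (-s)) := by
  have hb := h.b_nonneg
  have hg := integrable_one_add_norm_rpow (d := d) hs
  have hsq0 : 0 ≤ sqF (poissonLaw (modelIntensity κ μM lam)) μM F x :=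
    integral_nonneg fun _ => sq_nonneg _
  have hcx : c x ^ 2 ≤ b ^ 2 := sq_le_sq' (abs_le.1 (h.bound x)).1 (abs_le.1 (h.bound x)).2
  refine (abs_add_le _ _).trans (add_le_add ?_ ?_)
  · rw [abs_of_nonneg (mul_nonneg (sq_nonneg _) hsq0)]
    exact mul_le_mul hcx (h.sq hx).2 hsq0 (sq_nonneg _)
  · rw [← integral_const_mul, ← integral_const_mul]
    refine norm_integral_le_of_norm_le (f := fun z => κ (x + (dil d lam)⁻¹ • z) *
      (c x * c (x + (dil d lam)⁻¹ • z) * covF (poissonLaw (modelIntensity κ μM lam)) μM F x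
        (x + (dil d lam)⁻¹ • z))) ((hg.const_mul _).const_mul _) ?_
    filter_upwards [hdec.ae_bound hD hκ hκ0 hK h.dpos h.lpos hx] with z hz
    rw [Real.norm_eq_abs, mul_left_comm, abs_mul, abs_mul, pow_two]
    exact mul_le_mul (mul_le_mul (h.bound _) (h.bound _) (abs_nonneg _) hb) hz (abs_nonneg _)
      (mul_nonneg hb hb)

theorem LimitPoint.tendsto_covF (h : LimitPoint κ μM ξ Γ φ b p C K₁ l Q x)
    (h1 : LimitPoint κ μM ξ Γ (fun _ => 1) b' p C' K₁ l Q x) {z : Rd d} (hz : z ≠ 0)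
    (hc : PairCont ξ μM K₁ x z) (hc' : PairCont ξ μM K₁ x (-z)) :
    Tendsto (fun k => covF (poissonLaw (modelIntensity κ μM (l k))) μM (scF ξ Γ φ (l k)) x
      (x + (dil d (l k))⁻¹ • z)) atTop (𝓝 (φ x ^ 2 * covIntegrand ξ μM Q x z)) := by
  have e1 := (h.tendsto_mixF hz hc hc').sub
    ((h.tendsto_meanF (y := fun _ => x) tendsto_const_nhds).mul (h.tendsto_meanF (h.tendsto_line z)))
  rw [(h1.finite_mixedMoment hz hc hc').2, h1.finite_moments.2.2] at e1
  refine e1.trans_eq (congrArg 𝓝 ?_)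
  simp only [covIntegrand]
  ring

theorem ae_pairCont_neg (hpc : ∀ᵐ z, PairCont ξ μM K₁ x z) : ∀ᵐ z, PairCont ξ μM K₁ x (-z) :=
  (Measure.measurePreserving_neg (volume : Measure (Rd d))).quasiMeasurePreserving.ae hpc

theorem LimitPoint.mem_support (h : LimitPoint κ μM ξ Γ φ b p C K₁ l Q x) :
    x ∈ (densityMeasure κ).support :=
  (eventually_mem_support h.measκ h.pos h.contκ).self_of_nhds

theorem LimitPoint.measurable_covF_line (h : LimitPoint κ μM ξ Γ φ b p C K₁ l Q x) (k : ℕ) :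
    Measurable fun z => covF (poissonLaw (modelIntensity κ μM (l k))) μM (scF ξ Γ φ (l k)) x
      (x + (dil d (l k))⁻¹ • z) := by
  have := isFiniteMeasure_modelIntensity (κ := κ) (μM := μM) (l k)
  have := isProbabilityMeasure_poissonLaw (modelIntensity κ μM (l k))
  exact (measurable_covF (measurable_scF h.functional h.measφ h.bound (h.lpos k) (h.measΓ k)) x).comp
    (by fun_prop)

/-- The limit of the covariances inherits both measurability and the integrable bound D (1 +
‖z‖)^(-s). -/
theorem LimitPoint.integrable_covIntegrand
    (h : LimitPoint κ μM ξ Γ (fun _ => 1) b p C K₁ l Q x)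
    (hpc : ∀ᵐ z, PairCont ξ μM K₁ x z) (hs : (d : ℝ) < s)
    (hdec : ∀ k, CovDecay κ μM (l k) (scF ξ Γ (fun _ => 1) (l k)) D s) :
    Integrable (covIntegrand ξ μM Q x) := by
  have hlim : ∀ᵐ z, Tendsto (fun k => covF (poissonLaw (modelIntensity κ μM (l k))) μM
      (scF ξ Γ (fun _ => 1) (l k)) x (x + (dil d (l k))⁻¹ • z)) atTop
      (𝓝 (covIntegrand ξ μM Q x z)) := by
    filter_upwards [ae_ne_zero h.dpos, hpc, ae_pairCont_neg hpc] with z hz h1 h2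
    simpa using h.tendsto_covF h hz h1 h2
  have hm : AEStronglyMeasurable (covIntegrand ξ μM Q x) volume :=
    aestronglyMeasurable_of_tendsto_ae atTop
      (fun k => (h.measurable_covF_line k).aestronglyMeasurable) hlim
  refine ((integrable_one_add_norm_rpow (d := d) hs).const_mul D).mono' hm ?_
  filter_upwards [ae_ne_zero h.dpos, hlim] with z hz h1
  refine le_of_tendsto h1.abs ?_
  filter_upwards [h.eventually_support (h.tendsto_line z)] with k hk
  exact hdec k x h.mem_support z hz hk

/-- With c(x) in place of c(x + l^(-1/d) z), the inner integral converges by dominated convergence,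
κ and the covariances converging pointwise. Since c need not be continuous, the replacement is
justified separately, at a dilation point. -/
theorem LimitPoint.tendsto_varIntegrand (h : LimitPoint κ μM ξ Γ φ b p C K₁ l Q x)
    (h1 : LimitPoint κ μM ξ Γ (fun _ => 1) b' p C' K₁ l Q x)
    (hpc : ∀ᵐ z, PairCont ξ μM K₁ x z) (hs : (d : ℝ) < s) (hD : 0 ≤ D)
    (hdec : ∀ k, CovDecay κ μM (l k) (scF ξ Γ φ (l k)) D s)
    (hκ0 : ∀ x, 0 ≤ κ x) (hK : ∀ x, κ x ≤ K) (hc : Measurable c) {B : ℝ} (hB : ∀ x, |c x| ≤ B)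
    (hx : IsDilationPoint c x) :
    Tendsto (fun k => varIntegrand κ μM (l k) (scF ξ Γ φ (l k)) c x) atTop
      (𝓝 ((c x * φ x) ^ 2 * ((secondMoment ξ μM Q x).toReal +
        κ x * ∫ z, covIntegrand ξ μM Q x z))) := by
  set g : Rd d → ℝ := fun z => (1 + ‖z‖) ^ (-s) with hgdef
  have hg : Integrable g := integrable_one_add_norm_rpow (d := d) hs
  have hg0 : ∀ z, 0 ≤ g z := fun z => by positivity
  have hs0 : 0 ≤ s := (Nat.cast_nonneg d).trans hs.le
  have hg1 : ∀ z, g z ≤ 1 := fun z => Real.rpow_le_one_of_one_le_of_nonpos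
    (by linarith [norm_nonneg z]) (by linarith)
  have hB0 : 0 ≤ B := (abs_nonneg _).trans (hB 0)
  have hK0 : 0 ≤ K := (hκ0 0).trans (hK 0)
  have hκm := h.measκ
  set w : ℕ → Rd d → ℝ := fun k z => κ (x + (dil d (l k))⁻¹ • z) *
    covF (poissonLaw (modelIntensity κ μM (l k))) μM (scF ξ Γ φ (l k)) x
      (x + (dil d (l k))⁻¹ • z) with hw
  have hwm : ∀ k, Measurable (w k) := fun k =>
    (hκm.comp (by fun_prop)).mul (h.measurable_covF_line k)
  have hwb : ∀ k, ∀ᵐ z, |w k z| ≤ K * D * g z := fun k =>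
    (hdec k).ae_bound hD hκm hκ0 hK h.dpos (h.lpos k) h.mem_support
  have hwi : ∀ k, Integrable (w k) := fun k =>
    (hg.const_mul (K * D)).mono' (hwm k).aestronglyMeasurable (hwb k)
  have hlim : Tendsto (fun k => ∫ z, w k z) atTop
      (𝓝 (∫ z, κ x * (φ x ^ 2 * covIntegrand ξ μM Q x z))) := by
    refine tendsto_integral_of_dominated_convergence (fun z => K * D * g z)
      (fun k => (hwm k).aestronglyMeasurable) (hg.const_mul (K * D)) hwb ?_
    filter_upwards [ae_ne_zero h.dpos, hpc, ae_pairCont_neg hpc] with z hz a1 a2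
    exact (h.contκ.tendsto.comp (h.tendsto_line z)).mul (h.tendsto_covF h1 hz a1 a2)
  have hdilm : ∀ k, Measurable fun z : Rd d => c (x + (dil d (l k))⁻¹ • z) := fun k =>
    hc.comp (by fun_prop)
  -- The error of freezing c at x: the covariances are dominated by a multiple of g, so convergence
  -- in mean against the weight g is enough.
  have herr : Tendsto (fun k => ∫ z, c x * ((c (x + (dil d (l k))⁻¹ • z) - c x) * w k z)) atTop
      (𝓝 0) := by
    have e1 := (hx.tendsto hc hB h.lpos h.lim hg hg0 hg1).const_mul (B * (K * D))
    rw [mul_zero] at e1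
    refine squeeze_zero_norm (fun k => ?_) e1
    rw [← integral_const_mul]
    refine norm_integral_le_of_norm_le ?_ ?_
    · refine ((hg.const_mul (2 * B)).mono' (((hdilm k).sub_const _).abs.mul
        (by fun_prop)).aestronglyMeasurable (Eventually.of_forall fun z => ?_)).const_mul _
      refine (Real.norm_of_nonneg (mul_nonneg (abs_nonneg _) (hg0 z))).trans_le ?_
      refine mul_le_mul_of_nonneg_right ?_ (hg0 z)
      have := abs_sub (c (x + (dil d (l k))⁻¹ • z)) (c x)
      have := hB (x + (dil d (l k))⁻¹ • z)
      have := hB x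
      linarith
    · filter_upwards [hwb k] with z hz
      rw [Real.norm_eq_abs, abs_mul, abs_mul]
      calc |c x| * (|c (x + (dil d (l k))⁻¹ • z) - c x| * |w k z|)
          ≤ B * (|c (x + (dil d (l k))⁻¹ • z) - c x| * (K * D * g z)) := by
            gcongr
            exact hB x
        _ = _ := by ring
  have hsum := ((h.tendsto_sqF.const_mul (c x ^ 2)).add (hlim.const_mul (c x ^ 2))).add herr
  rw [h1.finite_moments.2.1] at hsum
  have hL : c x ^ 2 * (φ x ^ 2 * (secondMoment ξ μM Q x).toReal) +
      c x ^ 2 * (∫ z, κ x * (φ x ^ 2 * covIntegrand ξ μM Q x z)) + 0 =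
      (c x * φ x) ^ 2 * ((secondMoment ξ μM Q x).toReal +
        κ x * ∫ z, covIntegrand ξ μM Q x z) := by
    rw [integral_const_mul, integral_const_mul]
    ring
  rw [hL] at hsum
  refine hsum.congr fun k => ?_
  have hi : Integrable fun z => c x * ((c (x + (dil d (l k))⁻¹ • z) - c x) * w k z) := by
    refine ((hwi k).bdd_mul (c := 2 * B) ((hdilm k).sub_const _).aestronglyMeasurable
      (Eventually.of_forall fun z => ?_)).const_mul _
    have := abs_sub (c (x + (dil d (l k))⁻¹ • z)) (c x)
    have := hB (x + (dil d (l k))⁻¹ • z)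
    have := hB x
    rw [Real.norm_eq_abs]
    linarith
  rw [varIntegrand, add_assoc, ← integral_const_mul, ← integral_add ((hwi k).const_mul _) hi]
  congr 2
  funext z
  simp only [hw]
  ring

theorem scF_of_notMem {lam : ℝ} (hx : x ∉ Γ lam) (t : M) (X : Config d M) :
    scF ξ Γ φ lam ((x, t), X) = 0 := if_neg hx

theorem varIntegrand_of_notMem {lam : ℝ} (hx : x ∉ Γ lam) :
    varIntegrand κ μM lam (scF ξ Γ φ lam) c x = 0 := by
  simp [varIntegrand, sqF, covF, mixF, meanF, scF_of_notMem hx]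

end

/-! ### The pairing as a sum -/

section

variable {ξ : Functional d M} {Γ : ℝ → Set (Rd d)} {f : Rd d → ℝ} {b : ℝ} {l : ℝ}
  {X : Config d M}

/-- The contraction about x fixes x, so the measure remains a point mass at x and f enters only
through f(x). -/
theorem IsPointMass.integral_xiScaled (h : IsPointMass ξ) (hf : Measurable f) (hX : X.pts.Finite)
    (x : Rd d) (t : M) : ∫ z, f z ∂(xiScaled ξ Γ l x t X.pts) =
      f x * ∫ _, (1 : ℝ) ∂(xiScaled ξ Γ l x t X.pts) := by
  have hfin : (insert (x, t) (rescale l x X.pts)).Finite :=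
    ((hX.image _).image _).insert _
  have e := h x t _ hfin (Set.mem_insert _ _)
  rw [xiScaled]
  split_ifs
  · rw [integral_map (by fun_prop) hf.aestronglyMeasurable,
      integral_map (by fun_prop) aestronglyMeasurable_const, ins, e]
    simp [mul_comm]
  · simp

theorem pairing_eq_sum (hξ : IsMeasureFunctional ξ) (hf : Measurable f) (hb : ∀ x, |f x| ≤ b)
    (hl : 0 < l) (hΓ : MeasurableSet (Γ l)) (hX : X ∈ simpleConfigs d M) :
    pairing ξ Γ f l X.1 = X.sum fun p => weighted (fun _ => 1) (scF ξ Γ f l) (p, X) := by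
  have hm : Measurable fun p => weighted (fun _ => 1) (scF ξ Γ f l) (p, X) := by
    simp only [weighted, one_mul]
    exact (measurable_scF hξ hf hb hl hΓ).comp (by fun_prop)
  rw [Config.sum_eq_finsum hX.1 hm, pairing]
  refine finsum_mem_congr rfl fun p hp => ?_
  rw [weighted, one_mul]
  exact integral_xiScaled ξ Γ hf hl hX (Or.inl hp)

theorem IsPointMass.pairing_eq_sum (h : IsPointMass ξ) (hξ : IsMeasureFunctional ξ)
    (hf : Measurable f) (hl : 0 < l) (hΓ : MeasurableSet (Γ l)) (hX : X ∈ simpleConfigs d M) :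
    pairing ξ Γ f l X.1 = X.sum fun p => weighted f (scF ξ Γ (fun _ => 1) l) (p, X) := by
  have hm : Measurable fun p => weighted f (scF ξ Γ (fun _ => 1) l) (p, X) :=
    (hf.comp measurable_fst).mul ((measurable_scF hξ (φ := fun _ => 1) measurable_const (C := 1)
      (by simp) hl hΓ).comp (by fun_prop))
  rw [Config.sum_eq_finsum hX.1 hm, pairing]
  refine finsum_mem_congr rfl fun p hp => ?_
  rw [weighted, ← GeomMeas.integral_xiScaled ξ Γ (φ := fun _ => 1) measurable_const hl hX
    (Or.inl hp)]
  exact h.integral_xiScaled hf hX.1 p.1 p.2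

end

end

section

variable {d : ℕ} {M : Type*} [MeasurableSpace M]

/-! ### The limit of the variance -/

section

variable {κ : Rd d → ℝ} {μM : Measure M} {ξ : Functional d M} {H P P' : ℝ → Measure (Config d M)}
  {Γ : ℝ → Set (Rd d)} {Γlim S : Set (Rd d)} {φ c : Rd d → ℝ} {b p q C K₁ D s : ℝ} {l : ℕ → ℝ}
  {x : Rd d}

/-- The processes of the theorem are compared with the explicit laws; the condition involves scales
at least 1 only. -/
theorem MomentCond.congr (h : MomentCond ξ μM Γ S P p) (hP : ∀ l, 1 ≤ l → P l = P' l) :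
    MomentCond ξ μM Γ S P' p := by
  have e : ∀ l, 1 ≤ l → P' l = P l := fun l hl => (hP l hl).symm
  simpa +contextual only [MomentCond, e] using h

theorem MomentCondAdd.congr (h : MomentCondAdd ξ μM Γ S P p) (hP : ∀ l, 1 ≤ l → P l = P' l) :
    MomentCondAdd ξ μM Γ S P' p := by
  have e : ∀ l, 1 ≤ l → P' l = P l := fun l hl => (hP l hl).symm
  simpa +contextual only [MomentCondAdd, e] using h

theorem IsPowerLawStabilizing.congr (h : IsPowerLawStabilizing ξ μM Γ S P q)
    (hP : ∀ l, 1 ≤ l → P l = P' l) : IsPowerLawStabilizing ξ μM Γ S P' q := by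
  have e : ∀ s, tau ξ μM Γ S P' s = tau ξ μM Γ S P s := fun s => by
    refine iSup_congr fun l => iSup_congr fun hl => ?_
    rw [hP l hl]
  simpa only [IsPowerLawStabilizing, e] using h

/-- The hypotheses on the processes, the functional and the sets in the variance asymptotics. -/
structure IsVarianceModel (κ : Rd d → ℝ) (μM : Measure M) (ξ : Functional d M)
    (H : ℝ → Measure (Config d M)) (Γ : ℝ → Set (Rd d)) (Γlim : Set (Rd d)) (p q : ℝ) : Prop where
  dpos : 0 < d
  two_lt : 2 < p
  rate : d * p / (p - 2) < q
  functional : IsMeasureFunctional ξ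
  measκ : Measurable κ
  nonneg : ∀ x, 0 ≤ κ x
  bdd : ∃ K : ℝ, ∀ x, κ x ≤ K
  contκ : ∀ᵐ x, ContinuousAt κ x
  lawH : ∀ a : ℝ, 0 < a → IsPoissonLaw (H a)
    (ENNReal.ofReal a • (volume : Measure (Rd d)).prod μM)
  measΓ : ∀ l : ℝ, 1 ≤ l → MeasurableSet (Γ l)
  mono : ∀ l l' : ℝ, 1 ≤ l → l < l' → Γ l ⊆ Γ l'
  lim : Γlim = ⋃ (l : ℝ) (_ : 1 ≤ l), Γ l
  bdry : volume (frontier Γlim) = 0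
  interior : interior Γlim = ⋃ (l : ℝ) (_ : 1 ≤ l), interior (Γ l)
  stab : ∀ᵐ x ∂(densityMeasure κ), IsHomStabilizing ξ μM (H (κ x)) x
  mom : MomentCond ξ μM Γ (densityMeasure κ).support
    (fun l => poissonLaw (modelIntensity κ μM l)) p
  mom_add : MomentCondAdd ξ μM Γ (densityMeasure κ).support
    (fun l => poissonLaw (modelIntensity κ μM l)) p
  pow : IsPowerLawStabilizing ξ μM Γ (densityMeasure κ).support
    (fun l => poissonLaw (modelIntensity κ μM l)) q
  cont : IsTranslationInvariant ξ ∨ HasAEContinuousTotalMeasure ξ μM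

/-- The bounds on the moments and the covariances for all scales. -/
structure ScaleBounds (κ : Rd d → ℝ) (μM : Measure M) (ξ : Functional d M) (Γ : ℝ → Set (Rd d))
    (φ : Rd d → ℝ) (p C D s : ℝ) : Prop where
  C_nonneg : 0 ≤ C
  D_nonneg : 0 ≤ D
  lt : (d : ℝ) < s
  pm : ∀ l, 1 ≤ l → ∀ x ∈ (densityMeasure κ).support, ∀ y ∈ (densityMeasure κ).support, x ≠ y →
    PairMoments (poissonLaw (modelIntensity κ μM l)) μM (scF ξ Γ φ l) p C x y
  decay : ∀ l, 1 ≤ l → CovDecay κ μM l (scF ξ Γ φ l) D s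

/-- By monotonicity the union over real scales is a countable union. -/
theorem IsVarianceModel.measurableSet_lim (h : IsVarianceModel κ μM ξ H Γ Γlim p q) :
    MeasurableSet Γlim := by
  have e : Γlim = ⋃ n : ℕ, Γ (n + 1) := by
    rw [h.lim]
    refine Set.Subset.antisymm ?_ ?_
    · refine Set.iUnion₂_subset fun l hl => ?_
      obtain ⟨n, hn⟩ := exists_nat_ge l
      exact (h.mono l (n + 1) hl (by linarith)).trans (Set.subset_iUnion (fun n : ℕ => Γ (n + 1)) n)
    · exact Set.iUnion_subset fun n =>
        Set.subset_iUnion₂_of_subset (n + 1 : ℝ) (by linarith [Nat.cast_nonneg (α := ℝ) n])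
          subset_rfl
  rw [e]
  exact MeasurableSet.iUnion fun n => h.measΓ _ (by linarith [Nat.cast_nonneg (α := ℝ) n])

/-- The properties of almost every point at which the moments converge. -/
structure IsRegularPoint (κ : Rd d → ℝ) (μM : Measure M) (ξ : Functional d M)
    (H : ℝ → Measure (Config d M)) (Γlim : Set (Rd d)) (K₁ : ℝ) (x : Rd d) : Prop where
  pos : 0 < κ x
  contκ : ContinuousAt κ x
  notMem : x ∉ frontier Γlim
  stab : IsHomStabilizing ξ μM (H (κ x)) x
  cont : ∀ y : ℕ → Rd d, Tendsto y atTop (𝓝 x) → ∀ ν : Measure (Rd d × M), IsFiniteMeasure ν →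
    IsDiffuse ν → ν ≪ (volume : Measure (Rd d)).prod μM →
    ∀ᵐ q ∂((poissonLaw ν).prod μM), q.1.pts.Nonempty → ContAt ξ K₁ x y q.2 q.1
  pairCont : ∀ᵐ z, PairCont ξ μM K₁ x z

theorem densityMeasure_ae (h : ∀ᵐ x, x ∈ S) : ∀ᵐ x ∂(densityMeasure κ), x ∈ S :=
  (withDensity_absolutelyContinuous _ _).ae_le h

variable [IsProbabilityMeasure μM] [IsProbabilityMeasure (densityMeasure κ)]

theorem IsVarianceModel.exists_scaleBounds (h : IsVarianceModel κ μM ξ H Γ Γlim p q)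
    (hφ : Measurable φ) (hb : ∀ z, |φ z| ≤ b) : ∃ C D s, ScaleBounds κ μM ξ Γ φ p C D s := by
  obtain ⟨C, hC, hpm⟩ := exists_pairMoments h.dpos h.functional (fun l _ => rfl) h.measΓ
    (by linarith [h.two_lt]) h.mom h.mom_add hφ hb
  obtain ⟨D, s, hD, hs, hdec⟩ := exists_cov_decay h.dpos h.functional h.measΓ hφ hb h.two_lt hC hpm
    h.rate h.pow
  exact ⟨C, D, s, hC, hD, hs, hpm, hdec⟩

theorem IsVarianceModel.exists_ae_isRegularPoint (h : IsVarianceModel κ μM ξ H Γ Γlim p q) :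
    ∃ K₁, ∀ᵐ x ∂(densityMeasure κ), IsRegularPoint κ μM ξ H Γlim K₁ x := by
  obtain ⟨K₁, hK⟩ := exists_ae_contAt h.functional h.cont
  refine ⟨K₁, ?_⟩
  have h1 : ∀ᵐ x ∂(densityMeasure κ), 0 < κ x := by
    rw [densityMeasure, ae_withDensity_iff h.measκ.ennreal_ofReal]
    refine Eventually.of_forall fun x hx => ?_
    rwa [ne_eq, ENNReal.ofReal_eq_zero, not_le] at hx
  have h2 : ∀ᵐ x, x ∉ frontier Γlim := measure_eq_zero_iff_ae_notMem.1 h.bdry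
  filter_upwards [h1, densityMeasure_ae hK, densityMeasure_ae h2, densityMeasure_ae h.contκ,
    h.stab] with x a1 a2 a3 a4 a5
  exact ⟨a1, a4, a3, a5, a2.1, a2.2⟩

theorem IsVarianceModel.limitPoint (h : IsVarianceModel κ μM ξ H Γ Γlim p q)
    (hx : IsRegularPoint κ μM ξ H Γlim K₁ x) (hxΓ : x ∈ Γlim) (hφ : Measurable φ)
    (hb : ∀ z, |φ z| ≤ b) (hφx : ContinuousAt φ x) (hs : ScaleBounds κ μM ξ Γ φ p C D s)
    (hl : ∀ k, 1 ≤ l k) (hlim : Tendsto l atTop atTop) :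
    LimitPoint κ μM ξ Γ φ b p C K₁ l (H (κ x)) x where
  dpos := h.dpos
  measκ := h.measκ
  functional := h.functional
  measφ := hφ
  bound := hb
  contφ := hφx
  pos := hx.pos
  contκ := hx.contκ
  law := h.lawH _ hx.pos
  stab := hx.stab
  lpos k := by linarith [hl k]
  lim := by
    have hd : 0 < 1 / (d : ℝ) := by
      have := h.dpos
      positivity
    exact ((tendsto_rpow_atTop hd).comp hlim).inv_tendsto_atTop
  measΓ k := h.measΓ _ (hl k)
  mem := by
    -- A point of Γ off its boundary is interior to Γ, hence interior to some member of the family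
    -- by assumption, and by monotonicity one neighbourhood lies in all later members.
    have h1 : x ∈ _root_.interior Γlim := by
      rw [← self_sdiff_frontier]
      exact ⟨hxΓ, hx.notMem⟩
    rw [h.interior] at h1
    obtain ⟨L, hL, hxL⟩ := Set.mem_iUnion₂.1 h1
    refine ⟨_, isOpen_interior.mem_nhds hxL, ?_⟩
    filter_upwards [hlim.eventually_gt_atTop L] with k hk
    exact interior_subset.trans (h.mono L _ hL hk)
  pm k := hs.pm _ (hl k)
  two_lt := h.two_lt
  cont := hx.cont

theorem IsVarianceModel.varData (h : IsVarianceModel κ μM ξ H Γ Γlim p q)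
    (hφ : Measurable φ) (hb : ∀ z, |φ z| ≤ b) (hs : ScaleBounds κ μM ξ Γ φ p C D s)
    (hc : Measurable c) {B : ℝ} (hB : ∀ x, |c x| ≤ B) {l : ℝ} (hl : 1 ≤ l) :
    VarData κ μM l (scF ξ Γ φ l) c B p C where
  dpos := h.dpos
  lpos := by linarith
  measF := measurable_scF h.functional hφ hb (by linarith) (h.measΓ l hl)
  idem _ _ hp := scF_add ξ Γ φ l hp
  measc := hc
  bound := hB
  two_le := h.two_lt.le
  C_nonneg := hs.C_nonneg
  pm := hs.pm l hl

theorem IsVarianceModel.ae_finite (h : IsVarianceModel κ μM ξ H Γ Γlim p q) :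
    ∀ᵐ x ∂(densityMeasure κ), x ∈ Γlim → secondMoment ξ μM (H (κ x)) x < ∞ ∧
      (∀ᵐ z, mixedMoment ξ μM (H (κ x)) x z < ∞) ∧
      Integrable (fun z => covIntegrand ξ μM (H (κ x)) x z) := by
  obtain ⟨C, D, s, hs⟩ := h.exists_scaleBounds (φ := fun _ => 1) measurable_const (b := 1) (by simp)
  obtain ⟨K₁, hK⟩ := h.exists_ae_isRegularPoint
  filter_upwards [hK] with x hx hxΓ
  -- The limiting moments do not depend on the scales; any sequence of scales at least 1 that tends
  -- to infinity would serve.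
  have hl : ∀ k : ℕ, (1 : ℝ) ≤ k + 1 := fun k => by linarith [Nat.cast_nonneg (α := ℝ) k]
  have hL := h.limitPoint hx hxΓ measurable_const (b := 1) (by simp) continuousAt_const hs
    (l := fun k => k + 1) hl (tendsto_atTop_add_const_right _ _ tendsto_natCast_atTop_atTop)
  refine ⟨hL.finite_moments.1, ?_, hL.integrable_covIntegrand hx.pairCont hs.lt fun k =>
    hs.decay _ (hl k)⟩
  filter_upwards [ae_ne_zero h.dpos, hx.pairCont, ae_pairCont_neg hx.pairCont] with z hz h1 h2
  exact (hL.finite_mixedMoment hz h1 h2).1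

/-- The integrand of the limiting variance. -/
def limIntegrand (κ : Rd d → ℝ) (μM : Measure M) (ξ : Functional d M)
    (H : ℝ → Measure (Config d M)) (Γlim : Set (Rd d)) (f : Rd d → ℝ) : Rd d → ℝ :=
  Γlim.indicator fun x => f x ^ 2 * V ξ μM H x (κ x)

theorem IsVarianceModel.tendsto_varIntegrand (h : IsVarianceModel κ μM ξ H Γ Γlim p q)
    (hφ : Measurable φ) (hb : ∀ z, |φ z| ≤ b) (hφc : ∀ᵐ x, ContinuousAt φ x)
    (hc : Measurable c) {B : ℝ} (hB : ∀ x, |c x| ≤ B) (hl : ∀ k, 1 ≤ l k)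
    (hlim : Tendsto l atTop atTop) : ∀ᵐ x ∂(densityMeasure κ),
      Tendsto (fun k => varIntegrand κ μM (l k) (scF ξ Γ φ (l k)) c x) atTop
        (𝓝 (limIntegrand κ μM ξ H Γlim (fun x => c x * φ x) x)) := by
  obtain ⟨C, D, s, hs⟩ := h.exists_scaleBounds hφ hb
  obtain ⟨C', D', s', hs'⟩ := h.exists_scaleBounds (φ := fun _ => 1) measurable_const (b := 1)
    (by simp)
  obtain ⟨K₁, hK⟩ := h.exists_ae_isRegularPoint
  obtain ⟨K, hKκ⟩ := h.bdd
  filter_upwards [hK, densityMeasure_ae hφc, densityMeasure_ae (ae_isDilationPoint h.dpos hc hB)]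
    with x hx hφx hcx
  by_cases hxΓ : x ∈ Γlim
  · rw [limIntegrand, Set.indicator_of_mem hxΓ, V, if_neg hx.pos.ne']
    exact (h.limitPoint hx hxΓ hφ hb hφx hs hl hlim).tendsto_varIntegrand
      (h.limitPoint hx hxΓ measurable_const (b := 1) (by simp) continuousAt_const hs' hl hlim)
      hx.pairCont hs.lt hs.D_nonneg (fun k => hs.decay _ (hl k)) h.nonneg hKκ hc hB hcx
  · rw [limIntegrand, Set.indicator_of_notMem hxΓ]
    refine tendsto_const_nhds.congr fun k => (varIntegrand_of_notMem fun hk => hxΓ ?_).symm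
    rw [h.lim]
    exact Set.mem_iUnion₂.2 ⟨_, hl k, hk⟩

/-- Pointwise convergence holds almost everywhere on Γ, and off Γ both sides vanish. The constant A
dominates at every scale, and the limit inherits it, hence is integrable. -/
theorem IsVarianceModel.tendsto_integral (h : IsVarianceModel κ μM ξ H Γ Γlim p q)
    (hφ : Measurable φ) (hb : ∀ z, |φ z| ≤ b) (hφc : ∀ᵐ x, ContinuousAt φ x)
    (hc : Measurable c) {B : ℝ} (hB : ∀ x, |c x| ≤ B) :
    Integrable (limIntegrand κ μM ξ H Γlim fun x => c x * φ x) (densityMeasure κ) ∧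
    Tendsto (fun l => ∫ x, varIntegrand κ μM l (scF ξ Γ φ l) c x ∂(densityMeasure κ)) atTop
      (𝓝 (∫ x, limIntegrand κ μM ξ H Γlim (fun x => c x * φ x) x ∂(densityMeasure κ))) := by
  obtain ⟨C, D, s, hs⟩ := h.exists_scaleBounds hφ hb
  obtain ⟨K, hKκ⟩ := h.bdd
  have hS : ∀ᵐ x ∂(densityMeasure κ), x ∈ (densityMeasure κ).support := by
    rw [ae_iff]
    exact Measure.measure_compl_support
  set A := B ^ 2 * (1 + C) + B ^ 2 * (K * D * ∫ z : Rd d, (1 + ‖z‖) ^ (-s))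
  have hvd : ∀ l, 1 ≤ l → VarData κ μM l (scF ξ Γ φ l) c B p C := fun l hl =>
    h.varData hφ hb hs hc hB hl
  have hm : ∀ l, 1 ≤ l → AEStronglyMeasurable (varIntegrand κ μM l (scF ξ Γ φ l) c)
      (densityMeasure κ) := fun l hl =>
    ((hvd l hl).integrable_varIntegrand h.measκ h.nonneg).1.aestronglyMeasurable
  have hbd : ∀ l, 1 ≤ l → ∀ᵐ x ∂(densityMeasure κ),
      ‖varIntegrand κ μM l (scF ξ Γ φ l) c x‖ ≤ A := fun l hl => by
    filter_upwards [hS] with x hx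
    exact (hvd l hl).abs_varIntegrand_le (hs.decay l hl) hs.D_nonneg hs.lt h.measκ h.nonneg hKκ hx
  constructor
  · have hl : ∀ k : ℕ, (1 : ℝ) ≤ k + 1 := fun k => by linarith [Nat.cast_nonneg (α := ℝ) k]
    have hlim := h.tendsto_varIntegrand hφ hb hφc hc hB (l := fun k => k + 1) hl
      (tendsto_atTop_add_const_right _ _ tendsto_natCast_atTop_atTop)
    refine Integrable.of_bound (aestronglyMeasurable_of_tendsto_ae atTop
      (fun k => hm _ (hl k)) hlim) A ?_
    filter_upwards [hlim, ae_all_iff.2 fun k => hbd _ (hl k)] with x h1 h2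
    exact le_of_tendsto h1.norm (Eventually.of_forall h2)
  · refine tendsto_of_seq_tendsto fun u hu => ?_
    -- The assumptions concern scales at least 1 only; replacing u k by this maximum changes
    -- finitely many terms.
    have hl : ∀ k, 1 ≤ max 1 (u k) := fun k => le_max_left _ _
    have hu' : Tendsto (fun k => max 1 (u k)) atTop atTop :=
      tendsto_atTop_mono (fun k => le_max_right _ _) hu
    refine (tendsto_integral_of_dominated_convergence (fun _ => A) (fun k => hm _ (hl k))
      (integrable_const A) (fun k => hbd _ (hl k))
      (h.tendsto_varIntegrand hφ hb hφc hc hB hl hu')).congr' ?_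
    filter_upwards [hu.eventually_ge_atTop 1] with k hk
    rw [max_eq_right hk]
    rfl

/-- Common form of the two assumptions on f. The weight c is evaluated at the point itself and only
has to be measurable and bounded, whereas φ is integrated against the rescaled measure and has to be
almost everywhere continuous. -/
theorem IsVarianceModel.variance_asymptotics (h : IsVarianceModel κ μM ξ H Γ Γlim p q)
    (hφ : Measurable φ) (hb : ∀ z, |φ z| ≤ b) (hφc : ∀ᵐ x, ContinuousAt φ x)
    (hc : Measurable c) {B : ℝ} (hB : ∀ x, |c x| ≤ B) {f : Rd d → ℝ}
    (hf : ∀ x, f x = c x * φ x) (hsum : ∀ l, 1 ≤ l → ∀ X ∈ simpleConfigs d M,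
      pairing ξ Γ f l X.1 = X.sum fun p => weighted c (scF ξ Γ φ l) (p, X)) :
    (∀ l : ℝ, 1 ≤ l → MemLp (fun X => pairing ξ Γ f l X.1) 2
      (poissonLaw (modelIntensity κ μM l))) ∧
    Tendsto (fun l : ℝ => l⁻¹ * variance (fun X => pairing ξ Γ f l X.1)
      (poissonLaw (modelIntensity κ μM l))) atTop
      (𝓝 (∫ x in Γlim, f x ^ 2 * V ξ μM H x (κ x) * κ x)) ∧
    IntegrableOn (fun x => f x ^ 2 * V ξ μM H x (κ x) * κ x) Γlim := by
  obtain ⟨C, D, s, hs⟩ := h.exists_scaleBounds hφ hb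
  obtain rfl : f = fun x => c x * φ x := funext hf
  have hae : ∀ l, 1 ≤ l → (fun X : Config d M => pairing ξ Γ (fun x => c x * φ x) l X.1)
      =ᵐ[poissonLaw (modelIntensity κ μM l)]
        fun X => X.sum fun p => weighted c (scF ξ Γ φ l) (p, X) := fun l hl =>
    (ae_simpleConfigs_poissonLaw _).mono fun X hX => hsum l hl X hX
  have hvd : ∀ l, 1 ≤ l → VarData κ μM l (scF ξ Γ φ l) c B p C := fun l hl =>
    h.varData hφ hb hs hc hB hl
  obtain ⟨hint, hlim⟩ := h.tendsto_integral hφ hb hφc hc hB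
  have hind : (fun x => κ x * limIntegrand κ μM ξ H Γlim (fun x => c x * φ x) x) =
      Γlim.indicator fun x => (c x * φ x) ^ 2 * V ξ μM H x (κ x) * κ x := by
    funext x
    by_cases hx : x ∈ Γlim
    · rw [limIntegrand, Set.indicator_of_mem hx, Set.indicator_of_mem hx]
      ring
    · rw [limIntegrand, Set.indicator_of_notMem hx, Set.indicator_of_notMem hx, mul_zero]
  refine ⟨fun l hl => ?_, ?_, ?_⟩
  · have := isFiniteMeasure_modelIntensity (κ := κ) (μM := μM) l
    exact (memLp_congr_ae (hae l hl)).2 ((hvd l hl).isSquareSummable.memLp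
      (isDiffuse_modelIntensity h.dpos l))
  · rw [integral_densityMeasure h.measκ h.nonneg, hind,
      integral_indicator h.measurableSet_lim] at hlim
    refine hlim.congr' ?_
    filter_upwards [eventually_ge_atTop 1] with l hl
    rw [variance_congr (hae l hl)]
    exact ((hvd l hl).integrable_varIntegrand h.measκ h.nonneg).2.symm
  · rw [integrable_densityMeasure h.measκ h.nonneg, hind] at hint
    exact (integrable_indicator_iff h.measurableSet_lim).1 hint

end

end

end GeomMeas

end

/-! ### The theorem. -/

theorem theorem2p2 {d : ℕ} (hd : 0 < d)
    {M : Type*} [MeasurableSpace M] (μM : Measure M) [IsProbabilityMeasure μM]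
    -- the functional
    (ξ : GeomMeas.Functional d M) (hξ : GeomMeas.IsMeasureFunctional ξ)
    -- the density
    (κ : GeomMeas.Rd d → ℝ) (hκ_meas : Measurable κ) (hκ_nonneg : ∀ x, 0 ≤ κ x)
    (hκ_prob : IsProbabilityMeasure (GeomMeas.densityMeasure κ))
    (hκ_bdd : ∃ C : ℝ, ∀ x, κ x ≤ C) (hκ_cont : ∀ᵐ x, ContinuousAt κ x)
    -- the laws of the Poisson processes `P_l` and `H_a`
    (P : ℝ → Measure (GeomMeas.Config d M))
    (hP : ∀ l : ℝ, 0 < l → GeomMeas.IsPoissonLaw (P l)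
      (ENNReal.ofReal l • (GeomMeas.densityMeasure κ).prod μM))
    (H : ℝ → Measure (GeomMeas.Config d M))
    (hH : ∀ a : ℝ, 0 < a → GeomMeas.IsPoissonLaw (H a)
      (ENNReal.ofReal a • (volume : Measure (GeomMeas.Rd d)).prod μM))
    -- the sets `Γ_l`, `l ≥ 1`, and their union `Γ`
    (Γ : ℝ → Set (GeomMeas.Rd d)) (hΓ_meas : ∀ l : ℝ, 1 ≤ l → MeasurableSet (Γ l))
    (hΓ_mono : ∀ l l' : ℝ, 1 ≤ l → l < l' → Γ l ⊆ Γ l')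
    (Γlim : Set (GeomMeas.Rd d)) (hΓ_lim : Γlim = ⋃ (l : ℝ) (_ : 1 ≤ l), Γ l)
    (hΓ_bdry : volume (frontier Γlim) = 0)
    (hΓ_int : interior Γlim = ⋃ (l : ℝ) (_ : 1 ≤ l), interior (Γ l))
    -- homogeneous stabilization, moments conditions, power-law stabilization
    (hstab : ∀ᵐ x ∂(GeomMeas.densityMeasure κ), GeomMeas.IsHomStabilizing ξ μM (H (κ x)) x)
    (p : ℝ) (hp : 2 < p)
    (hmom : GeomMeas.MomentCond ξ μM Γ (GeomMeas.densityMeasure κ).support P p)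
    (hmom2 : GeomMeas.MomentCondAdd ξ μM Γ (GeomMeas.densityMeasure κ).support P p)
    (q : ℝ) (hq : d * p / (p - 2) < q)
    (hpow : GeomMeas.IsPowerLawStabilizing ξ μM Γ (GeomMeas.densityMeasure κ).support P q)
    -- the test function and the alternatives
    (f : GeomMeas.Rd d → ℝ) (hf_meas : Measurable f) (hf_bdd : ∃ C : ℝ, ∀ x, |f x| ≤ C)
    (hA13 : GeomMeas.IsPointMass ξ ∨ ∀ᵐ x, ContinuousAt f x)
    (hA45 : GeomMeas.IsTranslationInvariant ξ ∨ GeomMeas.HasAEContinuousTotalMeasure ξ μM) :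
    -- the variances are finite, and they converge after scaling
    (∀ l : ℝ, 1 ≤ l → MemLp (fun X => GeomMeas.pairing ξ Γ f l X.1) 2 (P l)) ∧
    Tendsto (fun l : ℝ => l⁻¹ * variance (fun X => GeomMeas.pairing ξ Γ f l X.1) (P l)) atTop
      (𝓝 (∫ x in Γlim, f x ^ 2 * GeomMeas.V ξ μM H x (κ x) * κ x)) ∧
    -- the expectations and the integral in the definition of `V` converge
    (∀ᵐ x ∂(GeomMeas.densityMeasure κ), x ∈ Γlim →
      GeomMeas.secondMoment ξ μM (H (κ x)) x < ∞ ∧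
      (∀ᵐ z, GeomMeas.mixedMoment ξ μM (H (κ x)) x z < ∞) ∧
      Integrable (fun z => GeomMeas.covIntegrand ξ μM (H (κ x)) x z)) ∧
    -- the limit is finite
    IntegrableOn (fun x => f x ^ 2 * GeomMeas.V ξ μM H x (κ x) * κ x) Γlim := by
  have hPl : ∀ l : ℝ, 1 ≤ l → P l = GeomMeas.poissonLaw (GeomMeas.modelIntensity κ μM l) := by
    intro l hl
    have := GeomMeas.isFiniteMeasure_modelIntensity (κ := κ) (μM := μM) l
    exact (hP l (by linarith)).eq_poissonLaw (GeomMeas.isDiffuse_modelIntensity hd l)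
  have h : GeomMeas.IsVarianceModel κ μM ξ H Γ Γlim p q :=
    ⟨hd, hp, hq, hξ, hκ_meas, hκ_nonneg, hκ_bdd, hκ_cont, hH, hΓ_meas, hΓ_mono, hΓ_lim, hΓ_bdry,
      hΓ_int, hstab, hmom.congr hPl, hmom2.congr hPl, hpow.congr hPl, hA45⟩
  obtain ⟨b, hb⟩ := hf_bdd
  have hmain : (∀ l : ℝ, 1 ≤ l → MemLp (fun X => GeomMeas.pairing ξ Γ f l X.1) 2
        (GeomMeas.poissonLaw (GeomMeas.modelIntensity κ μM l))) ∧
      Tendsto (fun l : ℝ => l⁻¹ * variance (fun X => GeomMeas.pairing ξ Γ f l X.1)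
        (GeomMeas.poissonLaw (GeomMeas.modelIntensity κ μM l))) atTop
        (𝓝 (∫ x in Γlim, f x ^ 2 * GeomMeas.V ξ μM H x (κ x) * κ x)) ∧
      IntegrableOn (fun x => f x ^ 2 * GeomMeas.V ξ μM H x (κ x) * κ x) Γlim := by
    rcases hA13 with hA | hA
    -- For point masses all of f goes into the weight, so its discontinuities do no harm.
    · exact h.variance_asymptotics (φ := fun _ => 1) (b := 1) measurable_const (by simp)
        (Eventually.of_forall fun _ => continuousAt_const) hf_meas hb (fun x => (mul_one _).symm)
        fun l hl X hX => hA.pairing_eq_sum hξ hf_meas (by linarith) (hΓ_meas l hl) hX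
    -- In general the mass is spread around the point, and f is integrated against it; its
    -- continuity is then used at the limit.
    · exact h.variance_asymptotics (c := fun _ => 1) (B := 1) hf_meas hb hA measurable_const
        (by simp) (fun x => (one_mul _).symm)
        fun l hl X hX => GeomMeas.pairing_eq_sum hξ hf_meas hb (by linarith) (hΓ_meas l hl) hX
  refine ⟨fun l hl => ?_, hmain.2.1.congr' ?_, h.ae_finite, hmain.2.2⟩
  · rw [hPl l hl]
    exact hmain.1 l hl
  · filter_upwards [eventually_ge_atTop 1] with l hl
    rw [hPl l hl]
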